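/- **Lemma (consistency of the interior penalty Galerkin (IPG) methods).** *Problem.* Let $d\in\{2,3\}$, let $\Omega\subset\mathbb R^d$ be a bounded polyhedral Lipschitz domain with outer unit normal $\nu$, and let $\partial\Omega=\Gamma_1\cup\Gamma_2\cup\Gamma_3$ be a disjoint decomposition with $\Gamma_3$ closed. Let $K=K^\top\in L^\infty(\Omega)^{d,d}$ be uniformly positive definite, $c\in L^\infty(\Omega)^d$ with $\partial_jc_j\in L^{3/2}(\Omega)$ for each $j$, $r\in L^\infty(\Omega)$, $f\in L^2(\Omega)$, $g_j\in L^2(\Gamma_j)$ ($j=1,2$), $\alpha\in L^\infty(\Gamma_2)$, and let $g_3$ be a function on $\Gamma_3$. Put $\Gamma_{2,1}=\{x\in\Gamma_2:\alpha=\nu\cdot c\}$ and suppose $\nu\cdot c\ge0$ a.e. on $\Gamma_{2,1}$. Consider $$-\nabla\cdot(K\nabla u-cu)+ru=f\ \text{in }\Omega,\quad (K\nabla u-cu)\cdot\nu=g_1\ \text{on }\Gamma_1,\quad (K\nabla u-cu)\cdot\nu+\alpha u=g_2\ \text{on }\Gamma_2,\quad u=g_3\ \text{on }\Gamma_3.$$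 With $V=\{v\in H^1(\Omega): v=0\text{ on }\Gamma_3\}$, a weak solution is a $u\in H^1(\Omega)$ with $u=g_3$ on $\Gamma_3$ in the sense of traces and $$(K\nabla u-cu,\nabla v)+(ru,v)+(\alpha u,v)_{\Gamma_2}=(f,v)+(g_1,v)_{\Gamma_1}+(g_2,v)_{\Gamma_2}\quad\text{for all }v\in V.$$ *Partition.* Let $\mathcal T$ be a finite partition of $\overline\Omega$ into closed polyhedra with pairwise disjoint interiors, each element having finitely many flat polyhedral faces that cover its boundary and overlap only in sets of surface measure zero. Suppose that each face of an element is contained in $\partial\Omega$ or is also a face of another element, and that $\overline{\Gamma_j}=\bigcup_{F\in\mathcal F_j}F$ for $j=1,2,3$, where $\mathcal F_j$ is the set of the faces $F\subset\partial\Omega$ with $F\subset\overline{\Gamma_j}$, and $\mathcal F_1,\mathcal F_2,\mathcal F_3$ are pairwise disjoint. Let $\mathcal F_{2,1}$ be the set of the faces in $\mathcal F_2$ on which $\alpha=\nu\cdot c$ a.e., let $\mathcal F_{2,2}=\mathcal F_2\setminus\mathcal F_{2,1}$, and suppose that $\alpha\ne\nu\cdot c$ a.e. on each face in $\mathcal F_{2,2}$.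 Let $\mathcal F$ be the set of interior faces and $h_F=\operatorname{diam}F$. Suppose that for each $\kappa\in\mathcal T$ the restriction $K|_\kappa$ has a trace on $\partial\kappa$ (for instance, $K$ continuous on each closed element), so that the terms below are defined. On an interior face $F$ shared by $\kappa,\kappa'$ (with outer normals $\nu_\kappa,\nu_{\kappa'}$) let $[v]=v|_\kappa\nu_\kappa+v|_{\kappa'}\nu_{\kappa'}$ and $\{p\}=\frac12(p|_\kappa+p|_{\kappa'})$, and let $c_{\mathrm{up}}(w)$ be $c\,w|_\kappa$ where $c\cdot\nu_\kappa>0$ and $c\,w|_{\kappa'}$ elsewhere. On a face $F\subset\partial\Omega$ of $\kappa$ let $[v]=v|_\kappa\nu_\kappa$ and $\{p\}=p|_\kappa$, and let $c_{\mathrm{up}}(w)$ be $c\,w|_\kappa$ where $c\cdot\nu_\kappa>0$ and $0$ elsewhere. All values on faces are traces. *Method.* For $k\in\mathbb N$ let $V_h$ be the space of the functions in $L^2(\Omega)$ whose restriction to each element $\kappa$ belongs to $\mathbb P_k(\kappa)$, where $\mathbb P_k(\kappa)$ is either $\mathcal P_k(\kappa)$ (total degree at most $k$) or $\mathcal Q_k(\kappa)$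 (degree at most $k$ in each variable). For $\theta\in\{0,\pm1\}$ and $\eta>0$, and with elementwise gradients, let $$\begin{aligned}a_h(w,v)={}&\sum_{\kappa\in\mathcal T}\big[(K\nabla w-cw,\nabla v)_\kappa+(rw,v)_\kappa\big]\\&+\sum_{F\in\mathcal F\cup\mathcal F_3}\Big[\theta(\{K\nabla v\},[w])_F-\Big(\{K\nabla w\}-\frac{\eta}{h_F}[w],[v]\Big)_F\Big]\\&+\sum_{F\in\mathcal F\cup\mathcal F_{2,1}}(c_{\mathrm{up}}(w),[v])_F+\sum_{F\in\mathcal F_{2,2}}(\alpha w,v)_F,\\ \ell_h(v)={}&(f,v)+\sum_{F\in\mathcal F_1}(g_1,v)_F+\sum_{F\in\mathcal F_2}(g_2,v)_F+\sum_{F\in\mathcal F_3}\Big[\frac{\eta}{h_F}(g_3,v)_F+(\theta K\nabla v-cv,\nu g_3)_F\Big].\end{aligned}$$ *Claim.* Let $u$ be a weak solution such that $u|_\kappa\in H^2(\kappa)$ for every $\kappa\in\mathcal T$, $K\nabla u\in H(\mathrm{div};\Omega)$ and $cu\in H^1(\Omega)^d$. Then, for every $\theta\in\{0,\pm1\}$,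 every $\eta>0$ and every $k$, $$a_h(u,v_h)=\ell_h(v_h)\qquad\text{for all }v_h\in V_h.$$ -/

import Mathlib

open MeasureTheory Filter Topology Set
open scoped ENNReal NNReal RealInnerProductSpace ContDiff

noncomputable section

namespace IPG

/-- The Euclidean space of dimension `d`. -/
abbrev E (d : ℕ) := EuclideanSpace ℝ (Fin d)

/-- The surface measure: the `(d-1)`-dimensional Hausdorff measure, normalised so that it is
`(d-1)`-dimensional Lebesgue measure on hyperplanes. -/
def surf (d : ℕ) : Measure (E d) := μHE[d - 1]

/-! ### Polyhedra and Lipschitz domains -/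

/-- A convex polytope: the convex hull of finitely many points. -/
def IsConvexPolytope {d : ℕ} (Q : Set (E d)) : Prop :=
  ∃ s : Finset (E d), Q = convexHull ℝ (s : Set (E d))

/-- An `n`-dimensional (closed, bounded, not necessarily convex) polyhedron: a finite nonempty union
of `n`-dimensional convex polytopes which lie in one `n`-dimensional affine subspace. -/
def IsPolyhedron {d : ℕ} (n : ℕ) (S : Set (E d)) : Prop :=
  ∃ A : AffineSubspace ℝ (E d), Module.finrank ℝ A.direction = n ∧
    ∃ 𝒬 : Set (Set (E d)), 𝒬.Finite ∧ 𝒬.Nonempty ∧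
      (∀ Q ∈ 𝒬, IsConvexPolytope Q ∧ affineSpan ℝ Q = A) ∧ S = ⋃₀ 𝒬

/-- Near each of its boundary points, the set is, in suitable orthogonal coordinates, the strict
epigraph of a Lipschitz function (`e` is the vertical direction and `φ` does not depend on the
vertical coordinate). -/
def HasLipschitzBoundary {d : ℕ} (Ω : Set (E d)) : Prop :=
  ∀ x ∈ frontier Ω, ∃ e : E d, ‖e‖ = 1 ∧ ∃ ρ : ℝ, 0 < ρ ∧ ∃ (L : ℝ≥0) (φ : E d → ℝ),
    LipschitzWith L φ ∧ (∀ (y : E d) (t : ℝ), φ (y + t • e) = φ y) ∧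
      ∀ y ∈ Metric.ball x ρ, (y ∈ Ω ↔ φ y < ⟪e, y⟫)

/-- `x` is a flat boundary point of `A` with unit outer normal `ν`: near `x` the interior of `A` is an
open half-ball with outer normal `ν`. Surface-almost every boundary point of a polyhedron (or of a
polyhedral Lipschitz domain) is of this kind. -/
def IsFlatPoint {d : ℕ} (A : Set (E d)) (x ν : E d) : Prop :=
  ‖ν‖ = 1 ∧ ∃ ρ : ℝ, 0 < ρ ∧ ∀ y ∈ Metric.ball x ρ, (y ∈ interior A ↔ ⟪ν, y - x⟫ < 0)

open Classical in
/-- The unit outer normal of a polyhedral set, defined at its flat boundary points. -/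
def outerNormal {d : ℕ} (A : Set (E d)) (x : E d) : E d :=
  if h : ∃ ν, IsFlatPoint A x ν then h.choose else 0

/-! ### Traces -/

/-- `g` is the trace on `∂A` of `w`, taken from inside the polyhedral set `A`: `g` is square
integrable on `∂A`, and near every flat boundary point, `w (y - t ν)` converges to `g y` in `L¹` (in
the mean over `0 < t < ε`, as `ε → 0`) when one approaches the boundary in the direction of the normal.
For `w ∈ H¹` this is the usual Sobolev trace; for `w` continuous up to the boundary it is the
restriction of `w`. The trace is unique up to surface null sets. -/
def HasTrace {d : ℕ} {G : Type*} [NormedAddCommGroup G] (A : Set (E d)) (w g : E d → G) : Prop :=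
  MemLp g 2 ((surf d).restrict (frontier A)) ∧
    ∀ x ν : E d, IsFlatPoint A x ν → ∃ ρ : ℝ, 0 < ρ ∧
      Tendsto (fun ε : ℝ =>
          (∫⁻ t in Ioo (0 : ℝ) ε, ∫⁻ y in frontier A ∩ Metric.ball x ρ,
            ‖w (y - t • ν) - g y‖ₑ ∂(surf d)) / ENNReal.ofReal ε)
        (𝓝[>] 0) (𝓝 0)

open Classical in
/-- The trace of `w` on `∂A`, taken from inside `A`. -/
def trace {d : ℕ} {G : Type*} [NormedAddCommGroup G] (A : Set (E d)) (w : E d → G) : E d → G :=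
  if h : ∃ g, HasTrace A w g then h.choose else 0

/-- `b` is the trace of the outer normal component of the vector field `p` on `∂A`, taken from
inside `A`. -/
def HasNormalTrace {d : ℕ} (A : Set (E d)) (p : E d → E d) (b : E d → ℝ) : Prop :=
  MemLp b 2 ((surf d).restrict (frontier A)) ∧
    ∀ x ν : E d, IsFlatPoint A x ν → ∃ ρ : ℝ, 0 < ρ ∧
      Tendsto (fun ε : ℝ =>
          (∫⁻ t in Ioo (0 : ℝ) ε, ∫⁻ y in frontier A ∩ Metric.ball x ρ,
            ‖⟪p (y - t • ν), ν⟫ - b y‖ₑ ∂(surf d)) / ENNReal.ofReal ε)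
        (𝓝[>] 0) (𝓝 0)

open Classical in
/-- The trace `p · ν` of the normal component of `p` on `∂A`, taken from inside `A`. -/
def normalTrace {d : ℕ} (A : Set (E d)) (p : E d → E d) : E d → ℝ :=
  if h : ∃ b, HasNormalTrace A p b then h.choose else 0

/-! ### Sobolev spaces on an open set `U` -/

/-- Test functions on `U`. -/
def IsTest {d : ℕ} (U : Set (E d)) (φ : E d → ℝ) : Prop :=
  ContDiff ℝ ∞ φ ∧ HasCompactSupport φ ∧ tsupport φ ⊆ U

/-- `D` is the weak derivative of `w` on `U` in the direction `e`. -/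
def HasWeakDeriv {d : ℕ} (U : Set (E d)) (w : E d → ℝ) (e : E d) (D : E d → ℝ) : Prop :=
  ∀ φ : E d → ℝ, IsTest U φ →
    ∫ x in U, w x * fderiv ℝ φ x e = - ∫ x in U, D x * φ x

/-- `G` is a square integrable weak gradient of `w` on `U`. -/
def HasWeakGrad {d : ℕ} (U : Set (E d)) (w : E d → ℝ) (G : E d → E d) : Prop :=
  MemLp G 2 (volume.restrict U) ∧ ∀ e : E d, HasWeakDeriv U w e (fun x => ⟪G x, e⟫)

/-- The space `H¹(U)`. -/
def MemH1 {d : ℕ} (U : Set (E d)) (w : E d → ℝ) : Prop :=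
  MemLp w 2 (volume.restrict U) ∧ ∃ G, HasWeakGrad U w G

open Classical in
/-- The weak gradient of `w ∈ H¹(U)`. -/
def weakGrad {d : ℕ} (U : Set (E d)) (w : E d → ℝ) : E d → E d :=
  if h : ∃ G, HasWeakGrad U w G then h.choose else 0

/-- The space `H²(U)`. -/
def MemH2 {d : ℕ} (U : Set (E d)) (w : E d → ℝ) : Prop :=
  MemH1 U w ∧ ∀ i : Fin d, MemH1 U (fun x => weakGrad U w x i)

/-- The space `H(div; U)`. -/
def MemHdiv {d : ℕ} (U : Set (E d)) (p : E d → E d) : Prop :=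
  MemLp p 2 (volume.restrict U) ∧ ∃ D : E d → ℝ, MemLp D 2 (volume.restrict U) ∧
    ∀ φ : E d → ℝ, IsTest U φ →
      ∫ x in U, fderiv ℝ φ x (p x) = - ∫ x in U, D x * φ x

/-! ### The boundary value problem -/

/-- The data of the problem `-∇·(K∇u - c u) + r u = f` in `Ω`, `(K∇u - c u)·ν = g₁` on `Γ₁`,
`(K∇u - c u)·ν + α u = g₂` on `Γ₂`, `u = g₃` on `Γ₃`. -/
structure Problem (d : ℕ) where
  Ω : Set (E d)
  Γ₁ : Set (E d)
  Γ₂ : Set (E d)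
  Γ₃ : Set (E d)
  K : E d → E d →L[ℝ] E d
  c : E d → E d
  r : E d → ℝ
  f : E d → ℝ
  α : E d → ℝ
  g₁ : E d → ℝ
  g₂ : E d → ℝ
  g₃ : E d → ℝ

/-- The standing assumptions on the data. -/
structure Problem.Admissible {d : ℕ} (P : Problem d) : Prop where
  isOpen : IsOpen P.Ω
  isConnected : IsConnected P.Ω
  isBounded : Bornology.IsBounded P.Ω
  lipschitz : HasLipschitzBoundary P.Ω
  polyhedral : IsPolyhedron d (closure P.Ω)
  boundary_eq : frontier P.Ω = P.Γ₁ ∪ P.Γ₂ ∪ P.Γ₃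
  disjoint₁₂ : Disjoint P.Γ₁ P.Γ₂
  disjoint₁₃ : Disjoint P.Γ₁ P.Γ₃
  disjoint₂₃ : Disjoint P.Γ₂ P.Γ₃
  isClosed₃ : IsClosed P.Γ₃
  K_bounded : MemLp P.K ∞ (volume.restrict P.Ω)
  K_symm : ∀ᵐ x ∂(volume.restrict P.Ω), ∀ ξ ζ : E d, ⟪P.K x ξ, ζ⟫ = ⟪ξ, P.K x ζ⟫
  K_elliptic : ∃ k₀ : ℝ, 0 < k₀ ∧
    ∀ᵐ x ∂(volume.restrict P.Ω), ∀ ξ : E d, k₀ * ‖ξ‖ ^ 2 ≤ ⟪ξ, P.K x ξ⟫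
  c_bounded : MemLp P.c ∞ (volume.restrict P.Ω)
  c_deriv : ∀ j : Fin d, ∃ D : E d → ℝ, MemLp D (3 / 2) (volume.restrict P.Ω) ∧
    HasWeakDeriv P.Ω (fun x => P.c x j) (EuclideanSpace.single j 1) D
  r_bounded : MemLp P.r ∞ (volume.restrict P.Ω)
  f_mem : MemLp P.f 2 (volume.restrict P.Ω)
  α_bounded : MemLp P.α ∞ ((surf d).restrict P.Γ₂)
  g₁_mem : MemLp P.g₁ 2 ((surf d).restrict P.Γ₁)
  g₂_mem : MemLp P.g₂ 2 ((surf d).restrict P.Γ₂)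

/-- `ν·c ≥ 0` on `Γ₂,₁ = {x ∈ Γ₂ | α(x) = ν·c}`. -/
def Problem.OutflowSign {d : ℕ} (P : Problem d) : Prop :=
  ∀ᵐ x ∂((surf d).restrict P.Γ₂),
    P.α x = normalTrace P.Ω P.c x → 0 ≤ normalTrace P.Ω P.c x

/-- The bilinear form `a(u,v) = (K∇u - c u, ∇v) + (r u, v) + (α u, v)_{Γ₂}`. -/
def Problem.form {d : ℕ} (P : Problem d) (u v : E d → ℝ) : ℝ :=
  (∫ x in P.Ω, (⟪P.K x (weakGrad P.Ω u x) - u x • P.c x, weakGrad P.Ω v x⟫ + P.r x * u x * v x))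
    + ∫ x in P.Γ₂, P.α x * trace P.Ω u x * trace P.Ω v x ∂(surf d)

/-- The linear form `ℓ(v) = (f, v) + (g₁, v)_{Γ₁} + (g₂, v)_{Γ₂}`. -/
def Problem.functional {d : ℕ} (P : Problem d) (v : E d → ℝ) : ℝ :=
  (∫ x in P.Ω, P.f x * v x) + (∫ x in P.Γ₁, P.g₁ x * trace P.Ω v x ∂(surf d))
    + ∫ x in P.Γ₂, P.g₂ x * trace P.Ω v x ∂(surf d)

/-- The space `V` of the functions in `H¹(Ω)` with zero trace on `Γ₃`. -/
def Problem.MemV {d : ℕ} (P : Problem d) (v : E d → ℝ) : Prop :=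
  MemH1 P.Ω v ∧ ∀ᵐ x ∂((surf d).restrict P.Γ₃), trace P.Ω v x = 0

/-- `u ∈ H¹(Ω)` is a weak solution: `u = g₃` on `Γ₃` in the sense of traces, and `a(u,v) = ℓ(v)` for
all `v ∈ V`. -/
def Problem.IsWeakSolution {d : ℕ} (P : Problem d) (u : E d → ℝ) : Prop :=
  MemH1 P.Ω u ∧ (∀ᵐ x ∂((surf d).restrict P.Γ₃), trace P.Ω u x = P.g₃ x) ∧
    ∀ v : E d → ℝ, P.MemV v → P.form u v = P.functional v

/-- `K∇u ∈ H(div; Ω)` and `c u ∈ H¹(Ω)` (componentwise). -/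
def Problem.FluxRegular {d : ℕ} (P : Problem d) (u : E d → ℝ) : Prop :=
  MemHdiv P.Ω (fun x => P.K x (weakGrad P.Ω u x)) ∧
    ∀ i : Fin d, MemH1 P.Ω (fun x => P.c x i * u x)

/-! ### Partitions -/

/-- A finite family of elements, together with the faces of each element. -/
structure Mesh (d : ℕ) where
  cells : Finset (Set (E d))
  faces : Set (E d) → Finset (Set (E d))

open Classical in
/-- All faces of all elements. -/
def Mesh.allFaces {d : ℕ} (T : Mesh d) : Finset (Set (E d)) := T.cells.biUnion T.faces

open Classical in
/-- The faces that lie on the boundary of `Ω`. -/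
def Mesh.boundaryFaces {d : ℕ} (T : Mesh d) (Ω : Set (E d)) : Finset (Set (E d)) :=
  T.allFaces.filter (fun F => F ⊆ frontier Ω)

open Classical in
/-- The interior faces. -/
def Mesh.interiorFaces {d : ℕ} (T : Mesh d) (Ω : Set (E d)) : Finset (Set (E d)) :=
  T.allFaces.filter (fun F => ¬ F ⊆ frontier Ω)

open Classical in
/-- The boundary faces that belong to the part `Γ` of the boundary. -/
def Mesh.facesOn {d : ℕ} (T : Mesh d) (Ω Γ : Set (E d)) : Finset (Set (E d)) :=
  (T.boundaryFaces Ω).filter (fun F => F ⊆ closure Γ)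

open Classical in
/-- The elements that have `F` as a face (two of them for an interior face, one for a boundary
face). -/
def Mesh.cellsAt {d : ℕ} (T : Mesh d) (F : Set (E d)) : Finset (Set (E d)) :=
  T.cells.filter (fun κ => F ∈ T.faces κ)

/-- `T` is a consistent partition of the closure of `Ω` into polyhedra: the elements cover, they have
disjoint interiors, each face of an element lies on `∂Ω` or is also a face of another element, and
each of the boundary parts `Γⱼ` is, up to closure, the union of its own set of faces. -/
structure Mesh.IsConsistent {d : ℕ} (T : Mesh d) (P : Problem d) : Prop where
  cell_polyhedron : ∀ κ ∈ T.cells, IsPolyhedron d κ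
  face_polyhedron : ∀ κ ∈ T.cells, ∀ F ∈ T.faces κ, IsPolyhedron (d - 1) F
  cell_boundary : ∀ κ ∈ T.cells, frontier κ = ⋃ F ∈ T.faces κ, F
  face_overlap : ∀ κ ∈ T.cells, ∀ F ∈ T.faces κ, ∀ F' ∈ T.faces κ, F ≠ F' → surf d (F ∩ F') = 0
  cover : closure P.Ω = ⋃ κ ∈ T.cells, κ
  disjoint : ∀ κ ∈ T.cells, ∀ κ' ∈ T.cells, κ ≠ κ' → Disjoint (interior κ) (interior κ')
  matching : ∀ κ ∈ T.cells, ∀ F ∈ T.faces κ,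
    F ⊆ frontier P.Ω ∨ ∃ κ' ∈ T.cells, κ' ≠ κ ∧ F ∈ T.faces κ'
  closure₁ : closure P.Γ₁ = ⋃ F ∈ T.facesOn P.Ω P.Γ₁, F
  closure₂ : closure P.Γ₂ = ⋃ F ∈ T.facesOn P.Ω P.Γ₂, F
  closure₃ : closure P.Γ₃ = ⋃ F ∈ T.facesOn P.Ω P.Γ₃, F
  faces_disjoint₁₂ : Disjoint (T.facesOn P.Ω P.Γ₁) (T.facesOn P.Ω P.Γ₂)
  faces_disjoint₁₃ : Disjoint (T.facesOn P.Ω P.Γ₁) (T.facesOn P.Ω P.Γ₃)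
  faces_disjoint₂₃ : Disjoint (T.facesOn P.Ω P.Γ₂) (T.facesOn P.Ω P.Γ₃)

open Classical in
/-- The faces of `Γ₂` on which `α = ν·c`. -/
def Mesh.faces₂₁ {d : ℕ} (T : Mesh d) (P : Problem d) : Finset (Set (E d)) :=
  (T.facesOn P.Ω P.Γ₂).filter
    (fun F => ∀ᵐ x ∂((surf d).restrict F), P.α x = normalTrace P.Ω P.c x)

open Classical in
/-- The remaining faces of `Γ₂`. -/
def Mesh.faces₂₂ {d : ℕ} (T : Mesh d) (P : Problem d) : Finset (Set (E d)) :=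
  T.facesOn P.Ω P.Γ₂ \ T.faces₂₁ P

/-- The partition is compatible with `Γ₂,₁ = {x ∈ Γ₂ | α(x) = ν·c}`: each face of `Γ₂` belongs (up to
null sets) to `Γ₂,₁` or to its complement. -/
def Mesh.IsCompatible {d : ℕ} (T : Mesh d) (P : Problem d) : Prop :=
  ∀ F ∈ T.faces₂₂ P, ∀ᵐ x ∂((surf d).restrict F), P.α x ≠ normalTrace P.Ω P.c x

/-- The broken Sobolev space `H²(T)`. -/
def Mesh.MemBrokenH2 {d : ℕ} (T : Mesh d) (Ω : Set (E d)) (w : E d → ℝ) : Prop :=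
  MemLp w 2 (volume.restrict Ω) ∧ ∀ κ ∈ T.cells, MemH2 (interior κ) w

/-- The two kinds of local polynomial spaces: `total` for `𝒫ₖ` (total degree at most `k`), `partialDeg`
for `𝒬ₖ` (degree at most `k` in each variable). -/
inductive PolyKind where
  | total
  | partialDeg

/-- `p` has degree at most `k`, in the sense of the given kind. -/
def PolyKind.DegreeLE {d : ℕ} : PolyKind → ℕ → MvPolynomial (Fin d) ℝ → Prop
  | .total, k, p => p.totalDegree ≤ k
  | .partialDeg, k, p => ∀ i, p.degreeOf i ≤ k

/-- The broken polynomial space; `kind` tells for each element whether `𝒫ₖ` or `𝒬ₖ` is used. -/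
def Mesh.MemBrokenPoly {d : ℕ} (T : Mesh d) (Ω : Set (E d)) (kind : Set (E d) → PolyKind) (k : ℕ)
    (v : E d → ℝ) : Prop :=
  MemLp v 2 (volume.restrict Ω) ∧ ∀ κ ∈ T.cells, ∃ p : MvPolynomial (Fin d) ℝ,
    (kind κ).DegreeLE k p ∧ ∀ᵐ x ∂(volume.restrict κ), v x = MvPolynomial.eval (fun i => x i) p

/-! ### The interior penalty forms -/

/-- The flux `K∇w` on the element `κ`, with the elementwise gradient. -/
def cellFlux {d : ℕ} (P : Problem d) (κ : Set (E d)) (w : E d → ℝ) : E d → E d :=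
  fun x => P.K x (weakGrad (interior κ) w x)

/-- The jump of a scalar function: `w|_κ ν_κ + w|_κ' ν_κ'` on an interior face, `w|_κ ν_κ` on a
boundary face. -/
def Mesh.jump {d : ℕ} (T : Mesh d) (F : Set (E d)) (w : E d → ℝ) (x : E d) : E d :=
  ∑ κ ∈ T.cellsAt F, trace κ w x • outerNormal κ x

/-- The average of `K∇w`: the mean of the traces from the two sides on an interior face, the trace on a
boundary face. -/
def Mesh.avgFlux {d : ℕ} (T : Mesh d) (P : Problem d) (F : Set (E d)) (w : E d → ℝ) (x : E d) : E d :=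
  ((T.cellsAt F).card : ℝ)⁻¹ • ∑ κ ∈ T.cellsAt F, trace κ (cellFlux P κ w) x

/-- The boundary value of `w` on a boundary face (the sum has one term). -/
def Mesh.bdryTrace {d : ℕ} (T : Mesh d) (F : Set (E d)) (w : E d → ℝ) (x : E d) : ℝ :=
  ∑ κ ∈ T.cellsAt F, trace κ w x

open Classical in
/-- The upwind value of `w`: the value from the element `κ` with `c·ν_κ > 0`. On a boundary face with
`c·ν ≤ 0`, and where `c·ν = 0`, it is zero. -/
def Mesh.upwind {d : ℕ} (T : Mesh d) (P : Problem d) (F : Set (E d)) (w : E d → ℝ) (x : E d) : ℝ :=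
  ∑ κ ∈ T.cellsAt F, if 0 < normalTrace κ P.c x then trace κ w x else 0

/-- The pointwise product of the upwind flux `c_upw(w)` with the jump of `v`: the upwind flux is `c`
times the upwind value of `w`, and `c · (v|_κ ν_κ + v|_κ' ν_κ') = (c·ν_κ) v|_κ + (c·ν_κ') v|_κ'`. -/
def Mesh.upwindJump {d : ℕ} (T : Mesh d) (P : Problem d) (F : Set (E d)) (w v : E d → ℝ)
    (x : E d) : ℝ :=
  T.upwind P F w x * ∑ κ ∈ T.cellsAt F, normalTrace κ P.c x * trace κ v x

open Classical in
/-- The bilinear form `a_h` of the interior penalty method with symmetrisation parameter `θ` and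
penalty parameter `η`; `h_F` is the diameter of `F`. -/
def Mesh.ipForm {d : ℕ} (T : Mesh d) (P : Problem d) (θ η : ℝ) (w v : E d → ℝ) : ℝ :=
  (∑ κ ∈ T.cells, ∫ x in κ,
      (⟪cellFlux P κ w x - w x • P.c x, weakGrad (interior κ) v x⟫ + P.r x * w x * v x))
    + (∑ F ∈ T.interiorFaces P.Ω ∪ T.facesOn P.Ω P.Γ₃, ∫ x in F,
        (θ * ⟪T.avgFlux P F v x, T.jump F w x⟫
          - ⟪T.avgFlux P F w x - (η / Metric.diam F) • T.jump F w x, T.jump F v x⟫) ∂(surf d))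
    + (∑ F ∈ T.interiorFaces P.Ω ∪ T.faces₂₁ P, ∫ x in F, T.upwindJump P F w v x ∂(surf d))
    + ∑ F ∈ T.faces₂₂ P, ∫ x in F, P.α x * T.bdryTrace F w x * T.bdryTrace F v x ∂(surf d)

/-- The linear form `ℓ_h` of the interior penalty method. -/
def Mesh.ipFunctional {d : ℕ} (T : Mesh d) (P : Problem d) (θ η : ℝ) (v : E d → ℝ) : ℝ :=
  (∫ x in P.Ω, P.f x * v x)
    + (∑ F ∈ T.facesOn P.Ω P.Γ₁, ∫ x in F, P.g₁ x * T.bdryTrace F v x ∂(surf d))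
    + (∑ F ∈ T.facesOn P.Ω P.Γ₂, ∫ x in F, P.g₂ x * T.bdryTrace F v x ∂(surf d))
    + ∑ F ∈ T.facesOn P.Ω P.Γ₃, ∫ x in F,
        ((η / Metric.diam F) * (P.g₃ x * T.bdryTrace F v x)
          + (θ * ⟪T.avgFlux P F v x, outerNormal P.Ω x⟫
              - normalTrace P.Ω P.c x * T.bdryTrace F v x) * P.g₃ x) ∂(surf d)

end IPG

end

namespace IPG

/-! ### Hyperplanes and their parametrisation -/

/-! The flux σ = K∇u − cu of a weak solution has weak divergence ru − f in Ω, as testing with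
functions supported in Ω shows (`hasWeakDiv_flux`). Green's formula on each polyhedral element,
applied with a polynomial, turns the volume part of the bilinear form into (f, v) plus the integrals
of (σ·ν_κ) v over the element boundaries (`green`). These are regrouped face by face, and every face
then balances on its own. Across an interior face the normal components of σ and of c from the two
sides cancel and the traces of u agree; hence the jump of u is zero, the average of K∇u carries the
normal component of σ plus (c·ν)u, and the upwind term removes the latter (`interior_face`). On Γ₁
and Γ₂ the weak formulation contains the natural conditions σ·ν = g₁ and σ·ν = g₂ − αu; where α =
ν·c, the sign ν·c ≥ 0 turns αu into the upwind flux. On Γ₃ one inserts u = g₃.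

The work lies in the traces. They are selected by choice among the functions to which w(y − tν)
converges in L¹, in the mean over short t, so existence, square integrability and uniqueness have to
be available wherever a trace occurs. For existence, a function with an integrable weak derivative
in a direction transversal to a hyperplane is, along that direction, an initial value plus the
integral of the derivative (`exists_initialValue`), and continuity of translations in L¹ replaces
the oblique direction by the normal one (`normal_avgZero_of_initialValue`). The freedom to choose
the direction is what gives square integrability up to the edges: near each of its points a convex
piece admits one direction that leads into its interior from all its nearby points
(`exists_lintegral_piece_lt_top`).

For Green's formula, a cutoff in the depth below a flat part of the boundary gives the formula on a
half ball (`integral_halfBall_eq`). Used from both sides of a hyperplane, it gives the cancellation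
of normal traces (`normalLimit_add_eq_zero`). All elements and Ω are bounded by finitely many
hyperplanes, and boundary points off the skeleton, the union of the pairwise intersections of
nonparallel hyperplanes, are flat. The skeleton has codimension two: tubes of width 1/k around it
have volume O(k⁻²), so cutoffs with gradients O(k) are negligible against square integrable fields,
and the formula extends to the whole element (`IsBody.integral_eq`). The skeleton is also surface
null, so edges and degenerate faces never contribute. -/

/-- `J` parametrises the hyperplane orthogonal to the unit vector `ν` isometrically. -/
def IsTangent {n : ℕ} (J : E n →ₗᵢ[ℝ] E (n + 1)) (ν : E (n + 1)) : Prop :=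
  ‖ν‖ = 1 ∧ ∀ z, ⟪ν, J z⟫ = 0

/-- The hyperplane through `x` with normal `ν`. -/
def plane {d : ℕ} (x ν : E d) : Set (E d) := {y | ⟪ν, y - x⟫ = 0}

theorem exists_isTangent {n : ℕ} {ν : E (n + 1)} (hν : ‖ν‖ = 1) :
    ∃ J : E n →ₗᵢ[ℝ] E (n + 1), IsTangent J ν := by
  have hne : ν ≠ 0 := by
    rintro rfl; simp at hν
  have : Fact (Module.finrank ℝ (E (n + 1)) = n + 1) := ⟨by simp⟩
  have hfr : Module.finrank ℝ (ℝ ∙ ν)ᗮ = n := Submodule.finrank_orthogonal_span_singleton hne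
  let b := (stdOrthonormalBasis ℝ (ℝ ∙ ν)ᗮ).reindex (finCongr hfr)
  refine ⟨(ℝ ∙ ν)ᗮ.subtypeₗᵢ.comp b.repr.symm.toLinearIsometry, hν, fun z => ?_⟩
  have := (b.repr.symm z).2
  rw [Submodule.mem_orthogonal_singleton_iff_inner_right] at this
  exact this

section Tangent

variable {n : ℕ} {J : E n →ₗᵢ[ℝ] E (n + 1)} {ν : E (n + 1)}

/-- The coordinates `(z, t) ↦ x + J z - t ν` adapted to a hyperplane. -/
noncomputable def flatMap (J : E n →ₗᵢ[ℝ] E (n + 1)) (x ν : E (n + 1)) (p : E n × ℝ) : E (n + 1) :=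
  x + J p.1 - p.2 • ν

theorem IsTangent.inner_flatMap (hJ : IsTangent J ν) (x : E (n + 1)) (p : E n × ℝ) :
    ⟪ν, flatMap J x ν p - x⟫ = - p.2 := by
  have h1 : flatMap J x ν p - x = J p.1 - p.2 • ν := by
    rw [flatMap]; abel
  rw [h1, inner_sub_right, hJ.2, inner_smul_right, real_inner_self_eq_norm_sq, hJ.1]
  simp

theorem IsTangent.norm_sq (hJ : IsTangent J ν) (z : E n) (t : ℝ) :
    ‖J z - t • ν‖ ^ 2 = ‖z‖ ^ 2 + t ^ 2 := by
  rw [norm_sub_sq_real, inner_smul_right, real_inner_comm, hJ.2, norm_smul, hJ.1, J.norm_map]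
  simp

/-- The linear isometry underlying `flatMap`. -/
theorem IsTangent.exists_isometryEquiv (hJ : IsTangent J ν) :
    ∃ Φ : WithLp 2 (E n × ℝ) ≃ₗᵢ[ℝ] E (n + 1), ∀ p, Φ p = J p.fst - p.snd • ν := by
  let L : WithLp 2 (E n × ℝ) →ₗᵢ[ℝ] E (n + 1) :=
    { toFun := fun p => J p.fst - p.snd • ν
      map_add' := by
        intro p q
        simp only [WithLp.add_fst, WithLp.add_snd, map_add, add_smul]; abel
      map_smul' := by
        intro c p
        simp only [WithLp.smul_fst, WithLp.smul_snd, map_smul, smul_eq_mul, mul_smul, RingHom.id_apply,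
          smul_sub]
      norm_map' := by
        intro p
        have h := hJ.norm_sq p.fst p.snd
        have h2 : ‖p‖ ^ 2 = ‖p.fst‖ ^ 2 + ‖p.snd‖ ^ 2 := WithLp.prod_norm_sq_eq_of_L2 p
        rw [Real.norm_eq_abs, sq_abs, ← h] at h2
        exact ((sq_eq_sq₀ (norm_nonneg _) (norm_nonneg _)).1 h2).symm }
  have hfr : Module.finrank ℝ (WithLp 2 (E n × ℝ)) = Module.finrank ℝ (E (n + 1)) := by
    rw [(WithLp.linearEquiv 2 ℝ (E n × ℝ)).finrank_eq]
    simp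
  exact ⟨L.toLinearIsometryEquiv hfr, fun p => rfl⟩

/-- `flatMap` as a homeomorphism. -/
theorem IsTangent.exists_homeomorph (hJ : IsTangent J ν) (x : E (n + 1)) :
    ∃ Φ : E n × ℝ ≃ₜ E (n + 1), ⇑Φ = flatMap J x ν := by
  obtain ⟨Φ, hΦ⟩ := hJ.exists_isometryEquiv
  refine ⟨((WithLp.prodContinuousLinearEquiv 2 ℝ (E n) ℝ).symm.toHomeomorph.trans
    Φ.toHomeomorph).trans (Homeomorph.addLeft x), ?_⟩
  funext p
  simp [flatMap, hΦ, add_sub_assoc]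

theorem IsTangent.measurableEmbedding_flatMap (hJ : IsTangent J ν) (x : E (n + 1)) :
    MeasurableEmbedding (flatMap J x ν) := by
  obtain ⟨Φ, hΦ⟩ := hJ.exists_homeomorph x
  rw [← hΦ]; exact Φ.measurableEmbedding

theorem IsTangent.measurePreserving_flatMap (hJ : IsTangent J ν) (x : E (n + 1)) :
    MeasurePreserving (flatMap J x ν) (volume : Measure (E n × ℝ)) volume := by
  obtain ⟨Φ, hΦ⟩ := hJ.exists_isometryEquiv
  have h := ((measurePreserving_add_left (volume : Measure (E (n + 1))) x).comp
    Φ.measurePreserving).comp (WithLp.volume_preserving_toLp (E n) ℝ)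
  have e : ((fun y => x + y) ∘ Φ) ∘ WithLp.toLp 2 = flatMap J x ν := by
    funext p
    simp [flatMap, hΦ, add_sub_assoc]
  rw [← e]; exact h

theorem IsTangent.isometry (J : E n →ₗᵢ[ℝ] E (n + 1)) (x : E (n + 1)) :
    Isometry (fun z => x + J z) :=
  (isometry_add_left x).comp J.isometry

theorem IsTangent.range_eq_plane (hJ : IsTangent J ν) (x : E (n + 1)) :
    range (fun z => x + J z) = plane x ν := by
  ext y
  constructor
  · rintro ⟨z, rfl⟩
    simp [plane, hJ.2]
  · intro hy
    obtain ⟨Φ, hΦ⟩ := hJ.exists_homeomorph x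
    obtain ⟨p, rfl⟩ := Φ.surjective y
    rw [hΦ, plane, mem_ofPred_eq, hJ.inner_flatMap, neg_eq_zero] at hy
    refine ⟨p.1, ?_⟩
    rw [hΦ]; simp [flatMap, hy]

theorem IsTangent.measurableEmbedding (J : E n →ₗᵢ[ℝ] E (n + 1)) (x : E (n + 1)) :
    MeasurableEmbedding (fun z => x + J z) :=
  (IsTangent.isometry J x).isClosedEmbedding.measurableEmbedding

theorem isClosed_plane {d : ℕ} (x ν : E d) : IsClosed (plane x ν) := by
  have : Continuous fun y : E d => ⟪ν, y - x⟫ := by fun_prop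
  exact isClosed_singleton.preimage this

theorem measurableSet_plane {d : ℕ} (x ν : E d) : MeasurableSet (plane x ν) :=
  (isClosed_plane x ν).measurableSet

/-- An isometry carries Hausdorff measure to Hausdorff measure on its range, and in full dimension
the normalised one is Lebesgue measure. Writing the dimension as `n + 1` makes the exponent in
`surf` equal to `n`. -/
theorem IsTangent.map_volume (hJ : IsTangent J ν) (x : E (n + 1)) :
    Measure.map (fun z => x + J z) (volume : Measure (E n)) =
      (surf (n + 1)).restrict (plane x ν) := by
  rw [← hJ.range_eq_plane x, surf, Nat.add_sub_cancel,
    ← (IsTangent.isometry J x).map_euclideanHausdorffMeasure,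
    EuclideanSpace.euclideanHausdorffMeasure_eq_volume]

theorem IsTangent.measurePreserving (hJ : IsTangent J ν) (x : E (n + 1)) :
    MeasurePreserving (fun z => x + J z) (volume : Measure (E n))
      ((surf (n + 1)).restrict (plane x ν)) :=
  ⟨(IsTangent.measurableEmbedding J x).measurable, hJ.map_volume x⟩

/-- On the whole space `surf` is far from sigma-finite; Fubini becomes available only after
restriction to a hyperplane. -/
theorem sigmaFinite_surf_plane (x : E (n + 1)) (hν : ‖ν‖ = 1) :
    SigmaFinite ((surf (n + 1)).restrict (plane x ν)) := by
  obtain ⟨J, hJ⟩ := exists_isTangent hν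
  rw [← hJ.map_volume x]
  exact (IsTangent.measurableEmbedding J x).sigmaFinite_map

/-- Moving a hyperplane along its normal preserves the measure. -/
theorem measurePreserving_normalFlow (x : E (n + 1)) (hν : ‖ν‖ = 1) :
    MeasurePreserving (fun p : E (n + 1) × ℝ => p.1 - p.2 • ν)
      (((surf (n + 1)).restrict (plane x ν)).prod volume) volume := by
  obtain ⟨J, hJ⟩ := exists_isTangent hν
  have h1 := hJ.measurePreserving_flatMap x
  have := sigmaFinite_surf_plane x hν
  have h2 : Measure.map (Prod.map (fun z => x + J z) (id : ℝ → ℝ))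
      (volume : Measure (E n × ℝ)) = (((surf (n + 1)).restrict (plane x ν)).prod volume) :=
    ((hJ.measurePreserving x).prod (MeasurePreserving.id volume)).map_eq
  refine ⟨by fun_prop, ?_⟩
  rw [← h2, Measure.map_map (by fun_prop)
    ((IsTangent.measurableEmbedding J x).measurable.prodMap measurable_id)]
  exact h1.map_eq

theorem surf_plane_lt_top (x : E (n + 1)) (hν : ‖ν‖ = 1) {B : Set (E (n + 1))}
    (hB : Bornology.IsBounded B) : surf (n + 1) (plane x ν ∩ B) < ⊤ := by
  obtain ⟨J, hJ⟩ := exists_isTangent hν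
  have hme := IsTangent.measurableEmbedding J x
  rw [inter_comm]
  refine (Measure.le_restrict_apply _ _).trans_lt ?_
  rw [← hJ.map_volume x, hme.map_apply]
  have : Bornology.IsBounded ((fun z => x + J z) ⁻¹' B) := by
    obtain ⟨C, hC⟩ := hB.subset_ball x
    refine (Metric.isBounded_ball (x := (0 : E n)) (r := C)).subset fun z hz => ?_
    have := hC hz
    simpa using this
  exact this.measure_lt_top

end Tangent

end IPG

namespace IPG

/-! ### Vanishing means over short time intervals -/

/-- The mean over `0 < t < ε` of the integral of `F t` tends to zero as `ε → 0`. -/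
def AvgZero {Y : Type*} [MeasurableSpace Y] (μ : Measure Y) (F : ℝ → Y → ℝ≥0∞) : Prop :=
  Tendsto (fun ε : ℝ => (∫⁻ t in Ioo (0 : ℝ) ε, ∫⁻ y, F t y ∂μ) / ENNReal.ofReal ε)
    (𝓝[>] 0) (𝓝 0)

namespace AvgZero

variable {Y : Type*} [MeasurableSpace Y] {μ : Measure Y} {F F₁ F₂ : ℝ → Y → ℝ≥0∞}

theorem of_le {δ : ℝ} (hδ : 0 < δ) (h : AvgZero μ F₂)
    (hle : ∀ᵐ t ∂(volume.restrict (Ioo (0 : ℝ) δ)), ∀ᵐ y ∂μ, F₁ t y ≤ F₂ t y) : AvgZero μ F₁ := by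
  refine tendsto_of_tendsto_of_tendsto_of_le_of_le' tendsto_const_nhds h
    (Eventually.of_forall fun _ => zero_le) ?_
  filter_upwards [Ioo_mem_nhdsGT hδ] with ε hε
  refine ENNReal.div_le_div_right (lintegral_mono_ae ?_) _
  have := ae_restrict_of_ae_restrict_of_subset (Ioo_subset_Ioo_right hε.2.le) hle
  filter_upwards [this] with t ht
  exact lintegral_mono_ae ht

theorem mono_measure {μ' : Measure Y} (h : AvgZero μ F) (hle : μ' ≤ μ) : AvgZero μ' F := by
  refine tendsto_of_tendsto_of_tendsto_of_le_of_le tendsto_const_nhds h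
    (fun _ => zero_le) fun ε => ?_
  dsimp only
  gcongr with t

theorem add (h₁ : AvgZero μ F₁) (h₂ : AvgZero μ F₂) [SFinite μ]
    (hm : AEMeasurable (Function.uncurry F₁) ((volume : Measure ℝ).prod μ)) :
    AvgZero μ (fun t y => F₁ t y + F₂ t y) := by
  have h := Filter.Tendsto.add h₁ h₂
  rw [add_zero] at h
  refine h.congr fun ε => ?_
  rw [← ENNReal.add_div]
  have hm' : AEMeasurable (Function.uncurry F₁) ((volume.restrict (Ioo 0 ε)).prod μ) :=
    hm.mono_ac (Measure.restrict_le_self.absolutelyContinuous.prod .rfl)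
  rw [← lintegral_add_left' (f := fun t => ∫⁻ y, F₁ t y ∂μ) hm'.lintegral_prod_right']
  congr 1
  refine lintegral_congr_ae ?_
  obtain ⟨k, hk, hFk⟩ := hm
  filter_upwards [ae_restrict_of_ae (Measure.ae_ae_of_ae_prod hFk)] with t ht
  have ht' : AEMeasurable (F₁ t) μ := ⟨fun y => k (t, y), hk.comp measurable_prodMk_left, ht⟩
  rw [lintegral_add_left' ht']

theorem const_mul (h : AvgZero μ F) {C : ℝ≥0∞} (hC : C ≠ ⊤) : AvgZero μ (fun t y => C * F t y) := by
  have h := ENNReal.Tendsto.const_mul h (Or.inr hC)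
  rw [mul_zero] at h
  refine h.congr fun ε => ?_
  rw [← mul_div_assoc, ← lintegral_const_mul' _ _ hC]
  simp_rw [← lintegral_const_mul' _ _ hC]

/-- The time mean of a stationary function is its integral. All uniqueness statements for traces
come down to this. -/
theorem lintegral_eq_zero {f : Y → ℝ≥0∞} (h : AvgZero μ (fun _ y => f y)) : ∫⁻ y, f y ∂μ = 0 := by
  have : Tendsto (fun _ : ℝ => ∫⁻ y, f y ∂μ) (𝓝[>] (0 : ℝ)) (𝓝 0) := by
    refine h.congr' ?_
    filter_upwards [self_mem_nhdsWithin] with ε hε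
    have hε : 0 < ε := hε
    rw [lintegral_const, Measure.restrict_apply_univ, Real.volume_Ioo, sub_zero,
      ENNReal.mul_div_cancel_right]
    · simpa using hε
    · simp
  exact tendsto_nhds_unique tendsto_const_nhds this

/-- A stationary error of integral at most δ contributes at most δ to every time mean, so it
suffices to control `F` up to arbitrarily small stationary errors. -/
theorem of_forall_le_add [SFinite μ]
    (h : ∀ δ : ℝ≥0∞, 0 < δ → ∃ (F' : ℝ → Y → ℝ≥0∞) (f : Y → ℝ≥0∞), AvgZero μ F' ∧
      AEMeasurable f μ ∧ ∫⁻ y, f y ∂μ ≤ δ ∧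
      ∃ τ : ℝ, 0 < τ ∧ ∀ᵐ t ∂(volume.restrict (Ioo (0 : ℝ) τ)), ∀ᵐ y ∂μ, F t y ≤ f y + F' t y) :
    AvgZero μ F := by
  refine ENNReal.tendsto_nhds_zero.2 fun δ hδ => ?_
  obtain ⟨F', f, h1, h2, h3, τ, hτ, h4⟩ := h (δ / 2) (ENNReal.half_pos hδ.ne')
  have h5 := ENNReal.tendsto_nhds_zero.1 h1 (δ / 2) (ENNReal.half_pos hδ.ne')
  filter_upwards [h5, Ioo_mem_nhdsGT hτ] with ε hε hετ
  have hle : ∫⁻ t in Ioo (0 : ℝ) ε, ∫⁻ y, F t y ∂μ ≤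
      ENNReal.ofReal ε * (δ / 2) + ∫⁻ t in Ioo (0 : ℝ) ε, ∫⁻ y, F' t y ∂μ := by
    calc ∫⁻ t in Ioo (0 : ℝ) ε, ∫⁻ y, F t y ∂μ
        ≤ ∫⁻ t in Ioo (0 : ℝ) ε, ((δ / 2) + ∫⁻ y, F' t y ∂μ) := by
          refine lintegral_mono_ae ?_
          filter_upwards [ae_restrict_of_ae_restrict_of_subset (Ioo_subset_Ioo_right hετ.2.le) h4]
            with t ht
          refine (lintegral_mono_ae ht).trans ?_
          rw [lintegral_add_left' h2]
          gcongr
      _ = _ := by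
          rw [lintegral_add_left' aemeasurable_const, lintegral_const, Measure.restrict_apply_univ,
            Real.volume_Ioo, sub_zero, mul_comm]
  calc _ ≤ (ENNReal.ofReal ε * (δ / 2) + ∫⁻ t in Ioo (0 : ℝ) ε, ∫⁻ y, F' t y ∂μ)
        / ENNReal.ofReal ε := by gcongr
    _ = δ / 2 + (∫⁻ t in Ioo (0 : ℝ) ε, ∫⁻ y, F' t y ∂μ) / ENNReal.ofReal ε := by
        rw [ENNReal.add_div, mul_comm, ENNReal.mul_div_cancel_right]
        · simpa using hετ.1
        · simp
    _ ≤ δ / 2 + δ / 2 := by gcongr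
    _ = δ := ENNReal.add_halves δ

/-- Split `f` at height N: the part below N costs only a factor N, while the excess over N is paid
for with the bound `C` and has integral tending to zero as N grows. -/
theorem mul_of_bounded [SFinite μ] (h : AvgZero μ F) {C : ℝ≥0∞} (hC : C ≠ ⊤)
    (hFC : ∀ᵐ t ∂(volume.restrict (Ioi (0 : ℝ))), ∀ᵐ y ∂μ, F t y ≤ C) {f : Y → ℝ≥0∞}
    (hf : AEMeasurable f μ) (hfi : ∫⁻ y, f y ∂μ ≠ ⊤) : AvgZero μ (fun t y => F t y * f y) := by
  have hlim : Tendsto (fun N : ℕ => C * ∫⁻ y, (f y - N) ∂μ) atTop (𝓝 0) := by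
    have : Tendsto (fun N : ℕ => ∫⁻ y, (f y - N) ∂μ) atTop (𝓝 (∫⁻ _, 0 ∂μ)) := by
      refine tendsto_lintegral_of_dominated_convergence' f (fun N => hf.sub aemeasurable_const)
        (fun N => Eventually.of_forall fun y => tsub_le_self) hfi ?_
      filter_upwards [ae_lt_top' hf hfi] with y hy
      obtain ⟨N, hN⟩ := ENNReal.exists_nat_gt hy.ne
      refine tendsto_const_nhds.congr' ?_
      filter_upwards [eventually_ge_atTop N] with M hM
      exact (tsub_eq_zero_of_le (hN.le.trans (by exact_mod_cast hM))).symm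
    have h2 := ENNReal.Tendsto.const_mul this (Or.inr hC)
    simpa using h2
  refine of_forall_le_add fun δ hδ => ?_
  obtain ⟨N, hN⟩ := ((ENNReal.tendsto_nhds_zero.1 hlim δ hδ)).exists
  refine ⟨fun t y => N * F t y, fun y => C * (f y - N), h.const_mul (by simp),
    (hf.sub aemeasurable_const).const_mul C, ?_, 1, one_pos, ?_⟩
  · rwa [lintegral_const_mul' _ _ hC]
  · filter_upwards [ae_restrict_of_ae_restrict_of_subset Ioo_subset_Ioi_self hFC] with t ht
    filter_upwards [ht] with y hy
    calc F t y * f y ≤ F t y * ((f y - N) + N) := by gcongr; exact le_tsub_add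
      _ = F t y * (f y - N) + N * F t y := by rw [mul_add, mul_comm (N : ℝ≥0∞)]
      _ ≤ C * (f y - N) + N * F t y := by gcongr

end AvgZero

/-! ### One-sided limits in the normal direction -/

/-- `w (y - t ν)` converges to `g y` in `L¹(D)`, in the mean over `0 < t < ε`, as `ε → 0`. -/
def NormalLimit {d : ℕ} {G : Type*} [NormedAddCommGroup G] (ν : E d) (D : Set (E d))
    (w g : E d → G) : Prop :=
  AvgZero ((surf d).restrict D) (fun t y => ‖w (y - t • ν) - g y‖ₑ)

/-- `p.2 - p.1 ν` maps null sets to null sets. -/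
theorem quasiMeasurePreserving_normalFlow {n : ℕ} {x ν : E (n + 1)} (hν : ‖ν‖ = 1)
    {D : Set (E (n + 1))} (hD : D ⊆ plane x ν) :
    Measure.QuasiMeasurePreserving (fun p : ℝ × E (n + 1) => p.2 - p.1 • ν)
      ((volume : Measure ℝ).prod ((surf (n + 1)).restrict D)) volume := by
  have h1 := (measurePreserving_normalFlow x hν).quasiMeasurePreserving
  have := sigmaFinite_surf_plane x hν
  have hac : (surf (n + 1)).restrict D ≪ (surf (n + 1)).restrict (plane x ν) :=
    (Measure.restrict_mono_set _ hD).absolutelyContinuous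
  have hsf : SFinite ((surf (n + 1)).restrict D) := by
    rw [← Measure.restrict_restrict_of_subset hD]; infer_instance
  have h2 : Measure.QuasiMeasurePreserving (Prod.swap : ℝ × E (n + 1) → E (n + 1) × ℝ)
      ((volume : Measure ℝ).prod ((surf (n + 1)).restrict D))
      (((surf (n + 1)).restrict (plane x ν)).prod volume) :=
    ⟨measurable_swap, by rw [Measure.prod_swap]; exact hac.prod .rfl⟩
  exact h1.comp h2

theorem sFinite_surf_restrict {n : ℕ} {x ν : E (n + 1)} (hν : ‖ν‖ = 1)
    {D : Set (E (n + 1))} (hD : D ⊆ plane x ν) : SFinite ((surf (n + 1)).restrict D) := by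
  have := sigmaFinite_surf_plane x hν
  rw [← Measure.restrict_restrict_of_subset hD]; infer_instance

/-- By Fubini, a volume null set meets almost every parallel translate of the hyperplane in a
surface null set. Hence normal limits see `w` only up to null sets. -/
theorem ae_ae_normalFlow {n : ℕ} {x ν : E (n + 1)} (hν : ‖ν‖ = 1)
    {D : Set (E (n + 1))} (hD : D ⊆ plane x ν) {p : E (n + 1) → Prop} (hp : ∀ᵐ y, p y) :
    ∀ᵐ t : ℝ, ∀ᵐ y ∂((surf (n + 1)).restrict D), p (y - t • ν) := by
  have := sFinite_surf_restrict hν hD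
  exact Measure.ae_ae_of_ae_prod ((quasiMeasurePreserving_normalFlow hν hD).ae hp)

theorem aestronglyMeasurable_normalFlow {n : ℕ} {G : Type*} [NormedAddCommGroup G]
    {x ν : E (n + 1)} (hν : ‖ν‖ = 1)
    {D : Set (E (n + 1))} (hD : D ⊆ plane x ν) {w : E (n + 1) → G}
    (hw : AEStronglyMeasurable w volume) :
    AEStronglyMeasurable (fun p : ℝ × E (n + 1) => w (p.2 - p.1 • ν))
      ((volume : Measure ℝ).prod ((surf (n + 1)).restrict D)) :=
  hw.comp_quasiMeasurePreserving (quasiMeasurePreserving_normalFlow hν hD)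

namespace NormalLimit

variable {n : ℕ} {G G₁ G₂ G₃ : Type*} [NormedAddCommGroup G] [NormedAddCommGroup G₁]
  [NormedAddCommGroup G₂] [NormedAddCommGroup G₃] {x ν : E (n + 1)} {D D' : Set (E (n + 1))}
  {w w' g g' : E (n + 1) → G}

theorem mono (h : NormalLimit ν D w g) (hD : D' ⊆ D) : NormalLimit ν D' w g :=
  AvgZero.mono_measure h (Measure.restrict_mono_set _ hD)

theorem congr_left (h : NormalLimit ν D w g) {δ : ℝ} (hδ : 0 < δ) (hDm : MeasurableSet D)
    (hww : ∀ y ∈ D, ∀ t ∈ Ioo 0 δ, w (y - t • ν) = w' (y - t • ν)) : NormalLimit ν D w' g := by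
  refine AvgZero.of_le hδ h ?_
  filter_upwards [ae_restrict_mem measurableSet_Ioo] with t ht
  filter_upwards [ae_restrict_mem hDm] with y hy
  rw [hww y hy t ht]

theorem congr_left_ae (h : NormalLimit ν D w g) (hν : ‖ν‖ = 1) (hD : D ⊆ plane x ν) {δ : ℝ}
    (hδ : 0 < δ) (hDm : MeasurableSet D) {U : Set (E (n + 1))}
    (hU : ∀ y ∈ D, ∀ t ∈ Ioo 0 δ, y - t • ν ∈ U) (hUm : MeasurableSet U)
    (hww : ∀ᵐ p ∂(volume.restrict U), w p = w' p) : NormalLimit ν D w' g := by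
  refine AvgZero.of_le hδ h ?_
  rw [ae_restrict_iff' hUm] at hww
  filter_upwards [ae_restrict_mem measurableSet_Ioo,
    ae_restrict_of_ae (ae_ae_normalFlow hν hD hww)] with t ht h1
  filter_upwards [ae_restrict_mem hDm, h1] with y hy h2
  rw [h2 (hU y hy t ht)]

theorem congr_right (h : NormalLimit ν D w g)
    (hgg : ∀ᵐ y ∂((surf (n + 1)).restrict D), g y = g' y) : NormalLimit ν D w g' := by
  refine AvgZero.of_le one_pos h (Eventually.of_forall fun t => ?_)
  filter_upwards [hgg] with y hy
  rw [hy]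

theorem aemeasurable_enorm_sub (hν : ‖ν‖ = 1) (hD : D ⊆ plane x ν)
    (hw : AEStronglyMeasurable w volume) (hg : AEStronglyMeasurable g ((surf (n + 1)).restrict D)) :
    AEMeasurable (Function.uncurry fun (t : ℝ) (y : E (n + 1)) => ‖w (y - t • ν) - g y‖ₑ)
      ((volume : Measure ℝ).prod ((surf (n + 1)).restrict D)) := by
  have := sFinite_surf_restrict hν hD
  exact ((aestronglyMeasurable_normalFlow hν hD hw).sub hg.comp_snd).enorm

/-- The triangle inequality bounds ‖g − g'‖, which does not depend on t, by two quantities with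
vanishing mean. -/
theorem unique (h : NormalLimit ν D w g) (h' : NormalLimit ν D w g') (hν : ‖ν‖ = 1)
    (hD : D ⊆ plane x ν) (hw : AEStronglyMeasurable w volume)
    (hg : AEStronglyMeasurable g ((surf (n + 1)).restrict D))
    (hg' : AEStronglyMeasurable g' ((surf (n + 1)).restrict D)) :
    ∀ᵐ y ∂((surf (n + 1)).restrict D), g y = g' y := by
  have := sFinite_surf_restrict hν hD
  have h1 := AvgZero.add h h' (aemeasurable_enorm_sub hν hD hw hg)
  have h2 : AvgZero ((surf (n + 1)).restrict D) (fun _ y => ‖g y - g' y‖ₑ) := by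
    refine AvgZero.of_le one_pos h1 (Eventually.of_forall fun t => Eventually.of_forall fun y => ?_)
    have : g y - g' y = -(w (y - t • ν) - g y) + (w (y - t • ν) - g' y) := by abel
    rw [this]
    exact (enorm_add_le _ _).trans (by rw [enorm_neg])
  have h3 := h2.lintegral_eq_zero
  rw [lintegral_eq_zero_iff' (f := fun y => ‖g y - g' y‖ₑ) (hg.sub hg').enorm] at h3
  filter_upwards [h3] with y hy
  simpa [sub_eq_zero] using hy

/-- The first factor is bounded and the second only has an integrable limit, so the cross term is
handled by `AvgZero.mul_of_bounded`. The operation is abstract so as to cover both the product of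
reals and the application of a linear map to a vector. -/
theorem bilin {w₁ g₁ : E (n + 1) → G₁} {w₂ g₂ : E (n + 1) → G₂} (op : G₁ → G₂ → G₃)
    (hop : ∀ a a' b b', ‖op a b - op a' b'‖ₑ ≤ ‖a‖ₑ * ‖b - b'‖ₑ + ‖a - a'‖ₑ * ‖b'‖ₑ)
    (h₁ : NormalLimit ν D w₁ g₁) (h₂ : NormalLimit ν D w₂ g₂) (hν : ‖ν‖ = 1)
    (hD : D ⊆ plane x ν) (hw₂ : AEStronglyMeasurable w₂ volume)
    (hg₂ : AEStronglyMeasurable g₂ ((surf (n + 1)).restrict D)) {M : ℝ≥0∞} (hM : M ≠ ⊤)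
    (hw₁M : ∀ᵐ p, ‖w₁ p‖ₑ ≤ M) (hg₁M : ∀ᵐ p ∂((surf (n + 1)).restrict D), ‖g₁ p‖ₑ ≤ M)
    (hg₂i : ∫⁻ y in D, ‖g₂ y‖ₑ ∂(surf (n + 1)) ≠ ⊤) :
    NormalLimit ν D (fun p => op (w₁ p) (w₂ p)) (fun y => op (g₁ y) (g₂ y)) := by
  have := sFinite_surf_restrict hν hD
  have hb := ae_ae_normalFlow hν hD hw₁M
  have h3 : AvgZero ((surf (n + 1)).restrict D)
      (fun t y => ‖w₁ (y - t • ν) - g₁ y‖ₑ * ‖g₂ y‖ₑ) := by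
    refine AvgZero.mul_of_bounded h₁ (C := M + M) (by simp [hM]) ?_ hg₂.enorm hg₂i
    filter_upwards [ae_restrict_of_ae hb] with t ht
    filter_upwards [ht, hg₁M] with y h1 h2
    exact (enorm_sub_le).trans (add_le_add h1 h2)
  refine AvgZero.of_le one_pos (AvgZero.add (AvgZero.const_mul h₂ hM) h3 ?_) ?_
  · exact (aemeasurable_enorm_sub hν hD hw₂ hg₂).const_mul M
  · filter_upwards [ae_restrict_of_ae hb] with t ht
    filter_upwards [ht] with y h1
    refine (hop _ _ _ _).trans ?_
    gcongr

theorem add (h : NormalLimit ν D w g) (h' : NormalLimit ν D w' g') (hν : ‖ν‖ = 1)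
    (hD : D ⊆ plane x ν) (hw : AEStronglyMeasurable w volume)
    (hg : AEStronglyMeasurable g ((surf (n + 1)).restrict D)) :
    NormalLimit ν D (fun p => w p + w' p) (fun p => g p + g' p) := by
  have := sFinite_surf_restrict hν hD
  refine AvgZero.of_le one_pos (AvgZero.add h h' (aemeasurable_enorm_sub hν hD hw hg))
    (Eventually.of_forall fun t => Eventually.of_forall fun y => ?_)
  rw [add_sub_add_comm]
  exact enorm_add_le _ _

theorem clm [NormedSpace ℝ G₁] [NormedSpace ℝ G₂] {w g : E (n + 1) → G₁} (L : G₁ →L[ℝ] G₂)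
    (h : NormalLimit ν D w g) : NormalLimit ν D (fun p => L (w p)) (fun p => L (g p)) := by
  refine AvgZero.of_le one_pos (AvgZero.const_mul h (C := ‖L‖ₑ) (by simp))
    (Eventually.of_forall fun t => Eventually.of_forall fun y => ?_)
  rw [← map_sub]
  exact L.le_opENorm _

theorem sum {ι : Type*} (s : Finset ι) {w g : ι → E (n + 1) → G}
    (h : ∀ i ∈ s, NormalLimit ν D (w i) (g i)) (hν : ‖ν‖ = 1)
    (hD : D ⊆ plane x ν) (hw : ∀ i ∈ s, AEStronglyMeasurable (w i) volume)
    (hg : ∀ i ∈ s, AEStronglyMeasurable (g i) ((surf (n + 1)).restrict D)) :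
    NormalLimit ν D (fun p => ∑ i ∈ s, w i p) (fun p => ∑ i ∈ s, g i p) := by
  classical
  induction s using Finset.induction_on with
  | empty =>
    simp only [NormalLimit, AvgZero, Finset.sum_empty, sub_zero, enorm_zero, lintegral_zero,
      ENNReal.zero_div]
    exact tendsto_const_nhds
  | insert a s ha ih =>
    simp_rw [Finset.sum_insert ha]
    exact (h a (by simp)).add (ih (fun i hi => h i (by simp [hi])) (fun i hi => hw i (by simp [hi]))
      (fun i hi => hg i (by simp [hi]))) hν hD (hw a (by simp)) (hg a (by simp))

/-- Where ‖w‖ ≤ M, the excess of ‖g‖ over M is at most ‖w − g‖; being stationary with vanishing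
mean, it is zero. -/
theorem enorm_le (h : NormalLimit ν D w g) (hν : ‖ν‖ = 1) (hD : D ⊆ plane x ν)
    (hg : AEStronglyMeasurable g ((surf (n + 1)).restrict D)) {M : ℝ≥0∞}
    (hM : ∀ᵐ p, ‖w p‖ₑ ≤ M) :
    ∀ᵐ p ∂((surf (n + 1)).restrict D), ‖g p‖ₑ ≤ M := by
  have h2 : AvgZero ((surf (n + 1)).restrict D) (fun _ y => ‖g y‖ₑ - M) := by
    refine AvgZero.of_le one_pos h ?_
    filter_upwards [ae_restrict_of_ae (ae_ae_normalFlow hν hD hM)] with t ht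
    filter_upwards [ht] with y hy
    rw [tsub_le_iff_left]
    have : g y = w (y - t • ν) - (w (y - t • ν) - g y) := by abel
    calc ‖g y‖ₑ = ‖w (y - t • ν) - (w (y - t • ν) - g y)‖ₑ := by rw [← this]
      _ ≤ ‖w (y - t • ν)‖ₑ + ‖w (y - t • ν) - g y‖ₑ := enorm_sub_le
      _ ≤ _ := by gcongr
  have h3 := h2.lintegral_eq_zero
  rw [lintegral_eq_zero_iff' (f := fun y => ‖g y‖ₑ - M) (hg.enorm.sub aemeasurable_const)] at h3
  filter_upwards [h3] with y hy
  simpa [tsub_eq_zero_iff_le] using hy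

end NormalLimit

end IPG

namespace IPG

/-! ### Functions on a product which are weakly differentiable in the last variable -/

/-- Smooth functions on `ℝ` with compact support in `(0, τ)`. -/
def IsTimeTest (τ : ℝ) (ζ : ℝ → ℝ) : Prop :=
  ContDiff ℝ ∞ ζ ∧ HasCompactSupport ζ ∧ tsupport ζ ⊆ Ioo 0 τ

theorem IsTimeTest.exists_Icc {τ : ℝ} (hτ : 0 < τ) {ζ : ℝ → ℝ} (hζ : IsTimeTest τ ζ) :
    ∃ a b, 0 < a ∧ b < τ ∧ a ≤ b ∧ tsupport ζ ⊆ Icc a b := by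
  rcases (tsupport ζ).eq_empty_or_nonempty with h | h
  · exact ⟨τ / 2, τ / 2, by positivity, by linarith, le_rfl, by simp [h]⟩
  · obtain ⟨a, ha⟩ := hζ.2.1.isCompact.exists_isLeast h
    obtain ⟨b, hb⟩ := hζ.2.1.isCompact.exists_isGreatest h
    exact ⟨a, b, (hζ.2.2 ha.1).1, (hζ.2.2 hb.1).2, ha.2 hb.1, fun t ht => ⟨ha.2 ht, hb.2 ht⟩⟩

theorem IsTimeTest.eq_zero {τ : ℝ} {ζ : ℝ → ℝ} (hζ : IsTimeTest τ ζ) {t : ℝ} (ht : t ∉ Ioo 0 τ) :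
    ζ t = 0 :=
  image_eq_zero_of_notMem_tsupport fun h => ht (hζ.2.2 h)

theorem IsTest.eq_zero {d : ℕ} {U : Set (E d)} {φ : E d → ℝ} (hφ : IsTest U φ) {x : E d}
    (hx : x ∉ U) : φ x = 0 :=
  image_eq_zero_of_notMem_tsupport fun h => hx (hφ.2.2 h)

theorem exists_bound_of_compactSupport {X : Type*} [TopologicalSpace X] {ζ : X → ℝ}
    (h : Continuous ζ) (hc : HasCompactSupport ζ) : ∃ C, ∀ t, ‖ζ t‖ ≤ C :=
  h.bounded_above_of_compact_support hc

/-- The primitive starting at 0 vanishes before the support of ζ, and after it equals the total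
integral, which is zero. -/
theorem IsTimeTest.exists_antideriv {τ : ℝ} (hτ : 0 < τ) {ζ : ℝ → ℝ} (hζ : IsTimeTest τ ζ)
    (h0 : ∫ t, ζ t = 0) : ∃ χ, IsTimeTest τ χ ∧ deriv χ = ζ := by
  obtain ⟨a, b, ha, hb, hab, hs⟩ := hζ.exists_Icc hτ
  have hcont := hζ.1.continuous
  have hzero : ∀ t, t ∉ Icc a b → ζ t = 0 := fun t ht =>
    image_eq_zero_of_notMem_tsupport fun h => ht (hs h)
  have hd : ∀ t, HasDerivAt (fun t => ∫ s in (0 : ℝ)..t, ζ s) (ζ t) t := fun t =>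
    intervalIntegral.integral_hasDerivAt_right (hcont.intervalIntegrable _ _)
      hcont.aestronglyMeasurable.stronglyMeasurableAtFilter hcont.continuousAt
  have hderiv : deriv (fun t => ∫ s in (0 : ℝ)..t, ζ s) = ζ := funext fun t => (hd t).deriv
  have hts : tsupport (fun t => ∫ s in (0 : ℝ)..t, ζ s) ⊆ Icc a b := by
    refine closure_minimal (fun t ht => ?_) isClosed_Icc
    by_contra hcon
    apply ht
    dsimp only
    rw [mem_Icc, not_and_or, not_le, not_le] at hcon
    rcases hcon with hcon | hcon
    · rw [intervalIntegral.integral_congr (g := fun _ => 0), intervalIntegral.integral_zero]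
      intro s hs'
      apply hzero
      intro h
      rcases le_total 0 t with h' | h'
      · rw [uIcc_of_le h'] at hs'; linarith [hs'.2, h.1]
      · rw [uIcc_of_ge h'] at hs'; linarith [hs'.2, h.1]
    · rw [intervalIntegral.integral_of_le (by linarith)]
      refine (setIntegral_eq_integral_of_forall_compl_eq_zero
        fun s hs' => hzero s fun h => hs' ?_).trans h0
      exact ⟨ha.trans_le h.1, h.2.trans hcon.le⟩
  refine ⟨fun t => ∫ s in (0 : ℝ)..t, ζ s, ⟨?_, ?_, ?_⟩, hderiv⟩
  · rw [contDiff_infty_iff_deriv, hderiv]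
    exact ⟨fun t => (hd t).differentiableAt, hζ.1⟩
  · exact HasCompactSupport.of_support_subset_isCompact isCompact_Icc (subset_closure.trans hts)
  · exact hts.trans fun t ht => ⟨ha.trans_le ht.1, ht.2.trans_lt hb⟩

theorem exists_isTimeTest_integral_eq_one {τ : ℝ} (hτ : 0 < τ) :
    ∃ χ, IsTimeTest τ χ ∧ ∫ t, χ t = 1 := by
  let b : ContDiffBump (τ / 2) := ⟨τ / 8, τ / 4, by positivity, by linarith⟩
  refine ⟨b.normed volume, ⟨b.contDiff_normed, b.hasCompactSupport_normed, ?_⟩,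
    b.integral_normed⟩
  rw [b.tsupport_normed_eq, Real.closedBall_eq_Icc]
  intro t ht
  have h1 : b.rOut = τ / 4 := rfl
  rw [h1] at ht
  exact ⟨by linarith [ht.1], by linarith [ht.2]⟩

section Product

variable {n : ℕ} {D : Set (E n)} {τ : ℝ}

theorem integrable_mul_tensor {μ : Measure (E n)} {lam : Measure ℝ} [SFinite μ] [SFinite lam]
    {Φ : E n × ℝ → ℝ}
    (hΦ : Integrable Φ (μ.prod lam)) {η : E n → ℝ} {ζ : ℝ → ℝ} (hη : Continuous η)
    (hη' : ∃ C, ∀ z, ‖η z‖ ≤ C) (hζ : Continuous ζ) (hζ' : ∃ C, ∀ z, ‖ζ z‖ ≤ C) :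
    Integrable (fun p => Φ p * (η p.1 * ζ p.2)) (μ.prod lam) := by
  obtain ⟨C, hC⟩ := hη'
  obtain ⟨C', hC'⟩ := hζ'
  refine hΦ.mul_bdd (c := C * C') (by fun_prop) (Eventually.of_forall fun p => ?_)
  rw [norm_mul]
  exact mul_le_mul (hC _) (hC' _) (norm_nonneg _) ((norm_nonneg _).trans (hC p.1))

/-- A function on `D × (0, τ)` which is orthogonal to all products of test functions vanishes. -/
theorem ae_eq_zero_of_tensor_tests (hD : IsOpen D) {Φ : E n × ℝ → ℝ}
    (hΦ : Integrable Φ ((volume.restrict D).prod (volume.restrict (Ioo 0 τ))))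
    (h : ∀ η ζ, IsTest D η → IsTimeTest τ ζ →
      ∫ p, Φ p * (η p.1 * ζ p.2) ∂((volume.restrict D).prod (volume.restrict (Ioo 0 τ))) = 0) :
    ∀ᵐ p ∂((volume.restrict D).prod (volume.restrict (Ioo 0 τ))), Φ p = 0 := by
  set μ := (volume : Measure (E n)).restrict D
  set lam := (volume : Measure ℝ).restrict (Ioo 0 τ)
  -- slices integrated against a time test vanish
  have step1 : ∀ ζ, IsTimeTest τ ζ → ∀ᵐ z ∂μ, ∫ t, Φ (z, t) * ζ t ∂lam = 0 := by
    intro ζ hζ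
    have hi : Integrable (fun p : E n × ℝ => Φ p * ζ p.2) (μ.prod lam) := by
      have := integrable_mul_tensor hΦ (η := fun _ => 1) continuous_const ⟨1, by simp⟩
        hζ.1.continuous (exists_bound_of_compactSupport hζ.1.continuous hζ.2.1)
      simpa using this
    have hG : Integrable (fun z => ∫ t, Φ (z, t) * ζ t ∂lam) μ := hi.integral_prod_left
    have := hD.ae_eq_zero_of_integral_contDiff_smul_eq_zero
      (IntegrableOn.locallyIntegrableOn (μ := volume) hG) (fun η hη1 hη2 hη3 => by
        have hη : IsTest D η := ⟨hη1, hη2, hη3⟩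
        have h1 := h η ζ hη hζ
        rw [integral_prod _ (integrable_mul_tensor hΦ hη1.continuous
          (exists_bound_of_compactSupport hη1.continuous hη2)
          hζ.1.continuous (exists_bound_of_compactSupport hζ.1.continuous hζ.2.1))] at h1
        rw [← setIntegral_eq_integral_of_forall_compl_eq_zero (s := D)
          (fun z hz => by rw [hη.eq_zero hz, zero_smul]), ← h1]
        refine integral_congr_ae (Eventually.of_forall fun z => ?_)
        simp only [smul_eq_mul]
        rw [← integral_const_mul]
        congr 1; funext t; ring)
    rw [ae_restrict_iff' hD.measurableSet]
    exact this
  -- The exceptional null set of `step1` depends on ζ. Integrating over a fixed set B absorbs it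
  -- before ζ varies.
  have step2 : ∀ B : Set (E n), MeasurableSet B → ∀ᵐ t ∂lam, ∫ z in B, Φ (z, t) ∂μ = 0 := by
    intro B hB
    have hΦB : Integrable Φ ((μ.restrict B).prod lam) :=
      hΦ.mono_measure (Measure.prod_mono Measure.restrict_le_self le_rfl)
    have hk : Integrable (fun t => ∫ z in B, Φ (z, t) ∂μ) lam := hΦB.integral_prod_right
    have := isOpen_Ioo.ae_eq_zero_of_integral_contDiff_smul_eq_zero
      (IntegrableOn.locallyIntegrableOn (μ := volume) hk) (fun ζ h1 h2 h3 => by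
        have hζ : IsTimeTest τ ζ := ⟨h1, h2, h3⟩
        have hi : Integrable (fun p : E n × ℝ => Φ p * ζ p.2) ((μ.restrict B).prod lam) := by
          have := integrable_mul_tensor hΦB (η := fun _ => 1) continuous_const ⟨1, by simp⟩
            hζ.1.continuous (exists_bound_of_compactSupport hζ.1.continuous hζ.2.1)
          simpa using this
        have e1 : ∫ p, Φ p * ζ p.2 ∂((μ.restrict B).prod lam) = 0 := by
          rw [integral_prod _ hi]
          refine integral_eq_zero_of_ae ?_
          exact ae_restrict_of_ae (step1 ζ hζ)
        rw [integral_prod_symm _ hi] at e1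
        rw [← setIntegral_eq_integral_of_forall_compl_eq_zero (s := Ioo 0 τ)
          (fun z hz => by rw [hζ.eq_zero hz, zero_smul])]
        refine Eq.trans ?_ e1
        refine integral_congr_ae (Eventually.of_forall fun t => ?_)
        simp only [smul_eq_mul]
        rw [← integral_const_mul]
        congr 1; funext t; ring)
    rw [ae_restrict_iff' measurableSet_Ioo]
    exact this
  -- Rectangles are a π-system generating the product σ-algebra, and the sets over which Φ
  -- integrates to zero form a Dynkin system.
  have step3 : ∀ A : Set (E n × ℝ), MeasurableSet A → ∫ p in A, Φ p ∂(μ.prod lam) = 0 := by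
    have hrect : ∀ (B : Set (E n)) (I : Set ℝ), MeasurableSet B → MeasurableSet I →
        ∫ p in B ×ˢ I, Φ p ∂(μ.prod lam) = 0 := by
      intro B I hB hI
      rw [← Measure.prod_restrict, integral_prod_symm]
      · exact integral_eq_zero_of_ae (ae_restrict_of_ae (step2 B hB))
      · rw [Measure.prod_restrict]; exact hΦ.restrict
    refine MeasurableSpace.induction_on_inter generateFrom_prod.symm isPiSystem_prod ?_ ?_ ?_ ?_
    · simp
    · rintro _ ⟨B, hB, I, hI, rfl⟩
      exact hrect B I hB hI
    · intro A hA ih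
      rw [setIntegral_compl hA hΦ, ih, sub_zero, ← setIntegral_univ, ← univ_prod_univ]
      exact hrect _ _ MeasurableSet.univ MeasurableSet.univ
    · intro A hdisj hA ih
      rw [integral_iUnion hA hdisj hΦ.integrableOn]
      simp [ih]
  exact hΦ.ae_eq_zero_of_forall_setIntegral_eq_zero (fun A hA _ => step3 A hA)

theorem measurePreserving_prodRightComm {X Y Z : Type*} [MeasurableSpace X] [MeasurableSpace Y]
    [MeasurableSpace Z] (μ : Measure X) (ν : Measure Y) (ρ : Measure Z) [SFinite μ] [SFinite ν]
    [SFinite ρ] : MeasurePreserving (fun p : (X × Y) × Z => ((p.1.1, p.2), p.1.2))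
      ((μ.prod ν).prod ρ) ((μ.prod ρ).prod ν) := by
  have h1 := measurePreserving_prodAssoc μ ν ρ
  have h2 : MeasurePreserving (Prod.map id Prod.swap) (μ.prod (ν.prod ρ)) (μ.prod (ρ.prod ν)) :=
    (MeasurePreserving.id μ).prod Measure.measurePreserving_swap
  have h3 := (measurePreserving_prodAssoc μ ρ ν).symm
  exact (h3.comp h2).comp h1

/-- A function on `D × (0, τ)` with an integrable weak derivative in the last variable has an
initial value and is the integral of its derivative. -/
theorem exists_initialValue (hD : IsOpen D) (hτ : 0 < τ) {f h : E n × ℝ → ℝ}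
    (hf : Integrable f ((volume.restrict D).prod (volume.restrict (Ioo 0 τ))))
    (hh : Integrable h ((volume.restrict D).prod (volume.restrict (Ioo 0 τ))))
    (H : ∀ η ζ, IsTest D η → IsTimeTest τ ζ →
      ∫ p, f p * (η p.1 * deriv ζ p.2) ∂((volume.restrict D).prod (volume.restrict (Ioo 0 τ))) =
        - ∫ p, h p * (η p.1 * ζ p.2) ∂((volume.restrict D).prod (volume.restrict (Ioo 0 τ)))) :
    ∃ g : E n → ℝ, Integrable g (volume.restrict D) ∧
      ∀ᵐ p ∂((volume.restrict D).prod (volume.restrict (Ioo 0 τ))),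
        f p = g p.1 + ∫ s in Ioo 0 p.2, h (p.1, s) := by
  set μ := (volume : Measure (E n)).restrict D
  set lam := (volume : Measure ℝ).restrict (Ioo 0 τ)
  -- `K` is h(z, s) on the triangle s < t, and `K'` is the same function with the two time variables
  -- exchanged. Integrability is immediate for `K'` and transfers to `K`, whose integral in s is the
  -- primitive `W`.
  let K : (E n × ℝ) × ℝ → ℝ := fun q => (Iio q.1.2).indicator (fun s => h (q.1.1, s)) q.2
  let K' : (E n × ℝ) × ℝ → ℝ := fun q => (Ioi q.1.2).indicator (fun _ => h q.1) q.2
  have hmeas' : MeasurableSet {q : (E n × ℝ) × ℝ | q.1.2 < q.2} :=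
    measurableSet_lt (by fun_prop) (by fun_prop)
  have hK'i : Integrable K' ((μ.prod lam).prod lam) := by
    have h1 : Integrable (fun q : (E n × ℝ) × ℝ => h q.1) ((μ.prod lam).prod lam) := hh.comp_fst lam
    have h2 := h1.indicator hmeas'
    exact h2
  have hMP := measurePreserving_prodRightComm μ lam lam
  have hKK' : K = fun q => K' ((q.1.1, q.2), q.1.2) := by
    funext q
    simp only [K, K', indicator, mem_Iio, mem_Ioi]
  have hKi : Integrable K ((μ.prod lam).prod lam) := by
    rw [hKK']
    exact hMP.integrable_comp_of_integrable hK'i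
  let W : E n × ℝ → ℝ := fun p => ∫ s, K (p, s) ∂lam
  have hWi : Integrable W (μ.prod lam) := hKi.integral_prod_left
  have hWeq : ∀ p : E n × ℝ, p.2 ∈ Ioo 0 τ → W p = ∫ s in Ioo 0 p.2, h (p.1, s) := by
    intro p hp
    have : (fun s => K (p, s)) = (Iio p.2).indicator (fun s => h (p.1, s)) := rfl
    simp only [W, this]
    rw [integral_indicator measurableSet_Iio, Measure.restrict_restrict measurableSet_Iio]
    congr 2
    ext s
    simp only [mem_inter_iff, mem_Iio, mem_Ioo]
    constructor
    · rintro ⟨h1, h2, h3⟩; exact ⟨h2, h1⟩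
    · rintro ⟨h1, h2⟩; exact ⟨h2, h1, h2.trans hp.2⟩
  have hWweak : ∀ η ζ, IsTest D η → IsTimeTest τ ζ →
      ∫ p, W p * (η p.1 * deriv ζ p.2) ∂(μ.prod lam) =
        - ∫ p, h p * (η p.1 * ζ p.2) ∂(μ.prod lam) := by
    intro η ζ hη hζ
    have hηb := exists_bound_of_compactSupport hη.1.continuous hη.2.1
    have hζ'c : Continuous (deriv ζ) := hζ.1.continuous_deriv (by simp)
    have hζ'b := exists_bound_of_compactSupport hζ'c hζ.2.1.deriv
    obtain ⟨C, hC⟩ := hηb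
    obtain ⟨C', hC'⟩ := hζ'b
    have hi' : Integrable (fun q => K' q * (η q.1.1 * deriv ζ q.2)) ((μ.prod lam).prod lam) := by
      refine hK'i.mul_bdd (c := C * C') ?_ (Eventually.of_forall fun p => ?_)
      · exact ((hη.1.continuous.comp (continuous_fst.comp continuous_fst)).mul
          (hζ'c.comp continuous_snd)).aestronglyMeasurable
      · rw [norm_mul]
        exact mul_le_mul (hC _) (hC' _) (norm_nonneg _) ((norm_nonneg _).trans (hC p.1.1))
    have hi : Integrable (fun q => K q * (η q.1.1 * deriv ζ q.1.2)) ((μ.prod lam).prod lam) := by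
      rw [hKK']
      exact hMP.integrable_comp_of_integrable hi'
    calc ∫ p, W p * (η p.1 * deriv ζ p.2) ∂(μ.prod lam)
        = ∫ p, ∫ s, K (p, s) * (η p.1 * deriv ζ p.2) ∂lam ∂(μ.prod lam) := by
          simp_rw [integral_mul_const]; rfl
      _ = ∫ q, K q * (η q.1.1 * deriv ζ q.1.2) ∂((μ.prod lam).prod lam) :=
          (integral_prod _ hi).symm
      _ = ∫ q, K' q * (η q.1.1 * deriv ζ q.2) ∂((μ.prod lam).prod lam) := by
          have := integral_map (μ := (μ.prod lam).prod lam) hMP.measurable.aemeasurable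
            (f := fun q => K' q * (η q.1.1 * deriv ζ q.2))
            (by rw [hMP.map_eq]; exact hi'.aestronglyMeasurable)
          rw [hMP.map_eq] at this
          rw [this, hKK']
      _ = ∫ p, ∫ t, K' (p, t) * (η p.1 * deriv ζ t) ∂lam ∂(μ.prod lam) := integral_prod _ hi'
      _ = ∫ p, - (h p * (η p.1 * ζ p.2)) ∂(μ.prod lam) := by
          refine integral_congr_ae ?_
          have hmem : ∀ᵐ p ∂(μ.prod lam), p.2 ∈ Ioo 0 τ :=
            Measure.quasiMeasurePreserving_snd.ae (ae_restrict_mem measurableSet_Ioo)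
          filter_upwards [hmem] with p hp
          have e1 : ∀ t, K' (p, t) * (η p.1 * deriv ζ t) =
              (Ioi p.2).indicator (fun t => h p * η p.1 * deriv ζ t) t := by
            intro t
            simp only [K', indicator]
            split_ifs <;> ring
          simp_rw [e1]
          rw [integral_indicator measurableSet_Ioi, Measure.restrict_restrict measurableSet_Ioi,
            integral_const_mul]
          have e2 : Ioi p.2 ∩ Ioo 0 τ = Ioo p.2 τ := by
            ext t; simp only [mem_inter_iff, mem_Ioi, mem_Ioo]
            exact ⟨fun h => ⟨h.1, h.2.2⟩, fun h => ⟨h.1, hp.1.trans h.1, h.2⟩⟩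
          rw [e2, ← integral_Ioc_eq_integral_Ioo, ← intervalIntegral.integral_of_le hp.2.le,
            intervalIntegral.integral_deriv_eq_sub' ζ rfl
              (fun t _ => (hζ.1.differentiable (by simp)).differentiableAt) hζ'c.continuousOn,
            hζ.eq_zero (t := τ) (by simp)]
          ring
      _ = _ := integral_neg _
  -- The argument of du Bois-Reymond: f − W has zero weak time derivative, and every ζ differs from
  -- (∫ζ) χ₀ by the derivative of a test function. Thus f − W acts on test functions like its
  -- χ₀-mean `g`, which is independent of time.
  obtain ⟨χ₀, hχ₀, hχ₀i⟩ := exists_isTimeTest_integral_eq_one hτ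
  have hχ₀b := exists_bound_of_compactSupport hχ₀.1.continuous hχ₀.2.1
  let F : E n × ℝ → ℝ := fun p => f p - W p
  have hFi : Integrable F (μ.prod lam) := hf.sub hWi
  let g : E n → ℝ := fun z => ∫ t, F (z, t) * χ₀ t ∂lam
  have hFχ : Integrable (fun p : E n × ℝ => F p * χ₀ p.2) (μ.prod lam) := by
    have := integrable_mul_tensor hFi (η := fun _ => 1) continuous_const ⟨1, by simp⟩
      hχ₀.1.continuous hχ₀b
    simpa using this
  have hgi : Integrable g μ := hFχ.integral_prod_left
  have hgi' : Integrable (fun p : E n × ℝ => g p.1) (μ.prod lam) := hgi.comp_fst lam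
  have hFtest : ∀ η ζ, IsTest D η → IsTimeTest τ ζ →
      ∫ p, F p * (η p.1 * deriv ζ p.2) ∂(μ.prod lam) = 0 := by
    intro η ζ hη hζ
    have hηb := exists_bound_of_compactSupport hη.1.continuous hη.2.1
    have hζ'c : Continuous (deriv ζ) := hζ.1.continuous_deriv (by simp)
    have hζ'b := exists_bound_of_compactSupport hζ'c hζ.2.1.deriv
    simp only [F, sub_mul]
    rw [integral_sub (integrable_mul_tensor hf hη.1.continuous hηb hζ'c hζ'b)
      (integrable_mul_tensor hWi hη.1.continuous hηb hζ'c hζ'b), H η ζ hη hζ, hWweak η ζ hη hζ]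
    ring
  have hzero := ae_eq_zero_of_tensor_tests hD (hFi.sub hgi') (by
    intro η ζ hη hζ
    have hηb := exists_bound_of_compactSupport hη.1.continuous hη.2.1
    have hζb := exists_bound_of_compactSupport hζ.1.continuous hζ.2.1
    set c := ∫ t, ζ t with hc
    have hζt : Integrable ζ := hζ.1.continuous.integrable_of_hasCompactSupport hζ.2.1
    have hχt : Integrable χ₀ := hχ₀.1.continuous.integrable_of_hasCompactSupport hχ₀.2.1
    have hk : IsTimeTest τ (fun t => ζ t - c * χ₀ t) := by
      refine ⟨hζ.1.sub (contDiff_const.mul hχ₀.1), hζ.2.1.sub hχ₀.2.1.mul_left, ?_⟩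
      refine (tsupport_sub _ _).trans (union_subset hζ.2.2 ?_)
      exact (closure_mono (Function.support_mul_subset_right _ _)).trans hχ₀.2.2
    obtain ⟨χ, hχ, hχd⟩ := hk.exists_antideriv hτ (by
      rw [integral_sub hζt (hχt.const_mul c), integral_const_mul, hχ₀i]; ring)
    have e1 := hFtest η χ hη hχ
    rw [hχd] at e1
    have i1 := integrable_mul_tensor hFi hη.1.continuous hηb hζ.1.continuous hζb
    have i2 := integrable_mul_tensor hFi hη.1.continuous hηb hχ₀.1.continuous hχ₀b
    have i3 := integrable_mul_tensor hgi' hη.1.continuous hηb hζ.1.continuous hζb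
    have e2 : ∫ p, F p * (η p.1 * ζ p.2) ∂(μ.prod lam) =
        c * ∫ p, F p * (η p.1 * χ₀ p.2) ∂(μ.prod lam) := by
      rw [← integral_const_mul, ← sub_eq_zero, ← integral_sub i1 (i2.const_mul c), ← e1]
      congr 1; funext p; ring
    have e3 : ∫ p, F p * (η p.1 * χ₀ p.2) ∂(μ.prod lam) = ∫ z, g z * η z ∂μ := by
      rw [integral_prod _ i2]
      congr 1; funext z
      simp only [g]
      rw [← integral_mul_const]
      congr 1; funext t; ring
    have e4 : ∫ p : E n × ℝ, g p.1 * (η p.1 * ζ p.2) ∂(μ.prod lam) = (∫ z, g z * η z ∂μ) * c := by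
      have hc' : c = ∫ t, ζ t ∂lam :=
        (setIntegral_eq_integral_of_forall_compl_eq_zero fun t ht => hζ.eq_zero ht).symm
      rw [hc', ← integral_prod_mul]
      congr 1; funext p; ring
    simp only [Pi.sub_apply, sub_mul]
    rw [integral_sub i1 i3, e2, e3, e4]
    ring)
  refine ⟨g, hgi, ?_⟩
  have hmem : ∀ᵐ p ∂(μ.prod lam), p.2 ∈ Ioo 0 τ :=
    Measure.quasiMeasurePreserving_snd.ae (ae_restrict_mem measurableSet_Ioo)
  filter_upwards [hzero, hmem] with p hp hp2
  rw [← hWeq p hp2]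
  simp only [Pi.sub_apply, F] at hp
  linarith

end Product

end IPG

namespace IPG

/-! ### Continuity of translations in `L¹` -/

/-- Translations preserve the L¹ distance to a continuous compactly supported approximation, and for
that approximation uniform continuity suffices. -/
theorem tendsto_lintegral_translate_sub {n : ℕ} {g : E n → ℝ} (hg : Integrable g) :
    Tendsto (fun v : E n => ∫⁻ z, ‖g (z + v) - g z‖ₑ) (𝓝 0) (𝓝 0) := by
  refine ENNReal.tendsto_nhds_zero.2 fun δ hδ => ?_
  have hδ3 : δ / 3 ≠ 0 := (ENNReal.div_pos hδ.ne' (by simp)).ne'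
  obtain ⟨ψ, hψc, hψ1, hψ2, hψ3⟩ := hg.exists_hasCompactSupport_lintegral_sub_le hδ3
  -- For shifts shorter than 1, both ψ and its translate vanish off this fixed set of finite volume.
  set K := Metric.cthickening 1 (tsupport ψ)
  have hK : IsCompact K := IsCompact.cthickening hψc.isCompact
  have hKfin : volume K ≠ ⊤ := hK.measure_lt_top.ne
  obtain ⟨r, hr0, hr⟩ : ∃ r : ℝ, 0 < r ∧ ENNReal.ofReal r * volume K ≤ δ / 3 := by
    have : Tendsto (fun r : ℝ => ENNReal.ofReal r * volume K) (𝓝[>] 0) (𝓝 0) := by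
      have h1 : Tendsto (fun r : ℝ => ENNReal.ofReal r) (𝓝[>] 0) (𝓝 0) := by
        have := (ENNReal.continuous_ofReal.tendsto 0).mono_left (nhdsWithin_le_nhds (s := Ioi 0))
        simpa using this
      have := ENNReal.Tendsto.mul_const h1 (Or.inr hKfin)
      simpa using this
    obtain ⟨r, h1, h2⟩ := ((ENNReal.tendsto_nhds_zero.1 this _ hδ3.bot_lt).and
      self_mem_nhdsWithin).exists
    exact ⟨r, h2, h1⟩
  have huc := hψc.uniformContinuous_of_continuous hψ2
  obtain ⟨s, hs0, hs⟩ := Metric.uniformContinuous_iff.1 huc r hr0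
  filter_upwards [Metric.ball_mem_nhds (0 : E n) (lt_min hs0 one_pos)] with v hv
  rw [mem_ball_zero_iff, lt_min_iff] at hv
  have hbound : ∀ z, ‖ψ (z + v) - ψ z‖ₑ ≤ K.indicator (fun _ => ENNReal.ofReal r) z := by
    intro z
    by_cases hz : z ∈ K
    · rw [indicator_of_mem hz, Real.enorm_eq_ofReal_abs]
      refine ENNReal.ofReal_le_ofReal ?_
      have := hs (a := z + v) (b := z) (by simpa [dist_eq_norm] using hv.1)
      rw [Real.dist_eq] at this
      exact this.le
    · rw [indicator_of_notMem hz]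
      have h1 : ψ z = 0 := image_eq_zero_of_notMem_tsupport fun h =>
        hz (Metric.self_subset_cthickening _ h)
      have h2 : ψ (z + v) = 0 := image_eq_zero_of_notMem_tsupport fun h => hz <| by
        refine Metric.mem_cthickening_of_dist_le z (z + v) 1 _ h ?_
        simpa [dist_eq_norm] using hv.2.le
      simp [h1, h2]
  have hgm := hg.aestronglyMeasurable
  have hψm := hψ3.aestronglyMeasurable
  have hmp : MeasurePreserving (fun z : E n => z + v) volume volume :=
    measurePreserving_add_right volume v
  have e1 : ∫⁻ z, ‖g (z + v) - ψ (z + v)‖ₑ ≤ δ / 3 := by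
    rw [hmp.lintegral_comp_emb (measurableEmbedding_addRight v) (fun z => ‖g z - ψ z‖ₑ)]
    exact hψ1
  calc ∫⁻ z, ‖g (z + v) - g z‖ₑ
      ≤ ∫⁻ z, (‖g (z + v) - ψ (z + v)‖ₑ + (‖ψ (z + v) - ψ z‖ₑ + ‖g z - ψ z‖ₑ)) := by
        refine lintegral_mono fun z => ?_
        have : g (z + v) - g z = (g (z + v) - ψ (z + v)) + ((ψ (z + v) - ψ z) + -(g z - ψ z)) := by
          ring
        rw [this]
        refine (enorm_add_le _ _).trans ?_
        gcongr
        refine (enorm_add_le _ _).trans ?_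
        rw [enorm_neg]
    _ = (∫⁻ z, ‖g (z + v) - ψ (z + v)‖ₑ) + ((∫⁻ z, ‖ψ (z + v) - ψ z‖ₑ) + ∫⁻ z, ‖g z - ψ z‖ₑ) := by
        rw [lintegral_add_left', lintegral_add_left']
        · exact ((hψ2.comp (continuous_add_const v)).sub hψ2).aestronglyMeasurable.enorm
        · exact ((hgm.sub hψm).comp_measurePreserving hmp).enorm
    _ ≤ δ / 3 + (δ / 3 + δ / 3) := by
        gcongr
        calc ∫⁻ z, ‖ψ (z + v) - ψ z‖ₑ ≤ ∫⁻ z, K.indicator (fun _ => ENNReal.ofReal r) z :=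
              lintegral_mono hbound
          _ = ENNReal.ofReal r * volume K := by
              rw [lintegral_indicator hK.measurableSet, lintegral_const, Measure.restrict_apply_univ]
          _ ≤ δ / 3 := hr
    _ = δ := by rw [← add_assoc, ENNReal.add_thirds]

theorem memLp_two_iff_lintegral {X G : Type*} [MeasurableSpace X] [NormedAddCommGroup G]
    {μ : Measure X} {f : X → G} (hf : AEStronglyMeasurable f μ) :
    MemLp f 2 μ ↔ ∫⁻ x, ‖f x‖ₑ ^ 2 ∂μ < ⊤ := by
  rw [MemLp, eLpNorm_lt_top_iff_lintegral_rpow_enorm_lt_top (by simp) (by simp)]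
  simp [hf]

/-- The Cauchy–Schwarz inequality against the constant 1. -/
theorem sq_lintegral_le {X : Type*} [MeasurableSpace X] {μ : Measure X} {f : X → ℝ≥0∞}
    (hf : AEMeasurable f μ) : (∫⁻ x, f x ∂μ) ^ 2 ≤ μ univ * ∫⁻ x, f x ^ 2 ∂μ := by
  have h := ENNReal.lintegral_mul_le_Lp_mul_Lq μ Real.HolderConjugate.two_two
    (aemeasurable_const (b := (1 : ℝ≥0∞))) hf
  simp only [Pi.mul_apply, one_mul, ENNReal.one_rpow, lintegral_one] at h
  calc (∫⁻ x, f x ∂μ) ^ 2 ≤ (μ univ ^ (1 / (2 : ℝ)) * (∫⁻ x, f x ^ (2 : ℝ) ∂μ) ^ (1 / (2 : ℝ))) ^ 2 := by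
        gcongr
    _ = _ := by
        rw [mul_pow, ← ENNReal.rpow_natCast, ← ENNReal.rpow_natCast, ← ENNReal.rpow_mul,
          ← ENNReal.rpow_mul]
        norm_num

/-! ### Oblique coordinates near a hyperplane -/

section Oblique

variable {n : ℕ} {J : E n →ₗᵢ[ℝ] E (n + 1)} {ν : E (n + 1)}

/-- With the component of `e` along ν normalised to −1, the parameter along `e` is exactly the depth
below the hyperplane. -/
theorem exists_tangent_add_normal (hJ : IsTangent J ν) {e : E (n + 1)} (he : ⟪ν, e⟫ = -1) :
    ∃ m : E n, e = J m - ν := by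
  have : (e + ν) ∈ plane 0 ν := by
    simp [plane, inner_add_right, he, hJ.1]
  rw [← hJ.range_eq_plane 0] at this
  obtain ⟨m, hm⟩ := this
  refine ⟨m, ?_⟩
  simp only [zero_add] at hm
  rw [hm]; abel

/-- The coordinates `(z, s) ↦ x + J z + s e`. -/
noncomputable def obliqueMap (J : E n →ₗᵢ[ℝ] E (n + 1)) (x e : E (n + 1)) (q : E n × ℝ) :
    E (n + 1) :=
  x + J q.1 + q.2 • e

/-- Oblique and normal coordinates differ by the shear (z, s) ↦ (z + s m, s), which preserves
volume; this is also what later relates the two kinds of limits. -/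
theorem obliqueMap_eq_flatMap (x : E (n + 1)) (m : E n) (q : E n × ℝ) :
    obliqueMap J x (J m - ν) q = flatMap J x ν (q.1 + q.2 • m, q.2) := by
  simp only [obliqueMap, flatMap, map_add, map_smul, smul_sub]
  abel

theorem measurePreserving_shear (m : E n) :
    MeasurePreserving (fun q : E n × ℝ => (q.1 + q.2 • m, q.2)) volume volume := by
  have h : MeasurePreserving (fun p : ℝ × E n => (p.1, p.2 + p.1 • m))
      ((volume : Measure ℝ).prod (volume : Measure (E n))) (volume.prod volume) := by
    refine (MeasurePreserving.id volume).skew_product (g := fun s z => z + s • m) (by fun_prop) ?_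
    exact Eventually.of_forall fun s => (measurePreserving_add_right volume (s • m)).map_eq
  exact (Measure.measurePreserving_swap.comp h).comp Measure.measurePreserving_swap

/-- The shear as a homeomorphism. -/
noncomputable def shearHomeomorph (m : E n) : E n × ℝ ≃ₜ E n × ℝ where
  toFun q := (q.1 + q.2 • m, q.2)
  invFun q := (q.1 - q.2 • m, q.2)
  left_inv q := by simp
  right_inv q := by simp
  continuous_toFun := by fun_prop
  continuous_invFun := by fun_prop

theorem IsTangent.measurePreserving_obliqueMap (hJ : IsTangent J ν) (x : E (n + 1)) (m : E n) :
    MeasurePreserving (obliqueMap J x (J m - ν)) volume volume := by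
  rw [funext (obliqueMap_eq_flatMap x m)]
  exact (hJ.measurePreserving_flatMap x).comp (measurePreserving_shear m)

theorem IsTangent.measurableEmbedding_obliqueMap (hJ : IsTangent J ν) (x : E (n + 1)) (m : E n) :
    MeasurableEmbedding (obliqueMap J x (J m - ν)) := by
  rw [funext (obliqueMap_eq_flatMap x m)]
  exact (hJ.measurableEmbedding_flatMap x).comp (shearHomeomorph m).measurableEmbedding

/-- The inverse of `obliqueMap`. -/
noncomputable def obliqueCoord (J : E n →ₗᵢ[ℝ] E (n + 1)) (x ν : E (n + 1)) (m : E n)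
    (p : E (n + 1)) : E n × ℝ :=
  (J.toContinuousLinearMap.adjoint (p - x) - (-⟪ν, p - x⟫) • m, -⟪ν, p - x⟫)

theorem IsTangent.adjoint_apply (J : E n →ₗᵢ[ℝ] E (n + 1)) (z : E n) :
    J.toContinuousLinearMap.adjoint (J z) = z := by
  refine ext_inner_right ℝ fun y => ?_
  rw [ContinuousLinearMap.adjoint_inner_left]
  exact J.inner_map_map z y

theorem IsTangent.adjoint_normal (hJ : IsTangent J ν) :
    J.toContinuousLinearMap.adjoint ν = 0 := by
  refine ext_inner_right ℝ fun y => ?_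
  rw [ContinuousLinearMap.adjoint_inner_left, inner_zero_left]
  exact hJ.2 y

theorem IsTangent.obliqueCoord_obliqueMap (hJ : IsTangent J ν) (x : E (n + 1)) (m : E n)
    (q : E n × ℝ) : obliqueCoord J x ν m (obliqueMap J x (J m - ν) q) = q := by
  have h1 : obliqueMap J x (J m - ν) q - x = J q.1 + q.2 • (J m - ν) := by
    simp only [obliqueMap]; abel
  have h2 : ⟪ν, J q.1 + q.2 • (J m - ν)⟫ = - q.2 := by
    rw [inner_add_right, inner_smul_right, inner_sub_right, hJ.2, hJ.2,
      real_inner_self_eq_norm_sq, hJ.1]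
    ring
  rw [obliqueCoord, h1, h2]
  ext1
  · simp [map_add, map_smul, map_sub, IsTangent.adjoint_apply, hJ.adjoint_normal]
  · simp

theorem IsTangent.obliqueMap_obliqueCoord (hJ : IsTangent J ν) (x : E (n + 1)) (m : E n)
    (p : E (n + 1)) : obliqueMap J x (J m - ν) (obliqueCoord J x ν m p) = p := by
  obtain ⟨Φ, hΦ⟩ := hJ.exists_homeomorph x
  obtain ⟨q, rfl⟩ : ∃ q, obliqueMap J x (J m - ν) q = p := by
    obtain ⟨q, hq⟩ := Φ.surjective p
    refine ⟨(q.1 - q.2 • m, q.2), ?_⟩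
    rw [obliqueMap_eq_flatMap, ← hq, hΦ]
    simp
  rw [hJ.obliqueCoord_obliqueMap]

end Oblique

end IPG

namespace IPG

/-! ### Initial values along oblique directions -/

section Oblique

variable {n : ℕ} {J : E n →ₗᵢ[ℝ] E (n + 1)} {ν : E (n + 1)}

theorem volume_restrict_prod (D : Set (E n)) (I : Set ℝ) :
    ((volume : Measure (E n)).restrict D).prod ((volume : Measure ℝ).restrict I) =
      (volume : Measure (E n × ℝ)).restrict (D ×ˢ I) := by
  rw [Measure.prod_restrict]; rfl

/-- Products of test functions in oblique coordinates are test functions. -/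
theorem IsTangent.isTest_oblique (hJ : IsTangent J ν) (x : E (n + 1)) (m : E n) {D : Set (E n)}
    {τ : ℝ} {U : Set (E (n + 1))}
    (hsub : ∀ z ∈ D, ∀ s ∈ Ioo 0 τ, obliqueMap J x (J m - ν) (z, s) ∈ U) {η : E n → ℝ} {ζ : ℝ → ℝ}
    (hη : IsTest D η) (hζ : IsTimeTest τ ζ) :
    IsTest U (fun p => η (obliqueCoord J x ν m p).1 * ζ (obliqueCoord J x ν m p).2) := by
  have hc : ContDiff ℝ ∞ (obliqueCoord J x ν m) := by
    unfold obliqueCoord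
    have h1 : ContDiff ℝ ∞ fun p : E (n + 1) => -⟪ν, p - x⟫ :=
      (contDiff_const.inner ℝ (contDiff_id.sub contDiff_const)).neg
    have h2 : ContDiff ℝ ∞ fun p : E (n + 1) => J.toContinuousLinearMap.adjoint (p - x) :=
      (ContinuousLinearMap.contDiff _).comp (contDiff_id.sub contDiff_const)
    exact (h2.sub (h1.smul contDiff_const)).prodMk h1
  have hob : Continuous (obliqueMap J x (J m - ν)) := by
    unfold obliqueMap
    have := J.continuous
    fun_prop
  have hK : IsCompact (obliqueMap J x (J m - ν) '' (tsupport η ×ˢ tsupport ζ)) :=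
    (hη.2.1.isCompact.prod hζ.2.1.isCompact).image hob
  have hsupp : Function.support
      (fun p => η (obliqueCoord J x ν m p).1 * ζ (obliqueCoord J x ν m p).2) ⊆
      obliqueMap J x (J m - ν) '' (tsupport η ×ˢ tsupport ζ) := by
    intro p hp
    have hp' := mul_ne_zero_iff.1 hp
    exact ⟨obliqueCoord J x ν m p, ⟨subset_tsupport _ hp'.1, subset_tsupport _ hp'.2⟩,
      hJ.obliqueMap_obliqueCoord x m p⟩
  refine ⟨(hη.1.comp (contDiff_fst.comp hc)).mul (hζ.1.comp (contDiff_snd.comp hc)),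
    HasCompactSupport.of_support_subset_isCompact hK hsupp, ?_⟩
  refine (closure_minimal hsupp hK.isClosed).trans ?_
  rintro _ ⟨q, hq, rfl⟩
  exact hsub _ (hη.2.2 hq.1) _ (hζ.2.2 hq.2)

/-- Moving along the oblique direction changes only the time coordinate, so a directional weak
derivative becomes a weak derivative in time. -/
theorem IsTangent.fderiv_oblique (hJ : IsTangent J ν) (x : E (n + 1)) (m : E n) {η : E n → ℝ}
    {ζ : ℝ → ℝ}
    (hd : Differentiable ℝ
      (fun p => η (obliqueCoord J x ν m p).1 * ζ (obliqueCoord J x ν m p).2)) (q : E n × ℝ) :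
    fderiv ℝ (fun p => η (obliqueCoord J x ν m p).1 * ζ (obliqueCoord J x ν m p).2)
      (obliqueMap J x (J m - ν) q) (J m - ν) = η q.1 * deriv ζ q.2 := by
  rw [← (hd _).lineDeriv_eq_fderiv, lineDeriv]
  have : ∀ t : ℝ, obliqueMap J x (J m - ν) q + t • (J m - ν) =
      obliqueMap J x (J m - ν) (q.1, q.2 + t) := by
    intro t; simp only [obliqueMap, add_smul]; abel
  simp_rw [this, hJ.obliqueCoord_obliqueMap]
  rw [deriv_const_mul_field, deriv_comp_const_add]
  simp

/-- A function with an integrable weak derivative in a direction transversal to a hyperplane has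
an initial value on the hyperplane. -/
theorem IsTangent.exists_obliqueTrace (hJ : IsTangent J ν) (x : E (n + 1)) {m : E n}
    {D : Set (E n)} (hD : IsOpen D) {τ : ℝ} (hτ : 0 < τ) {U : Set (E (n + 1))} (hU : IsOpen U)
    (hsub : ∀ z ∈ D, ∀ s ∈ Ioo 0 τ, obliqueMap J x (J m - ν) (z, s) ∈ U) {w Dw : E (n + 1) → ℝ}
    (hw : IntegrableOn w U) (hDw : IntegrableOn Dw U) (hweak : HasWeakDeriv U w (J m - ν) Dw) :
    ∃ g : E n → ℝ, IntegrableOn g D ∧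
      (Integrable (fun q => Dw (obliqueMap J x (J m - ν) q))
        ((volume.restrict D).prod (volume.restrict (Ioo 0 τ)))) ∧
      ∀ᵐ q ∂((volume.restrict D).prod (volume.restrict (Ioo 0 τ))),
        w (obliqueMap J x (J m - ν) q) =
          g q.1 + ∫ s in Ioo 0 q.2, Dw (obliqueMap J x (J m - ν) (q.1, s)) := by
  set ob := obliqueMap J x (J m - ν)
  have hMP : MeasurePreserving ob volume volume := hJ.measurePreserving_obliqueMap x m
  have hME : MeasurableEmbedding ob := hJ.measurableEmbedding_obliqueMap x m
  have hmeas : MeasurableSet (D ×ˢ Ioo 0 τ) := hD.measurableSet.prod measurableSet_Ioo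
  have hint : ∀ {f : E (n + 1) → ℝ}, IntegrableOn f U →
      Integrable (fun q => f (ob q)) ((volume.restrict D).prod (volume.restrict (Ioo 0 τ))) := by
    intro f hf
    rw [volume_restrict_prod]
    have h1 : Integrable (U.indicator f) volume := hf.integrable_indicator hU.measurableSet
    have h2 := (hMP.integrable_comp_of_integrable h1).integrableOn (s := D ×ˢ Ioo 0 τ)
    refine (integrableOn_congr_fun (fun q hq => ?_) hmeas).1 h2
    exact indicator_of_mem (hsub _ hq.1 _ hq.2) f
  have hchange : ∀ {f : E (n + 1) → ℝ} {φ : E (n + 1) → ℝ} {k : E n × ℝ → ℝ},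
      (∀ q, φ (ob q) = k q) → (∀ p, p ∉ U → φ p = 0) → (∀ q, q ∉ D ×ˢ Ioo 0 τ → k q = 0) →
      ∫ p in U, f p * φ p =
        ∫ q, f (ob q) * k q ∂((volume.restrict D).prod (volume.restrict (Ioo 0 τ))) := by
    intro f φ k h1 h2 h3
    rw [volume_restrict_prod, setIntegral_eq_integral_of_forall_compl_eq_zero
      (f := fun p => f p * φ p) (fun p hp => by rw [h2 p hp, mul_zero]),
      setIntegral_eq_integral_of_forall_compl_eq_zero
      (f := fun q => f (ob q) * k q) (fun q hq => by rw [h3 q hq, mul_zero]),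
      ← hMP.integral_comp hME]
    simp_rw [h1]
  obtain ⟨g, hg, hg'⟩ := exists_initialValue hD hτ (hint hw) (hint hDw) (by
    intro η ζ hη hζ
    have hT := hJ.isTest_oblique x m hsub hη hζ
    have h := hweak _ hT
    rw [hchange (k := fun q => η q.1 * deriv ζ q.2), hchange (k := fun q => η q.1 * ζ q.2)] at h
    · exact h
    · intro q
      simp only [ob, hJ.obliqueCoord_obliqueMap]
    · intro p hp
      exact hT.eq_zero hp
    · intro q hq
      rw [mem_prod, not_and_or] at hq
      rcases hq with hq | hq
      · rw [hη.eq_zero hq, zero_mul]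
      · rw [hζ.eq_zero hq, mul_zero]
    · exact hJ.fderiv_oblique x m (hT.1.differentiable (by simp))
    · intro p hp
      have : p ∉ tsupport (fun p => η (obliqueCoord J x ν m p).1 * ζ (obliqueCoord J x ν m p).2) :=
        fun h => hp (hT.2.2 h)
      rw [image_eq_zero_of_notMem_tsupport (f := fderiv ℝ _)
        (fun h => this (tsupport_fderiv_subset ℝ h))]
      rfl
    · intro q hq
      rw [mem_prod, not_and_or] at hq
      rcases hq with hq | hq
      · rw [hη.eq_zero hq, zero_mul]
      · rw [image_eq_zero_of_notMem_tsupport (f := deriv ζ)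
          (fun h => hq (hζ.2.2 (tsupport_deriv_subset (𝕜 := ℝ) h))), mul_zero])
  exact ⟨g, hg, hint hDw, hg'⟩

/-- The initial value is square integrable if the function and its derivative are. -/
theorem memLp_two_initialValue {D : Set (E n)} {τ : ℝ} (hτ : 0 < τ)
    {f h : E n × ℝ → ℝ} {g : E n → ℝ}
    (hf : MemLp f 2 ((volume.restrict D).prod (volume.restrict (Ioo 0 τ))))
    (hh : MemLp h 2 ((volume.restrict D).prod (volume.restrict (Ioo 0 τ))))
    (hg : AEStronglyMeasurable g (volume.restrict D))
    (hfg : ∀ᵐ q ∂((volume.restrict D).prod (volume.restrict (Ioo 0 τ))),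
        f q = g q.1 + ∫ s in Ioo 0 q.2, h (q.1, s)) : MemLp g 2 (volume.restrict D) := by
  set μ := (volume : Measure (E n)).restrict D
  set lam := (volume : Measure ℝ).restrict (Ioo 0 τ)
  rw [memLp_two_iff_lintegral hg]
  have hf2 := (memLp_two_iff_lintegral hf.1).1 hf
  have hh2 := (memLp_two_iff_lintegral hh.1).1 hh
  have hlam : lam univ = ENNReal.ofReal τ := by simp [lam]
  let k : E n → ℝ≥0∞ := fun z => ∫⁻ s, ‖h (z, s)‖ₑ ^ 2 ∂lam
  have hk : ∫⁻ z, k z ∂μ = ∫⁻ q, ‖h q‖ₑ ^ 2 ∂(μ.prod lam) :=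
    (lintegral_prod _ (hh.1.enorm.pow_const 2)).symm
  have hkm : AEMeasurable k μ := (hh.1.enorm.pow_const 2).lintegral_prod_right'
  have hmem : ∀ᵐ p ∂(μ.prod lam), p.2 ∈ Ioo 0 τ :=
    Measure.quasiMeasurePreserving_snd.ae (ae_restrict_mem measurableSet_Ioo)
  have hslice : ∀ᵐ p ∂(μ.prod lam), AEStronglyMeasurable (fun s => h (p.1, s)) lam := by
    have h1 : ∀ᵐ z ∂μ, AEStronglyMeasurable (fun s => h (z, s)) lam := hh.1.prodMk_left
    exact Measure.quasiMeasurePreserving_fst.ae h1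
  -- Cauchy–Schwarz over a time interval of length at most τ bounds the square of the integral of h.
  -- As g does not depend on time, integrating this bound over the slab gives τ times the integral
  -- of g², and τ > 0.
  have key : ∀ᵐ p ∂(μ.prod lam),
      ‖g p.1‖ₑ ^ 2 ≤ 2 * ‖f p‖ₑ ^ 2 + 2 * (ENNReal.ofReal τ * k p.1) := by
    filter_upwards [hfg, hmem, hslice] with p hp hp2 hp3
    have e1 : g p.1 = f p - ∫ s in Ioo 0 p.2, h (p.1, s) := by rw [hp]; ring
    have e2 : ‖∫ s in Ioo 0 p.2, h (p.1, s)‖ₑ ≤ ∫⁻ s, ‖h (p.1, s)‖ₑ ∂lam :=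
      (enorm_integral_le_lintegral_enorm _).trans
        (lintegral_mono_set (Ioo_subset_Ioo_right hp2.2.le))
    have e3 := sq_lintegral_le hp3.enorm
    rw [hlam] at e3
    calc ‖g p.1‖ₑ ^ 2 ≤ (‖f p‖ₑ + ∫⁻ s, ‖h (p.1, s)‖ₑ ∂lam) ^ 2 := by
          gcongr
          rw [e1]
          exact enorm_sub_le.trans (by gcongr)
      _ ≤ 2 * (‖f p‖ₑ ^ 2 + (∫⁻ s, ‖h (p.1, s)‖ₑ ∂lam) ^ 2) := by
          have := ENNReal.rpow_add_le_mul_rpow_add_rpow ‖f p‖ₑ (∫⁻ s, ‖h (p.1, s)‖ₑ ∂lam)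
            (p := 2) (by norm_num)
          norm_num at this
          exact this
      _ ≤ _ := by rw [mul_add]; gcongr
  have hint : ∫⁻ p, ‖g p.1‖ₑ ^ 2 ∂(μ.prod lam) < ⊤ := by
    refine (lintegral_mono_ae key).trans_lt ?_
    rw [lintegral_add_left' ((hf.1.enorm.pow_const 2).const_mul 2), lintegral_const_mul' _ _ (by simp),
      lintegral_const_mul' _ _ (by simp), lintegral_const_mul' _ _ (by simp)]
    refine ENNReal.add_lt_top.2 ⟨ENNReal.mul_lt_top (by simp) hf2,
      ENNReal.mul_lt_top (by simp) (ENNReal.mul_lt_top (by simp) ?_)⟩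
    rw [lintegral_prod (fun q => k q.1) (hkm.comp_quasiMeasurePreserving Measure.quasiMeasurePreserving_fst)]
    simp only [lintegral_const, hlam]
    rw [lintegral_mul_const' _ _ (by simp), hk]
    exact ENNReal.mul_lt_top hh2 (by simp)
  rw [lintegral_prod (fun q => ‖g q.1‖ₑ ^ 2) ((hg.enorm.pow_const 2).comp_quasiMeasurePreserving
    Measure.quasiMeasurePreserving_fst)] at hint
  simp only [lintegral_const, hlam] at hint
  rw [lintegral_mul_const' _ _ (by simp)] at hint
  by_contra hcon
  rw [not_lt, top_le_iff] at hcon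
  rw [hcon, ENNReal.top_mul (by simpa using hτ)] at hint
  exact lt_irrefl _ hint

/-- Convergence to the initial value along the oblique direction implies convergence in the
normal direction. -/
theorem normal_avgZero_of_initialValue (x : E (n + 1)) {m : E n}
    {D : Set (E n)} (hD : IsOpen D) {τ : ℝ} (hτ : 0 < τ) {w Dw : E (n + 1) → ℝ} {g : E n → ℝ}
    (hg : IntegrableOn g D)
    (hDw : Integrable (fun q => Dw (obliqueMap J x (J m - ν) q))
        ((volume.restrict D).prod (volume.restrict (Ioo 0 τ))))
    (hwg : ∀ᵐ q ∂((volume.restrict D).prod (volume.restrict (Ioo 0 τ))),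
        w (obliqueMap J x (J m - ν) q) =
          g q.1 + ∫ s in Ioo 0 q.2, Dw (obliqueMap J x (J m - ν) (q.1, s)))
    {z₀ : E n} {ρ : ℝ} (hρ : 0 < ρ) (hball : Metric.ball z₀ (2 * ρ) ⊆ D) :
    AvgZero (volume.restrict (Metric.ball z₀ ρ))
      (fun t z => ‖w (flatMap J x ν (z, t)) - g z‖ₑ) := by
  set ob := obliqueMap J x (J m - ν)
  set μ := (volume : Measure (E n)).restrict D
  set lam := (volume : Measure ℝ).restrict (Ioo 0 τ)
  set κ : ℝ → ℝ≥0∞ := fun s => ∫⁻ z, ‖Dw (ob (z, s))‖ₑ ∂μ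
  have hκm : AEMeasurable κ lam := hDw.1.enorm.lintegral_prod_left'
  have hκ : ∫⁻ s, κ s ∂lam ≠ ⊤ := by
    have h1 := hDw.2
    rw [HasFiniteIntegral, lintegral_prod_symm _ hDw.1.enorm] at h1
    exact h1.ne
  -- the modulus of continuity of the translates of the initial value
  let g₁ := D.indicator g
  have hg₁ : Integrable g₁ := hg.integrable_indicator hD.measurableSet
  let om : ℝ → ℝ≥0∞ := fun t => ∫⁻ z, ‖g₁ (z + (-t) • m) - g₁ z‖ₑ
  have hom : Tendsto om (𝓝 0) (𝓝 0) := by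
    have h1 : Tendsto (fun t : ℝ => (-t) • m) (𝓝 0) (𝓝 0) := by
      have : Continuous fun t : ℝ => (-t) • m := by fun_prop
      simpa using this.tendsto 0
    exact (tendsto_lintegral_translate_sub hg₁).comp h1
  have hsmall : Tendsto (fun ε : ℝ => ∫⁻ s in Ioo 0 ε, κ s ∂lam) (𝓝[>] 0) (𝓝 0) := by
    refine tendsto_setLIntegral_zero hκ ?_
    refine tendsto_of_tendsto_of_tendsto_of_le_of_le tendsto_const_nhds (?_ : Tendsto
      (fun ε : ℝ => ENNReal.ofReal ε) (𝓝[>] 0) (𝓝 0)) (fun _ => zero_le) (fun ε => ?_)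
    · have := (ENNReal.continuous_ofReal.tendsto 0).mono_left (nhdsWithin_le_nhds (s := Ioi 0))
      simpa using this
    · exact (Measure.restrict_le_self _).trans (by simp)
  -- slice estimate
  have hslice : ∀ᵐ t ∂lam, ∀ᵐ z ∂μ, ‖w (ob (z, t)) - g z‖ₑ ≤ ∫⁻ s in Ioo 0 t, ‖Dw (ob (z, s))‖ₑ := by
    have h1 := Measure.measurePreserving_swap.quasiMeasurePreserving.ae hwg
    have h2 := Measure.ae_ae_of_ae_prod h1
    filter_upwards [h2] with t ht
    filter_upwards [ht] with z hz
    simp only [Prod.swap_prod_mk] at hz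
    rw [hz, add_sub_cancel_left]
    exact enorm_integral_le_lintegral_enorm _
  have hmain : ∀ᵐ t ∂lam, ∫⁻ z, ‖w (ob (z, t)) - g z‖ₑ ∂μ ≤ ∫⁻ s in Ioo 0 t, κ s ∂lam := by
    filter_upwards [hslice, ae_restrict_mem measurableSet_Ioo] with t ht htm
    refine (lintegral_mono_ae ht).trans ?_
    have e1 : lam.restrict (Ioo 0 t) = volume.restrict (Ioo 0 t) :=
      Measure.restrict_restrict_of_subset (Ioo_subset_Ioo_right htm.2.le)
    rw [e1]
    have hm : AEMeasurable (Function.uncurry fun (z : E n) (s : ℝ) => ‖Dw (ob (z, s))‖ₑ)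
        (μ.prod (volume.restrict (Ioo 0 t))) := by
      refine hDw.1.enorm.mono_ac ?_
      refine Measure.AbsolutelyContinuous.prod .rfl ?_
      exact (Measure.restrict_mono_set _ (Ioo_subset_Ioo_right htm.2.le)).absolutelyContinuous
    rw [lintegral_lintegral_swap hm]
  -- The point at depth t on the normal through z lies on the oblique line that starts at z − t m.
  -- Its value differs from g(z) by the increment along that line and by g(z − t m) − g(z). For ε‖m‖
  -- < ρ the starting point stays in the ball of radius 2ρ, hence in D.
  have hle : ∀ᶠ ε in 𝓝[>] (0 : ℝ), ∀ᵐ t ∂(volume.restrict (Ioo 0 ε)),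
      ∫⁻ z in Metric.ball z₀ ρ, ‖w (flatMap J x ν (z, t)) - g z‖ₑ ≤
        (∫⁻ s in Ioo 0 ε, κ s ∂lam) + om t := by
    have hδ : ∀ᶠ ε in 𝓝[>] (0 : ℝ), ε * ‖m‖ < ρ := by
      have : Tendsto (fun ε : ℝ => ε * ‖m‖) (𝓝[>] 0) (𝓝 0) := by
        have h : Continuous fun ε : ℝ => ε * ‖m‖ := by fun_prop
        simpa using (h.tendsto 0).mono_left (nhdsWithin_le_nhds (s := Ioi 0))
      exact this.eventually_lt_const hρ
    filter_upwards [Ioo_mem_nhdsGT hτ, hδ] with ε hε hεm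
    have := ae_restrict_of_ae_restrict_of_subset (Ioo_subset_Ioo_right hε.2.le) hmain
    filter_upwards [this, ae_restrict_mem measurableSet_Ioo] with t ht htm
    have htm' : ‖t • m‖ < ρ := by
      rw [norm_smul, Real.norm_eq_abs, abs_of_pos htm.1]
      exact (mul_le_mul_of_nonneg_right htm.2.le (norm_nonneg m)).trans_lt hεm
    have hmem : ∀ z ∈ Metric.ball z₀ ρ, z + (-t) • m ∈ D := by
      intro z hz
      apply hball
      rw [Metric.mem_ball, dist_eq_norm] at hz ⊢
      have : z + (-t) • m - z₀ = (z - z₀) - t • m := by rw [neg_smul]; abel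
      rw [this]
      exact (norm_sub_le _ _).trans_lt (by linarith)
    have hmem' : ∀ z ∈ Metric.ball z₀ ρ, z ∈ D := fun z hz =>
      hball (Metric.ball_subset_ball (by linarith) hz)
    have hob : ∀ z, flatMap J x ν (z, t) = ob (z + (-t) • m, t) := by
      intro z
      simp only [ob, obliqueMap_eq_flatMap]
      congr 2
      rw [neg_smul]; abel
    calc ∫⁻ z in Metric.ball z₀ ρ, ‖w (flatMap J x ν (z, t)) - g z‖ₑ
        ≤ ∫⁻ z in Metric.ball z₀ ρ, ((D.indicator (fun z => ‖w (ob (z, t)) - g z‖ₑ) (z + (-t) • m))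
            + ‖g₁ (z + (-t) • m) - g₁ z‖ₑ) := by
          refine setLIntegral_mono' measurableSet_ball fun z hz => ?_
          rw [hob, indicator_of_mem (hmem z hz)]
          simp only [g₁, indicator_of_mem (hmem z hz), indicator_of_mem (hmem' z hz)]
          have : w (ob (z + (-t) • m, t)) - g z = (w (ob (z + (-t) • m, t)) - g (z + (-t) • m)) +
            (g (z + (-t) • m) - g z) := by ring
          rw [this]
          exact enorm_add_le _ _
      _ ≤ ∫⁻ z, ((D.indicator (fun z => ‖w (ob (z, t)) - g z‖ₑ) (z + (-t) • m))
            + ‖g₁ (z + (-t) • m) - g₁ z‖ₑ) := setLIntegral_le_lintegral _ _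
      _ = (∫⁻ z, (D.indicator (fun z => ‖w (ob (z, t)) - g z‖ₑ) (z + (-t) • m))) + om t := by
          rw [lintegral_add_right']
          have hmp : MeasurePreserving (fun z : E n => z + (-t) • m) volume volume :=
            measurePreserving_add_right volume _
          exact ((hg₁.1.comp_measurePreserving hmp).sub hg₁.1).enorm
      _ = (∫⁻ z, ‖w (ob (z, t)) - g z‖ₑ ∂μ) + om t := by
          congr 1
          rw [lintegral_add_right_eq_self (D.indicator (fun z => ‖w (ob (z, t)) - g z‖ₑ)),
            lintegral_indicator hD.measurableSet]
      _ ≤ _ := by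
          gcongr
          exact ht.trans (lintegral_mono_set (Ioo_subset_Ioo_right htm.2.le))
  refine ENNReal.tendsto_nhds_zero.2 fun δ hδ => ?_
  have hδ2 := ENNReal.half_pos hδ.ne'
  obtain ⟨r, hr0, hr⟩ := Metric.eventually_nhds_iff.1 (ENNReal.tendsto_nhds_zero.1 hom _ hδ2)
  filter_upwards [hle, ENNReal.tendsto_nhds_zero.1 hsmall _ hδ2, Ioo_mem_nhdsGT hr0] with ε h1 h2 h3
  refine ENNReal.div_le_of_le_mul ?_
  calc _ ≤ ∫⁻ t in Ioo 0 ε, δ := by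
        refine lintegral_mono_ae ?_
        filter_upwards [h1, ae_restrict_mem measurableSet_Ioo] with t ht htm
        refine ht.trans ?_
        calc _ ≤ δ / 2 + δ / 2 := by
              gcongr
              apply hr
              rw [Real.dist_eq, sub_zero, abs_of_pos htm.1]
              exact htm.2.trans h3.2
          _ = δ := ENNReal.add_halves δ
    _ = δ * ENNReal.ofReal ε := by simp

end Oblique

end IPG

namespace IPG

/-! ### Traces on hyperplanes and on flat parts of half balls -/

section Oblique

variable {n : ℕ} {J : E n →ₗᵢ[ℝ] E (n + 1)} {ν : E (n + 1)}

theorem IsTangent.surf_restrict_image (hJ : IsTangent J ν) (x : E (n + 1)) (B : Set (E n)) :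
    (surf (n + 1)).restrict ((fun z => x + J z) '' B) =
      Measure.map (fun z => x + J z) (volume.restrict B) := by
  have hinj : Function.Injective (fun z => x + J z) := (IsTangent.isometry J x).injective
  have h := (IsTangent.measurableEmbedding J x).restrict_map volume ((fun z => x + J z) '' B)
  rw [hJ.map_volume x, preimage_image_eq _ hinj, Measure.restrict_restrict_of_subset] at h
  · exact h
  · rw [← hJ.range_eq_plane x]; exact image_subset_range _ _

theorem IsTangent.image_ball (hJ : IsTangent J ν) (x : E (n + 1)) (z₀ : E n) (ρ : ℝ) :
    (fun z => x + J z) '' Metric.ball z₀ ρ = plane x ν ∩ Metric.ball (x + J z₀) ρ := by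
  rw [← hJ.range_eq_plane x]
  ext y
  constructor
  · rintro ⟨z, hz, rfl⟩
    refine ⟨⟨z, rfl⟩, ?_⟩
    have := (IsTangent.isometry J x).dist_eq z z₀
    rw [Metric.mem_ball] at hz ⊢
    exact this.trans_lt hz
  · rintro ⟨⟨z, rfl⟩, hz⟩
    have := (IsTangent.isometry J x).dist_eq z z₀
    exact ⟨z, this.symm.trans_lt hz, rfl⟩

/-- The tangential coordinate of a point of the hyperplane. -/
noncomputable def planeCoord (J : E n →ₗᵢ[ℝ] E (n + 1)) (x : E (n + 1)) (p : E (n + 1)) : E n :=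
  J.toContinuousLinearMap.adjoint (p - x)

theorem planeCoord_apply (J : E n →ₗᵢ[ℝ] E (n + 1)) (x : E (n + 1)) (z : E n) :
    planeCoord J x (x + J z) = z := by
  rw [planeCoord, add_sub_cancel_left, IsTangent.adjoint_apply]

theorem IsTangent.normalLimit_of_avgZero (hJ : IsTangent J ν) (x : E (n + 1)) {B : Set (E n)}
    {w : E (n + 1) → ℝ} {g : E n → ℝ}
    (h : AvgZero (volume.restrict B) (fun t z => ‖w (flatMap J x ν (z, t)) - g z‖ₑ)) :
    NormalLimit ν ((fun z => x + J z) '' B) w (fun y => g (planeCoord J x y)) := by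
  rw [NormalLimit, AvgZero, hJ.surf_restrict_image]
  simp_rw [(IsTangent.measurableEmbedding J x).lintegral_map, planeCoord_apply]
  exact h

theorem HasWeakDeriv.smul {d : ℕ} {U : Set (E d)} {w D : E d → ℝ} {e : E d}
    (h : HasWeakDeriv U w e D) (c : ℝ) : HasWeakDeriv U w (c • e) (fun p => c * D p) := by
  intro φ hφ
  have := h φ hφ
  simp_rw [map_smul, smul_eq_mul, mul_left_comm _ c, mul_assoc, integral_const_mul, this]
  ring

/-- A function with an integrable weak derivative in a direction transversal to a hyperplane has
a trace on the hyperplane. -/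
theorem IsTangent.exists_trace (hJ : IsTangent J ν) (x : E (n + 1)) {e : E (n + 1)}
    (he : ⟪ν, e⟫ < 0) {D : Set (E n)} (hD : IsOpen D) {τ : ℝ} (hτ : 0 < τ) {U : Set (E (n + 1))}
    (hU : IsOpen U) (hsub : ∀ z ∈ D, ∀ s ∈ Ioo 0 τ, x + J z + s • e ∈ U) {w Dw : E (n + 1) → ℝ}
    (hw : IntegrableOn w U) (hDw : IntegrableOn Dw U) (hweak : HasWeakDeriv U w e Dw) :
    ∃ g : E (n + 1) → ℝ, IntegrableOn g ((fun z => x + J z) '' D) (surf (n + 1)) ∧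
      (∀ z₀ ∈ D, ∃ ρ > 0, Metric.ball z₀ ρ ⊆ D ∧
        NormalLimit ν (plane x ν ∩ Metric.ball (x + J z₀) ρ) w g) ∧
      (MemLp w 2 (volume.restrict U) → MemLp Dw 2 (volume.restrict U) →
        MemLp g 2 ((surf (n + 1)).restrict ((fun z => x + J z) '' D))) := by
  set a := -⟪ν, e⟫ with ha
  have ha0 : 0 < a := by rw [ha]; linarith
  -- Dividing `e` by its rate of descent a = −⟪ν, e⟫ turns time into depth; the derivative is scaled
  -- by a⁻¹ and the time span becomes aτ.
  obtain ⟨m, hm⟩ := exists_tangent_add_normal hJ (e := a⁻¹ • e) (by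
    rw [inner_smul_right]; field_simp; linarith)
  have hweak' := hweak.smul a⁻¹
  rw [hm] at hweak'
  have hDw' : IntegrableOn (fun p => a⁻¹ * Dw p) U := hDw.const_mul a⁻¹
  have hsub' : ∀ z ∈ D, ∀ s ∈ Ioo 0 (a * τ), obliqueMap J x (J m - ν) (z, s) ∈ U := by
    intro z hz s hs
    rw [← hm, obliqueMap, smul_smul]
    refine hsub z hz _ ⟨mul_pos hs.1 (inv_pos.2 ha0), ?_⟩
    rw [← div_eq_mul_inv, div_lt_iff₀ ha0, mul_comm]
    exact hs.2
  have hτ' : 0 < a * τ := mul_pos ha0 hτ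
  obtain ⟨g, hg, hDi, hwg⟩ := hJ.exists_obliqueTrace x hD hτ' hU hsub' hw hDw' hweak'
  have hME := IsTangent.measurableEmbedding J x
  refine ⟨fun y => g (planeCoord J x y), ?_, ?_, ?_⟩
  · rw [IntegrableOn, hJ.surf_restrict_image, hME.integrable_map_iff]
    have : (fun y => g (planeCoord J x y)) ∘ (fun z => x + J z) = g := by
      funext z; simp [planeCoord_apply]
    rw [this]; exact hg
  · intro z₀ hz₀
    obtain ⟨ρ, hρ, hball⟩ := Metric.isOpen_iff.1 hD z₀ hz₀
    refine ⟨ρ / 2, by positivity, (Metric.ball_subset_ball (by linarith)).trans hball, ?_⟩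
    rw [← hJ.image_ball]
    refine hJ.normalLimit_of_avgZero x ?_
    exact normal_avgZero_of_initialValue (m := m) (Dw := fun p => a⁻¹ * Dw p) x hD hτ' hg hDi hwg (by positivity)
      (by rw [mul_div_cancel₀ _ (two_ne_zero)]; exact hball)
  · intro hw2 hDw2
    have hmem : ∀ {f : E (n + 1) → ℝ}, MemLp f 2 (volume.restrict U) →
        MemLp (fun q => f (obliqueMap J x (J m - ν) q)) 2
          ((volume.restrict D).prod (volume.restrict (Ioo 0 (a * τ)))) := by
      intro f hf
      rw [volume_restrict_prod]
      have h1 : MemLp (U.indicator f) 2 volume := (memLp_indicator_iff_restrict hU.measurableSet).2 hf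
      have h2 := (h1.comp_measurePreserving (hJ.measurePreserving_obliqueMap x m)).restrict
        (D ×ˢ Ioo 0 (a * τ))
      refine (memLp_congr_ae ?_).1 h2
      filter_upwards [ae_restrict_mem (hD.measurableSet.prod measurableSet_Ioo)] with q hq
      exact indicator_of_mem (hsub' _ hq.1 _ hq.2) f
    have h3 := memLp_two_initialValue hτ' (hmem hw2) (hmem (hDw2.const_mul a⁻¹)) hg.1 hwg
    rw [hJ.surf_restrict_image, hME.memLp_map_measure_iff]
    have : (fun y => g (planeCoord J x y)) ∘ (fun z => x + J z) = g := by
      funext z; simp [planeCoord_apply]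
    rw [this]; exact h3

/-- The open half ball below a hyperplane. -/
def halfBall {d : ℕ} (x ν : E d) (r : ℝ) : Set (E d) := {p | p ∈ Metric.ball x r ∧ ⟪ν, p - x⟫ < 0}

theorem isOpen_halfBall {d : ℕ} (x ν : E d) (r : ℝ) : IsOpen (halfBall x ν r) := by
  have : Continuous fun y : E d => ⟪ν, y - x⟫ := by fun_prop
  exact Metric.isOpen_ball.inter (isOpen_Iio.preimage this)

/-- The intersection of a hyperplane with a ball. -/
def disc {d : ℕ} (x ν : E d) (r : ℝ) : Set (E d) := plane x ν ∩ Metric.ball x r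

theorem disc_subset_plane {d : ℕ} (x ν : E d) (r : ℝ) : disc x ν r ⊆ plane x ν := inter_subset_left

theorem measurableSet_disc {d : ℕ} (x ν : E d) (r : ℝ) : MeasurableSet (disc x ν r) :=
  (measurableSet_plane x ν).inter measurableSet_ball

theorem disc_mono {d : ℕ} {x ν : E d} {r s : ℝ} (h : r ≤ s) : disc x ν r ⊆ disc x ν s :=
  inter_subset_inter_right _ (Metric.ball_subset_ball h)

theorem exists_trace_halfBall (hν : ‖ν‖ = 1) {x : E (n + 1)} {r : ℝ} (hr : 0 < r)
    {e : E (n + 1)} (he : ⟪ν, e⟫ < 0) {U : Set (E (n + 1))} (hU : IsOpen U)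
    (hsub : halfBall x ν r ⊆ U) {w Dw : E (n + 1) → ℝ}
    (hw : IntegrableOn w U) (hDw : IntegrableOn Dw U) (hweak : HasWeakDeriv U w e Dw) :
    ∃ ρ > 0, ∃ g : E (n + 1) → ℝ, IntegrableOn g (disc x ν ρ) (surf (n + 1)) ∧
      NormalLimit ν (disc x ν ρ) w g := by
  obtain ⟨J, hJ⟩ := exists_isTangent hν
  -- From the disc of radius r/2, a displacement along `e` during a time below r/(2(1 + ‖e‖)) is
  -- shorter than r/2, so it ends in the ball of radius r, below the hyperplane because ⟪ν, e⟫ < 0.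
  have hden : 0 < 2 * (1 + ‖e‖) := by positivity
  obtain ⟨g, hg1, hg2, -⟩ := hJ.exists_trace x he (D := Metric.ball 0 (r / 2)) Metric.isOpen_ball
    (τ := r / (2 * (1 + ‖e‖))) (by positivity) hU (by
      intro z hz s hs
      apply hsub
      rw [mem_ball_zero_iff] at hz
      have h1 : x + J z + s • e - x = J z + s • e := by abel
      constructor
      · rw [Metric.mem_ball, dist_eq_norm, h1]
        have h2 := hs.2
        rw [lt_div_iff₀ hden] at h2
        have h3 : ‖s • e‖ = s * ‖e‖ := by rw [norm_smul, Real.norm_eq_abs, abs_of_pos hs.1]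
        have h4 := norm_add_le (J z) (s • e)
        rw [J.norm_map, h3] at h4
        nlinarith [hs.1]
      · rw [h1, inner_add_right, hJ.2, inner_smul_right, zero_add]
        exact mul_neg_of_pos_of_neg hs.1 he) hw hDw hweak
  obtain ⟨ρ, hρ, hball, hlim⟩ := hg2 0 (Metric.mem_ball_self (by positivity))
  rw [map_zero, add_zero] at hlim
  refine ⟨ρ, hρ, g, ?_, hlim⟩
  refine hg1.mono_set ?_
  have := hJ.image_ball x 0 ρ
  rw [map_zero, add_zero] at this
  rw [disc, ← this]
  exact image_mono hball

end Oblique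

end IPG

namespace IPG

/-! ### Green's formula near a flat boundary point -/

section Green

variable {n : ℕ} {ν : E (n + 1)}

/-- `D` is the weak divergence of `q` on `U`. -/
def HasWeakDiv {d : ℕ} (U : Set (E d)) (q : E d → E d) (D : E d → ℝ) : Prop :=
  ∀ φ : E d → ℝ, IsTest U φ → ∫ x in U, fderiv ℝ φ x (q x) = - ∫ x in U, D x * φ x

theorem IsTest.mono {d : ℕ} {U V : Set (E d)} {φ : E d → ℝ} (h : IsTest U φ) (hUV : U ⊆ V) :
    IsTest V φ := ⟨h.1, h.2.1, h.2.2.trans hUV⟩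

theorem IsTest.fderiv_eq_zero {d : ℕ} {U : Set (E d)} {φ : E d → ℝ} (hφ : IsTest U φ) {x : E d}
    (hx : x ∉ U) : fderiv ℝ φ x = 0 :=
  image_eq_zero_of_notMem_tsupport fun h => hx (hφ.2.2 (tsupport_fderiv_subset ℝ h))

theorem IsTest.exists_bound {d : ℕ} {U : Set (E d)} {φ : E d → ℝ} (hφ : IsTest U φ) :
    ∃ C, ∀ x, ‖φ x‖ ≤ C := exists_bound_of_compactSupport hφ.1.continuous hφ.2.1

theorem IsTest.exists_fderiv_bound {d : ℕ} {U : Set (E d)} {φ : E d → ℝ} (hφ : IsTest U φ) :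
    ∃ C, ∀ x, ‖fderiv ℝ φ x‖ ≤ C :=
  (hφ.1.continuous_fderiv (by simp)).bounded_above_of_compact_support (hφ.2.1.fderiv (𝕜 := ℝ))

theorem integrableOn_fderiv_apply {d : ℕ} {U V : Set (E d)} {φ : E d → ℝ} (hφ : IsTest V φ)
    {q : E d → E d} (hq : IntegrableOn q U) : IntegrableOn (fun x => fderiv ℝ φ x (q x)) U := by
  obtain ⟨C, hC⟩ := hφ.exists_fderiv_bound
  have hc : Continuous (fderiv ℝ φ) := hφ.1.continuous_fderiv (by simp)
  refine Integrable.mono' (hq.norm.const_mul C) ?_ (Eventually.of_forall fun x => ?_)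
  · exact (ContinuousLinearMap.aestronglyMeasurable_comp₂
      (ContinuousLinearMap.apply ℝ ℝ : E d →L[ℝ] _) hq.1 hc.aestronglyMeasurable)
  · exact (ContinuousLinearMap.le_opNorm _ _).trans (by gcongr; exact hC x)

theorem integrableOn_mul_test {d : ℕ} {U V : Set (E d)} {φ : E d → ℝ} (hφ : IsTest V φ)
    {D : E d → ℝ} {μ : Measure (E d)} (hD : IntegrableOn D U μ) :
    IntegrableOn (fun x => D x * φ x) U μ := by
  obtain ⟨C, hC⟩ := hφ.exists_bound
  exact hD.mul_bdd (c := C) hφ.1.continuous.aestronglyMeasurable (Eventually.of_forall hC)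

theorem HasWeakDiv.mono {d : ℕ} {U V : Set (E d)} {q : E d → E d} {D : E d → ℝ}
    (h : HasWeakDiv U q D) (hVU : V ⊆ U) : HasWeakDiv V q D := by
  intro φ hφ
  have hφU := hφ.mono hVU
  have := h φ hφU
  rw [setIntegral_eq_integral_of_forall_compl_eq_zero
      (fun x hx => by rw [hφU.fderiv_eq_zero hx]; rfl),
    setIntegral_eq_integral_of_forall_compl_eq_zero
      (fun x hx => by rw [hφU.eq_zero hx, mul_zero])] at this
  rw [setIntegral_eq_integral_of_forall_compl_eq_zero
      (fun x hx => by rw [hφ.fderiv_eq_zero hx]; rfl),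
    setIntegral_eq_integral_of_forall_compl_eq_zero
      (fun x hx => by rw [hφ.eq_zero hx, mul_zero]), this]

/-- A smooth step: `0` on `(-∞, 1/2]` and `1` on `[1, ∞)`. -/
noncomputable def step (s : ℝ) : ℝ := Real.smoothTransition (2 * s - 1)

theorem step_contDiff : ContDiff ℝ ∞ step := by
  unfold step
  exact Real.smoothTransition.contDiff.comp (by fun_prop)

theorem step_eq_zero {s : ℝ} (h : s ≤ 1 / 2) : step s = 0 :=
  Real.smoothTransition.zero_of_nonpos (by linarith)

theorem step_eq_one {s : ℝ} (h : 1 ≤ s) : step s = 1 :=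
  Real.smoothTransition.one_of_one_le (by linarith)

theorem step_nonneg (s : ℝ) : 0 ≤ step s := Real.smoothTransition.nonneg _

theorem step_le_one (s : ℝ) : step s ≤ 1 := Real.smoothTransition.le_one _

theorem deriv_step_eq_zero {s : ℝ} (h : s ∉ Ioo (0 : ℝ) 1) : deriv step s = 0 := by
  rw [mem_Ioo, not_and_or, not_lt, not_lt] at h
  have hd : Continuous (deriv step) := step_contDiff.continuous_deriv (by simp)
  rcases h with h | h
  · have : step =ᶠ[𝓝 s] fun _ => 0 := by
      filter_upwards [Iio_mem_nhds (show s < 1 / 2 by linarith)] with t ht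
      exact step_eq_zero ht.le
    rw [this.deriv_eq]; simp
  -- At the endpoint 1 the function is known to be constant only on the right; the derivative there
  -- vanishes by continuity.
  · have hz : ∀ t ∈ Ioi (1 : ℝ), deriv step t = 0 := by
      intro t ht
      have : step =ᶠ[𝓝 t] fun _ => 1 := by
        filter_upwards [Ioi_mem_nhds ht] with u hu
        exact step_eq_one (le_of_lt hu)
      rw [this.deriv_eq]; simp
    have hcl : closure (Ioi (1 : ℝ)) ⊆ {t | deriv step t = 0} :=
      closure_minimal hz (isClosed_eq hd continuous_const)
    rw [closure_Ioi] at hcl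
    exact hcl h

theorem exists_deriv_step_bound : ∃ C : ℝ, ∀ s, ‖deriv step s‖ ≤ C := by
  have hd : Continuous (deriv step) := step_contDiff.continuous_deriv (by simp)
  refine hd.bounded_above_of_compact_support
    (HasCompactSupport.of_support_subset_isCompact (isCompact_Icc (a := (0 : ℝ)) (b := 1)) ?_)
  intro s hs
  by_contra h
  exact hs (deriv_step_eq_zero fun h' => h ⟨h'.1.le, h'.2.le⟩)

/-- The kernel `ε⁻¹ step'(t / ε)`. -/
noncomputable def stepKernel (ε t : ℝ) : ℝ := ε⁻¹ * deriv step (t / ε)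

theorem integral_stepKernel {ε : ℝ} (hε : 0 < ε) : ∫ t in Ioo 0 ε, stepKernel ε t = 1 := by
  have hd : Continuous (deriv step) := step_contDiff.continuous_deriv (by simp)
  rw [← integral_Ioc_eq_integral_Ioo, ← intervalIntegral.integral_of_le hε.le]
  simp only [stepKernel]
  rw [intervalIntegral.integral_const_mul, intervalIntegral.integral_comp_div _ hε.ne',
    intervalIntegral.integral_deriv_eq_sub' step rfl
      (fun t _ => (step_contDiff.differentiable (by simp)).differentiableAt) hd.continuousOn,
    zero_div, div_self hε.ne', step_eq_one le_rfl, step_eq_zero (by norm_num)]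
  simp [hε.ne']

/-- Averages against the kernel converge to the integral of the trace. -/
theorem NormalLimit.tendsto_integral_stepKernel {x : E (n + 1)} (hν : ‖ν‖ = 1)
    {D : Set (E (n + 1))} (hD : D ⊆ plane x ν) {W B : E (n + 1) → ℝ}
    (hW : AEStronglyMeasurable W volume) (hB : IntegrableOn B D (surf (n + 1)))
    (h : NormalLimit ν D W B) :
    Tendsto (fun ε : ℝ => ∫ p, stepKernel ε p.1 * W (p.2 - p.1 • ν)
      ∂((volume.restrict (Ioo 0 ε)).prod ((surf (n + 1)).restrict D))) (𝓝[>] 0)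
      (𝓝 (∫ y in D, B y ∂(surf (n + 1)))) := by
  have := sFinite_surf_restrict hν hD
  set μ := (surf (n + 1)).restrict D
  obtain ⟨C, hC⟩ := exists_deriv_step_bound
  have hd : Continuous (deriv step) := step_contDiff.continuous_deriv (by simp)
  have hC0 : 0 ≤ C := (norm_nonneg _).trans (hC 0)
  have hlim : Tendsto (fun ε : ℝ => ENNReal.ofReal C * ((∫⁻ t in Ioo (0 : ℝ) ε, ∫⁻ y,
      ‖W (y - t • ν) - B y‖ₑ ∂μ) / ENNReal.ofReal ε)) (𝓝[>] 0) (𝓝 0) := by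
    have := ENNReal.Tendsto.const_mul (a := ENNReal.ofReal C) h (Or.inr ENNReal.ofReal_ne_top)
    simpa using this
  rw [tendsto_iff_edist_tendsto_0]
  refine tendsto_of_tendsto_of_tendsto_of_le_of_le' tendsto_const_nhds hlim
    (Eventually.of_forall fun _ => zero_le) ?_
  -- Integrability of W along the normal flow is not assumed. For small ε the mean distance to B is
  -- at most 1, hence finite, and W inherits integrability from B.
  have hfin := ENNReal.tendsto_nhds_zero.1 h 1 one_pos
  filter_upwards [self_mem_nhdsWithin, hfin] with ε hε hε1
  have hε : 0 < ε := hε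
  have hWm : AEStronglyMeasurable (fun p : ℝ × E (n + 1) => W (p.2 - p.1 • ν))
      ((volume.restrict (Ioo 0 ε)).prod μ) :=
    (aestronglyMeasurable_normalFlow hν hD hW).mono_ac
      (Measure.restrict_le_self.absolutelyContinuous.prod .rfl)
  have hBi : Integrable (fun p : ℝ × E (n + 1) => B p.2) ((volume.restrict (Ioo 0 ε)).prod μ) :=
    Integrable.comp_snd hB _
  have hgap : ∫⁻ p, ‖W (p.2 - p.1 • ν) - B p.2‖ₑ ∂((volume.restrict (Ioo 0 ε)).prod μ) =
      ∫⁻ t in Ioo (0 : ℝ) ε, ∫⁻ y, ‖W (y - t • ν) - B y‖ₑ ∂μ :=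
    lintegral_prod _ (hWm.sub hBi.1).enorm
  have hgapfin : ∫⁻ p, ‖W (p.2 - p.1 • ν) - B p.2‖ₑ ∂((volume.restrict (Ioo 0 ε)).prod μ) < ⊤ := by
    rw [hgap]
    by_contra hcon
    rw [not_lt, top_le_iff] at hcon
    rw [hcon, ENNReal.top_div_of_ne_top ENNReal.ofReal_ne_top] at hε1
    simp at hε1
  have hdiff : Integrable (fun p : ℝ × E (n + 1) => W (p.2 - p.1 • ν) - B p.2)
      ((volume.restrict (Ioo 0 ε)).prod μ) := ⟨hWm.sub hBi.1, hgapfin⟩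
  have hWi : Integrable (fun p : ℝ × E (n + 1) => W (p.2 - p.1 • ν))
      ((volume.restrict (Ioo 0 ε)).prod μ) := by
    have := hdiff.add hBi
    refine this.congr (Eventually.of_forall fun p => ?_)
    simp
  have hkc : Continuous (stepKernel ε) := by
    unfold stepKernel; fun_prop
  have hkb : ∀ t, ‖stepKernel ε t‖ ≤ C / ε := by
    intro t
    rw [stepKernel, norm_mul, norm_inv, Real.norm_of_nonneg hε.le, div_eq_inv_mul C]
    exact mul_le_mul_of_nonneg_left (hC _) (inv_nonneg.2 hε.le)
  have hkm : AEStronglyMeasurable (fun p : ℝ × E (n + 1) => stepKernel ε p.1)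
      ((volume.restrict (Ioo 0 ε)).prod μ) := (hkc.comp continuous_fst).aestronglyMeasurable
  have hkW := hWi.bdd_mul (c := C / ε) hkm (Eventually.of_forall fun p => hkb p.1)
  have hkB := hBi.bdd_mul (c := C / ε) hkm (Eventually.of_forall fun p => hkb p.1)
  have e1 : ∫ y, B y ∂μ =
      ∫ p, stepKernel ε p.1 * B p.2 ∂((volume.restrict (Ioo 0 ε)).prod μ) := by
    rw [integral_prod_mul, integral_stepKernel hε, one_mul]
  rw [e1, edist_eq_enorm_sub, ← integral_sub hkW hkB]
  calc _ ≤ ∫⁻ p, ‖stepKernel ε p.1 * W (p.2 - p.1 • ν) - stepKernel ε p.1 * B p.2‖ₑ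
        ∂((volume.restrict (Ioo 0 ε)).prod μ) := enorm_integral_le_lintegral_enorm _
    _ ≤ ∫⁻ p, ENNReal.ofReal (C / ε) * ‖W (p.2 - p.1 • ν) - B p.2‖ₑ
        ∂((volume.restrict (Ioo 0 ε)).prod μ) := by
        refine lintegral_mono fun p => ?_
        rw [← mul_sub, enorm_mul]
        gcongr
        rw [← ofReal_norm]
        exact ENNReal.ofReal_le_ofReal (hkb _)
    _ = _ := by
        rw [lintegral_const_mul' _ _ ENNReal.ofReal_ne_top, hgap, ENNReal.ofReal_div_of_pos hε,
          div_eq_mul_inv, div_eq_mul_inv, mul_assoc, mul_comm (ENNReal.ofReal ε)⁻¹]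

/-- Uniform continuity near the bounded set D makes the difference at most s for short times, and D
has finite surface measure. -/
theorem NormalLimit.of_continuous {x : E (n + 1)} (hν : ‖ν‖ = 1) {D : Set (E (n + 1))}
    {G : Type*} [NormedAddCommGroup G]
    (hD : D ⊆ plane x ν) (hDm : MeasurableSet D) (hDb : Bornology.IsBounded D) {φ : E (n + 1) → G}
    (hφ : Continuous φ) : NormalLimit ν D φ φ := by
  have := sFinite_surf_restrict hν hD
  have hfin : (surf (n + 1)).restrict D univ < ⊤ := by
    rw [Measure.restrict_apply_univ]
    have := surf_plane_lt_top x hν hDb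
    rwa [inter_eq_right.2 hD] at this
  obtain ⟨R, hR⟩ := hDb.subset_closedBall (0 : E (n + 1))
  have huc : UniformContinuousOn φ (Metric.closedBall 0 (R + 1)) :=
    (isCompact_closedBall _ _).uniformContinuousOn_of_continuous hφ.continuousOn
  refine AvgZero.of_forall_le_add fun δ hδ => ?_
  obtain ⟨s, hs0, hs⟩ : ∃ s : ℝ, 0 < s ∧ ENNReal.ofReal s * (surf (n + 1)).restrict D univ ≤ δ := by
    have : Tendsto (fun r : ℝ => ENNReal.ofReal r * (surf (n + 1)).restrict D univ)
        (𝓝[>] 0) (𝓝 0) := by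
      have h1 : Tendsto (fun r : ℝ => ENNReal.ofReal r) (𝓝[>] 0) (𝓝 0) := by
        have := (ENNReal.continuous_ofReal.tendsto 0).mono_left (nhdsWithin_le_nhds (s := Ioi 0))
        simpa using this
      have := ENNReal.Tendsto.mul_const h1 (Or.inr hfin.ne)
      simpa using this
    obtain ⟨r, h1, h2⟩ := ((ENNReal.tendsto_nhds_zero.1 this _ hδ).and self_mem_nhdsWithin).exists
    exact ⟨r, h2, h1⟩
  obtain ⟨r, hr0, hr⟩ := Metric.uniformContinuousOn_iff.1 huc s hs0
  refine ⟨fun _ _ => 0, fun _ => ENNReal.ofReal s, ?_, aemeasurable_const, ?_, min r 1,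
    lt_min hr0 one_pos, ?_⟩
  · simp only [AvgZero, lintegral_zero, ENNReal.zero_div]; exact tendsto_const_nhds
  · rw [lintegral_const]; exact hs
  · filter_upwards [ae_restrict_mem measurableSet_Ioo] with t ht
    filter_upwards [ae_restrict_mem hDm] with y hy
    rw [add_zero, ← ofReal_norm, ← dist_eq_norm]
    refine ENNReal.ofReal_le_ofReal (hr _ ?_ _ ?_ ?_).le
    · have h1 := hR hy
      rw [mem_closedBall_zero_iff] at h1 ⊢
      refine (norm_sub_le _ _).trans ?_
      rw [norm_smul, hν, Real.norm_of_nonneg ht.1.le, mul_one]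
      linarith [ht.2, min_le_right r 1]
    · exact Metric.closedBall_subset_closedBall (by linarith) (hR hy)
    · rw [dist_eq_norm, sub_sub_cancel_left, norm_neg, norm_smul, hν,
        Real.norm_of_nonneg ht.1.le, mul_one]
      exact ht.2.trans_le (min_le_left _ _)

theorem NormalLimit.mul_continuous {x : E (n + 1)} (hν : ‖ν‖ = 1) {D : Set (E (n + 1))}
    (hD : D ⊆ plane x ν) (hDm : MeasurableSet D) (hDb : Bornology.IsBounded D)
    {φ Q b : E (n + 1) → ℝ} (hφ : Continuous φ) (hφb : ∃ C, ∀ p, ‖φ p‖ ≤ C)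
    (hQ : AEStronglyMeasurable Q volume) (hb : IntegrableOn b D (surf (n + 1)))
    (h : NormalLimit ν D Q b) :
    NormalLimit ν D (fun p => φ p * Q p) (fun y => φ y * b y) := by
  obtain ⟨C, hC⟩ := hφb
  have hC' : ∀ p, ‖φ p‖ₑ ≤ ENNReal.ofReal C := fun p => by
    rw [← ofReal_norm]; exact ENNReal.ofReal_le_ofReal (hC p)
  refine NormalLimit.bilin (fun a b : ℝ => a * b) (fun a a' b b' => ?_)
    (NormalLimit.of_continuous hν hD hDm hDb hφ) h hν hD hQ hb.1 ENNReal.ofReal_ne_top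
    (Eventually.of_forall hC') (Eventually.of_forall hC') hb.2.ne
  rw [← enorm_mul, ← enorm_mul]
  have : a * b - a' * b' = a * (b - b') + (a - a') * b' := by ring
  rw [this]
  exact enorm_add_le _ _

/-- Green's formula near a flat boundary point. -/
theorem integral_halfBall_eq {x : E (n + 1)} (hν : ‖ν‖ = 1) {r : ℝ}
    {q : E (n + 1) → E (n + 1)} {Dv : E (n + 1) → ℝ} {b : E (n + 1) → ℝ}
    (hqm : AEStronglyMeasurable q volume) (hq : IntegrableOn q (halfBall x ν r))
    (hDv : IntegrableOn Dv (halfBall x ν r)) (hdiv : HasWeakDiv (halfBall x ν r) q Dv)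
    (hb : IntegrableOn b (disc x ν r) (surf (n + 1)))
    (hlim : NormalLimit ν (disc x ν r) (fun p => ⟪q p, ν⟫) b) {φ : E (n + 1) → ℝ}
    (hφ : IsTest (Metric.ball x r) φ) :
    ∫ p in halfBall x ν r, (fderiv ℝ φ p (q p) + Dv p * φ p) =
      ∫ y in disc x ν r, b y * φ y ∂(surf (n + 1)) := by
  set H := halfBall x ν r
  set D := disc x ν r
  have hHm : MeasurableSet H := (isOpen_halfBall x ν r).measurableSet
  have hDm : MeasurableSet D := measurableSet_disc x ν r
  have hDp : D ⊆ plane x ν := disc_subset_plane x ν r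
  have hQm : AEStronglyMeasurable (fun p => ⟪q p, ν⟫) volume := hqm.inner aestronglyMeasurable_const
  have hlim' := hlim.mul_continuous hν hDp hDm (Metric.isBounded_ball.subset inter_subset_right)
    hφ.1.continuous hφ.exists_bound hQm hb
  have hWm : AEStronglyMeasurable (fun p => φ p * ⟪q p, ν⟫) volume :=
    hφ.1.continuous.aestronglyMeasurable.mul hQm
  have hbφ : IntegrableOn (fun y => φ y * b y) D (surf (n + 1)) := by
    refine (integrableOn_mul_test hφ hb).congr (Eventually.of_forall fun y => mul_comm _ _)
  have hT := NormalLimit.tendsto_integral_stepKernel hν hDp hWm hbφ hlim'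
  let s : E (n + 1) → ℝ := fun p => -⟪ν, p - x⟫
  have hs : ContDiff ℝ ∞ s := (contDiff_const.inner ℝ (contDiff_id.sub contDiff_const)).neg
  have hsd : ∀ p v, fderiv ℝ s p v = -⟪ν, v⟫ := by
    intro p v
    have : HasFDerivAt s (-(innerSL ℝ ν)) p := by
      have h1 : HasFDerivAt (fun p => ⟪ν, p - x⟫) (innerSL ℝ ν) p :=
        (innerSL ℝ ν).hasFDerivAt.comp p ((hasFDerivAt_id p).sub_const x)
      exact h1.neg
    rw [this.fderiv]; simp
  -- the identity for each cutoff
  have hid : ∀ ε : ℝ, 0 < ε →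
      ∫ p in H, step (s p / ε) * (fderiv ℝ φ p (q p) + Dv p * φ p) =
        ∫ p, stepKernel ε p.1 * (φ (p.2 - p.1 • ν) * ⟪q (p.2 - p.1 • ν), ν⟫)
          ∂((volume.restrict (Ioo 0 ε)).prod ((surf (n + 1)).restrict D)) := by
    intro ε hε
    set χ : E (n + 1) → ℝ := fun p => step (s p / ε)
    have hχ : ContDiff ℝ ∞ χ := step_contDiff.comp (hs.div_const ε)
    have hχd : ∀ p v, fderiv ℝ χ p v = -(stepKernel ε (s p) * ⟪ν, v⟫) := by
      intro p v
      have h1 : HasDerivAt step (deriv step (s p / ε)) (s p / ε) :=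
        ((step_contDiff.differentiable (by simp)) _).hasDerivAt
      have h2 : HasFDerivAt (fun p => s p / ε) (ε⁻¹ • fderiv ℝ s p) p := by
        have := ((hs.differentiable (by simp)) p).hasFDerivAt.const_smul ε⁻¹
        refine this.congr_of_eventuallyEq (Eventually.of_forall fun y => ?_)
        simp [div_eq_inv_mul]
      have h3 := h1.comp_hasFDerivAt p h2
      have h4 : HasFDerivAt χ (deriv step (s p / ε) • ε⁻¹ • fderiv ℝ s p) p := h3
      rw [h4.fderiv]
      simp only [smul_apply, hsd, stepKernel, smul_eq_mul]
      ring
    -- The cutoff vanishes at depths up to ε/2, so the product is supported in the open half ball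
    -- and may be inserted in the weak divergence. The gradient of the cutoff is `stepKernel ε` of
    -- the depth times −ν; in the limit it concentrates on the disc and produces the boundary term.
    have hψ : IsTest H (fun p => χ p * φ p) := by
      refine ⟨hχ.mul hφ.1, hφ.2.1.mul_left, fun p hp => ?_⟩
      have h1 : p ∈ tsupport φ := (tsupport_mul_subset_right) hp
      refine ⟨hφ.2.2 h1, ?_⟩
      have h2 : p ∈ {p | ε / 2 ≤ s p} := by
        have hcl : IsClosed {p | ε / 2 ≤ s p} := isClosed_le continuous_const hs.continuous
        refine closure_minimal (fun y hy => ?_) hcl ((tsupport_mul_subset_left) hp)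
        by_contra hcon
        apply hy
        refine step_eq_zero ?_
        rw [mem_ofPred_eq, not_le] at hcon
        rw [div_le_iff₀ hε]; linarith
      have h3 : ε / 2 ≤ -⟪ν, p - x⟫ := h2
      linarith
    have h0 := hdiv _ hψ
    have hprod : ∀ p, fderiv ℝ (fun p => χ p * φ p) p (q p) =
        χ p * fderiv ℝ φ p (q p) - stepKernel ε (s p) * (φ p * ⟪q p, ν⟫) := by
      intro p
      rw [fderiv_fun_mul ((hχ.differentiable (by simp)) p) ((hφ.1.differentiable (by simp)) p)]
      simp only [add_apply, smul_apply, hχd, smul_eq_mul]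
      rw [real_inner_comm]; ring
    have hχb : ∀ p, ‖χ p‖ ≤ 1 := fun p => by
      rw [Real.norm_of_nonneg (step_nonneg _)]; exact step_le_one _
    have i1 : IntegrableOn (fun p => χ p * fderiv ℝ φ p (q p)) H :=
      (integrableOn_fderiv_apply hφ hq).bdd_mul (c := 1) hχ.continuous.aestronglyMeasurable
        (Eventually.of_forall hχb)
    have i2 : IntegrableOn (fun p => χ p * (Dv p * φ p)) H :=
      (integrableOn_mul_test hφ hDv).bdd_mul (c := 1) hχ.continuous.aestronglyMeasurable
        (Eventually.of_forall hχb)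
    obtain ⟨C, hC⟩ := exists_deriv_step_bound
    have hkc : Continuous (stepKernel ε) := by
      have hd : Continuous (deriv step) := step_contDiff.continuous_deriv (by simp)
      unfold stepKernel; fun_prop
    have i3 : IntegrableOn (fun p => stepKernel ε (s p) * (φ p * ⟪q p, ν⟫)) H := by
      have h1 : IntegrableOn (fun p => φ p * ⟪q p, ν⟫) H := by
        refine (integrableOn_mul_test hφ (D := fun p => ⟪q p, ν⟫) ?_).congr
          (Eventually.of_forall fun p => mul_comm _ _)
        exact hq.inner_const ν
      refine h1.bdd_mul (c := C / ε) (hkc.comp hs.continuous).aestronglyMeasurable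
        (Eventually.of_forall fun p => ?_)
      rw [stepKernel, norm_mul, norm_inv, Real.norm_of_nonneg hε.le, div_eq_inv_mul C]
      exact mul_le_mul_of_nonneg_left (hC _) (inv_nonneg.2 hε.le)
    simp_rw [hprod] at h0
    rw [integral_sub i1 i3] at h0
    have e1 : ∫ p in H, χ p * (fderiv ℝ φ p (q p) + Dv p * φ p) =
        ∫ p in H, stepKernel ε (s p) * (φ p * ⟪q p, ν⟫) := by
      simp_rw [mul_add]
      rw [integral_add i1 i2]
      have : ∫ p in H, Dv p * (χ p * φ p) = ∫ p in H, χ p * (Dv p * φ p) := by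
        congr 1; funext p; ring
      rw [this] at h0
      linarith
    rw [e1]
    -- change of variables
    have hMP := measurePreserving_normalFlow x hν
    have hsf := sigmaFinite_surf_plane x hν
    set F : E (n + 1) → ℝ := fun p => stepKernel ε (s p) * (φ p * ⟪q p, ν⟫)
    have hk0 : ∀ t, t ∉ Ioo 0 ε → stepKernel ε t = 0 := by
      intro t ht
      rw [stepKernel, deriv_step_eq_zero, mul_zero]
      intro h; apply ht
      exact ⟨by have := mul_pos h.1 hε; rwa [div_mul_cancel₀ _ hε.ne'] at this,
        (div_lt_one hε).1 h.2⟩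
    have hF0 : ∀ p, p ∉ H → F p = 0 := by
      intro p hp
      by_cases h1 : p ∈ Metric.ball x r
      · have : s p ∉ Ioo 0 ε := by
          intro h
          have h2 : 0 < -⟪ν, p - x⟫ := h.1
          exact hp ⟨h1, by linarith⟩
        simp only [F, hk0 _ this, zero_mul]
      · simp only [F, hφ.eq_zero h1, zero_mul, mul_zero]
    rw [setIntegral_eq_integral_of_forall_compl_eq_zero hF0]
    have hFm : AEStronglyMeasurable F volume :=
      (hkc.comp hs.continuous).aestronglyMeasurable.mul hWm
    have e2 : ∫ p, F p = ∫ p, F (p.1 - p.2 • ν)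
        ∂(((surf (n + 1)).restrict (plane x ν)).prod (volume : Measure ℝ)) := by
      have := integral_map (f := F) hMP.measurable.aemeasurable (by rw [hMP.map_eq]; exact hFm)
      rw [hMP.map_eq] at this
      exact this
    have e3 : ∫ p, F (p.1 - p.2 • ν)
        ∂(((surf (n + 1)).restrict (plane x ν)).prod (volume : Measure ℝ)) =
        ∫ p in (D ×ˢ Ioo 0 ε), F (p.1 - p.2 • ν)
        ∂(((surf (n + 1)).restrict (plane x ν)).prod (volume : Measure ℝ)) := by
      have hmem : ∀ᵐ p ∂(((surf (n + 1)).restrict (plane x ν)).prod (volume : Measure ℝ)),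
          p.1 ∈ plane x ν :=
        Measure.quasiMeasurePreserving_fst.ae (ae_restrict_mem (measurableSet_plane x ν))
      rw [← integral_indicator (hDm.prod measurableSet_Ioo)]
      refine integral_congr_ae ?_
      filter_upwards [hmem] with p hp
      rw [indicator]
      split_ifs with hpD
      · rfl
      · have hsp : s (p.1 - p.2 • ν) = p.2 := by
          simp only [s]
          have h1 : p.1 - p.2 • ν - x = (p.1 - x) - p.2 • ν := by abel
          have h2 : ⟪ν, p.1 - x⟫ = 0 := hp
          rw [h1, inner_sub_right, h2, inner_smul_right, real_inner_self_eq_norm_sq, hν]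
          ring
        by_cases h2 : p.2 ∈ Ioo 0 ε
        -- Leaving the hyperplane along its normal increases the distance to x, so normals through
        -- points outside the disc never enter the ball.
        · have h3 : p.1 - p.2 • ν ∉ Metric.ball x r := by
            intro hball
            refine hpD ⟨⟨hp, ?_⟩, h2⟩
            rw [Metric.mem_ball, dist_eq_norm] at hball ⊢
            refine lt_of_le_of_lt ?_ hball
            have h1 : p.1 - p.2 • ν - x = (p.1 - x) - p.2 • ν := by abel
            have h4 : ⟪ν, p.1 - x⟫ = 0 := hp
            rw [h1]
            refine (sq_le_sq₀ (norm_nonneg _) (norm_nonneg _)).1 ?_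
            rw [norm_sub_sq_real (p.1 - x), inner_smul_right, real_inner_comm, h4]
            nlinarith [sq_nonneg ‖p.2 • ν‖]
          simp only [F, hφ.eq_zero h3, zero_mul, mul_zero]
        · simp only [F, hsp, hk0 _ h2, zero_mul]
    have hsf' := sFinite_surf_restrict hν hDp
    rw [e2, e3, ← Measure.prod_restrict, Measure.restrict_restrict_of_subset hDp,
      ← Measure.prod_swap]
    rw [integral_map measurable_swap.aemeasurable]
    · refine integral_congr_ae ?_
      have hmem : ∀ᵐ p ∂((volume.restrict (Ioo 0 ε)).prod ((surf (n + 1)).restrict D)),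
          p.2 ∈ D := Measure.quasiMeasurePreserving_snd.ae (ae_restrict_mem hDm)
      filter_upwards [hmem] with p hp
      have hsp : s (p.2 - p.1 • ν) = p.1 := by
        simp only [s]
        have h1 : p.2 - p.1 • ν - x = (p.2 - x) - p.1 • ν := by abel
        have h2 : ⟪ν, p.2 - x⟫ = 0 := hDp hp
        rw [h1, inner_sub_right, h2, inner_smul_right, real_inner_self_eq_norm_sq, hν]
        ring
      simp only [F, Prod.fst_swap, Prod.snd_swap, hsp]
    · rw [Measure.prod_swap]
      have h1 : AEStronglyMeasurable (fun p : E (n + 1) × ℝ => F (p.1 - p.2 • ν))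
          (((surf (n + 1)).restrict (plane x ν)).prod (volume : Measure ℝ)) :=
        hFm.comp_measurePreserving hMP
      exact h1.mono_ac (Measure.AbsolutelyContinuous.prod
        (Measure.restrict_mono_set _ hDp).absolutelyContinuous
        Measure.restrict_le_self.absolutelyContinuous)
  have hleft : Tendsto (fun ε : ℝ => ∫ p in H, step (s p / ε) * (fderiv ℝ φ p (q p) + Dv p * φ p))
      (𝓝[>] 0) (𝓝 (∫ p in H, (fderiv ℝ φ p (q p) + Dv p * φ p))) := by
    have hi := (integrableOn_fderiv_apply hφ hq).add (integrableOn_mul_test hφ hDv)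
    refine tendsto_integral_filter_of_dominated_convergence
      (fun p => ‖fderiv ℝ φ p (q p) + Dv p * φ p‖) ?_ ?_ hi.norm ?_
    · refine Eventually.of_forall fun ε => ?_
      exact (step_contDiff.continuous.comp (hs.continuous.div_const ε)).aestronglyMeasurable.mul hi.1
    · refine Eventually.of_forall fun ε => Eventually.of_forall fun p => ?_
      rw [norm_mul, Real.norm_of_nonneg (step_nonneg _)]
      exact mul_le_of_le_one_left (norm_nonneg _) (step_le_one _)
    · filter_upwards [ae_restrict_mem hHm] with p hp
      refine tendsto_const_nhds.congr' ?_
      have hsp : 0 < s p := by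
        have := hp.2
        simp only [s]; linarith
      filter_upwards [Ioo_mem_nhdsGT hsp] with ε hε
      rw [step_eq_one ((one_le_div hε.1).2 hε.2.le), one_mul]
  have hT' := hT.congr' (f₂ := fun ε : ℝ =>
      ∫ p in H, step (s p / ε) * (fderiv ℝ φ p (q p) + Dv p * φ p)) (by
    filter_upwards [self_mem_nhdsWithin] with ε hε
    exact (hid ε hε).symm)
  rw [tendsto_nhds_unique hleft hT']
  congr 1; funext y; ring

theorem volume_plane (x : E (n + 1)) (hν : ‖ν‖ = 1) : volume (plane x ν) = 0 := by
  obtain ⟨J, hJ⟩ := exists_isTangent hν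
  rw [← (hJ.measurePreserving_flatMap x).measure_preimage
    (measurableSet_plane x ν).nullMeasurableSet]
  have : flatMap J x ν ⁻¹' plane x ν = univ ×ˢ {0} := by
    ext p
    simp [plane, hJ.inner_flatMap]
  rw [this, Measure.volume_eq_prod, Measure.prod_prod]
  simp

theorem halfBall_neg_eq {d : ℕ} (x ν : E d) (r : ℝ) :
    halfBall x (-ν) r = {p | p ∈ Metric.ball x r ∧ 0 < ⟪ν, p - x⟫} := by
  ext p; simp [halfBall, inner_neg_left]

theorem plane_neg {d : ℕ} (x ν : E d) : plane x (-ν) = plane x ν := by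
  ext p; simp [plane, inner_neg_left]

theorem disc_neg {d : ℕ} (x ν : E d) (r : ℝ) : disc x (-ν) r = disc x ν r := by
  rw [disc, plane_neg, disc]

theorem setIntegral_ball_eq_halfBall_add {x : E (n + 1)} (hν : ‖ν‖ = 1) {r : ℝ}
    {F : E (n + 1) → ℝ} (hF : IntegrableOn F (Metric.ball x r)) :
    ∫ p in Metric.ball x r, F p =
      (∫ p in halfBall x ν r, F p) + ∫ p in halfBall x (-ν) r, F p := by
  have h1 : (halfBall x ν r ∪ halfBall x (-ν) r : Set (E (n + 1))) =ᵐ[volume] Metric.ball x r := by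
    have hpl : ∀ᵐ p : E (n + 1), p ∉ plane x ν := by
      rw [ae_iff]; simpa using volume_plane x hν
    filter_upwards [hpl] with p hp
    refine propext ?_
    change p ∈ halfBall x ν r ∪ halfBall x (-ν) r ↔ p ∈ Metric.ball x r
    rw [halfBall_neg_eq]
    constructor
    · rintro (h | h) <;> exact h.1
    · intro h
      rcases lt_trichotomy ⟪ν, p - x⟫ 0 with h2 | h2 | h2
      · exact Or.inl ⟨h, h2⟩
      · exact absurd h2 hp
      · exact Or.inr ⟨h, h2⟩
  rw [← setIntegral_congr_set h1, setIntegral_union]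
  · rw [Set.disjoint_left, halfBall_neg_eq]
    rintro p ⟨_, h⟩ ⟨_, h'⟩
    exact lt_asymm h h'
  · exact (isOpen_halfBall _ _ _).measurableSet
  · exact hF.mono_set fun p hp => hp.1
  · exact hF.mono_set fun p hp => hp.1

/-- The normal traces from the two sides of a hyperplane of a field with an integrable weak
divergence cancel. -/
theorem normalLimit_add_eq_zero {x : E (n + 1)} (hν : ‖ν‖ = 1) {r : ℝ}
    {q₁ q₂ : E (n + 1) → E (n + 1)} {q : E (n + 1) → E (n + 1)} {Dv b₁ b₂ : E (n + 1) → ℝ}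
    (hq₁m : AEStronglyMeasurable q₁ volume) (hq₂m : AEStronglyMeasurable q₂ volume)
    (h₁ : ∀ᵐ p ∂(volume.restrict (halfBall x ν r)), q p = q₁ p)
    (h₂ : ∀ᵐ p ∂(volume.restrict (halfBall x (-ν) r)), q p = q₂ p)
    (hq : IntegrableOn q (Metric.ball x r))
    (hDv : IntegrableOn Dv (Metric.ball x r)) (hdiv : HasWeakDiv (Metric.ball x r) q Dv)
    (hb₁ : IntegrableOn b₁ (disc x ν r) (surf (n + 1)))
    (hb₂ : IntegrableOn b₂ (disc x ν r) (surf (n + 1)))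
    (hlim₁ : NormalLimit ν (disc x ν r) (fun p => ⟪q₁ p, ν⟫) b₁)
    (hlim₂ : NormalLimit (-ν) (disc x ν r) (fun p => ⟪q₂ p, -ν⟫) b₂) :
    ∀ᵐ y ∂((surf (n + 1)).restrict (disc x ν r)), b₁ y + b₂ y = 0 := by
  have hν' : ‖-ν‖ = 1 := by rwa [norm_neg]
  have hs1 : halfBall x ν r ⊆ Metric.ball x r := fun p hp => hp.1
  have hs2 : halfBall x (-ν) r ⊆ Metric.ball x r := fun p hp => hp.1
  have hdivc : ∀ {V : Set (E (n + 1))} {k : E (n + 1) → E (n + 1)}, V ⊆ Metric.ball x r →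
      (∀ᵐ p ∂(volume.restrict V), q p = k p) → HasWeakDiv V k Dv := by
    intro V k hV hk φ hφ
    rw [← (hdiv.mono hV) φ hφ]
    refine integral_congr_ae ?_
    filter_upwards [hk] with p hp
    rw [hp]
  -- The volume terms of the two half balls add up to the integral over the ball, the hyperplane
  -- being null, and this vanishes by the weak divergence. Only the sum of the two boundary terms is
  -- left.
  have key : ∀ φ, IsTest (Metric.ball x r) φ →
      ∫ y in disc x ν r, φ y • (b₁ y + b₂ y) ∂(surf (n + 1)) = 0 := by
    intro φ hφ
    have e1 := integral_halfBall_eq hν hq₁m ((hq.mono_set hs1).congr h₁) (hDv.mono_set hs1)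
      (hdivc hs1 h₁) hb₁ hlim₁ hφ
    have e2 := integral_halfBall_eq (x := x) (r := r) hν' hq₂m ((hq.mono_set hs2).congr h₂)
      (hDv.mono_set hs2) (hdivc hs2 h₂) (by rwa [disc_neg]) (by rwa [disc_neg]) hφ
    rw [disc_neg] at e2
    have i1 := (integrableOn_fderiv_apply hφ hq)
    have i2 := (integrableOn_mul_test hφ hDv)
    have e3 := setIntegral_ball_eq_halfBall_add hν (F := fun p => fderiv ℝ φ p (q p) + Dv p * φ p)
      (i1.add i2)
    rw [integral_add i1 i2, hdiv φ hφ, neg_add_cancel] at e3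
    have e4 : ∫ p in halfBall x ν r, (fderiv ℝ φ p (q p) + Dv p * φ p) =
        ∫ p in halfBall x ν r, (fderiv ℝ φ p (q₁ p) + Dv p * φ p) :=
      integral_congr_ae (by filter_upwards [h₁] with p hp; rw [hp])
    have e5 : ∫ p in halfBall x (-ν) r, (fderiv ℝ φ p (q p) + Dv p * φ p) =
        ∫ p in halfBall x (-ν) r, (fderiv ℝ φ p (q₂ p) + Dv p * φ p) :=
      integral_congr_ae (by filter_upwards [h₂] with p hp; rw [hp])
    rw [e4, e5, e1, e2, ← integral_add (integrableOn_mul_test hφ hb₁)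
      (integrableOn_mul_test hφ hb₂)] at e3
    rw [e3]
    congr 1; funext y; rw [smul_eq_mul]; ring
  have hloc : LocallyIntegrableOn (fun y => b₁ y + b₂ y) (Metric.ball x r)
      ((surf (n + 1)).restrict (disc x ν r)) :=
    (Integrable.integrableOn (hb₁.add hb₂)).locallyIntegrableOn
  have := Metric.isOpen_ball.ae_eq_zero_of_integral_contDiff_smul_eq_zero hloc
    (fun φ h1 h2 h3 => key φ ⟨h1, h2, h3⟩)
  filter_upwards [this, ae_restrict_mem (measurableSet_disc x ν r)] with y hy hyD
  exact hy hyD.2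

end Green

end IPG

namespace IPG

/-! ### Hyperplane arrangements and polyhedral sets -/

/-- The hyperplane `{y | ⟪ν, y⟫ = a}`. -/
def hyper {d : ℕ} (p : E d × ℝ) : Set (E d) := {y | ⟪p.1, y⟫ = p.2}

theorem isClosed_hyper {d : ℕ} (p : E d × ℝ) : IsClosed (hyper p) :=
  isClosed_eq (by fun_prop) continuous_const

theorem hyper_eq_plane {d : ℕ} {p : E d × ℝ} {x : E d} (hx : x ∈ hyper p) :
    hyper p = plane x p.1 := by
  ext y
  have hx' : ⟪p.1, x⟫ = p.2 := hx
  simp [hyper, plane, inner_sub_right, hx', sub_eq_zero]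

/-- The pairwise intersections of the nonparallel hyperplanes of an arrangement. -/
def skeleton {d : ℕ} (𝒜 : Finset (E d × ℝ)) : Set (E d) :=
  {x | ∃ p ∈ 𝒜, ∃ q ∈ 𝒜, LinearIndependent ℝ ![p.1, q.1] ∧ x ∈ hyper p ∧ x ∈ hyper q}

/-- A finite arrangement of hyperplanes, given by unit normals. -/
def IsArrangement {d : ℕ} (𝒜 : Finset (E d × ℝ)) : Prop := ∀ p ∈ 𝒜, ‖p.1‖ = 1

/-- `A` is a finite union of convex bodies bounded by hyperplanes of the arrangement. -/
def IsBody {d : ℕ} (𝒜 : Finset (E d × ℝ)) (𝒬 : Set (Set (E d))) (A : Set (E d)) : Prop :=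
  𝒬.Finite ∧ A = ⋃₀ 𝒬 ∧ ∀ Q ∈ 𝒬, Convex ℝ Q ∧ IsCompact Q ∧ (interior Q).Nonempty ∧
    frontier Q ⊆ ⋃ p ∈ 𝒜, hyper p

theorem IsBody.mono {d : ℕ} {𝒜 𝒜' : Finset (E d × ℝ)} {𝒬 : Set (Set (E d))} {A : Set (E d)}
    (h : IsBody 𝒜 𝒬 A) (h𝒜 : 𝒜 ⊆ 𝒜') : IsBody 𝒜' 𝒬 A :=
  ⟨h.1, h.2.1, fun Q hQ => ⟨(h.2.2 Q hQ).1, (h.2.2 Q hQ).2.1, (h.2.2 Q hQ).2.2.1,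
    (h.2.2 Q hQ).2.2.2.trans (biUnion_subset_biUnion_left h𝒜)⟩⟩

/-- A boundary point x has a supporting hyperplane, and the vertices with positive weight in a
convex representation of x all lie on it. Any other hyperplane through these vertices also contains
x, so one choice for each set of vertices suffices, and there are finitely many such sets. -/
theorem exists_arrangement_convexHull {d : ℕ} (s : Finset (E d))
    (hs : (interior (convexHull ℝ (s : Set (E d)))).Nonempty) :
    ∃ 𝒜 : Finset (E d × ℝ), IsArrangement 𝒜 ∧
      frontier (convexHull ℝ (s : Set (E d))) ⊆ ⋃ p ∈ 𝒜, hyper p := by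
  classical
  let P : Finset (E d) → E d × ℝ → Prop := fun t p => ‖p.1‖ = 1 ∧ ∀ y ∈ t, ⟪p.1, y⟫ = p.2
  let 𝒯 : Finset (Finset (E d)) := s.powerset.filter fun t => ∃ p, P t p
  let c : Finset (E d) → E d × ℝ := fun t => if h : ∃ p, P t p then h.choose else 0
  have hc : ∀ t ∈ 𝒯, P t (c t) := by
    intro t ht
    have h := (Finset.mem_filter.1 ht).2
    simp only [c, dif_pos h]
    exact h.choose_spec
  refine ⟨𝒯.image c, fun p hp => ?_, fun x hx => ?_⟩
  · obtain ⟨t, ht, rfl⟩ := Finset.mem_image.1 hp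
    exact (hc t ht).1
  · set Q := convexHull ℝ (s : Set (E d))
    have hQ : Convex ℝ Q := convex_convexHull ℝ _
    have hQc : IsClosed Q := (Set.Finite.isCompact_convexHull ℝ s.finite_toSet).isClosed
    have hxQ : x ∈ Q := hQc.frontier_subset hx
    have hxi : x ∉ interior Q := hx.2
    obtain ⟨f, hf⟩ := geometric_hahn_banach_open_point hQ.interior isOpen_interior hxi
    have hfQ : ∀ y ∈ Q, f y ≤ f x := by
      have h1 : closure (interior Q) ⊆ {y | f y ≤ f x} :=
        closure_minimal (fun y hy => (hf y hy).le) (isClosed_le f.continuous continuous_const)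
      rw [hQ.closure_interior_eq_closure_of_nonempty_interior hs, hQc.closure_eq] at h1
      exact h1
    set m := (InnerProductSpace.toDual ℝ (E d)).symm f
    have hm : ∀ y, ⟪m, y⟫ = f y := fun y => InnerProductSpace.toDual_symm_apply
    have hm0 : m ≠ 0 := by
      intro h0
      obtain ⟨y, hy⟩ := hs
      have := hf y hy
      rw [← hm, ← hm, h0] at this
      simp at this
    obtain ⟨w, hw0, hw1, hwx⟩ := Finset.mem_convexHull.1 hxQ
    have hxsum : ∀ v : E d, ⟪v, x⟫ = ∑ y ∈ s, w y * ⟪v, y⟫ := by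
      intro v
      rw [← hwx, Finset.centerMass_eq_of_sum_1 _ _ hw1, inner_sum]
      simp [inner_smul_right]
    have hz : ∀ y ∈ s, w y * (f x - f y) = 0 := by
      have h1 : ∑ y ∈ s, w y * (f x - f y) = 0 := by
        simp_rw [mul_sub, Finset.sum_sub_distrib, ← Finset.sum_mul, hw1, one_mul, ← hm]
        rw [hxsum]; simp
      refine (Finset.sum_eq_zero_iff_of_nonneg fun y hy => ?_).1 h1
      exact mul_nonneg (hw0 y hy) (sub_nonneg.2 (hfQ y (subset_convexHull ℝ _ hy)))
    let t := s.filter fun y => f y = f x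
    have ht : t ∈ 𝒯 := by
      refine Finset.mem_filter.2 ⟨Finset.mem_powerset.2 (Finset.filter_subset _ _),
        (‖m‖⁻¹ • m, ‖m‖⁻¹ * f x), ?_, fun y hy => ?_⟩
      · rw [norm_smul, norm_inv, norm_norm, inv_mul_cancel₀ (norm_ne_zero_iff.2 hm0)]
      · rw [real_inner_smul_left, hm, (Finset.mem_filter.1 hy).2]
    rw [mem_iUnion₂]
    refine ⟨c t, Finset.mem_image_of_mem c ht, ?_⟩
    change ⟪(c t).1, x⟫ = (c t).2
    rw [hxsum]
    calc ∑ y ∈ s, w y * ⟪(c t).1, y⟫ = ∑ y ∈ s, w y * (c t).2 := by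
          refine Finset.sum_congr rfl fun y hy => ?_
          rcases mul_eq_zero.1 (hz y hy) with h | h
          · rw [h, zero_mul, zero_mul]
          · rw [(hc t ht).2 y (Finset.mem_filter.2 ⟨hy, by linarith⟩)]
      _ = (c t).2 := by rw [← Finset.sum_mul, hw1, one_mul]

theorem IsPolyhedron.exists_isBody {n : ℕ} {A : Set (E (n + 1))} (hA : IsPolyhedron (n + 1) A) :
    ∃ 𝒜 : Finset (E (n + 1) × ℝ), IsArrangement 𝒜 ∧ ∃ 𝒬, IsBody 𝒜 𝒬 A := by
  classical
  obtain ⟨S, hS, 𝒬, hfin, hne, hQ, rfl⟩ := hA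
  -- In full dimension the ambient affine subspace is everything. It is not empty, since the
  -- direction of `⊥` has dimension 0 and not n + 1.
  have hStop : S = ⊤ := by
    have hne : (S : Set (E (n + 1))).Nonempty := by
      rw [AffineSubspace.nonempty_iff_ne_bot]
      rintro rfl
      rw [AffineSubspace.direction_bot, finrank_bot] at hS
      omega
    rw [← AffineSubspace.direction_eq_top_iff_of_nonempty hne]
    exact Submodule.eq_top_of_finrank_eq (by rw [hS]; simp)
  have key : ∀ Q ∈ 𝒬, ∃ 𝒜 : Finset (E (n + 1) × ℝ), IsArrangement 𝒜 ∧
      (Convex ℝ Q ∧ IsCompact Q ∧ (interior Q).Nonempty ∧ frontier Q ⊆ ⋃ p ∈ 𝒜, hyper p) := by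
    intro Q hQ'
    obtain ⟨⟨s, rfl⟩, hspan⟩ := hQ Q hQ'
    rw [affineSpan_convexHull, hStop] at hspan
    have hint := interior_convexHull_nonempty_iff_affineSpan_eq_top.2 hspan
    obtain ⟨𝒜, h1, h2⟩ := exists_arrangement_convexHull s hint
    exact ⟨𝒜, h1, convex_convexHull ℝ _, Set.Finite.isCompact_convexHull ℝ s.finite_toSet, hint, h2⟩
  choose! f hf using key
  refine ⟨hfin.toFinset.biUnion f, fun p hp => ?_, 𝒬, hfin, rfl, fun Q hQ' => ?_⟩
  · obtain ⟨Q, hQ', hp⟩ := Finset.mem_biUnion.1 hp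
    exact (hf Q (hfin.mem_toFinset.1 hQ')).1 p hp
  · obtain ⟨h1, h2, h3, h4⟩ := (hf Q hQ').2
    refine ⟨h1, h2, h3, h4.trans (biUnion_subset_biUnion_left fun p hp => ?_)⟩
    exact Finset.mem_biUnion.2 ⟨Q, hfin.mem_toFinset.2 hQ', hp⟩

namespace IsBody

variable {d : ℕ} {𝒜 : Finset (E d × ℝ)} {𝒬 : Set (Set (E d))} {A : Set (E d)}

theorem isCompact (h : IsBody 𝒜 𝒬 A) : IsCompact A := by
  rw [h.2.1]
  exact h.1.isCompact_sUnion fun Q hQ => (h.2.2 Q hQ).2.1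

theorem isClosed (h : IsBody 𝒜 𝒬 A) : IsClosed A := h.isCompact.isClosed

theorem subset_closure_interior (h : IsBody 𝒜 𝒬 A) : A ⊆ closure (interior A) := by
  intro x hx
  rw [h.2.1] at hx
  obtain ⟨Q, hQ, hxQ⟩ := hx
  obtain ⟨h1, h2, h3, -⟩ := h.2.2 Q hQ
  have h4 := h1.closure_interior_eq_closure_of_nonempty_interior h3
  rw [h2.isClosed.closure_eq] at h4
  rw [← h4] at hxQ
  refine closure_mono (interior_mono ?_) hxQ
  rw [h.2.1]
  exact subset_sUnion_of_mem hQ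

theorem frontier_subset (h : IsBody 𝒜 𝒬 A) : frontier A ⊆ ⋃ p ∈ 𝒜, hyper p := by
  intro x hx
  have hxA : x ∈ A := h.isClosed.frontier_subset hx
  have hxi : x ∉ interior A := hx.2
  rw [h.2.1] at hxA
  obtain ⟨Q, hQ, hxQ⟩ := hxA
  refine (h.2.2 Q hQ).2.2.2 ⟨subset_closure hxQ, fun hi => hxi ?_⟩
  refine interior_mono ?_ hi
  rw [h.2.1]
  exact subset_sUnion_of_mem hQ

end IsBody

theorem hyper_eq_of_not_linearIndependent {d : ℕ} {p q : E d × ℝ} (hp : ‖p.1‖ = 1)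
    (hq : ‖q.1‖ = 1) (h : ¬ LinearIndependent ℝ ![p.1, q.1]) {x : E d} (hxp : x ∈ hyper p)
    (hxq : x ∈ hyper q) : hyper q = hyper p := by
  have hp0 : p.1 ≠ 0 := by intro h; rw [h] at hp; simp at hp
  have hq0 : q.1 ≠ 0 := by intro h; rw [h] at hq; simp at hq
  rw [LinearIndependent.pair_iff' hp0] at h
  push Not at h
  obtain ⟨a, ha⟩ := h
  have ha0 : a ≠ 0 := by rintro rfl; rw [zero_smul] at ha; exact hq0 ha.symm
  rw [hyper_eq_plane hxp, hyper_eq_plane hxq, ← ha]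
  ext y
  simp [plane, real_inner_smul_left, ha0]

/-- Near a point outside the skeleton, the arrangement is a single hyperplane. -/
theorem exists_ball_hyper {d : ℕ} {𝒜 : Finset (E d × ℝ)} (h𝒜 : IsArrangement 𝒜) {x : E d}
    (hx : x ∉ skeleton 𝒜) {p : E d × ℝ} (hp : p ∈ 𝒜) (hxp : x ∈ hyper p) :
    ∃ ρ > 0, ∀ q ∈ 𝒜, hyper q ∩ Metric.ball x ρ ⊆ plane x p.1 := by
  have h1 : ∀ q ∈ 𝒜, ∀ᶠ y in 𝓝 x, y ∈ hyper q → y ∈ plane x p.1 := by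
    intro q hq
    by_cases hxq : x ∈ hyper q
    · have h2 : ¬ LinearIndependent ℝ ![p.1, q.1] := fun hli => hx ⟨p, hp, q, hq, hli, hxp, hxq⟩
      have h3 := hyper_eq_of_not_linearIndependent (h𝒜 p hp) (h𝒜 q hq) h2 hxp hxq
      refine Eventually.of_forall fun y hy => ?_
      rw [h3, hyper_eq_plane hxp] at hy
      exact hy
    · filter_upwards [(isClosed_hyper q).isOpen_compl.mem_nhds hxq] with y hy hy'
      exact absurd hy' hy
  obtain ⟨ρ, hρ, h⟩ := Metric.eventually_nhds_iff_ball.1 ((Finset.eventually_all 𝒜).2 h1)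
  exact ⟨ρ, hρ, fun q hq y hy => h y hy.2 q hq hy.1⟩

theorem convex_halfBall {d : ℕ} (x ν : E d) (r : ℝ) : Convex ℝ (halfBall x ν r) := by
  have h1 : halfBall x ν r = Metric.ball x r ∩ {p | innerSL ℝ ν p < ⟪ν, x⟫} := by
    ext p; simp [halfBall, inner_sub_right]
  rw [h1]
  exact (convex_ball x r).inter (convex_halfSpace_lt (innerSL ℝ ν).isLinear _)

theorem sub_smul_mem_halfBall {d : ℕ} {x ν : E d} (hν : ‖ν‖ = 1) {r : ℝ} {y : E d}
    (hy : y ∈ disc x ν r) : ∀ᶠ t in 𝓝[>] (0 : ℝ), y - t • ν ∈ halfBall x ν r := by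
  have h1 : Tendsto (fun t : ℝ => y - t • ν) (𝓝[>] 0) (𝓝 y) := by
    have : Continuous fun t : ℝ => y - t • ν := by fun_prop
    simpa using (this.tendsto 0).mono_left (nhdsWithin_le_nhds (s := Ioi 0))
  filter_upwards [h1.eventually (Metric.isOpen_ball.mem_nhds hy.2), self_mem_nhdsWithin] with t ht h0
  refine ⟨ht, ?_⟩
  have h2 : ⟪ν, y - x⟫ = 0 := hy.1
  have h3 : y - t • ν - x = (y - x) - t • ν := by abel
  have h0' : (0 : ℝ) < t := h0
  rw [h3, inner_sub_right, h2, inner_smul_right, real_inner_self_eq_norm_sq, hν]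
  linarith

theorem disc_subset_closure_halfBall {d : ℕ} {x ν : E d} (hν : ‖ν‖ = 1) {r : ℝ} :
    disc x ν r ⊆ closure (halfBall x ν r) := by
  intro y hy
  have h1 : Tendsto (fun t : ℝ => y - t • ν) (𝓝[>] 0) (𝓝 y) := by
    have : Continuous fun t : ℝ => y - t • ν := by fun_prop
    simpa using (this.tendsto 0).mono_left (nhdsWithin_le_nhds (s := Ioi 0))
  exact mem_closure_of_tendsto h1 (sub_smul_mem_halfBall hν hy)

theorem ball_subset_union {d : ℕ} (x ν : E d) (r : ℝ) :
    Metric.ball x r ⊆ halfBall x ν r ∪ disc x ν r ∪ halfBall x (-ν) r := by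
  intro y hy
  rw [halfBall_neg_eq]
  rcases lt_trichotomy ⟪ν, y - x⟫ 0 with h | h | h
  · exact Or.inl (Or.inl ⟨hy, h⟩)
  · exact Or.inl (Or.inr ⟨h, hy⟩)
  · exact Or.inr ⟨hy, h⟩

theorem disjoint_halfBall_plane {d : ℕ} (x ν : E d) (r : ℝ) :
    Disjoint (halfBall x ν r) (plane x ν) := by
  rw [Set.disjoint_left]
  intro y hy hy'
  have h1 : ⟪ν, y - x⟫ = 0 := hy'
  have h2 := hy.2
  linarith

theorem isFlatPoint_iff {d : ℕ} {A : Set (E d)} {x ν : E d} :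
    IsFlatPoint A x ν ↔ ‖ν‖ = 1 ∧ ∃ ρ > 0, interior A ∩ Metric.ball x ρ = halfBall x ν ρ := by
  refine and_congr_right fun _ => exists_congr fun ρ => and_congr_right fun _ => ?_
  constructor
  · intro h
    ext y
    exact ⟨fun hy => ⟨hy.2, (h y hy.2).1 hy.1⟩, fun hy => ⟨(h y hy.1).2 hy.2, hy.1⟩⟩
  · intro h y hy
    constructor
    · intro h1
      have : y ∈ halfBall x ν ρ := h ▸ ⟨h1, hy⟩
      exact this.2
    · intro h1
      have : y ∈ interior A ∩ Metric.ball x ρ := h ▸ ⟨hy, h1⟩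
      exact this.1

theorem halfBall_inter_ball {d : ℕ} (x ν : E d) {r s : ℝ} (h : r ≤ s) :
    halfBall x ν s ∩ Metric.ball x r = halfBall x ν r := by
  ext y
  exact ⟨fun hy => ⟨hy.2, hy.1.2⟩, fun hy => ⟨⟨Metric.ball_subset_ball h hy.1, hy.2⟩, hy.1⟩⟩

theorem halfBall_eq_of_mem_plane {d : ℕ} {x y ν : E d} (hy : y ∈ plane x ν) (r : ℝ) :
    halfBall y ν r = {p | p ∈ Metric.ball y r ∧ ⟪ν, p - x⟫ < 0} := by
  have h2 : ⟪ν, y - x⟫ = 0 := hy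
  ext p
  have e : ⟪ν, p - x⟫ = ⟪ν, p - y⟫ := by
    rw [show p - x = (p - y) + (y - x) by abel, inner_add_right, h2, add_zero]
  simp only [halfBall, mem_ofPred_eq, e]

theorem plane_eq_of_mem {d : ℕ} {x y ν : E d} (hy : y ∈ plane x ν) : plane y ν = plane x ν := by
  have h2 : ⟪ν, y - x⟫ = 0 := hy
  ext p
  have e : ⟪ν, p - x⟫ = ⟪ν, p - y⟫ := by
    rw [show p - x = (p - y) + (y - x) by abel, inner_add_right, h2, add_zero]
  simp only [plane, mem_ofPred_eq, e]

/-- The local structure of a regular set near a flat boundary point. -/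
theorem IsFlatPoint.exists_radius {d : ℕ} {A : Set (E d)} (hA : A ⊆ closure (interior A)) {x ν : E d}
    (h : IsFlatPoint A x ν) : ∃ ρ > 0, ∀ r, r ≤ ρ →
      interior A ∩ Metric.ball x r = halfBall x ν r ∧
      frontier A ∩ Metric.ball x r = disc x ν r ∧ ∀ y ∈ disc x ν r, IsFlatPoint A y ν := by
  obtain ⟨hν, ρ, hρ, hi⟩ := isFlatPoint_iff.1 h
  have hir : ∀ r, r ≤ ρ → interior A ∩ Metric.ball x r = halfBall x ν r := by
    intro r hr
    rw [← halfBall_inter_ball x ν hr, ← hi, inter_assoc,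
      inter_eq_right.2 (Metric.ball_subset_ball hr)]
  refine ⟨ρ, hρ, fun r hr => ⟨hir r hr, ?_, fun y hy => ?_⟩⟩
  · ext y
    constructor
    · rintro ⟨hy, hyb⟩
      refine ⟨?_, hyb⟩
      have h1 : ¬ ⟪ν, y - x⟫ < 0 := fun h1 => by
        have : y ∈ halfBall x ν r := ⟨hyb, h1⟩
        rw [← hir r hr] at this
        exact hy.2 this.1
      have h2 : ⟪ν, y - x⟫ ≤ 0 := by
        have h3 : y ∈ closure (interior A) := closure_minimal hA isClosed_closure hy.1
        have h4 : y ∈ closure (interior A ∩ Metric.ball x r) := by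
          rw [inter_comm]
          exact Metric.isOpen_ball.inter_closure ⟨hyb, h3⟩
        rw [hir r hr] at h4
        have hcl : IsClosed {p : E d | ⟪ν, p - x⟫ ≤ 0} :=
          isClosed_le (by fun_prop) continuous_const
        exact closure_minimal (fun p hp => hp.2.le) hcl h4
      exact le_antisymm h2 (not_lt.1 h1)
    · intro hy
      refine ⟨⟨?_, fun h1 => ?_⟩, hy.2⟩
      · have h1 := disc_subset_closure_halfBall hν hy
        rw [← hir r hr] at h1
        exact closure_mono (inter_subset_left.trans interior_subset) h1
      · have h2 : y ∈ halfBall x ν r := by rw [← hir r hr]; exact ⟨h1, hy.2⟩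
        exact Set.disjoint_left.1 (disjoint_halfBall_plane x ν r) h2 hy.1
  · obtain ⟨s, hs, hsub⟩ := Metric.isOpen_iff.1 Metric.isOpen_ball y hy.2
    refine isFlatPoint_iff.2 ⟨hν, s, hs, ?_⟩
    rw [halfBall_eq_of_mem_plane hy.1]
    ext p
    constructor
    · rintro ⟨h1, h2⟩
      have : p ∈ halfBall x ν r := by rw [← hir r hr]; exact ⟨h1, hsub h2⟩
      exact ⟨h2, this.2⟩
    · rintro ⟨h1, h2⟩
      have : p ∈ interior A ∩ Metric.ball x r := by rw [hir r hr]; exact ⟨hsub h1, h2⟩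
      exact ⟨this.1, h1⟩

/-- If the normals differ, the direction ν' − ν enters the half ball of ν and leaves that of ν'. -/
theorem IsFlatPoint.unique {d : ℕ} {A : Set (E d)} {x ν ν' : E d}
    (h : IsFlatPoint A x ν) (h' : IsFlatPoint A x ν') : ν = ν' := by
  obtain ⟨hν, ρ, hρ, hi⟩ := h
  obtain ⟨hν', ρ', hρ', hi'⟩ := h'
  by_contra hne
  have hlt : ⟪ν, ν'⟫ < 1 := by
    refine lt_of_le_of_ne ?_ fun h1 => hne ((inner_eq_one_iff_of_norm_eq_one hν hν').1 h1)
    simpa [hν, hν'] using real_inner_le_norm ν ν'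
  have hcont : Tendsto (fun s : ℝ => x + s • (ν' - ν)) (𝓝[>] 0) (𝓝 x) := by
    have : Continuous fun s : ℝ => x + s • (ν' - ν) := by fun_prop
    simpa using (this.tendsto 0).mono_left (nhdsWithin_le_nhds (s := Ioi 0))
  obtain ⟨s, ⟨h1, h2⟩, hs⟩ := (((hcont.eventually (Metric.ball_mem_nhds x hρ)).and
    (hcont.eventually (Metric.ball_mem_nhds x hρ'))).and self_mem_nhdsWithin).exists
  have hs : (0 : ℝ) < s := hs
  have e1 : ⟪ν, ν' - ν⟫ < 0 := by
    rw [inner_sub_right, real_inner_self_eq_norm_sq, hν]; linarith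
  have e2 : 0 < ⟪ν', ν' - ν⟫ := by
    rw [inner_sub_right, real_inner_self_eq_norm_sq, hν', real_inner_comm]; linarith
  have h3 := (hi _ h1).2 (by
    rw [add_sub_cancel_left, inner_smul_right]; exact mul_neg_of_pos_of_neg hs e1)
  have h4 := (hi' _ h2).1 h3
  rw [add_sub_cancel_left, inner_smul_right] at h4
  have := mul_pos hs e2
  linarith

theorem IsFlatPoint.outerNormal_eq {d : ℕ} {A : Set (E d)} {x ν : E d} (h : IsFlatPoint A x ν) :
    outerNormal A x = ν := by
  have hex : ∃ ν, IsFlatPoint A x ν := ⟨ν, h⟩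
  rw [outerNormal, dif_pos hex]
  exact hex.choose_spec.unique h

theorem halfBall_nonempty {d : ℕ} {x ν : E d} (hν : ‖ν‖ = 1) {r : ℝ} (hr : 0 < r) :
    (halfBall x ν r).Nonempty := by
  have hx : x ∈ disc x ν r := ⟨by simp [plane], Metric.mem_ball_self hr⟩
  obtain ⟨t, ht⟩ := (sub_smul_mem_halfBall hν hx).exists
  exact ⟨_, ht⟩

/-- A boundary point outside the skeleton is flat, and the body looks there like one of its convex
pieces. -/
theorem IsBody.exists_isFlatPoint {n : ℕ} {𝒜 : Finset (E (n + 1) × ℝ)}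
    {𝒬 : Set (Set (E (n + 1)))} {A : Set (E (n + 1))} (h : IsBody 𝒜 𝒬 A) (h𝒜 : IsArrangement 𝒜)
    {x : E (n + 1)} (hx : x ∈ frontier A) (hxS : x ∉ skeleton 𝒜) :
    ∃ ν, IsFlatPoint A x ν ∧ (∃ p ∈ 𝒜, x ∈ hyper p ∧ (ν = p.1 ∨ ν = -p.1)) ∧
      ∃ Q ∈ 𝒬, x ∈ Q ∧ ∃ ρ > 0, halfBall x ν ρ ⊆ interior Q := by
  obtain ⟨p, hp, hxp⟩ := mem_iUnion₂.1 (h.frontier_subset hx)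
  obtain ⟨ρ, hρ, hball⟩ := exists_ball_hyper h𝒜 hxS hp hxp
  have hp1 := h𝒜 p hp
  have hfr : ∀ B : Set (E (n + 1)), frontier B ⊆ ⋃ p ∈ 𝒜, hyper p → ∀ ν, (ν = p.1 ∨ ν = -p.1) →
      Disjoint (halfBall x ν ρ) (frontier B) := by
    intro B hB ν hν
    rw [Set.disjoint_left]
    intro y hy hyB
    obtain ⟨q, hq, hyq⟩ := mem_iUnion₂.1 (hB hyB)
    have h1 := hball q hq ⟨hyq, hy.1⟩
    have h2 : y ∈ plane x ν := by
      rcases hν with rfl | rfl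
      · exact h1
      · rw [plane_neg]; exact h1
    exact Set.disjoint_left.1 (disjoint_halfBall_plane x ν ρ) hy h2
  -- The half ball is connected and contains no boundary point of B, because near x the arrangement
  -- is one hyperplane. So it lies in the interior of B as soon as it meets B.
  have hdich : ∀ B : Set (E (n + 1)), frontier B ⊆ ⋃ p ∈ 𝒜, hyper p → ∀ ν, (ν = p.1 ∨ ν = -p.1) →
      (halfBall x ν ρ ∩ B).Nonempty → halfBall x ν ρ ⊆ interior B := by
    intro B hB ν hν hne
    have hd := hfr B hB ν hν
    refine IsPreconnected.subset_left_of_subset_union isOpen_interior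
      (isClosed_closure (s := B)).isOpen_compl
      ?_ (fun y hy => ?_) ?_ (convex_halfBall x ν ρ).isPreconnected
    · exact disjoint_compl_right.mono_left (interior_subset.trans subset_closure)
    · by_cases hyB : y ∈ closure B
      · exact Or.inl (by_contra fun hcon => Set.disjoint_left.1 hd hy ⟨hyB, hcon⟩)
      · exact Or.inr hyB
    · obtain ⟨y, hy, hyB⟩ := hne
      exact ⟨y, hy, by_contra fun hcon => Set.disjoint_left.1 hd hy ⟨subset_closure hyB, hcon⟩⟩
  have hxA := h.isClosed.frontier_subset hx
  -- one of the two half balls lies in the interior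
  obtain ⟨ν, hν, hνA⟩ : ∃ ν, (ν = p.1 ∨ ν = -p.1) ∧ (halfBall x ν ρ ∩ A).Nonempty := by
    have h1 : (Metric.ball x ρ ∩ interior A).Nonempty :=
      mem_closure_iff.1 (h.subset_closure_interior hxA) _ Metric.isOpen_ball
        (Metric.mem_ball_self hρ)
    obtain ⟨y, hy1, hy2⟩ := h1
    rcases ball_subset_union x p.1 ρ hy1 with (hy | hy) | hy
    · exact ⟨p.1, Or.inl rfl, y, hy, interior_subset hy2⟩
    · have h3 := disc_subset_closure_halfBall hp1 hy
      obtain ⟨z, hz1, hz2⟩ := mem_closure_iff.1 h3 _ isOpen_interior hy2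
      exact ⟨p.1, Or.inl rfl, z, hz2, interior_subset hz1⟩
    · exact ⟨-p.1, Or.inr rfl, y, hy, interior_subset hy2⟩
  have hν1 : ‖ν‖ = 1 := by rcases hν with rfl | rfl <;> simp [hp1]
  have hν' : -ν = p.1 ∨ -ν = -p.1 := by
    rcases hν with rfl | rfl
    · exact Or.inr rfl
    · exact Or.inl (neg_neg _)
  have hin := hdich A h.frontier_subset ν hν hνA
  -- If A contained both half balls, closedness would add the disc between them and x would be an
  -- interior point.
  have hout : ¬ (halfBall x (-ν) ρ ∩ A).Nonempty := by
    intro hne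
    have hin' := hdich A h.frontier_subset (-ν) hν' hne
    have : Metric.ball x ρ ⊆ A := by
      intro y hy
      rcases ball_subset_union x ν ρ hy with (hy | hy) | hy
      · exact interior_subset (hin hy)
      · exact closure_minimal (hin.trans interior_subset) h.isClosed
          (disc_subset_closure_halfBall hν1 hy)
      · exact interior_subset (hin' hy)
    exact hx.2 (mem_interior.2 ⟨_, this, Metric.isOpen_ball, Metric.mem_ball_self hρ⟩)
  refine ⟨ν, isFlatPoint_iff.2 ⟨hν1, ρ, hρ, ?_⟩, ⟨p, hp, hxp, hν⟩, ?_⟩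
  · refine Subset.antisymm (fun y hy => ?_) (fun y hy => ⟨hin hy, hy.1⟩)
    rcases ball_subset_union x ν ρ hy.2 with (hy' | hy') | hy'
    · exact hy'
    · have h3 : y ∈ closure (halfBall x (-ν) ρ) :=
        disc_subset_closure_halfBall (by rwa [norm_neg]) (by rwa [disc_neg])
      obtain ⟨z, hz1, hz2⟩ := mem_closure_iff.1 h3 _ isOpen_interior hy.1
      exact absurd ⟨z, hz2, interior_subset hz1⟩ hout
    · exact absurd ⟨y, hy', interior_subset hy.1⟩ hout
  · have hxmem : x ∈ closure (halfBall x ν ρ) :=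
      disc_subset_closure_halfBall hν1 ⟨by simp [plane], Metric.mem_ball_self hρ⟩
    obtain ⟨y, hy⟩ := halfBall_nonempty (x := x) hν1 hρ
    have hyA := interior_subset (hin hy)
    rw [h.2.1] at hyA
    obtain ⟨Q, hQ, hyQ⟩ := hyA
    have h4 := hdich Q (h.2.2 Q hQ).2.2.2 ν hν ⟨y, hy, hyQ⟩
    exact ⟨Q, hQ, closure_minimal (h4.trans interior_subset) (h.2.2 Q hQ).2.1.isClosed hxmem,
      ρ, hρ, h4⟩

/-! ### Null sets and finite surface measure for arrangements -/

section Measure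

variable {n : ℕ} {𝒜 : Finset (E (n + 1) × ℝ)} {𝒬 : Set (Set (E (n + 1)))} {A : Set (E (n + 1))}

theorem measure_biUnion_finset_null {α ι : Type*} [MeasurableSpace α] {μ : Measure α} {I : Finset ι}
    {s : ι → Set α} (h : ∀ i ∈ I, μ (s i) = 0) : μ (⋃ i ∈ I, s i) = 0 :=
  (measure_biUnion_null_iff (I := {i | i ∈ I}) I.countable_toSet).2 h

theorem volume_hyperplane_eq_zero {m : ℕ} {v : E m} (hv : v ≠ 0) (c : ℝ) :
    volume {z : E m | ⟪v, z⟫ = c} = 0 := by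
  rcases m with _ | m
  · exact absurd (Subsingleton.elim v 0) hv
  · rcases eq_empty_or_nonempty {z : E (m + 1) | ⟪v, z⟫ = c} with h | ⟨x, hx⟩
    · rw [h, measure_empty]
    · have hx' : ⟪v, x⟫ = c := hx
      have hn : ‖v‖ ≠ 0 := norm_ne_zero_iff.2 hv
      have : {z : E (m + 1) | ⟪v, z⟫ = c} = plane x (‖v‖⁻¹ • v) := by
        ext y
        simp [plane, real_inner_smul_left, hn, inner_sub_right, hx', sub_eq_zero]
      rw [this]
      exact volume_plane x (by rw [norm_smul, norm_inv, norm_norm, inv_mul_cancel₀ hn])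

/-- The tangential part of a normal that is not parallel to ν does not vanish. Therefore the second
hyperplane cuts the first one in a proper hyperplane of `E n`. -/
theorem IsTangent.adjoint_ne_zero {n : ℕ} {J : E n →ₗᵢ[ℝ] E (n + 1)} {ν q : E (n + 1)}
    (hJ : IsTangent J ν) (hli : LinearIndependent ℝ ![ν, q]) :
    J.toContinuousLinearMap.adjoint q ≠ 0 := by
  intro h0
  have h3 : ∀ z, ⟪q, J z⟫ = 0 := by
    intro z
    have : ⟪J.toContinuousLinearMap.adjoint q, z⟫ = 0 := by rw [h0, inner_zero_left]
    rwa [ContinuousLinearMap.adjoint_inner_left] at this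
  have h4 : q - ⟪ν, q⟫ • ν ∈ plane 0 ν := by
    simp [plane, inner_sub_right, inner_smul_right, hJ.1]
  rw [← hJ.range_eq_plane 0] at h4
  obtain ⟨z, hz⟩ := h4
  simp only [zero_add] at hz
  have h5 : ⟪J z, J z⟫ = 0 := by
    nth_rewrite 1 [hz]
    rw [inner_sub_left, real_inner_smul_left, h3, hJ.2]; simp
  rw [inner_self_eq_zero] at h5
  rw [h5] at hz
  have hp0 : ν ≠ 0 := by intro h; have := hJ.1; rw [h] at this; simp at this
  rw [LinearIndependent.pair_iff' hp0] at hli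
  exact hli _ (sub_eq_zero.1 hz.symm).symm

/-- Inside the first hyperplane, identified with `E n`, the second one becomes the hyperplane with
normal `J* q ≠ 0`, which is Lebesgue null. -/
theorem surf_skeleton (h𝒜 : IsArrangement 𝒜) : surf (n + 1) (skeleton 𝒜) = 0 := by
  have hsub : skeleton 𝒜 ⊆ ⋃ p ∈ 𝒜, ⋃ q ∈ 𝒜, {x | LinearIndependent ℝ ![p.1, q.1] ∧
      x ∈ hyper p ∧ x ∈ hyper q} := by
    rintro x ⟨p, hp, q, hq, h⟩
    exact mem_iUnion₂.2 ⟨p, hp, mem_iUnion₂.2 ⟨q, hq, h⟩⟩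
  refine measure_mono_null hsub ?_
  refine measure_biUnion_finset_null ?_
  intro p hp
  refine measure_biUnion_finset_null ?_
  intro q hq
  by_cases hli : LinearIndependent ℝ ![p.1, q.1]
  swap
  · have : {x | LinearIndependent ℝ ![p.1, q.1] ∧ x ∈ hyper p ∧ x ∈ hyper q} = ∅ := by
      ext x; simp [hli]
    rw [this, measure_empty]
  rcases eq_empty_or_nonempty (hyper p) with he | ⟨x, hx⟩
  · refine measure_mono_null (t := ∅) (fun y hy => ?_) measure_empty
    rw [← he]; exact hy.2.1
  have hp1 := h𝒜 p hp
  obtain ⟨J, hJ⟩ := exists_isTangent hp1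
  have h1 : {x | LinearIndependent ℝ ![p.1, q.1] ∧ x ∈ hyper p ∧ x ∈ hyper q} =
      hyper q ∩ plane x p.1 := by
    ext y
    rw [← hyper_eq_plane hx]
    exact ⟨fun h => ⟨h.2.2, h.2.1⟩, fun h => ⟨hli, h.2, h.1⟩⟩
  rw [h1, ← Measure.restrict_apply (isClosed_hyper q).measurableSet, ← hJ.map_volume x,
    (IsTangent.measurableEmbedding J x).map_apply]
  have h2 : (fun z => x + J z) ⁻¹' hyper q =
      {z | ⟪J.toContinuousLinearMap.adjoint q.1, z⟫ = q.2 - ⟪q.1, x⟫} := by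
    ext z
    simp only [hyper, mem_preimage, mem_ofPred_eq, inner_add_right,
      ContinuousLinearMap.adjoint_inner_left, LinearIsometry.coe_toContinuousLinearMap]
    constructor <;> intro h <;> linarith
  rw [h2]
  exact volume_hyperplane_eq_zero (hJ.adjoint_ne_zero hli) _

theorem hyper_eq_plane_smul {d : ℕ} {p : E d × ℝ} (hp : ‖p.1‖ = 1) :
    hyper p = plane (p.2 • p.1) p.1 := by
  refine hyper_eq_plane ?_
  change ⟪p.1, p.2 • p.1⟫ = p.2
  rw [inner_smul_right, real_inner_self_eq_norm_sq, hp]; ring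

theorem IsBody.surf_frontier_lt_top (h : IsBody 𝒜 𝒬 A) (h𝒜 : IsArrangement 𝒜) :
    surf (n + 1) (frontier A) < ⊤ := by
  have hsub : frontier A ⊆ ⋃ p ∈ 𝒜, (hyper p ∩ A) := by
    intro x hx
    obtain ⟨p, hp, hxp⟩ := mem_iUnion₂.1 (h.frontier_subset hx)
    exact mem_iUnion₂.2 ⟨p, hp, hxp, h.isClosed.frontier_subset hx⟩
  refine (measure_mono hsub).trans_lt ((measure_biUnion_finset_le _ _).trans_lt ?_)
  refine ENNReal.sum_lt_top.2 fun p hp => ?_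
  rw [hyper_eq_plane_smul (h𝒜 p hp)]
  exact surf_plane_lt_top _ (h𝒜 p hp) h.isCompact.isBounded

theorem IsBody.volume_frontier (h : IsBody 𝒜 𝒬 A) (h𝒜 : IsArrangement 𝒜) :
    volume (frontier A) = 0 := by
  refine measure_mono_null h.frontier_subset ?_
  refine measure_biUnion_finset_null ?_
  intro p hp
  rw [hyper_eq_plane_smul (h𝒜 p hp)]
  exact volume_plane _ (h𝒜 p hp)

end Measure

/-! ### Lipschitz domains are regular -/

/-- Arbitrarily close to a boundary point there are points strictly below the Lipschitz graph, with
neighbourhoods disjoint from Ω; so no boundary point is interior to the closure. This excludes slits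
and lets the closed domain be treated as a polyhedral body. -/
theorem HasLipschitzBoundary.interior_closure {d : ℕ} {Ω : Set (E d)} (hΩ : IsOpen Ω)
    (h : HasLipschitzBoundary Ω) : interior (closure Ω) = Ω := by
  refine Subset.antisymm (fun x hx => ?_) (interior_maximal subset_closure hΩ)
  by_contra hxΩ
  have hxf : x ∈ frontier Ω := by
    rw [hΩ.frontier_eq]; exact ⟨interior_subset hx, hxΩ⟩
  obtain ⟨e, he, ρ, hρ, L, φ, hφ, hinv, hiff⟩ := h x hxf
  have hx0 : ⟪e, x⟫ ≤ φ x := not_lt.1 fun h1 => hxΩ ((hiff x (Metric.mem_ball_self hρ)).2 h1)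
  have h1 : Tendsto (fun t : ℝ => x + (-t) • e) (𝓝[>] 0) (𝓝 x) := by
    have : Continuous fun t : ℝ => x + (-t) • e := by fun_prop
    simpa using (this.tendsto 0).mono_left (nhdsWithin_le_nhds (s := Ioi 0))
  obtain ⟨t, ⟨ht1, ht2⟩, ht⟩ := (((h1.eventually (Metric.ball_mem_nhds x hρ)).and
    (h1.eventually (isOpen_interior.mem_nhds hx))).and self_mem_nhdsWithin).exists
  have ht : (0 : ℝ) < t := ht
  have hlt : ⟪e, x + (-t) • e⟫ < φ (x + (-t) • e) := by
    rw [hinv, inner_add_right, inner_smul_right, real_inner_self_eq_norm_sq, he]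
    linarith
  have hopen : IsOpen ({y | ⟪e, y⟫ < φ y} ∩ Metric.ball x ρ) :=
    (isOpen_lt (by fun_prop) hφ.continuous).inter Metric.isOpen_ball
  obtain ⟨z, ⟨hz1, hz2⟩, hz⟩ := mem_closure_iff.1 (interior_subset ht2) _ hopen ⟨hlt, ht1⟩
  have := (hiff z hz2).1 hz
  exact absurd this (not_lt.2 (le_of_lt hz1))

/-! ### Traces depend only on interior and frontier -/

section Congr

variable {d : ℕ} {A B : Set (E d)}

theorem isFlatPoint_congr (hi : interior A = interior B) : IsFlatPoint A = IsFlatPoint B := by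
  unfold IsFlatPoint; rw [hi]

theorem outerNormal_congr (hi : interior A = interior B) : outerNormal A = outerNormal B := by
  unfold outerNormal; rw [isFlatPoint_congr hi]

/-- The trace is chosen from a predicate that involves only interior and frontier. Equal predicates
give the same choice, so the traces taken from Ω and from its closure are literally equal, not just
almost everywhere. -/
theorem trace_congr {G : Type*} [NormedAddCommGroup G] (hi : interior A = interior B)
    (hf : frontier A = frontier B) : trace (G := G) A = trace B := by
  unfold trace HasTrace; rw [isFlatPoint_congr hi, hf]

theorem normalTrace_congr (hi : interior A = interior B) (hf : frontier A = frontier B) :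
    normalTrace A = normalTrace B := by
  unfold normalTrace HasNormalTrace; rw [isFlatPoint_congr hi, hf]

end Congr

end IPG

namespace IPG

/-- By second countability, countably many of the neighbourhoods cover the set. -/
theorem ae_restrict_of_local {X : Type*} [TopologicalSpace X] [SecondCountableTopology X]
    [MeasurableSpace X] {μ : Measure X} {s : Set X} {p : X → Prop}
    (h : ∀ x ∈ s, ∃ t ∈ 𝓝[s] x, ∀ᵐ y ∂(μ.restrict t), p y) : ∀ᵐ y ∂(μ.restrict s), p y := by
  choose! t ht hp using h
  obtain ⟨I, hI, hIc, hsub⟩ := TopologicalSpace.countable_cover_nhdsWithin ht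
  refine ae_restrict_of_ae_restrict_of_subset hsub ?_
  exact (ae_restrict_biUnion_iff t hIc p).2 fun x hx => hp x (hI hx)

/-! ### Gluing of local traces -/

/-- `g` is the boundary limit of the functions `W ν` at the flat boundary points with normal `ν`. -/
def HasLimit {d : ℕ} {G : Type*} [NormedAddCommGroup G] (A : Set (E d)) (W : E d → E d → G)
    (g : E d → G) : Prop :=
  ∀ x ν, IsFlatPoint A x ν → ∃ ρ > 0, NormalLimit ν (frontier A ∩ Metric.ball x ρ) (W ν) g

/-- Traces and normal traces are both instances of `HasLimit`, with `W ν` independent of ν or equal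
to ⟪p, ν⟫. Gluing and calculus are therefore done once for both. -/
theorem hasTrace_iff {d : ℕ} {G : Type*} [NormedAddCommGroup G] {A : Set (E d)} {w g : E d → G} :
    HasTrace A w g ↔ MemLp g 2 ((surf d).restrict (frontier A)) ∧ HasLimit A (fun _ => w) g :=
  Iff.rfl

theorem hasNormalTrace_iff {d : ℕ} {A : Set (E d)} {p : E d → E d} {b : E d → ℝ} :
    HasNormalTrace A p b ↔ MemLp b 2 ((surf d).restrict (frontier A)) ∧
      HasLimit A (fun ν x => ⟪p x, ν⟫) b :=
  Iff.rfl

/-- `A` is the closure of its interior and surface almost every boundary point is flat. -/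
structure IsFlatBody {d : ℕ} (A : Set (E d)) : Prop where
  subset : A ⊆ closure (interior A)
  isCompact : IsCompact A
  null : surf d {x ∈ frontier A | ¬ ∃ ν, IsFlatPoint A x ν} = 0
  finite : surf d (frontier A) < ⊤
  volume_frontier : volume (frontier A) = 0

theorem IsBody.isFlatBody {n : ℕ} {𝒜 : Finset (E (n + 1) × ℝ)} {𝒬 : Set (Set (E (n + 1)))}
    {A : Set (E (n + 1))} (h : IsBody 𝒜 𝒬 A) (h𝒜 : IsArrangement 𝒜) : IsFlatBody A where
  subset := h.subset_closure_interior
  isCompact := h.isCompact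
  null := by
    refine measure_mono_null (fun x hx => ?_) (surf_skeleton h𝒜)
    by_contra hS
    obtain ⟨ν, hν, -⟩ := h.exists_isFlatPoint h𝒜 hx.1 hS
    exact hx.2 ⟨ν, hν⟩
  finite := h.surf_frontier_lt_top h𝒜
  volume_frontier := h.volume_frontier h𝒜

theorem sub_smul_mem_halfBall' {d : ℕ} {x ν : E d} (hν : ‖ν‖ = 1) {r : ℝ} {y : E d}
    (hy : y ∈ disc x ν (r / 2)) {t : ℝ} (ht : t ∈ Ioo 0 (r / 2)) : y - t • ν ∈ halfBall x ν r := by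
  have h2 : ⟪ν, y - x⟫ = 0 := hy.1
  have h3 : y - t • ν - x = (y - x) - t • ν := by abel
  constructor
  · rw [Metric.mem_ball, dist_eq_norm, h3]
    have h4 := norm_sub_le (y - x) (t • ν)
    have h5 : ‖t • ν‖ = t := by rw [norm_smul, hν, mul_one, Real.norm_eq_abs, abs_of_pos ht.1]
    have h6 := hy.2
    rw [Metric.mem_ball, dist_eq_norm] at h6
    linarith [ht.2]
  · rw [h3, inner_sub_right, h2, inner_smul_right, real_inner_self_eq_norm_sq, hν]
    linarith [ht.1]

section Limits

variable {n : ℕ} {G : Type*} [NormedAddCommGroup G] {A : Set (E (n + 1))}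
  {W W' : E (n + 1) → E (n + 1) → G} {g g' : E (n + 1) → G}

/-- A radius for which the local structure near a flat point is explicit. -/
theorem IsFlatBody.exists_radius (hA : IsFlatBody A) {x ν : E (n + 1)} (h : IsFlatPoint A x ν) :
    ∃ ρ > 0, interior A ∩ Metric.ball x ρ = halfBall x ν ρ ∧ ∀ r, r ≤ ρ →
      halfBall x ν r ⊆ interior A ∧ frontier A ∩ Metric.ball x r = disc x ν r ∧
      ∀ y ∈ disc x ν r, IsFlatPoint A y ν := by
  obtain ⟨ρ, hρ, h⟩ := h.exists_radius hA.subset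
  refine ⟨ρ, hρ, (h ρ le_rfl).1, fun r hr => ⟨?_, (h r hr).2⟩⟩
  rw [← (h r hr).1]; exact inter_subset_left

/-- Short normal segments below a flat point stay in the interior of A, so nothing outside matters.
-/
theorem HasLimit.congr_left (h : HasLimit A W g) (hA : IsFlatBody A)
    (hW : ∀ ν, ∀ᵐ p ∂(volume.restrict (interior A)), W ν p = W' ν p) : HasLimit A W' g := by
  intro x ν hx
  obtain ⟨ρ, hρ, hlim⟩ := h x ν hx
  obtain ⟨R, hR, -, hR'⟩ := hA.exists_radius hx
  set r := min ρ (R / 2)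
  have hr : 0 < r := lt_min hρ (by positivity)
  refine ⟨r, hr, ?_⟩
  have hd := (hR' r ((min_le_right _ _).trans (by linarith))).2.1
  have h1 := hlim.mono (inter_subset_inter_right _ (Metric.ball_subset_ball (min_le_left ρ (R / 2))))
  rw [hd] at h1 ⊢
  refine h1.congr_left_ae hx.1 (disc_subset_plane x ν r) (δ := R / 2) (by positivity)
    (measurableSet_disc x ν r) (fun y hy t ht => ?_) isOpen_interior.measurableSet (hW ν)
  exact (hR' R le_rfl).1 (sub_smul_mem_halfBall' hx.1 (disc_mono (min_le_right ρ (R / 2)) hy) ht)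

theorem HasLimit.congr_right (h : HasLimit A W g)
    (hg : ∀ᵐ y ∂((surf (n + 1)).restrict (frontier A)), g y = g' y) : HasLimit A W g' := by
  intro x ν hx
  obtain ⟨ρ, hρ, hlim⟩ := h x ν hx
  exact ⟨ρ, hρ, hlim.congr_right (ae_restrict_of_ae_restrict_of_subset inter_subset_left hg)⟩

/-- It suffices to check a property of surface points near the flat boundary points. -/
theorem IsFlatBody.ae_of_local (hA : IsFlatBody A) {p : E (n + 1) → Prop}
    (h : ∀ x ν, IsFlatPoint A x ν → ∃ ρ > 0,
      ∀ᵐ y ∂((surf (n + 1)).restrict (frontier A ∩ Metric.ball x ρ)), p y) :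
    ∀ᵐ y ∂((surf (n + 1)).restrict (frontier A)), p y := by
  have h1 : ∀ᵐ y ∂((surf (n + 1)).restrict {x ∈ frontier A | ∃ ν, IsFlatPoint A x ν}), p y := by
    refine ae_restrict_of_local fun x hx => ?_
    obtain ⟨ν, hν⟩ := hx.2
    obtain ⟨ρ, hρ, hp⟩ := h x ν hν
    refine ⟨frontier A ∩ Metric.ball x ρ, ?_, hp⟩
    exact mem_nhdsWithin.2 ⟨_, Metric.isOpen_ball, Metric.mem_ball_self hρ,
      fun y hy => ⟨hy.2.1, hy.1⟩⟩
  have h2 : ∀ᵐ y ∂((surf (n + 1)).restrict {x ∈ frontier A | ¬ ∃ ν, IsFlatPoint A x ν}), p y := by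
    rw [Measure.restrict_eq_zero.2 hA.null]; simp
  have h3 := ae_restrict_union_iff _ _ _ |>.2 ⟨h1, h2⟩
  refine ae_restrict_of_ae_restrict_of_subset (fun x hx => ?_) h3
  by_cases hf : ∃ ν, IsFlatPoint A x ν
  · exact Or.inl ⟨hx, hf⟩
  · exact Or.inr ⟨hx, hf⟩

/-- The functions `W ν`, extended by zero outside of `A`. -/
theorem HasLimit.exists_disc (h : HasLimit A W g) (hA : IsFlatBody A) {x ν : E (n + 1)}
    (hx : IsFlatPoint A x ν) : ∃ ρ > 0, frontier A ∩ Metric.ball x ρ = disc x ν ρ ∧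
      NormalLimit ν (disc x ν ρ) ((interior A).indicator (W ν)) g := by
  have h' : HasLimit A (fun ν => (interior A).indicator (W ν)) g := by
    refine h.congr_left hA fun ν => ?_
    filter_upwards [ae_restrict_mem isOpen_interior.measurableSet] with p hp
    rw [indicator_of_mem hp]
  obtain ⟨ρ, hρ, hlim⟩ := h' x ν hx
  obtain ⟨R, hR, -, hR'⟩ := hA.exists_radius hx
  have hd := (hR' (min ρ R) (min_le_right _ _)).2.1
  refine ⟨min ρ R, lt_min hρ hR, hd, ?_⟩
  rw [← hd]
  exact hlim.mono (inter_subset_inter_right _ (Metric.ball_subset_ball (min_le_left ρ R)))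

theorem aestronglyMeasurable_indicator_interior {w : E (n + 1) → G}
    (hw : AEStronglyMeasurable w (volume.restrict (interior A))) :
    AEStronglyMeasurable ((interior A).indicator w) volume :=
  (aestronglyMeasurable_indicator_iff isOpen_interior.measurableSet).2 hw

theorem HasLimit.unique (h : HasLimit A W g) (h' : HasLimit A W g') (hA : IsFlatBody A)
    (hW : ∀ ν, AEStronglyMeasurable (W ν) (volume.restrict (interior A)))
    (hg : AEStronglyMeasurable g ((surf (n + 1)).restrict (frontier A)))
    (hg' : AEStronglyMeasurable g' ((surf (n + 1)).restrict (frontier A))) :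
    ∀ᵐ y ∂((surf (n + 1)).restrict (frontier A)), g y = g' y := by
  refine hA.ae_of_local fun x ν hx => ?_
  obtain ⟨ρ, hρ, hd, hl⟩ := h.exists_disc hA hx
  obtain ⟨ρ', hρ', hd', hl'⟩ := h'.exists_disc hA hx
  set r := min ρ ρ'
  have hdr : frontier A ∩ Metric.ball x r = disc x ν r := by
    rcases min_choice ρ ρ' with h | h <;> simpa only [r, h]
  have hsub : disc x ν r ⊆ frontier A := by rw [← hdr]; exact inter_subset_left
  refine ⟨r, lt_min hρ hρ', ?_⟩
  rw [hdr]
  exact (hl.mono (disc_mono (min_le_left _ _))).unique (hl'.mono (disc_mono (min_le_right _ _))) hx.1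
    (disc_subset_plane x ν r) (aestronglyMeasurable_indicator_interior (hW ν))
    (hg.mono_set hsub) (hg'.mono_set hsub)

theorem HasLimit.enorm_le (h : HasLimit A W g) (hA : IsFlatBody A)
    (hg : AEStronglyMeasurable g ((surf (n + 1)).restrict (frontier A))) {M : ℝ≥0∞}
    (hM : ∀ ν, ‖ν‖ = 1 → ∀ᵐ p ∂(volume.restrict (interior A)), ‖W ν p‖ₑ ≤ M) :
    ∀ᵐ y ∂((surf (n + 1)).restrict (frontier A)), ‖g y‖ₑ ≤ M := by
  refine hA.ae_of_local fun x ν hx => ?_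
  obtain ⟨ρ, hρ, hd, hl⟩ := h.exists_disc hA hx
  have hsub : disc x ν ρ ⊆ frontier A := by rw [← hd]; exact inter_subset_left
  refine ⟨ρ, hρ, ?_⟩
  rw [hd]
  refine hl.enorm_le hx.1 (disc_subset_plane x ν ρ) (hg.mono_set hsub) ?_
  have h1 := (ae_restrict_iff' isOpen_interior.measurableSet).1 (hM ν hx.1)
  filter_upwards [h1] with p hp
  by_cases hpA : p ∈ interior A
  · rw [indicator_of_mem hpA]; exact hp hpA
  · rw [indicator_of_notMem hpA]; simp

/-- Local boundary limits can be glued. -/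
theorem IsFlatBody.exists_hasLimit (hA : IsFlatBody A)
    (hW : ∀ ν, AEStronglyMeasurable (W ν) (volume.restrict (interior A)))
    (h : ∀ x ν, IsFlatPoint A x ν → ∃ ρ > 0, ∃ g : E (n + 1) → G,
      AEStronglyMeasurable g ((surf (n + 1)).restrict (disc x ν ρ)) ∧
      NormalLimit ν (disc x ν ρ) ((interior A).indicator (W ν)) g) :
    ∃ g : E (n + 1) → G, AEStronglyMeasurable g ((surf (n + 1)).restrict (frontier A)) ∧
      HasLimit A W g := by
  classical
  set Fl : Set (E (n + 1)) := {x | ∃ ν, IsFlatPoint A x ν} with hFl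
  have key : ∀ x ∈ Fl, ∃ (ν : E (n + 1)) (ρ : ℝ) (g : E (n + 1) → G), IsFlatPoint A x ν ∧ 0 < ρ ∧
      frontier A ∩ Metric.ball x ρ = disc x ν ρ ∧ (∀ y ∈ disc x ν ρ, IsFlatPoint A y ν) ∧
      AEStronglyMeasurable g ((surf (n + 1)).restrict (disc x ν ρ)) ∧
      NormalLimit ν (disc x ν ρ) ((interior A).indicator (W ν)) g := by
    rintro x ⟨ν, hx⟩
    obtain ⟨ρ, hρ, g, hg, hlim⟩ := h x ν hx
    obtain ⟨R, hR, -, hR'⟩ := hA.exists_radius hx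
    obtain ⟨-, h2, h3⟩ := hR' (min ρ R) (min_le_right _ _)
    exact ⟨ν, min ρ R, g, hx, lt_min hρ hR, h2, h3, hg.mono_set (disc_mono (min_le_left _ _)),
      hlim.mono (disc_mono (min_le_left _ _))⟩
  choose! ν ρ γ hflat hρ hfr hfl hγ hlim using key
  rcases eq_empty_or_nonempty Fl with hem | hne
  · refine ⟨0, aestronglyMeasurable_const, fun x ν hx => ?_⟩
    have : x ∈ Fl := ⟨ν, hx⟩
    rw [hem] at this
    exact absurd this (notMem_empty x)
  obtain ⟨I, hI, hIc, hcov⟩ := TopologicalSpace.countable_cover_nhdsWithin (s := Fl)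
    (f := fun x => Metric.ball x (ρ x)) fun x hx =>
      mem_nhdsWithin_of_mem_nhds (Metric.ball_mem_nhds x (hρ x hx))
  have hIne : I.Nonempty := by
    obtain ⟨x, hx⟩ := hne
    obtain ⟨y, hy, -⟩ := mem_iUnion₂.1 (hcov hx)
    exact ⟨y, hy⟩
  obtain ⟨a, ha⟩ := hIc.exists_eq_range hIne
  have haF : ∀ k, a k ∈ Fl := fun k => hI (by rw [ha]; exact mem_range_self k)
  have hcov' : ∀ x ∈ Fl, ∃ k, x ∈ Metric.ball (a k) (ρ (a k)) := by
    intro x hx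
    obtain ⟨y, hy, hxy⟩ := mem_iUnion₂.1 (hcov hx)
    rw [ha] at hy
    obtain ⟨k, rfl⟩ := hy
    exact ⟨k, hxy⟩
  -- Countably many balls around flat points cover all flat points; the local function with the
  -- least admissible index is taken.
  let g : E (n + 1) → G := fun y =>
    if hy : ∃ k, y ∈ Metric.ball (a k) (ρ (a k)) then γ (a (Nat.find hy)) y else 0
  set Δ : ℕ → Set (E (n + 1)) := fun k => disc (a k) (ν (a k)) (ρ (a k)) with hΔ
  -- the local functions agree on overlaps
  have hagree : ∀ j k, ∀ᵐ y ∂((surf (n + 1)).restrict (Δ j ∩ Δ k)), γ (a j) y = γ (a k) y := by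
    intro j k
    rcases eq_empty_or_nonempty (Δ j ∩ Δ k) with he | ⟨y, hyj, hyk⟩
    · rw [he]; simp
    -- A common flat point forces a common normal, so both local functions are limits of the same `W
    -- ν` and uniqueness applies.
    · have hνe : ν (a j) = ν (a k) := (hfl _ (haF j) y hyj).unique (hfl _ (haF k) y hyk)
      have hlk : NormalLimit (ν (a j)) (Δ j ∩ Δ k) ((interior A).indicator (W (ν (a j))))
          (γ (a k)) := by
        rw [hνe]; exact (hlim _ (haF k)).mono inter_subset_right
      exact ((hlim _ (haF j)).mono inter_subset_left).unique hlk (hflat _ (haF j)).1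
        (inter_subset_left.trans (disc_subset_plane _ _ _))
        (aestronglyMeasurable_indicator_interior (hW _))
        ((hγ _ (haF j)).mono_set inter_subset_left) ((hγ _ (haF k)).mono_set inter_subset_right)
  have hΔb : ∀ k y, y ∈ frontier A → (y ∈ Metric.ball (a k) (ρ (a k)) ↔ y ∈ Δ k) := by
    intro k y hy
    simp only [hΔ, ← hfr _ (haF k)]
    exact ⟨fun h => ⟨hy, h⟩, fun h => h.2⟩
  have hΔf : ∀ k, Δ k ⊆ frontier A := by
    intro k
    simp only [hΔ, ← hfr _ (haF k)]; exact inter_subset_left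
  have hΔm : ∀ k, MeasurableSet (Δ k) := fun k => measurableSet_disc _ _ _
  have hgk : ∀ k, ∀ᵐ y ∂((surf (n + 1)).restrict (Δ k)), γ (a k) y = g y := by
    intro k
    have h1 : ∀ j, ∀ᵐ y ∂((surf (n + 1)).restrict (Δ k)), y ∈ Δ j → γ (a j) y = γ (a k) y := by
      intro j
      have := hagree j k
      rw [← Measure.restrict_restrict (hΔm j), ae_restrict_iff' (hΔm j)] at this
      exact this
    filter_upwards [ae_all_iff.2 h1, ae_restrict_mem (hΔm k)] with y hy hyk
    have hyf := hΔf k hyk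
    have hex : ∃ k, y ∈ Metric.ball (a k) (ρ (a k)) := ⟨k, (hΔb k y hyf).2 hyk⟩
    simp only [g, dif_pos hex]
    exact (hy _ ((hΔb _ y hyf).1 (Nat.find_spec hex))).symm
  refine ⟨g, ?_, fun x ν' hx => ?_⟩
  · have h1 : AEStronglyMeasurable g ((surf (n + 1)).restrict (⋃ k, Δ k)) := by
      rw [aestronglyMeasurable_iUnion_iff]
      exact fun k => (hγ _ (haF k)).congr (hgk k)
    have h2 : frontier A ⊆ (⋃ k, Δ k) ∪ {x ∈ frontier A | ¬ ∃ ν, IsFlatPoint A x ν} := by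
      intro x hx
      by_cases hf : ∃ ν, IsFlatPoint A x ν
      · obtain ⟨k, hk⟩ := hcov' x hf
        exact Or.inl (mem_iUnion.2 ⟨k, (hΔb k x hx).1 hk⟩)
      · exact Or.inr ⟨hx, hf⟩
    refine AEStronglyMeasurable.mono_set h2 ?_
    rw [aestronglyMeasurable_union_iff]
    refine ⟨h1, ?_⟩
    rw [Measure.restrict_eq_zero.2 hA.null]
    exact aestronglyMeasurable_zero_measure g
  · obtain ⟨k, hk⟩ := hcov' x ⟨ν', hx⟩
    obtain ⟨r, hr, hsub⟩ := Metric.isOpen_iff.1 Metric.isOpen_ball x hk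
    obtain ⟨R, hR, -, hR'⟩ := hA.exists_radius hx
    set s := min r (R / 2)
    have hs : 0 < s := lt_min hr (by positivity)
    have hd := (hR' s ((min_le_right _ _).trans (by linarith))).2.1
    have hxf : x ∈ frontier A := by
      have : x ∈ disc x ν' s := ⟨by simp [plane], Metric.mem_ball_self hs⟩
      rw [← hd] at this; exact this.1
    have hνe : ν (a k) = ν' := (hfl _ (haF k) x ((hΔb k x hxf).1 hk)).unique hx
    have hsub' : disc x ν' s ⊆ Δ k := by
      intro y hy
      have hyf : y ∈ frontier A := by rw [← hd] at hy; exact hy.1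
      exact (hΔb k y hyf).1 (hsub (Metric.ball_subset_ball (min_le_left _ _) hy.2))
    refine ⟨s, hs, ?_⟩
    rw [hd]
    have h1 := ((hlim _ (haF k)).congr_right (hgk k)).mono hsub'
    rw [hνe] at h1
    refine h1.congr_left (δ := R / 2) (by positivity) (measurableSet_disc _ _ _) fun y hy t ht => ?_
    exact indicator_of_mem ((hR' R le_rfl).1
      (sub_smul_mem_halfBall' hx.1 (disc_mono (min_le_right r (R / 2)) hy) ht)) _

end Limits

end IPG

namespace IPG

/-! ### Calculus of boundary limits -/

section Calculus

variable {n : ℕ} {G G₁ G₂ G₃ : Type*} [NormedAddCommGroup G] [NormedAddCommGroup G₁]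
  [NormedAddCommGroup G₂] [NormedAddCommGroup G₃] {A : Set (E (n + 1))}

theorem IsFlatBody.isFiniteMeasure (hA : IsFlatBody A) :
    IsFiniteMeasure ((surf (n + 1)).restrict (frontier A)) :=
  ⟨by rw [Measure.restrict_apply_univ]; exact hA.finite⟩

theorem disc_min {x ν : E (n + 1)} {ρ ρ' : ℝ} (hd : frontier A ∩ Metric.ball x ρ = disc x ν ρ)
    (hd' : frontier A ∩ Metric.ball x ρ' = disc x ν ρ') :
    frontier A ∩ Metric.ball x (min ρ ρ') = disc x ν (min ρ ρ') := by
  rcases min_choice ρ ρ' with h | h <;> simpa only [h]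

theorem HasLimit.bilin {W₁ : E (n + 1) → E (n + 1) → G₁} {W₂ : E (n + 1) → E (n + 1) → G₂}
    {g₁ : E (n + 1) → G₁} {g₂ : E (n + 1) → G₂} (op : G₁ → G₂ → G₃)
    (hop : ∀ a a' b b', ‖op a b - op a' b'‖ₑ ≤ ‖a‖ₑ * ‖b - b'‖ₑ + ‖a - a'‖ₑ * ‖b'‖ₑ)
    (h₁ : HasLimit A W₁ g₁) (h₂ : HasLimit A W₂ g₂) (hA : IsFlatBody A)
    (hW₂ : ∀ ν, AEStronglyMeasurable (W₂ ν) (volume.restrict (interior A)))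
    (hg₁ : AEStronglyMeasurable g₁ ((surf (n + 1)).restrict (frontier A)))
    (hg₂ : IntegrableOn g₂ (frontier A) (surf (n + 1))) {M : ℝ≥0∞} (hM : M ≠ ⊤)
    (hM₁ : ∀ ν, ‖ν‖ = 1 → ∀ᵐ p ∂(volume.restrict (interior A)), ‖W₁ ν p‖ₑ ≤ M) :
    HasLimit A (fun ν p => op (W₁ ν p) (W₂ ν p)) (fun y => op (g₁ y) (g₂ y)) := by
  have hgM := h₁.enorm_le hA hg₁ hM₁
  have key : HasLimit A (fun ν p => op ((interior A).indicator (W₁ ν) p)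
      ((interior A).indicator (W₂ ν) p)) (fun y => op (g₁ y) (g₂ y)) := by
    intro x ν hx
    obtain ⟨ρ, hρ, hd, hl⟩ := h₁.exists_disc hA hx
    obtain ⟨ρ', hρ', hd', hl'⟩ := h₂.exists_disc hA hx
    have hdr := disc_min hd hd'
    set r := min ρ ρ'
    have hsub : disc x ν r ⊆ frontier A := by rw [← hdr]; exact inter_subset_left
    refine ⟨r, lt_min hρ hρ', ?_⟩
    rw [hdr]
    refine (hl.mono (disc_mono (min_le_left ρ ρ'))).bilin op hop
      (hl'.mono (disc_mono (min_le_right ρ ρ'))) hx.1 (disc_subset_plane x ν r)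
      (aestronglyMeasurable_indicator_interior (hW₂ ν)) (hg₂.1.mono_set hsub) hM ?_
      (ae_restrict_of_ae_restrict_of_subset hsub hgM) (hg₂.mono_set hsub).2.ne
    filter_upwards [(ae_restrict_iff' isOpen_interior.measurableSet).1 (hM₁ ν hx.1)] with p hp
    by_cases hpA : p ∈ interior A
    · rw [indicator_of_mem hpA]; exact hp hpA
    · rw [indicator_of_notMem hpA]; simp
  refine key.congr_left hA fun ν => ?_
  filter_upwards [ae_restrict_mem isOpen_interior.measurableSet] with p hp
  rw [indicator_of_mem hp, indicator_of_mem hp]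

theorem HasLimit.add {W W' : E (n + 1) → E (n + 1) → G} {g g' : E (n + 1) → G}
    (h₁ : HasLimit A W g) (h₂ : HasLimit A W' g') (hA : IsFlatBody A)
    (hW : ∀ ν, AEStronglyMeasurable (W ν) (volume.restrict (interior A)))
    (hg : AEStronglyMeasurable g ((surf (n + 1)).restrict (frontier A))) :
    HasLimit A (fun ν p => W ν p + W' ν p) (fun y => g y + g' y) := by
  have key : HasLimit A (fun ν p => (interior A).indicator (W ν) p +
      (interior A).indicator (W' ν) p) (fun y => g y + g' y) := by
    intro x ν hx
    obtain ⟨ρ, hρ, hd, hl⟩ := h₁.exists_disc hA hx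
    obtain ⟨ρ', hρ', hd', hl'⟩ := h₂.exists_disc hA hx
    have hdr := disc_min hd hd'
    set r := min ρ ρ'
    have hsub : disc x ν r ⊆ frontier A := by rw [← hdr]; exact inter_subset_left
    refine ⟨r, lt_min hρ hρ', ?_⟩
    rw [hdr]
    exact (hl.mono (disc_mono (min_le_left ρ ρ'))).add
      (hl'.mono (disc_mono (min_le_right ρ ρ'))) hx.1 (disc_subset_plane x ν r)
      (aestronglyMeasurable_indicator_interior (hW ν)) (hg.mono_set hsub)
  refine key.congr_left hA fun ν => ?_
  filter_upwards [ae_restrict_mem isOpen_interior.measurableSet] with p hp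
  rw [indicator_of_mem hp, indicator_of_mem hp]

theorem HasLimit.clm [NormedSpace ℝ G₁] [NormedSpace ℝ G₂] {W : E (n + 1) → E (n + 1) → G₁}
    {g : E (n + 1) → G₁} (L : G₁ →L[ℝ] G₂) (h : HasLimit A W g) :
    HasLimit A (fun ν p => L (W ν p)) (fun y => L (g y)) := by
  intro x ν hx
  obtain ⟨ρ, hρ, hl⟩ := h x ν hx
  exact ⟨ρ, hρ, hl.clm L⟩

theorem HasLimit.sum {ι : Type*} (s : Finset ι) {W : ι → E (n + 1) → E (n + 1) → G}
    {g : ι → E (n + 1) → G} (h : ∀ i ∈ s, HasLimit A (W i) (g i)) (hA : IsFlatBody A)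
    (hW : ∀ i ∈ s, ∀ ν, AEStronglyMeasurable (W i ν) (volume.restrict (interior A)))
    (hg : ∀ i ∈ s, AEStronglyMeasurable (g i) ((surf (n + 1)).restrict (frontier A))) :
    HasLimit A (fun ν p => ∑ i ∈ s, W i ν p) (fun y => ∑ i ∈ s, g i y) := by
  classical
  induction s using Finset.induction_on with
  | empty =>
    intro x ν hx
    refine ⟨1, one_pos, ?_⟩
    simp [NormalLimit, AvgZero]
  | insert a s ha ih =>
    simp only [Finset.sum_insert ha]
    exact (h a (Finset.mem_insert_self a s)).add
      (ih (fun i hi => h i (Finset.mem_insert_of_mem hi))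
        (fun i hi => hW i (Finset.mem_insert_of_mem hi))
        fun i hi => hg i (Finset.mem_insert_of_mem hi)) hA
      (hW a (Finset.mem_insert_self a s)) (hg a (Finset.mem_insert_self a s))

theorem HasLimit.of_continuous {φ : E (n + 1) → G} (hφ : Continuous φ) (hA : IsFlatBody A) :
    HasLimit A (fun _ => φ) φ := by
  intro x ν hx
  obtain ⟨R, hR, -, hR'⟩ := hA.exists_radius hx
  refine ⟨R, hR, ?_⟩
  rw [(hR' R le_rfl).2.1]
  exact NormalLimit.of_continuous hx.1 (disc_subset_plane x ν R) (measurableSet_disc x ν R)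
    (Metric.isBounded_ball.subset inter_subset_right) hφ

/-- The outer normal is selected point by point, so its measurability is not evident. It agrees
almost everywhere with the glued limit of the constant functions `W ν = ν`, which is measurable by
construction. -/
theorem IsFlatBody.aestronglyMeasurable_outerNormal (hA : IsFlatBody A) :
    AEStronglyMeasurable (outerNormal A) ((surf (n + 1)).restrict (frontier A)) := by
  have hloc : ∀ x ν, IsFlatPoint A x ν → ∃ ρ > 0, ∃ g : E (n + 1) → E (n + 1),
      AEStronglyMeasurable g ((surf (n + 1)).restrict (disc x ν ρ)) ∧
      NormalLimit ν (disc x ν ρ) ((interior A).indicator fun _ => ν) g := by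
    intro x ν hx
    obtain ⟨R, hR, -, hR'⟩ := hA.exists_radius hx
    refine ⟨R / 2, by positivity, fun _ => ν, aestronglyMeasurable_const, ?_⟩
    have h1 : NormalLimit ν (disc x ν (R / 2)) (fun _ => ν) (fun _ => ν) := by
      simp [NormalLimit, AvgZero]
    refine h1.congr_left (δ := R / 2) (by positivity) (measurableSet_disc _ _ _) fun y hy t ht => ?_
    exact (indicator_of_mem ((hR' R le_rfl).1 (sub_smul_mem_halfBall' hx.1 hy ht)) fun _ => ν).symm
  obtain ⟨g, hg, hlim⟩ := hA.exists_hasLimit (W := fun ν _ => ν)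
    (fun ν => aestronglyMeasurable_const) hloc
  refine hg.congr (hA.ae_of_local fun x ν hx => ?_)
  obtain ⟨ρ, hρ, hd, hl⟩ := hlim.exists_disc hA hx
  obtain ⟨R, hR, -, hR'⟩ := hA.exists_radius hx
  obtain ⟨-, hd', hfl⟩ := hR' (min ρ (R / 2)) ((min_le_right _ _).trans (by linarith))
  set r := min ρ (R / 2)
  have hsub : disc x ν r ⊆ frontier A := by rw [← hd']; exact inter_subset_left
  refine ⟨r, lt_min hρ (by positivity), ?_⟩
  rw [hd']
  have h1 : NormalLimit ν (disc x ν r) (fun _ => ν) (fun _ => ν) := by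
    simp [NormalLimit, AvgZero]
  have h2 : NormalLimit ν (disc x ν r) (fun _ => ν) g := by
    refine (hl.mono (disc_mono (min_le_left _ _))).congr_left (δ := R / 2) (by positivity)
      (measurableSet_disc _ _ _) fun y hy t ht => ?_
    exact indicator_of_mem ((hR' R le_rfl).1 (sub_smul_mem_halfBall' hx.1
      (disc_mono (min_le_right _ _) hy) ht)) _
  filter_upwards [h2.unique h1 hx.1 (disc_subset_plane x ν r) aestronglyMeasurable_const
    (hg.mono_set hsub) aestronglyMeasurable_const, ae_restrict_mem (measurableSet_disc x ν r)]
    with y hy hy'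
  rw [hy, (hfl y hy').outerNormal_eq]

theorem norm_outerNormal_le {d : ℕ} (A : Set (E d)) (x : E d) : ‖outerNormal A x‖ ≤ 1 := by
  by_cases h : ∃ ν, IsFlatPoint A x ν
  · obtain ⟨ν, hν⟩ := h
    rw [hν.outerNormal_eq, hν.1]
  · rw [outerNormal, dif_neg h, norm_zero]; exact zero_le_one

/-- Near a flat point the normal is constant, so the pairing is a fixed continuous linear functional
there. -/
theorem HasLimit.inner_outerNormal {q g : E (n + 1) → E (n + 1)} (h : HasLimit A (fun _ => q) g)
    (hA : IsFlatBody A) : HasLimit A (fun ν p => ⟪q p, ν⟫) (fun y => ⟪g y, outerNormal A y⟫) := by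
  intro x ν hx
  obtain ⟨ρ, hρ, hl⟩ := h x ν hx
  obtain ⟨R, hR, -, hR'⟩ := hA.exists_radius hx
  obtain ⟨-, hd', hfl⟩ := hR' (min ρ R) (min_le_right _ _)
  refine ⟨min ρ R, lt_min hρ hR, ?_⟩
  rw [hd']
  have h1 := (hl.mono (inter_subset_inter_right _ (Metric.ball_subset_ball (min_le_left ρ R)))).clm
    (innerSL ℝ ν)
  rw [hd'] at h1
  have h2 := h1.congr_right (g' := fun y => ⟪g y, outerNormal A y⟫) (by
    filter_upwards [ae_restrict_mem (measurableSet_disc x ν (min ρ R))] with y hy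
    rw [(hfl y hy).outerNormal_eq, innerSL_apply_apply, real_inner_comm])
  refine h2.congr_left one_pos (measurableSet_disc _ _ _) fun y _ t _ => ?_
  rw [innerSL_apply_apply, real_inner_comm]

end Calculus

/-! ### The chosen traces -/

section Chosen

variable {n : ℕ} {G : Type*} [NormedAddCommGroup G] {A : Set (E (n + 1))}

theorem hasTrace_trace {d : ℕ} {A : Set (E d)} {w : E d → G} (h : ∃ g, HasTrace A w g) :
    HasTrace A w (trace A w) := by
  rw [trace, dif_pos h]; exact h.choose_spec

/-- Without any trace the default value 0 is square integrable as well. Integrability of face terms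
can thus be used for K∇v before any trace of it is known to exist. -/
theorem memLp_trace {d : ℕ} (A : Set (E d)) (w : E d → G) :
    MemLp (trace A w) 2 ((surf d).restrict (frontier A)) := by
  by_cases h : ∃ g, HasTrace A w g
  · exact (hasTrace_trace h).1
  · rw [trace, dif_neg h]; exact MemLp.zero

theorem hasNormalTrace_normalTrace {d : ℕ} {A : Set (E d)} {p : E d → E d}
    (h : ∃ b, HasNormalTrace A p b) : HasNormalTrace A p (normalTrace A p) := by
  rw [normalTrace, dif_pos h]; exact h.choose_spec

theorem HasTrace.ae_eq {w g : E (n + 1) → G} (h : HasTrace A w g) (hA : IsFlatBody A)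
    (hw : AEStronglyMeasurable w (volume.restrict (interior A))) :
    ∀ᵐ y ∂((surf (n + 1)).restrict (frontier A)), trace A w y = g y :=
  HasLimit.unique (W := fun _ => w) (hasTrace_iff.1 (hasTrace_trace ⟨g, h⟩)).2
    (hasTrace_iff.1 h).2 hA (fun _ => hw) (hasTrace_trace ⟨g, h⟩).1.1 h.1.1

theorem HasTrace.of_continuous {φ : E (n + 1) → G} (hφ : Continuous φ) (hA : IsFlatBody A) :
    HasTrace A φ φ := by
  refine ⟨?_, HasLimit.of_continuous hφ hA⟩
  have := hA.isFiniteMeasure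
  obtain ⟨C, hC⟩ := hA.isCompact.exists_bound_of_continuousOn hφ.continuousOn
  have hm : AEStronglyMeasurable φ ((surf (n + 1)).restrict (frontier A)) :=
    ContinuousOn.aestronglyMeasurable_of_isCompact hφ.continuousOn
      (hA.isCompact.of_isClosed_subset isClosed_frontier hA.isCompact.isClosed.frontier_subset)
      isClosed_frontier.measurableSet
  refine MemLp.of_bound hm C ?_
  filter_upwards [ae_restrict_mem isClosed_frontier.measurableSet] with y hy
  exact hC y (hA.isCompact.isClosed.frontier_subset hy)

theorem HasTrace.congr_left {w w' g : E (n + 1) → G} (h : HasTrace A w g) (hA : IsFlatBody A)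
    (hw : ∀ᵐ p ∂(volume.restrict (interior A)), w p = w' p) : HasTrace A w' g :=
  ⟨h.1, HasLimit.congr_left h.2 hA fun _ => hw⟩

end Chosen

/-! ### Existence of traces -/

theorem HasWeakDeriv.mono {d : ℕ} {U V : Set (E d)} {w D : E d → ℝ} {e : E d}
    (h : HasWeakDeriv U w e D) (hVU : V ⊆ U) : HasWeakDeriv V w e D := by
  intro φ hφ
  have hφU := hφ.mono hVU
  have := h φ hφU
  rw [setIntegral_eq_integral_of_forall_compl_eq_zero
      (fun x hx => by rw [hφU.fderiv_eq_zero hx]; simp),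
    setIntegral_eq_integral_of_forall_compl_eq_zero
      (fun x hx => by rw [hφU.eq_zero hx, mul_zero])] at this
  rw [setIntegral_eq_integral_of_forall_compl_eq_zero
      (fun x hx => by rw [hφ.fderiv_eq_zero hx]; simp),
    setIntegral_eq_integral_of_forall_compl_eq_zero
      (fun x hx => by rw [hφ.eq_zero hx, mul_zero]), this]

section Existence

variable {n : ℕ} {A : Set (E (n + 1))}

theorem NormalLimit.exists_indicator {G : Type*} [NormedAddCommGroup G] (hA : IsFlatBody A)
    {x ν : E (n + 1)} (hx : IsFlatPoint A x ν) {ρ : ℝ} (hρ : 0 < ρ) {w g : E (n + 1) → G}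
    (h : NormalLimit ν (disc x ν ρ) w g) : ∃ r > 0, r ≤ ρ ∧
      NormalLimit ν (disc x ν r) ((interior A).indicator w) g := by
  obtain ⟨R, hR, -, hR'⟩ := hA.exists_radius hx
  refine ⟨min ρ (R / 2), lt_min hρ (by positivity), min_le_left _ _, ?_⟩
  refine (h.mono (disc_mono (min_le_left _ _))).congr_left (δ := R / 2) (by positivity)
    (measurableSet_disc _ _ _) fun y hy t ht => ?_
  exact (indicator_of_mem ((hR' R le_rfl).1 (sub_smul_mem_halfBall' hx.1
    (disc_mono (min_le_right _ _) hy) ht)) _).symm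

/-- A half ball inside Q at the boundary point x makes the tangent hyperplane supporting. Otherwise
some interior point q' lies strictly beyond it, its reflection x − s(q' − x) falls into the half
ball for small s, and x becomes a convex combination of two interior points with weights 1/(1 + s)
and s/(1 + s). -/
theorem inner_sub_neg_of_mem_interior {d : ℕ} {Q : Set (E d)} (hQ : Convex ℝ Q) {x ν : E d}
    (hν : ‖ν‖ = 1) (hx : x ∉ interior Q) {ρ : ℝ} (hρ : 0 < ρ) (hsub : halfBall x ν ρ ⊆ interior Q)
    {q : E d} (hq : q ∈ interior Q) : ⟪ν, q - x⟫ < 0 := by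
  by_contra hcon
  push Not at hcon
  have h1 : Tendsto (fun t : ℝ => q + t • ν) (𝓝[>] 0) (𝓝 q) := by
    have : Continuous fun t : ℝ => q + t • ν := by fun_prop
    simpa using (this.tendsto 0).mono_left (nhdsWithin_le_nhds (s := Ioi 0))
  obtain ⟨t, ht, ht0⟩ := ((h1.eventually (isOpen_interior.mem_nhds hq)).and
    self_mem_nhdsWithin).exists
  have ht0 : (0 : ℝ) < t := ht0
  set q' := q + t • ν
  have hq' : 0 < ⟪ν, q' - x⟫ := by
    have : q' - x = (q - x) + t • ν := by simp only [q']; abel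
    rw [this, inner_add_right, inner_smul_right, real_inner_self_eq_norm_sq, hν]
    linarith
  have h2 : Tendsto (fun s : ℝ => x - s • (q' - x)) (𝓝[>] 0) (𝓝 x) := by
    have : Continuous fun s : ℝ => x - s • (q' - x) := by fun_prop
    simpa using (this.tendsto 0).mono_left (nhdsWithin_le_nhds (s := Ioi 0))
  obtain ⟨s, hs, hs0⟩ := ((h2.eventually (Metric.ball_mem_nhds x hρ)).and
    self_mem_nhdsWithin).exists
  have hs0 : (0 : ℝ) < s := hs0
  have hz : x - s • (q' - x) ∈ interior Q := by
    refine hsub ⟨hs, ?_⟩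
    rw [sub_sub_cancel_left, inner_neg_right, inner_smul_right]
    have := mul_pos hs0 hq'
    linarith
  refine hx ?_
  have hs1 : (1 + s) ≠ 0 := by positivity
  have h3 := hQ.interior hz ht (a := 1 / (1 + s)) (b := s / (1 + s)) (by positivity) (by positivity)
    (by field_simp)
  convert h3 using 1
  match_scalars <;> field_simp <;> ring

/-- Square integrability of the trace on the part of the boundary which belongs to a convex piece. -/
theorem exists_lintegral_piece_lt_top (hA : IsFlatBody A) {Q : Set (E (n + 1))} (hQ : Convex ℝ Q)
    (hQc : IsClosed Q) (hQi : (interior Q).Nonempty) (hQA : interior Q ⊆ interior A)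
    {w g : E (n + 1) → ℝ} (hw : MemLp w 2 (volume.restrict (interior A)))
    {Gw : E (n + 1) → E (n + 1)} (hGw : HasWeakGrad (interior A) w Gw)
    (hg : AEStronglyMeasurable g ((surf (n + 1)).restrict (frontier A)))
    (hlim : HasLimit A (fun _ => w) g) (ν : E (n + 1)) (a : ℝ) (y₀ : E (n + 1)) :
    ∃ r > 0, ∫⁻ y in {x | x ∈ frontier A ∧ IsFlatPoint A x ν ∧ ⟪ν, x⟫ = a ∧
        ∃ ρ > 0, halfBall x ν ρ ⊆ interior Q} ∩ Metric.ball y₀ r, ‖g y‖ₑ ^ 2 ∂(surf (n + 1)) < ⊤ := by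
  set M := {x | x ∈ frontier A ∧ IsFlatPoint A x ν ∧ ⟪ν, x⟫ = a ∧
    ∃ ρ > 0, halfBall x ν ρ ⊆ interior Q} with hM
  have hMQ : ∀ x ∈ M, x ∈ Q := by
    rintro x ⟨-, hx, -, ρ, hρ, hsub⟩
    refine closure_minimal (hsub.trans interior_subset) hQc ?_
    exact disc_subset_closure_halfBall hx.1 ⟨by simp [plane], Metric.mem_ball_self hρ⟩
  by_cases hy₀ : y₀ ∈ Q
  swap
  · obtain ⟨r, hr, hsub⟩ := Metric.isOpen_iff.1 hQc.isOpen_compl y₀ hy₀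
    refine ⟨r, hr, ?_⟩
    have : M ∩ Metric.ball y₀ r = ∅ := by
      ext x; simp only [mem_inter_iff, mem_empty_iff_false, iff_false]
      exact fun h => hsub h.2 (hMQ x h.1)
    rw [this]; simp
  obtain ⟨x₀, hx₀⟩ := hQi
  obtain ⟨r, hr, hball⟩ := Metric.isOpen_iff.1 isOpen_interior x₀ hx₀
  refine ⟨r, hr, ?_⟩
  rcases eq_empty_or_nonempty (M ∩ Metric.ball y₀ r) with he | ⟨x₁, hx₁, hx₁b⟩
  · rw [he]; simp
  -- The translation that takes y₀ to the centre x₀ of a ball inside Q takes every point near y₀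
  -- into the interior of Q. So one direction works for all faces of Q near y₀, also at an edge,
  -- where the discs around flat points shrink.
  set e := x₀ - y₀ with he
  have hshift : ∀ y ∈ Metric.ball y₀ r, y + e ∈ interior Q := by
    intro y hy
    refine hball ?_
    rw [Metric.mem_ball, dist_eq_norm] at hy ⊢
    rwa [he, show y + (x₀ - y₀) - x₀ = y - y₀ by abel]
  have hν := hx₁.2.1.1
  have hx₁Q : x₁ ∉ interior Q := fun h => hx₁.1.2 (hQA h)
  obtain ⟨ρ₁, hρ₁, hsub₁⟩ := hx₁.2.2.2
  have hneg : ⟪ν, e⟫ < 0 := by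
    have := inner_sub_neg_of_mem_interior hQ hν hx₁Q hρ₁ hsub₁ (hshift x₁ hx₁b)
    rwa [add_sub_cancel_left] at this
  obtain ⟨J, hJ⟩ := exists_isTangent hν
  -- At each point of M the set Q contains a disc of the hyperplane, so the coordinates of the
  -- points of M near y₀ lie in this open set. Above it, the segments in direction `e` stay inside Q
  -- by convexity.
  set D := interior ((fun z => x₁ + J z) ⁻¹' (Q ∩ Metric.ball y₀ r)) with hD
  have hJc : Continuous fun z => x₁ + J z := continuous_const.add J.continuous
  have hfin : IsFiniteMeasure (volume.restrict (interior A)) :=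
    ⟨by rw [Measure.restrict_apply_univ]
        exact (measure_mono interior_subset).trans_lt hA.isCompact.measure_lt_top⟩
  have hDw : MemLp (fun x => ⟪Gw x, e⟫) 2 (volume.restrict (interior A)) := hGw.1.inner_const e
  obtain ⟨g', hg'i, hg'l, hg'2⟩ := hJ.exists_trace x₁ hneg (D := D) isOpen_interior one_pos
    (U := interior A) isOpen_interior (fun z hz s hs => by
      have hzQ := interior_subset hz
      have h1 := hQ.combo_self_interior_mem_interior hzQ.1 (hshift _ hzQ.2) (a := 1 - s) (b := s)
        (by linarith [hs.2]) hs.1 (by ring)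
      refine hQA ?_
      convert h1 using 1
      module) (hw.integrable one_le_two) (hDw.integrable one_le_two) (hGw.2 e)
  have hplane : ∀ x ∈ M, x ∈ plane x₁ ν := by
    intro x hx
    change ⟪ν, x - x₁⟫ = 0
    rw [inner_sub_right, hx.2.2.1, hx₁.2.2.1, sub_self]
  have hmem : ∀ x ∈ M ∩ Metric.ball y₀ r, ∃ z ∈ D, x₁ + J z = x := by
    rintro x ⟨hx, hxb⟩
    have h1 := hplane x hx
    rw [← hJ.range_eq_plane x₁] at h1
    obtain ⟨z, rfl⟩ := h1
    refine ⟨z, ?_, rfl⟩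
    obtain ⟨-, hxf, -, ρ, hρ, hsub⟩ := hx
    refine mem_interior.2 ⟨(fun z => x₁ + J z) ⁻¹' (Metric.ball (x₁ + J z) ρ ∩ Metric.ball y₀ r),
      fun z' hz' => ⟨?_, hz'.2⟩, (Metric.isOpen_ball.inter Metric.isOpen_ball).preimage hJc,
      Metric.mem_ball_self hρ, hxb⟩
    refine closure_minimal (hsub.trans interior_subset) hQc (disc_subset_closure_halfBall hν ?_)
    refine ⟨?_, hz'.1⟩
    change ⟪ν, x₁ + J z' - (x₁ + J z)⟫ = 0
    rw [add_sub_add_left_eq_sub, inner_sub_right, hJ.2, hJ.2, sub_self]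
  have hae : ∀ᵐ y ∂((surf (n + 1)).restrict (M ∩ Metric.ball y₀ r)), g y = g' y := by
    refine ae_restrict_of_local fun x hx => ?_
    obtain ⟨z, hz, rfl⟩ := hmem x hx
    have hxf := hx.1.2.1
    obtain ⟨ρ, hρ, hzball, hl⟩ := hg'l z hz
    have hpl := plane_eq_of_mem (hplane _ hx.1)
    have hdisc : plane x₁ ν ∩ Metric.ball (x₁ + J z) ρ = disc (x₁ + J z) ν ρ := by
      rw [disc, hpl]
    have himg : disc (x₁ + J z) ν ρ ⊆ (fun z => x₁ + J z) '' D := by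
      rw [← hdisc, ← hJ.image_ball]; exact image_mono hzball
    rw [hdisc] at hl
    obtain ⟨s, hs, hsρ, hl'⟩ := hl.exists_indicator hA hxf hρ
    obtain ⟨ρ', hρ', hd, hl2⟩ := hlim.exists_disc hA hxf
    have hsub : disc (x₁ + J z) ν ρ' ⊆ frontier A := by rw [← hd]; exact inter_subset_left
    refine ⟨disc (x₁ + J z) ν (min ρ' s), ?_, ?_⟩
    · refine mem_nhdsWithin.2 ⟨_, Metric.isOpen_ball, Metric.mem_ball_self (lt_min hρ' hs),
        fun y hy => ⟨?_, hy.1⟩⟩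
      rw [hpl]; exact hplane y hy.2.1
    · exact (hl2.mono (disc_mono (min_le_left _ _))).unique (hl'.mono (disc_mono (min_le_right _ _)))
        hν (disc_subset_plane _ _ _) (aestronglyMeasurable_indicator_interior hw.1)
        (hg.mono_set ((disc_mono (min_le_left _ _)).trans hsub))
        (hg'i.1.mono_set ((disc_mono ((min_le_right _ _).trans hsρ)).trans himg))
  have h2 := hg'2 hw hDw
  calc ∫⁻ y in M ∩ Metric.ball y₀ r, ‖g y‖ₑ ^ 2 ∂(surf (n + 1))
      = ∫⁻ y in M ∩ Metric.ball y₀ r, ‖g' y‖ₑ ^ 2 ∂(surf (n + 1)) := by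
        refine lintegral_congr_ae ?_
        filter_upwards [hae] with y hy
        rw [hy]
    _ ≤ ∫⁻ y in (fun z => x₁ + J z) '' D, ‖g' y‖ₑ ^ 2 ∂(surf (n + 1)) := by
        refine lintegral_mono_set fun x hx => ?_
        obtain ⟨z, hz, h⟩ := hmem x hx
        exact ⟨z, hz, h⟩
    _ < ⊤ := (memLp_two_iff_lintegral h2.1).1 h2

theorem IsBody.interior_subset {d : ℕ} {𝒜 : Finset (E d × ℝ)} {𝒬 : Set (Set (E d))} {A : Set (E d)}
    (h : IsBody 𝒜 𝒬 A) {Q : Set (E d)} (hQ : Q ∈ 𝒬) : interior Q ⊆ interior A := by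
  refine interior_mono ?_
  rw [h.2.1]
  exact subset_sUnion_of_mem hQ

theorem lintegral_biUnion_finset_lt_top {α ι : Type*} [MeasurableSpace α] {μ : Measure α}
    {s : Finset ι} {t : ι → Set α} {f : α → ℝ≥0∞} (h : ∀ i ∈ s, ∫⁻ x in t i, f x ∂μ < ⊤) :
    ∫⁻ x in ⋃ i ∈ s, t i, f x ∂μ < ⊤ := by
  classical
  induction s using Finset.induction_on with
  | empty => simp
  | insert a s ha ih =>
    rw [Finset.set_biUnion_insert]
    refine (lintegral_union_le f _ _).trans_lt (ENNReal.add_lt_top.2 ⟨h a (Finset.mem_insert_self a s),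
      ih fun i hi => h i (Finset.mem_insert_of_mem hi)⟩)

/-- The flat boundary points with normal `i.2.1` on the hyperplane `i.2` which belong to the convex
piece `i.1`. -/
def bodyPiece {d : ℕ} (A : Set (E d)) (i : Set (E d) × (E d × ℝ)) : Set (E d) :=
  {x | x ∈ frontier A ∧ IsFlatPoint A x i.2.1 ∧ ⟪i.2.1, x⟫ = i.2.2 ∧
    ∃ ρ > 0, halfBall x i.2.1 ρ ⊆ interior i.1}

theorem IsBody.exists_pieces {𝒜 : Finset (E (n + 1) × ℝ)} {𝒬 : Set (Set (E (n + 1)))}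
    (h : IsBody 𝒜 𝒬 A) (h𝒜 : IsArrangement 𝒜) :
    ∃ I : Finset (Set (E (n + 1)) × (E (n + 1) × ℝ)), (∀ i ∈ I, i.1 ∈ 𝒬) ∧
      ∀ x ∈ frontier A, x ∉ skeleton 𝒜 → ∃ i ∈ I, x ∈ bodyPiece A i := by
  set J : Set (E (n + 1) × ℝ) := {p | p ∈ 𝒜} ∪ (fun p => (-p.1, -p.2)) '' {p | p ∈ 𝒜} with hJ
  have hJf : J.Finite := 𝒜.finite_toSet.union (𝒜.finite_toSet.image _)
  have hmem : ∀ i, i ∈ (h.1.prod hJf).toFinset ↔ i.1 ∈ 𝒬 ∧ i.2 ∈ J := fun i => by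
    rw [Set.Finite.mem_toFinset]; rfl
  refine ⟨(h.1.prod hJf).toFinset, fun i hi => ((hmem i).1 hi).1, fun x hx hxS => ?_⟩
  obtain ⟨ν, hν, ⟨p, hp, hxp, hνp⟩, Q, hQ, -, ρ, hρ, hsub⟩ := h.exists_isFlatPoint h𝒜 hx hxS
  have hxp' : ⟪p.1, x⟫ = p.2 := hxp
  rcases hνp with rfl | rfl
  · exact ⟨(Q, p), (hmem _).2 ⟨hQ, Or.inl hp⟩, hx, hν, hxp', ρ, hρ, hsub⟩
  · exact ⟨(Q, (-p.1, -p.2)), (hmem _).2 ⟨hQ, Or.inr ⟨p, hp, rfl⟩⟩, hx, hν,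
      by simp only [inner_neg_left, hxp'], ρ, hρ, hsub⟩

/-- `H¹` functions on a polyhedral body have traces. -/
theorem IsBody.exists_hasTrace {𝒜 : Finset (E (n + 1) × ℝ)} {𝒬 : Set (Set (E (n + 1)))}
    (h : IsBody 𝒜 𝒬 A) (h𝒜 : IsArrangement 𝒜) {w : E (n + 1) → ℝ} (hw : MemH1 (interior A) w) :
    ∃ g, HasTrace A w g := by
  classical
  have hA := h.isFlatBody h𝒜
  obtain ⟨hw2, Gw, hGw⟩ := hw
  have hfin : IsFiniteMeasure (volume.restrict (interior A)) :=
    ⟨by rw [Measure.restrict_apply_univ]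
        exact (measure_mono _root_.interior_subset).trans_lt hA.isCompact.measure_lt_top⟩
  -- At a flat point the direction −ν gives a local limit. The size of its domain degenerates
  -- towards the edges, so square integrability is obtained separately from oblique directions.
  obtain ⟨g, hg, hlim⟩ := hA.exists_hasLimit (W := fun _ => w) (fun _ => hw2.1) (by
    intro x ν hx
    obtain ⟨R, hR, -, hR'⟩ := hA.exists_radius hx
    obtain ⟨ρ, hρ, g, hgi, hl⟩ := exists_trace_halfBall hx.1 (x := x) hR (e := -ν)
      (by rw [inner_neg_right, real_inner_self_eq_norm_sq, hx.1]; norm_num) isOpen_interior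
      (hR' R le_rfl).1 (hw2.integrable one_le_two) ((hGw.1.inner_const (-ν)).integrable one_le_two)
      (hGw.2 (-ν))
    obtain ⟨r, hr, hrρ, hl'⟩ := hl.exists_indicator hA hx hρ
    exact ⟨r, hr, g, hgi.1.mono_set (disc_mono hrρ), hl'⟩)
  refine ⟨g, (memLp_two_iff_lintegral hg).2 ?_, hlim⟩
  have hcpt : IsCompact (frontier A) :=
    h.isCompact.of_isClosed_subset isClosed_frontier h.isClosed.frontier_subset
  -- the finitely many pieces of the boundary
  obtain ⟨I, hIQ, hI⟩ := h.exists_pieces h𝒜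
  have hcov : frontier A ⊆ skeleton 𝒜 ∪ ⋃ i ∈ I, bodyPiece A i := by
    intro x hx
    by_cases hxS : x ∈ skeleton 𝒜
    · exact Or.inl hxS
    · obtain ⟨i, hi, hxi⟩ := hI x hx hxS
      exact Or.inr (mem_biUnion (s := {i | i ∈ I}) hi hxi)
  refine hcpt.induction_on (p := fun s => ∫⁻ x in s, ‖g x‖ₑ ^ 2 ∂(surf (n + 1)) < ⊤) (by simp)
    (fun s t hst ht => (lintegral_mono_set hst).trans_lt ht)
    (fun s t hs ht => (lintegral_union_le _ _ _).trans_lt (ENNReal.add_lt_top.2 ⟨hs, ht⟩)) ?_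
  intro y₀ _
  have hloc : ∀ i ∈ I, ∃ r > 0,
      ∫⁻ y in bodyPiece A i ∩ Metric.ball y₀ r, ‖g y‖ₑ ^ 2 ∂(surf (n + 1)) < ⊤ := by
    intro i hi
    have hQ := hIQ i hi
    obtain ⟨h1, h2, h3, -⟩ := h.2.2 _ hQ
    exact exists_lintegral_piece_lt_top hA h1 h2.isClosed h3 (h.interior_subset hQ) hw2 hGw hg hlim
      i.2.1 i.2.2 y₀
  choose! r hr hint using hloc
  refine ⟨frontier A ∩ ⋂ i ∈ I, Metric.ball y₀ (r i), ?_, ?_⟩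
  · refine inter_mem_nhdsWithin _ ((Filter.biInter_finset_mem I).2 fun i hi => ?_)
    exact Metric.ball_mem_nhds y₀ (hr i hi)
  · have hsub : frontier A ∩ ⋂ i ∈ I, Metric.ball y₀ (r i) ⊆
        skeleton 𝒜 ∪ ⋃ i ∈ I, (bodyPiece A i ∩ Metric.ball y₀ (r i)) := by
      rintro x ⟨hx, hxb⟩
      rcases hcov hx with h | h
      · exact Or.inl h
      · obtain ⟨i, hi, hxi⟩ := mem_iUnion₂.1 h
        exact Or.inr (mem_iUnion₂.2 ⟨i, hi, hxi, mem_iInter₂.1 hxb i hi⟩)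
    refine (lintegral_mono_set hsub).trans_lt ((lintegral_union_le _ _ _).trans_lt
      (ENNReal.add_lt_top.2 ⟨?_, lintegral_biUnion_finset_lt_top hint⟩))
    rw [Measure.restrict_eq_zero.2 (surf_skeleton h𝒜), lintegral_zero_measure]
    exact ENNReal.zero_lt_top

/-- A vector field whose components are in `H¹` has a trace. -/
theorem IsBody.exists_hasTrace_of_components {𝒜 : Finset (E (n + 1) × ℝ)}
    {𝒬 : Set (Set (E (n + 1)))} (h : IsBody 𝒜 𝒬 A) (h𝒜 : IsArrangement 𝒜)
    {q : E (n + 1) → E (n + 1)} (hq : ∀ i, MemH1 (interior A) fun x => q x i) :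
    ∃ g, HasTrace A q g := by
  have hA := h.isFlatBody h𝒜
  choose g hg using fun i => h.exists_hasTrace h𝒜 (hq i)
  let L : Fin (n + 1) → ℝ →L[ℝ] E (n + 1) := fun i =>
    (ContinuousLinearMap.id ℝ ℝ).smulRight (EuclideanSpace.single i 1)
  have hL : ∀ i, MemLp (fun y => L i (g i y)) 2 ((surf (n + 1)).restrict (frontier A)) :=
    fun i => (L i).comp_memLp' (hg i).1
  have hsum := HasLimit.sum Finset.univ (W := fun i _ x => L i (q x i))
    (g := fun i y => L i (g i y)) (fun i _ => HasLimit.clm (L i) (hg i).2) hA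
    (fun i _ _ => (L i).continuous.comp_aestronglyMeasurable (hq i).1.1) (fun i _ => (hL i).1)
  refine ⟨fun y => ∑ i, L i (g i y), memLp_finsetSum _ fun i _ => hL i, hsum.congr_left hA
    fun _ => Eventually.of_forall fun p => ?_⟩
  have := (EuclideanSpace.basisFun (Fin (n + 1)) ℝ).sum_repr (q p)
  simpa [L] using this

/-- A bounded vector field whose components have integrable partial derivatives has a normal
trace. -/
theorem IsFlatBody.exists_hasNormalTrace (hA : IsFlatBody A) {c : E (n + 1) → E (n + 1)}
    (hc : MemLp c ⊤ (volume.restrict (interior A)))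
    (hD : ∀ j : Fin (n + 1), ∃ D : E (n + 1) → ℝ, IntegrableOn D (interior A) ∧
      HasWeakDeriv (interior A) (fun x => c x j) (EuclideanSpace.single j 1) D) :
    ∃ b, HasNormalTrace A c b := by
  have hfin : IsFiniteMeasure (volume.restrict (interior A)) :=
    ⟨by rw [Measure.restrict_apply_univ]
        exact (measure_mono _root_.interior_subset).trans_lt hA.isCompact.measure_lt_top⟩
  have hfin' := hA.isFiniteMeasure
  choose D hDi hDw using hD
  have hci : Integrable c (volume.restrict (interior A)) := hc.integrable le_top
  have hcj : ∀ j, IntegrableOn (fun x => c x j) (interior A) := fun j =>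
    (EuclideanSpace.proj (𝕜 := ℝ) j).integrable_comp hci
  obtain ⟨b, hb, hlim⟩ := hA.exists_hasLimit (W := fun ν x => ⟪c x, ν⟫)
    (fun ν => hci.1.inner aestronglyMeasurable_const) (by
    intro x ν hx
    obtain ⟨R, hR, -, hR'⟩ := hA.exists_radius hx
    have hj : ∀ j, ∃ ρ > 0, ∃ g : E (n + 1) → ℝ,
        AEStronglyMeasurable g ((surf (n + 1)).restrict (disc x ν ρ)) ∧
        NormalLimit ν (disc x ν ρ) (fun p => ν j * (interior A).indicator (fun x => c x j) p) g := by
      intro j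
      -- A component with ν_j = 0 does not enter c·ν, and its coordinate direction is tangential.
      -- Otherwise −ν_j times the j-th basis vector points inwards, and the derivative of c_j in
      -- that direction is available.
      by_cases hνj : ν j = 0
      · refine ⟨1, one_pos, 0, aestronglyMeasurable_const, ?_⟩
        simp [hνj, NormalLimit, AvgZero]
      · obtain ⟨ρ, hρ, g, hgi, hl⟩ := exists_trace_halfBall hx.1 (x := x) hR
          (e := (-ν j) • EuclideanSpace.single j 1)
          (by
            rw [inner_smul_right, EuclideanSpace.inner_single_right]
            have : 0 < ν j * ν j := mul_self_pos.2 hνj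
            simp only [one_mul, conj_trivial]
            linarith) isOpen_interior
          (hR' R le_rfl).1 (hcj j) ((hDi j).const_mul (-ν j)) ((hDw j).smul (-ν j))
        obtain ⟨r, hr, hrρ, hl'⟩ := hl.exists_indicator hA hx hρ
        refine ⟨r, hr, fun y => ν j * g y, (hgi.1.mono_set (disc_mono hrρ)).const_mul _, ?_⟩
        exact hl'.clm (ν j • ContinuousLinearMap.id ℝ ℝ)
    choose ρ hρ g hgm hl using hj
    set r := Finset.univ.inf' Finset.univ_nonempty ρ
    have hr : 0 < r := (Finset.lt_inf'_iff _).2 fun j _ => hρ j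
    have hrj : ∀ j, r ≤ ρ j := fun j => Finset.inf'_le _ (Finset.mem_univ j)
    refine ⟨r, hr, fun y => ∑ j, g j y, ?_, ?_⟩
    · exact Finset.aestronglyMeasurable_fun_sum _ fun j _ => (hgm j).mono_set (disc_mono (hrj j))
    · have := NormalLimit.sum Finset.univ (fun j _ => (hl j).mono (disc_mono (hrj j))) hx.1
        (disc_subset_plane x ν r)
        (fun j _ => (aestronglyMeasurable_indicator_interior (hcj j).1).const_mul _)
        (fun j _ => (hgm j).mono_set (disc_mono (hrj j)))
      refine this.congr_left one_pos (measurableSet_disc _ _ _) fun y _ t _ => ?_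
      generalize y - t • ν = p
      by_cases hp : p ∈ interior A
      · simp [hp, PiLp.inner_apply]
      · simp [hp])
  refine ⟨b, ?_, hlim⟩
  -- The limit inherits the essential bound of c, and on a boundary of finite surface measure
  -- bounded functions are square integrable.
  set Mc := eLpNorm c ⊤ (volume.restrict (interior A)) with hMc
  have hbM : ∀ᵐ y ∂((surf (n + 1)).restrict (frontier A)), ‖b y‖ₑ ≤ Mc := by
    refine hlim.enorm_le hA hb fun ν hν => ?_
    filter_upwards [enorm_ae_le_eLpNormEssSup c (volume.restrict (interior A))] with p hp
    rw [hMc, eLpNorm_exponent_top]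
    refine le_trans ?_ hp
    have := norm_inner_le_norm (𝕜 := ℝ) (c p) ν
    rw [hν, mul_one] at this
    exact enorm_le_iff_norm_le.2 this
  refine MemLp.of_bound hb Mc.toReal ?_
  filter_upwards [hbM] with y hy
  rw [← ofReal_norm] at hy
  exact (ENNReal.ofReal_le_iff_le_toReal hc.2.ne).1 hy

end Existence

end IPG

namespace IPG

/-! ### Test functions -/

theorem IsTest.mul_left {d : ℕ} {U : Set (E d)} {φ χ : E d → ℝ} (hφ : IsTest U φ)
    (hχ : ContDiff ℝ ∞ χ) : IsTest U (fun x => χ x * φ x) :=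
  ⟨hχ.mul hφ.1, hφ.2.1.mul_left, (tsupport_mul_subset_right (f := χ) (g := φ)).trans hφ.2.2⟩

/-- A smooth function which is one near a compact set, with compact support in an open set. -/
theorem exists_isTest_one {d : ℕ} {K O : Set (E d)} (hK : IsCompact K) (hO : IsOpen O)
    (hKO : K ⊆ O) : ∃ χ, IsTest O χ ∧ ∀ᶠ x in 𝓝ˢ K, χ x = 1 := by
  obtain ⟨L, hL, hKL, hLO⟩ := exists_compact_between hK hO hKO
  obtain ⟨f, hf1, hf0, -⟩ := exists_contMDiffMap_one_nhds_of_subset_interior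
    (n := (⊤ : ℕ∞)) (modelWithCornersSelf ℝ (E d)) hK.isClosed hKL
  have hsupp : tsupport f ⊆ L := closure_minimal (fun x hx => by
    by_contra h; exact hx (hf0 x h)) hL.isClosed
  exact ⟨f, ⟨f.contMDiff.contDiff, hL.of_isClosed_subset (isClosed_tsupport f) hsupp,
    hsupp.trans hLO⟩, hf1⟩

/-- A partition of unity for two sets: χ is one near the compact part of the support outside O₂, so
multiplication by 1 − χ pushes the support into O₂. -/
theorem IsTest.exists_add {d : ℕ} {O₁ O₂ : Set (E d)} (h₁ : IsOpen O₁) (h₂ : IsOpen O₂)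
    {φ : E d → ℝ} (hφ : IsTest (O₁ ∪ O₂) φ) :
    ∃ φ₁ φ₂, IsTest O₁ φ₁ ∧ IsTest O₂ φ₂ ∧ φ = fun x => φ₁ x + φ₂ x := by
  have hK : IsCompact (tsupport φ \ O₂) := hφ.2.1.diff h₂
  obtain ⟨χ, hχ, hχ1⟩ := exists_isTest_one hK h₁ fun x hx => (hφ.2.2 hx.1).resolve_right hx.2
  refine ⟨fun x => φ x * χ x, fun x => (1 - χ x) * φ x, hχ.mul_left hφ.1,
    ⟨(contDiff_const.sub hχ.1).mul hφ.1, hφ.2.1.mul_left, fun x hx => ?_⟩, by funext x; ring⟩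
  have hxφ := tsupport_mul_subset_right (f := fun x => 1 - χ x) (g := φ) hx
  have hxχ := tsupport_mul_subset_left (f := fun x => 1 - χ x) (g := φ) hx
  by_contra hxO
  rw [eventually_nhdsSet_iff_forall] at hχ1
  have h1 := hχ1 x ⟨hxφ, hxO⟩
  refine notMem_tsupport_iff_eventuallyEq.2 ?_ hxχ
  filter_upwards [h1] with y hy
  simp [hy]

/-- An additive property of test functions may be checked locally. -/
theorem IsTest.induction_local {d : ℕ} {U : Set (E d)} {P : (E d → ℝ) → Prop}
    (hzero : P fun _ => 0)
    (hadd : ∀ φ ψ, IsTest U φ → IsTest U ψ → P φ → P ψ → P fun x => φ x + ψ x)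
    (hloc : ∀ x ∈ U, ∃ r > 0, ∀ φ, IsTest (Metric.ball x r ∩ U) φ → P φ) (hU : IsOpen U)
    {φ : E d → ℝ} (hφ : IsTest U φ) : P φ := by
  have key : ∃ O, IsOpen O ∧ tsupport φ ⊆ O ∧ ∀ ψ, IsTest (O ∩ U) ψ → P ψ := by
    refine hφ.2.1.isCompact.induction_on (p := fun s => ∃ O, IsOpen O ∧ s ⊆ O ∧
      ∀ ψ, IsTest (O ∩ U) ψ → P ψ) ?_ ?_ ?_ ?_
    · refine ⟨∅, isOpen_empty, subset_rfl, fun ψ hψ => ?_⟩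
      have : ψ = fun _ => 0 := funext fun x => hψ.eq_zero (by simp)
      rw [this]; exact hzero
    · rintro s t hst ⟨O, hO, htO, h⟩
      exact ⟨O, hO, hst.trans htO, h⟩
    · rintro s t ⟨O, hO, hs, h⟩ ⟨O', hO', ht, h'⟩
      refine ⟨O ∪ O', hO.union hO', union_subset_union hs ht, fun ψ hψ => ?_⟩
      rw [union_inter_distrib_right] at hψ
      obtain ⟨ψ₁, ψ₂, h1, h2, rfl⟩ := hψ.exists_add (hO.inter hU) (hO'.inter hU)
      exact hadd _ _ (h1.mono inter_subset_right) (h2.mono inter_subset_right) (h _ h1) (h' _ h2)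
    · intro x hx
      obtain ⟨r, hr, h⟩ := hloc x (hφ.2.2 hx)
      exact ⟨_, mem_nhdsWithin_of_mem_nhds (Metric.ball_mem_nhds x hr), _, Metric.isOpen_ball,
        subset_rfl, h⟩
  obtain ⟨O, -, hO, h⟩ := key
  exact h φ ⟨hφ.1, hφ.2.1, subset_inter hO hφ.2.2⟩

/-! ### Neighbourhoods of intersections of two hyperplanes -/

theorem isClosed_slab {d : ℕ} (p : E d) (a δ : ℝ) : IsClosed {y : E d | |⟪p, y⟫ - a| ≤ δ} := by
  have : Continuous fun y : E d => |⟪p, y⟫ - a| := by fun_prop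
  exact isClosed_le this continuous_const

theorem isClosed_norm_le {d : ℕ} (R : ℝ) : IsClosed {y : E d | ‖y‖ ≤ R} :=
  isClosed_le continuous_norm continuous_const

/-- In coordinates adapted to ν the set lies in the product of a ball with an interval of length 2δ.
-/
theorem volume_slab_le {m : ℕ} {ν : E (m + 1)} (hν : ‖ν‖ = 1) (R c δ : ℝ) :
    volume {y : E (m + 1) | ‖y‖ ≤ R ∧ |⟪ν, y⟫ - c| ≤ δ} ≤
      volume (Metric.closedBall (0 : E m) R) * ENNReal.ofReal (2 * δ) := by
  obtain ⟨J, hJ⟩ := exists_isTangent hν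
  have hm := hJ.measurePreserving_flatMap 0
  have hcl : IsClosed {y : E (m + 1) | ‖y‖ ≤ R ∧ |⟪ν, y⟫ - c| ≤ δ} :=
    (isClosed_norm_le R).inter (isClosed_slab ν c δ)
  rw [← hm.measure_preimage hcl.measurableSet.nullMeasurableSet]
  have hsub : flatMap J 0 ν ⁻¹' {y : E (m + 1) | ‖y‖ ≤ R ∧ |⟪ν, y⟫ - c| ≤ δ} ⊆
      Metric.closedBall 0 R ×ˢ Icc (-c - δ) (-c + δ) := by
    rintro ⟨z, t⟩ ⟨h1, h2⟩
    have h3 : flatMap J 0 ν (z, t) = J z - t • ν := by simp [flatMap]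
    rw [h3] at h1 h2
    rw [inner_sub_right, hJ.2, inner_smul_right, real_inner_self_eq_norm_sq, hJ.1, abs_le] at h2
    have h4 : ‖J z - t • ν‖ ^ 2 = ‖z‖ ^ 2 + t ^ 2 := by
      rw [norm_sub_sq_real, inner_smul_right, real_inner_comm, hJ.2, norm_smul, hJ.1, J.norm_map,
        Real.norm_eq_abs, mul_one, sq_abs]
      ring
    refine ⟨?_, by linarith [h2.2], by linarith [h2.1]⟩
    rw [mem_closedBall_zero_iff]
    exact (abs_le_of_sq_le_sq' (by nlinarith [sq_nonneg t, norm_nonneg (J z - t • ν)])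
      ((norm_nonneg _).trans h1)).2
  refine (measure_mono hsub).trans (le_of_eq ?_)
  rw [Measure.volume_eq_prod, Measure.prod_prod, Real.volume_Icc]
  congr 2
  ring

/-- Slicing parallel to the first hyperplane leaves an interval of length 2δ of slices. Each is a
slab for the tangential part v of `q`, of width proportional to δ/‖v‖, which gives the order δ². -/
theorem exists_volume_tube_le {m : ℕ} {p q : E (m + 2)} (hp : ‖p‖ = 1)
    (hpq : LinearIndependent ℝ ![p, q]) (R : ℝ) :
    ∃ C : ℝ≥0∞, C ≠ ⊤ ∧ ∀ a b δ : ℝ,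
      volume {y : E (m + 2) | ‖y‖ ≤ R ∧ |⟪p, y⟫ - a| ≤ δ ∧ |⟪q, y⟫ - b| ≤ δ} ≤
        C * ENNReal.ofReal δ ^ 2 := by
  obtain ⟨J, hJ⟩ := exists_isTangent hp
  set v := J.toContinuousLinearMap.adjoint q with hv
  have hv0 : v ≠ 0 := hJ.adjoint_ne_zero hpq
  have hvn : 0 < ‖v‖ := norm_pos_iff.2 hv0
  set C₀ := volume (Metric.closedBall (0 : E m) R)
  refine ⟨C₀ * ENNReal.ofReal (2 / ‖v‖) * ENNReal.ofReal 2, ?_, fun a b δ => ?_⟩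
  · exact ENNReal.mul_ne_top (ENNReal.mul_ne_top (isCompact_closedBall _ _).measure_lt_top.ne
      ENNReal.ofReal_ne_top) ENNReal.ofReal_ne_top
  set S := {y : E (m + 2) | ‖y‖ ≤ R ∧ |⟪p, y⟫ - a| ≤ δ ∧ |⟪q, y⟫ - b| ≤ δ}
  have hm := hJ.measurePreserving_flatMap 0
  have hcl : IsClosed S :=
    (isClosed_norm_le R).inter ((isClosed_slab p a δ).inter (isClosed_slab q b δ))
  rw [← hm.measure_preimage hcl.measurableSet.nullMeasurableSet, Measure.volume_eq_prod,
    Measure.prod_apply_symm (hm.measurable hcl.measurableSet)]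
  have hslice : ∀ t : ℝ, volume ((fun z => (z, t)) ⁻¹' (flatMap J 0 p ⁻¹' S)) ≤
      (Icc (-a - δ) (-a + δ)).indicator (fun _ => C₀ * ENNReal.ofReal (2 * (δ / ‖v‖))) t := by
    intro t
    have hmem : ∀ z, (z, t) ∈ flatMap J 0 p ⁻¹' S → t ∈ Icc (-a - δ) (-a + δ) ∧
        (‖z‖ ≤ R ∧ |⟪‖v‖⁻¹ • v, z⟫ - (b + t * ⟪q, p⟫) / ‖v‖| ≤ δ / ‖v‖) := by
      rintro z ⟨h1, h2, h5⟩
      have h3 : flatMap J 0 p (z, t) = J z - t • p := by simp [flatMap]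
      rw [h3] at h1 h2 h5
      rw [inner_sub_right, hJ.2, inner_smul_right, real_inner_self_eq_norm_sq, hJ.1, abs_le] at h2
      have h4 : ‖J z - t • p‖ ^ 2 = ‖z‖ ^ 2 + t ^ 2 := by
        rw [norm_sub_sq_real, inner_smul_right, real_inner_comm, hJ.2, norm_smul, hJ.1, J.norm_map,
          Real.norm_eq_abs, mul_one, sq_abs]
        ring
      refine ⟨⟨by linarith [h2.2], by linarith [h2.1]⟩, ?_, ?_⟩
      · exact (abs_le_of_sq_le_sq' (by nlinarith [sq_nonneg t, norm_nonneg (J z - t • p)])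
          ((norm_nonneg _).trans h1)).2
      · have h6 : ⟪‖v‖⁻¹ • v, z⟫ - (b + t * ⟪q, p⟫) / ‖v‖ = (⟪q, J z - t • p⟫ - b) / ‖v‖ := by
          rw [real_inner_smul_left, hv, ContinuousLinearMap.adjoint_inner_left, inner_sub_right,
            inner_smul_right, LinearIsometry.coe_toContinuousLinearMap]
          field_simp
          ring
        rw [h6, abs_div, abs_of_pos hvn]
        gcongr
    by_cases ht : t ∈ Icc (-a - δ) (-a + δ)
    · rw [indicator_of_mem ht]
      refine (measure_mono fun z hz => (hmem z hz).2).trans (volume_slab_le ?_ _ _ _)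
      rw [norm_smul, norm_inv, norm_norm, inv_mul_cancel₀ hvn.ne']
    · have : ((fun z => (z, t)) ⁻¹' (flatMap J 0 p ⁻¹' S)) = ∅ := by
        ext z
        simp only [mem_empty_iff_false, iff_false]
        exact fun hz => ht (hmem z hz).1
      rw [this, measure_empty]
      exact zero_le
  refine (lintegral_mono hslice).trans (le_of_eq ?_)
  rw [lintegral_indicator_const measurableSet_Icc, Real.volume_Icc]
  have e1 : -a + δ - (-a - δ) = 2 * δ := by ring
  have e2 : 2 * (δ / ‖v‖) = (2 / ‖v‖) * δ := by ring
  rw [e1, e2, ENNReal.ofReal_mul (by positivity), ENNReal.ofReal_mul (by norm_num)]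
  ring

/-! ### Cutoff functions -/

/-- Smooth functions which vanish near `N`, converge to one off `N`, and whose gradients are
negligible against square integrable fields on `V`. -/
structure IsCutoff {d : ℕ} (V N : Set (E d)) (ψ : ℕ → E d → ℝ) : Prop where
  contDiff : ∀ k, ContDiff ℝ ∞ (ψ k)
  mem_Icc : ∀ k x, ψ k x ∈ Icc (0 : ℝ) 1
  eq_zero : ∀ k, ∃ O, IsOpen O ∧ N ⊆ O ∧ ∀ x ∈ O, ψ k x = 0
  tendsto : ∀ x ∉ N, Tendsto (fun k => ψ k x) atTop (𝓝 1)
  grad : ∀ q : E d → E d, MemLp q 2 (volume.restrict V) →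
    Tendsto (fun k => ∫⁻ x in V, ‖fderiv ℝ (ψ k) x‖ₑ * ‖q x‖ₑ) atTop (𝓝 0)

theorem isCutoff_empty {d : ℕ} (V : Set (E d)) : IsCutoff V ∅ (fun _ _ => 1) where
  contDiff _ := contDiff_const
  mem_Icc _ _ := ⟨zero_le_one, le_rfl⟩
  eq_zero _ := ⟨∅, isOpen_empty, subset_rfl, fun _ h => absurd h (notMem_empty _)⟩
  tendsto _ _ := tendsto_const_nhds
  grad q _ := by
    have : ∀ x, fderiv ℝ (fun _ : E d => (1 : ℝ)) x = 0 := fun x => by simp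
    simp_rw [this, ← ofReal_norm, norm_zero, ENNReal.ofReal_zero, zero_mul, lintegral_zero]
    exact tendsto_const_nhds

/-- As both factors take values in [0, 1], the gradient of the product is at most the sum of the
gradients. -/
theorem IsCutoff.mul {d : ℕ} {V N N' : Set (E d)} {ψ ψ' : ℕ → E d → ℝ} (h : IsCutoff V N ψ)
    (h' : IsCutoff V N' ψ') : IsCutoff V (N ∪ N') (fun k x => ψ k x * ψ' k x) where
  contDiff k := (h.contDiff k).mul (h'.contDiff k)
  mem_Icc k x := ⟨mul_nonneg (h.mem_Icc k x).1 (h'.mem_Icc k x).1,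
    mul_le_one₀ (h.mem_Icc k x).2 (h'.mem_Icc k x).1 (h'.mem_Icc k x).2⟩
  eq_zero k := by
    obtain ⟨O, hO, hN, h0⟩ := h.eq_zero k
    obtain ⟨O', hO', hN', h0'⟩ := h'.eq_zero k
    refine ⟨O ∪ O', hO.union hO', union_subset_union hN hN', ?_⟩
    rintro x (hx | hx)
    · rw [h0 x hx, zero_mul]
    · rw [h0' x hx, mul_zero]
  tendsto x hx := by
    have := (h.tendsto x fun hx' => hx (Or.inl hx')).mul (h'.tendsto x fun hx' => hx (Or.inr hx'))
    rwa [one_mul] at this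
  grad q hq := by
    have h0 := (h.grad q hq).add (h'.grad q hq)
    rw [add_zero] at h0
    refine tendsto_of_tendsto_of_tendsto_of_le_of_le tendsto_const_nhds h0 (fun _ => zero_le)
      fun k => ?_
    have hm : AEMeasurable (fun x => ‖fderiv ℝ (ψ k) x‖ₑ * ‖q x‖ₑ) (volume.restrict V) :=
      (((h.contDiff k).continuous_fderiv (by simp)).enorm.aemeasurable).mul hq.1.enorm
    dsimp only
    rw [← lintegral_add_left' hm]
    refine lintegral_mono fun x => ?_
    rw [← add_mul]
    gcongr
    have hd := ((h.contDiff k).differentiable (by simp)).differentiableAt (x := x)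
    have hd' := ((h'.contDiff k).differentiable (by simp)).differentiableAt (x := x)
    rw [fderiv_fun_mul hd hd', ← ofReal_norm, ← ofReal_norm, ← ofReal_norm,
      ← ENNReal.ofReal_add (norm_nonneg _) (norm_nonneg _)]
    refine ENNReal.ofReal_le_ofReal ((norm_add_le _ _).trans ?_)
    obtain ⟨h1, h2⟩ := h.mem_Icc k x
    obtain ⟨h3, h4⟩ := h'.mem_Icc k x
    rw [norm_smul, norm_smul, Real.norm_of_nonneg h1, Real.norm_of_nonneg h3, add_comm]
    exact add_le_add (mul_le_of_le_one_left (norm_nonneg _) h4)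
      (mul_le_of_le_one_left (norm_nonneg _) h2)

theorem exists_isCutoff_biUnion {d : ℕ} {ι : Type*} {V : Set (E d)} (s : Finset ι)
    {N : ι → Set (E d)} (h : ∀ i ∈ s, ∃ ψ, IsCutoff V (N i) ψ) :
    ∃ ψ, IsCutoff V (⋃ i ∈ s, N i) ψ := by
  classical
  induction s using Finset.induction_on with
  | empty => exact ⟨_, by simpa using isCutoff_empty V⟩
  | insert a s ha ih =>
    obtain ⟨ψ, hψ⟩ := h a (Finset.mem_insert_self a s)
    obtain ⟨ψ', hψ'⟩ := ih fun i hi => h i (Finset.mem_insert_of_mem hi)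
    rw [Finset.set_biUnion_insert]
    exact ⟨_, hψ.mul hψ'⟩

/-- A set of codimension two has zero H¹ capacity up to boundedness: the gradient of the k-th cutoff
is of order k and lives on a tube of volume of order k⁻². Its L² norm stays bounded, while the L²
mass of a fixed field on the tubes tends to zero. -/
theorem exists_isCutoff_pair {m : ℕ} {p q : E (m + 2) × ℝ} (hp : ‖p.1‖ = 1) (hq : ‖q.1‖ = 1)
    (hpq : LinearIndependent ℝ ![p.1, q.1]) {V : Set (E (m + 2))} (hV : Bornology.IsBounded V) :
    ∃ ψ, IsCutoff V (hyper p ∩ hyper q) ψ := by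
  set F : E (m + 2) → ℝ := fun x => (⟪p.1, x⟫ - p.2) ^ 2 + (⟪q.1, x⟫ - q.2) ^ 2 with hF
  have hFc : ContDiff ℝ ∞ F := by
    have h1 : ∀ r : E (m + 2) × ℝ, ContDiff ℝ ∞ fun x : E (m + 2) => (⟪r.1, x⟫ - r.2) ^ 2 := fun r =>
      ((contDiff_const.inner ℝ contDiff_id).sub contDiff_const).pow 2
    exact (h1 p).add (h1 q)
  have hFd : ∀ x, ‖fderiv ℝ F x‖ ≤ 2 * |⟪p.1, x⟫ - p.2| + 2 * |⟪q.1, x⟫ - q.2| := by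
    intro x
    have h1 : ∀ r : E (m + 2) × ℝ, HasFDerivAt (fun x : E (m + 2) => (⟪r.1, x⟫ - r.2) ^ 2)
        ((2 * (⟪r.1, x⟫ - r.2)) • innerSL ℝ r.1) x := by
      intro r
      have h2 : HasFDerivAt (fun x : E (m + 2) => ⟪r.1, x⟫ - r.2) (innerSL ℝ r.1) x :=
        (innerSL ℝ r.1).hasFDerivAt.sub_const r.2
      simpa using h2.pow 2
    have h3 := ((h1 p).add (h1 q)).fderiv
    have h4 : fderiv ℝ F x = (2 * (⟪p.1, x⟫ - p.2)) • innerSL ℝ p.1 +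
        (2 * (⟪q.1, x⟫ - q.2)) • innerSL ℝ q.1 := h3
    rw [h4]
    refine (norm_add_le _ _).trans (le_of_eq ?_)
    rw [norm_smul, norm_smul, innerSL_apply_norm, innerSL_apply_norm, hp, hq, norm_mul, norm_mul]
    simp
  obtain ⟨C, hC⟩ := exists_deriv_step_bound
  have hC0 : 0 ≤ C := (norm_nonneg _).trans (hC 0)
  obtain ⟨R, hR⟩ := hV.subset_closedBall (0 : E (m + 2))
  obtain ⟨B, hB, hBv⟩ := exists_volume_tube_le hp hpq R
  set κ : ℕ → ℝ := fun k => (k + 1 : ℝ) with hκ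
  have hκ0 : ∀ k, 0 < κ k := fun k => by positivity
  set T : ℕ → Set (E (m + 2)) := fun k =>
    {y | |⟪p.1, y⟫ - p.2| ≤ (κ k)⁻¹ ∧ |⟪q.1, y⟫ - q.2| ≤ (κ k)⁻¹} with hT
  have hTm : ∀ k, MeasurableSet (T k) := fun k =>
    ((isClosed_slab p.1 p.2 _).inter (isClosed_slab q.1 q.2 _)).measurableSet
  have hTv : ∀ k, volume.restrict V (T k) ≤ B * ENNReal.ofReal (κ k)⁻¹ ^ 2 := by
    intro k
    rw [Measure.restrict_apply (hTm k)]
    refine (measure_mono fun y hy => ?_).trans (hBv p.2 q.2 (κ k)⁻¹)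
    exact ⟨mem_closedBall_zero_iff.1 (hR hy.2), hy.1⟩
  set ψ : ℕ → E (m + 2) → ℝ := fun k x => step (κ k ^ 2 * F x) with hψ
  have hψc : ∀ k, ContDiff ℝ ∞ (ψ k) := fun k => step_contDiff.comp (contDiff_const.mul hFc)
  -- In the transition region both linear forms are at most κ⁻¹ in absolute value, so ‖∇F‖ ≤ 4κ⁻¹,
  -- and the chain rule gives C · κ² · 4κ⁻¹.
  have hψd : ∀ k x, ‖fderiv ℝ (ψ k) x‖ₑ ≤
      (T k).indicator (fun _ => ENNReal.ofReal (4 * C * κ k)) x := by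
    intro k x
    have h1 : HasFDerivAt (ψ k) (deriv step (κ k ^ 2 * F x) • (κ k ^ 2 • fderiv ℝ F x)) x :=
      ((step_contDiff.differentiable (by simp)).differentiableAt.hasDerivAt).comp_hasFDerivAt x
        (((hFc.differentiable (by simp)).differentiableAt.hasFDerivAt).const_mul (κ k ^ 2))
    rw [h1.fderiv]
    by_cases hs : κ k ^ 2 * F x ∈ Ioo (0 : ℝ) 1
    swap
    · rw [deriv_step_eq_zero hs, zero_smul, ← ofReal_norm, norm_zero, ENNReal.ofReal_zero]
      exact zero_le
    have h2 : F x < (κ k)⁻¹ ^ 2 := by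
      rw [inv_pow, ← one_div, lt_div_iff₀ (by have := hκ0 k; positivity), mul_comm]; exact hs.2
    have hk := inv_pos.2 (hκ0 k)
    have h3 : |⟪p.1, x⟫ - p.2| ≤ (κ k)⁻¹ :=
      abs_le_of_sq_le_sq (by simp only [hF] at h2; nlinarith [sq_nonneg (⟪q.1, x⟫ - q.2)]) hk.le
    have h4 : |⟪q.1, x⟫ - q.2| ≤ (κ k)⁻¹ :=
      abs_le_of_sq_le_sq (by simp only [hF] at h2; nlinarith [sq_nonneg (⟪p.1, x⟫ - p.2)]) hk.le
    have hxT : x ∈ T k := ⟨h3, h4⟩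
    rw [indicator_of_mem hxT, ← ofReal_norm]
    refine ENNReal.ofReal_le_ofReal ?_
    rw [norm_smul, norm_smul, norm_pow, Real.norm_of_nonneg (hκ0 k).le]
    have h5 := (hFd x).trans (show _ ≤ 4 * (κ k)⁻¹ by linarith)
    calc ‖deriv step (κ k ^ 2 * F x)‖ * (κ k ^ 2 * ‖fderiv ℝ F x‖)
        ≤ C * (κ k ^ 2 * (4 * (κ k)⁻¹)) := by
          have := hC (κ k ^ 2 * F x)
          gcongr
      _ = 4 * C * κ k := by
          have := (hκ0 k).ne'
          field_simp
  have hκtop : Tendsto κ atTop atTop :=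
    tendsto_atTop_add_const_right _ _ tendsto_natCast_atTop_atTop
  refine ⟨ψ, hψc, fun k x => ⟨step_nonneg _, step_le_one _⟩, fun k => ?_, fun x hx => ?_,
    fun w hw => ?_⟩
  · refine ⟨{x | κ k ^ 2 * F x < 1 / 2}, isOpen_lt (continuous_const.mul hFc.continuous)
      continuous_const, fun x hx => ?_, fun x hx => step_eq_zero (le_of_lt hx)⟩
    have h1 : ⟪p.1, x⟫ = p.2 := hx.1
    have h2 : ⟪q.1, x⟫ = q.2 := hx.2
    simp [hF, h1, h2]
  · have hF0 : 0 < F x := by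
      rcases not_and_or.1 hx with h | h
      · have : ⟪p.1, x⟫ - p.2 ≠ 0 := fun h' => h (sub_eq_zero.1 h')
        simp only [hF]; positivity
      · have : ⟪q.1, x⟫ - q.2 ≠ 0 := fun h' => h (sub_eq_zero.1 h')
        simp only [hF]; positivity
    have h1 : Tendsto (fun k => κ k ^ 2 * F x) atTop atTop :=
      ((tendsto_pow_atTop two_ne_zero).comp hκtop).atTop_mul_const hF0
    refine tendsto_const_nhds.congr' ?_
    filter_upwards [h1.eventually_ge_atTop 1] with k hk
    exact (step_eq_one hk).symm
  · have hinv : Tendsto (fun k => ENNReal.ofReal (κ k)⁻¹) atTop (𝓝 0) := by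
      have := ENNReal.tendsto_ofReal (tendsto_inv_atTop_zero.comp hκtop)
      simpa using this
    have hTlim : Tendsto ((volume.restrict V) ∘ T) atTop (𝓝 0) := by
      have h1 : Tendsto (fun k => B * ENNReal.ofReal (κ k)⁻¹ ^ 2) atTop (𝓝 (B * 0 ^ 2)) :=
        ENNReal.Tendsto.const_mul (ENNReal.Tendsto.pow hinv) (Or.inr hB)
      rw [zero_pow two_ne_zero, mul_zero] at h1
      exact tendsto_of_tendsto_of_tendsto_of_le_of_le tendsto_const_nhds h1 (fun _ => zero_le) hTv
    have hw2 := (memLp_two_iff_lintegral hw.1).1 hw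
    have hlim := tendsto_setLIntegral_zero hw2.ne hTlim
    set c₁ := ENNReal.ofReal (4 * C) ^ 2 * B with hc₁
    have hc₁' : c₁ ≠ ⊤ := ENNReal.mul_ne_top (ENNReal.pow_ne_top ENNReal.ofReal_ne_top) hB
    have hlim' := ENNReal.Tendsto.const_mul hlim (a := c₁) (Or.inr hc₁')
    rw [mul_zero] at hlim'
    -- By Cauchy–Schwarz on the tube, the square of the gradient bound and the volume of the tube
    -- cancel in κ, and only the L² mass of the field on the tube survives.
    have hsq : ∀ k, (∫⁻ x in V, ‖fderiv ℝ (ψ k) x‖ₑ * ‖w x‖ₑ) ^ 2 ≤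
        c₁ * ∫⁻ x in T k, ‖w x‖ₑ ^ 2 ∂(volume.restrict V) := by
      intro k
      have h1 : ∫⁻ x in V, ‖fderiv ℝ (ψ k) x‖ₑ * ‖w x‖ₑ ≤
          ENNReal.ofReal (4 * C * κ k) * ∫⁻ x in T k, ‖w x‖ₑ ∂(volume.restrict V) := by
        rw [← lintegral_const_mul' _ _ ENNReal.ofReal_ne_top, ← lintegral_indicator (hTm k)]
        refine lintegral_mono fun x => ?_
        refine (mul_le_mul_left (hψd k x) _).trans (le_of_eq ?_)
        by_cases hx : x ∈ T k <;> simp [hx]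
      have h2 := sq_lintegral_le (μ := (volume.restrict V).restrict (T k)) hw.1.enorm.restrict
      rw [Measure.restrict_apply_univ] at h2
      calc (∫⁻ x in V, ‖fderiv ℝ (ψ k) x‖ₑ * ‖w x‖ₑ) ^ 2
          ≤ (ENNReal.ofReal (4 * C * κ k) * ∫⁻ x in T k, ‖w x‖ₑ ∂(volume.restrict V)) ^ 2 := by
            gcongr
        _ ≤ ENNReal.ofReal (4 * C * κ k) ^ 2 * (B * ENNReal.ofReal (κ k)⁻¹ ^ 2 *
              ∫⁻ x in T k, ‖w x‖ₑ ^ 2 ∂(volume.restrict V)) := by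
            rw [mul_pow]
            gcongr
            exact h2.trans (mul_le_mul_left (hTv k) _)
        _ = (ENNReal.ofReal (κ k) * ENNReal.ofReal (κ k)⁻¹) ^ 2 *
              (c₁ * ∫⁻ x in T k, ‖w x‖ₑ ^ 2 ∂(volume.restrict V)) := by
            rw [ENNReal.ofReal_mul (by positivity), hc₁]; ring
        _ = _ := by
            rw [← ENNReal.ofReal_mul (hκ0 k).le, mul_inv_cancel₀ (hκ0 k).ne']; simp
    refine ENNReal.tendsto_nhds_zero.2 fun ε hε => ?_
    have hε2 : 0 < ε ^ 2 := by positivity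
    filter_upwards [ENNReal.tendsto_nhds_zero.1 hlim' _ hε2] with k hk
    exact (ENNReal.pow_le_pow_left_iff two_ne_zero).1 ((hsq k).trans hk)

theorem skeleton_eq_biUnion {d : ℕ} (𝒜 : Finset (E d × ℝ)) :
    skeleton 𝒜 = ⋃ i ∈ 𝒜 ×ˢ 𝒜,
      {x | LinearIndependent ℝ ![i.1.1, i.2.1] ∧ x ∈ hyper i.1 ∩ hyper i.2} := by
  ext x
  rw [mem_iUnion₂]
  constructor
  · rintro ⟨p, hp, q, hq, h⟩
    exact ⟨(p, q), Finset.mem_product.2 ⟨hp, hq⟩, h⟩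
  · rintro ⟨⟨p, q⟩, hpq, h⟩
    exact ⟨p, (Finset.mem_product.1 hpq).1, q, (Finset.mem_product.1 hpq).2, h⟩

theorem isClosed_skeleton {d : ℕ} (𝒜 : Finset (E d × ℝ)) : IsClosed (skeleton 𝒜) := by
  rw [skeleton_eq_biUnion]
  refine isClosed_biUnion_finset fun i _ => ?_
  by_cases h : LinearIndependent ℝ ![i.1.1, i.2.1]
  · simpa [h] using! (isClosed_hyper i.1).inter (isClosed_hyper i.2)
  · simp [h]

theorem exists_isCutoff_skeleton {m : ℕ} {𝒜 : Finset (E (m + 2) × ℝ)} (h𝒜 : IsArrangement 𝒜)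
    {V : Set (E (m + 2))} (hV : Bornology.IsBounded V) : ∃ ψ, IsCutoff V (skeleton 𝒜) ψ := by
  rw [skeleton_eq_biUnion]
  refine exists_isCutoff_biUnion _ fun i hi => ?_
  by_cases h : LinearIndependent ℝ ![i.1.1, i.2.1]
  · have := exists_isCutoff_pair (h𝒜 _ (Finset.mem_product.1 hi).1) (h𝒜 _ (Finset.mem_product.1 hi).2)
      h hV
    simpa [h] using! this
  · exact ⟨_, by simpa [h] using! isCutoff_empty V⟩

theorem volume_skeleton {n : ℕ} {𝒜 : Finset (E (n + 1) × ℝ)} (h𝒜 : IsArrangement 𝒜) :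
    volume (skeleton 𝒜) = 0 := by
  have hsub : skeleton 𝒜 ⊆ ⋃ p ∈ 𝒜, hyper p := by
    rintro x ⟨p, hp, q, hq, -, h, -⟩
    exact mem_iUnion₂.2 ⟨p, hp, h⟩
  refine measure_mono_null hsub (measure_biUnion_finset_null fun p hp => ?_)
  rw [hyper_eq_plane_smul (h𝒜 p hp)]
  exact volume_plane _ (h𝒜 p hp)

end IPG

namespace IPG

/-! ### Green's formula on polyhedral bodies -/

theorem indicator_inner {d : ℕ} {S : Set (E d)} {q : E d → E d} {ν : E d} :
    S.indicator (fun p => ⟪q p, ν⟫) = fun p => ⟪S.indicator q p, ν⟫ := by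
  funext p
  by_cases hp : p ∈ S <;> simp [hp]

theorem IsFlatBody.isFiniteMeasure_interior {d : ℕ} {A : Set (E d)} (hA : IsFlatBody A) :
    IsFiniteMeasure (volume.restrict (interior A)) :=
  ⟨by rw [Measure.restrict_apply_univ]
      exact (measure_mono interior_subset).trans_lt hA.isCompact.measure_lt_top⟩

section Green

variable {n : ℕ} {A : Set (E (n + 1))} {σ : E (n + 1) → E (n + 1)} {D b : E (n + 1) → ℝ}

theorem IsFlatBody.integral_eq_of_isTest_ball (hA : IsFlatBody A)
    (hσ : IntegrableOn σ (interior A)) (hD : IntegrableOn D (interior A))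
    (hdiv : HasWeakDiv (interior A) σ D) (hb : IntegrableOn b (frontier A) (surf (n + 1)))
    (hlim : HasLimit A (fun ν p => ⟪σ p, ν⟫) b) {x ν : E (n + 1)} (hx : IsFlatPoint A x ν) :
    ∃ r > 0, ∀ φ, IsTest (Metric.ball x r) φ →
      ∫ p in interior A, (fderiv ℝ φ p (σ p) + D p * φ p) =
        ∫ y in frontier A, b y * φ y ∂(surf (n + 1)) := by
  obtain ⟨ρ, hρ, hd, hl⟩ := hlim.exists_disc hA hx
  obtain ⟨R, hR, hR'⟩ := hx.exists_radius hA.subset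
  obtain ⟨hri, hdr, -⟩ := hR' (min ρ R) (min_le_right _ _)
  set r := min ρ R
  have hsub : halfBall x ν r ⊆ interior A := by rw [← hri]; exact inter_subset_left
  have hsubd : disc x ν r ⊆ frontier A := by rw [← hdr]; exact inter_subset_left
  refine ⟨r, lt_min hρ hR, fun φ hφ => ?_⟩
  have hl' := hl.mono (disc_mono (min_le_left ρ R))
  rw [indicator_inner] at hl'
  have hσ' : ∀ p ∈ halfBall x ν r, (interior A).indicator σ p = σ p := fun p hp =>
    indicator_of_mem (hsub hp) σ
  have hm := (isOpen_halfBall x ν r).measurableSet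
  have hdiv' : HasWeakDiv (halfBall x ν r) ((interior A).indicator σ) D := by
    intro ψ hψ
    rw [← hdiv.mono hsub ψ hψ]
    exact setIntegral_congr_fun hm fun p hp => by simp only [hσ' p hp]
  have key := integral_halfBall_eq hx.1 (aestronglyMeasurable_indicator_interior hσ.1)
    ((hσ.mono_set hsub).congr_fun (fun p hp => (hσ' p hp).symm) hm) (hD.mono_set hsub) hdiv'
    (hb.mono_set hsubd) hl' hφ
  have e1 : ∫ p in interior A, (fderiv ℝ φ p (σ p) + D p * φ p) =
      ∫ p in halfBall x ν r, (fderiv ℝ φ p ((interior A).indicator σ p) + D p * φ p) := by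
    refine (setIntegral_eq_of_subset_of_forall_sdiff_eq_zero isOpen_interior.measurableSet hsub
      (fun p hp => ?_)).trans
      (setIntegral_congr_fun (μ := volume) hm fun p hp => by simp only [hσ' p hp])
    have hpb : p ∉ Metric.ball x r := fun h => hp.2 (hri ▸ ⟨hp.1, h⟩)
    simp [hφ.fderiv_eq_zero hpb, hφ.eq_zero hpb]
  have e2 : ∫ y in frontier A, b y * φ y ∂(surf (n + 1)) =
      ∫ y in disc x ν r, b y * φ y ∂(surf (n + 1)) := by
    rw [← setIntegral_eq_of_subset_of_forall_sdiff_eq_zero isClosed_frontier.measurableSet hsubd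
      (fun p hp => ?_)]
    have hpb : p ∉ Metric.ball x r := fun h => hp.2 (hdr ▸ ⟨hp.1, h⟩)
    rw [hφ.eq_zero hpb, mul_zero]
  rw [e1, key, e2]

/-- Green's formula for test functions supported away from the nonflat boundary points. -/
theorem IsFlatBody.integral_eq_of_isTest_compl (hA : IsFlatBody A)
    (hσ : IntegrableOn σ (interior A)) (hD : IntegrableOn D (interior A))
    (hdiv : HasWeakDiv (interior A) σ D) (hb : IntegrableOn b (frontier A) (surf (n + 1)))
    (hlim : HasLimit A (fun ν p => ⟪σ p, ν⟫) b) {N : Set (E (n + 1))} (hN : IsClosed N)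
    (hflat : ∀ x ∈ frontier A, x ∉ N → ∃ ν, IsFlatPoint A x ν) {φ : E (n + 1) → ℝ}
    (hφ : IsTest Nᶜ φ) :
    ∫ p in interior A, (fderiv ℝ φ p (σ p) + D p * φ p) =
      ∫ y in frontier A, b y * φ y ∂(surf (n + 1)) := by
  refine IsTest.induction_local (P := fun φ =>
    ∫ p in interior A, (fderiv ℝ φ p (σ p) + D p * φ p) =
      ∫ y in frontier A, b y * φ y ∂(surf (n + 1))) ?_ ?_ ?_ hN.isOpen_compl hφ
  · simp
  · intro φ ψ hφ hψ h1 h2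
    have hdφ := fun p => (hφ.1.differentiable (by simp)).differentiableAt (x := p)
    have hdψ := fun p => (hψ.1.differentiable (by simp)).differentiableAt (x := p)
    have e1 : ∀ p, fderiv ℝ (fun x => φ x + ψ x) p (σ p) + D p * (φ p + ψ p) =
        (fderiv ℝ φ p (σ p) + D p * φ p) + (fderiv ℝ ψ p (σ p) + D p * ψ p) := by
      intro p
      rw [fderiv_fun_add (hdφ p) (hdψ p), add_apply]
      ring
    have i1 : ∀ {χ}, IsTest Nᶜ χ →
        IntegrableOn (fun p => fderiv ℝ χ p (σ p) + D p * χ p) (interior A) := fun hχ =>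
      (integrableOn_fderiv_apply hχ hσ).add (integrableOn_mul_test hχ hD)
    simp_rw [e1, mul_add]
    rw [integral_add (i1 hφ) (i1 hψ), integral_add (integrableOn_mul_test hφ hb) (integrableOn_mul_test hψ hb), h1, h2]
  -- Three local situations: off A both sides vanish, in the interior the identity is the weak
  -- divergence, and at a flat boundary point it is the formula on a half ball.
  · intro x hx
    have hAc : IsClosed A := hA.isCompact.isClosed
    by_cases hxA : x ∈ A
    swap
    · obtain ⟨r, hr, hsub⟩ := Metric.isOpen_iff.1 hAc.isOpen_compl x hxA
      refine ⟨r, hr, fun φ hφ => ?_⟩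
      have hout : ∀ p ∈ A, p ∉ Metric.ball x r ∩ Nᶜ := fun p hp h => hsub h.1 hp
      rw [setIntegral_eq_zero_of_forall_eq_zero, setIntegral_eq_zero_of_forall_eq_zero]
      · intro p hp
        rw [hφ.eq_zero (hout p (hAc.frontier_subset hp)), mul_zero]
      · intro p hp
        rw [hφ.eq_zero (hout p (interior_subset hp)), hφ.fderiv_eq_zero (hout p (interior_subset hp))]
        simp
    by_cases hxi : x ∈ interior A
    · obtain ⟨r, hr, hsub⟩ := Metric.isOpen_iff.1 isOpen_interior x hxi
      refine ⟨r, hr, fun φ hφ => ?_⟩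
      rw [integral_add (integrableOn_fderiv_apply hφ hσ) (integrableOn_mul_test hφ hD),
        hdiv φ (hφ.mono (inter_subset_left.trans hsub)), neg_add_cancel,
        setIntegral_eq_zero_of_forall_eq_zero]
      intro p hp
      rw [hφ.eq_zero fun h => hp.2 (hsub h.1), mul_zero]
    · obtain ⟨ν, hν⟩ := hflat x ⟨subset_closure hxA, hxi⟩ hx
      obtain ⟨r, hr, h⟩ := hA.integral_eq_of_isTest_ball hσ hD hdiv hb hlim hν
      exact ⟨r, hr, fun φ hφ => h φ (hφ.mono inter_subset_left)⟩

end Green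

/-- Green's formula on a polyhedral body. -/
theorem IsBody.integral_eq {m : ℕ} {𝒜 : Finset (E (m + 2) × ℝ)} {𝒬 : Set (Set (E (m + 2)))}
    {A : Set (E (m + 2))} (h : IsBody 𝒜 𝒬 A) (h𝒜 : IsArrangement 𝒜)
    {σ : E (m + 2) → E (m + 2)} {D b : E (m + 2) → ℝ}
    (hσ : MemLp σ 2 (volume.restrict (interior A))) (hD : IntegrableOn D (interior A))
    (hdiv : HasWeakDiv (interior A) σ D) (hb : IntegrableOn b (frontier A) (surf (m + 2)))
    (hlim : HasLimit A (fun ν p => ⟪σ p, ν⟫) b) {φ : E (m + 2) → ℝ} (hφ : IsTest univ φ) :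
    ∫ p in interior A, (fderiv ℝ φ p (σ p) + D p * φ p) =
      ∫ y in frontier A, b y * φ y ∂(surf (m + 2)) := by
  have hA := h.isFlatBody h𝒜
  have hfin := hA.isFiniteMeasure_interior
  have hσ1 : IntegrableOn σ (interior A) := hσ.integrable one_le_two
  obtain ⟨ψ, hψ⟩ := exists_isCutoff_skeleton h𝒜 (hA.isCompact.isBounded.subset _root_.interior_subset)
  set S := skeleton 𝒜
  set F : E (m + 2) → ℝ := fun p => fderiv ℝ φ p (σ p) + D p * φ p with hF
  have hFi : IntegrableOn F (interior A) :=
    (integrableOn_fderiv_apply hφ hσ1).add (integrableOn_mul_test hφ hD)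
  have hbφ : IntegrableOn (fun y => b y * φ y) (frontier A) (surf (m + 2)) :=
    integrableOn_mul_test hφ hb
  have hψb : ∀ k x, ‖ψ k x‖ ≤ 1 := fun k x => by
    rw [Real.norm_of_nonneg (hψ.mem_Icc k x).1]; exact (hψ.mem_Icc k x).2
  have htest : ∀ k, IsTest Sᶜ (fun x => ψ k x * φ x) := by
    intro k
    obtain ⟨O, hO, hSO, h0⟩ := hψ.eq_zero k
    have h1 := hφ.mul_left (hψ.contDiff k)
    refine ⟨h1.1, h1.2.1, fun x hx hxS => ?_⟩
    refine notMem_tsupport_iff_eventuallyEq.2 ?_ hx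
    filter_upwards [hO.mem_nhds (hSO hxS)] with y hy
    change ψ k y * φ y = 0
    rw [h0 y hy, zero_mul]
  -- The only error caused by the cutoff. It vanishes in the limit because gradients of the cutoffs
  -- are negligible against the L² field σ.
  set g : ℕ → E (m + 2) → ℝ := fun k p => φ p * fderiv ℝ (ψ k) p (σ p) with hg
  have hdφ := fun p => (hφ.1.differentiable (by simp)).differentiableAt (x := p)
  have hdψ := fun k p => ((hψ.contDiff k).differentiable (by simp)).differentiableAt (x := p)
  have hid : ∀ k p, fderiv ℝ (fun x => ψ k x * φ x) p (σ p) + D p * (ψ k p * φ p) =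
      ψ k p * F p + g k p := by
    intro k p
    rw [fderiv_fun_mul (hdψ k p) (hdφ p), add_apply, smul_apply, smul_apply, smul_eq_mul,
      smul_eq_mul, hF, hg]
    ring
  have hψF : ∀ k, IntegrableOn (fun p => ψ k p * F p) (interior A) := fun k =>
    hFi.bdd_mul (c := 1) (hψ.contDiff k).continuous.aestronglyMeasurable
      (Eventually.of_forall (hψb k))
  have hgi : ∀ k, IntegrableOn (g k) (interior A) := by
    intro k
    have h1 := (integrableOn_fderiv_apply (htest k) hσ1).add (integrableOn_mul_test (htest k) hD)
    refine (h1.sub (hψF k)).congr (Eventually.of_forall fun p => ?_)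
    simp only [Pi.sub_apply, Pi.add_apply]
    rw [hid]; ring
  have hgreen : ∀ k, (∫ p in interior A, ψ k p * F p) + ∫ p in interior A, g k p =
      ∫ y in frontier A, ψ k y * (b y * φ y) ∂(surf (m + 2)) := by
    intro k
    have h1 := hA.integral_eq_of_isTest_compl hσ1 hD hdiv hb hlim (isClosed_skeleton 𝒜)
      (fun x hx hxS => by
        obtain ⟨ν, hν, -⟩ := h.exists_isFlatPoint h𝒜 hx hxS
        exact ⟨ν, hν⟩) (htest k)
    rw [← integral_add (hψF k) (hgi k)]
    simp_rw [hid] at h1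
    rw [h1]
    exact integral_congr_ae (Eventually.of_forall fun y => by ring)
  have hl1 : Tendsto (fun k => ∫ p in interior A, ψ k p * F p) atTop
      (𝓝 (∫ p in interior A, F p)) := by
    refine tendsto_integral_of_dominated_convergence (fun p => ‖F p‖) (fun k => (hψF k).1) hFi.norm
      (fun k => Eventually.of_forall fun p => ?_) ?_
    · rw [norm_mul]
      exact mul_le_of_le_one_left (norm_nonneg _) (hψb k p)
    · have h0 : ∀ᵐ p ∂(volume.restrict (interior A)), p ∉ S :=
        ae_restrict_of_ae (by rw [ae_iff]; simpa using volume_skeleton h𝒜)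
      filter_upwards [h0] with p hp
      simpa using (hψ.tendsto p hp).mul_const (F p)
  have hl3 : Tendsto (fun k => ∫ y in frontier A, ψ k y * (b y * φ y) ∂(surf (m + 2))) atTop
      (𝓝 (∫ y in frontier A, b y * φ y ∂(surf (m + 2)))) := by
    refine tendsto_integral_of_dominated_convergence (fun y => ‖b y * φ y‖)
      (fun k => (hψ.contDiff k).continuous.aestronglyMeasurable.mul hbφ.1) hbφ.norm
      (fun k => Eventually.of_forall fun p => ?_) ?_
    · rw [norm_mul]
      exact mul_le_of_le_one_left (norm_nonneg _) (hψb k p)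
    · have h0 : ∀ᵐ p ∂((surf (m + 2)).restrict (frontier A)), p ∉ S :=
        ae_restrict_of_ae (by rw [ae_iff]; simpa using surf_skeleton h𝒜)
      filter_upwards [h0] with p hp
      simpa using (hψ.tendsto p hp).mul_const (b p * φ p)
  have hl2 : Tendsto (fun k => ∫ p in interior A, g k p) atTop (𝓝 0) := by
    obtain ⟨C, hC⟩ := hφ.exists_bound
    have h1 := ENNReal.Tendsto.const_mul (hψ.grad σ hσ) (a := ENNReal.ofReal C)
      (Or.inr ENNReal.ofReal_ne_top)
    rw [mul_zero] at h1
    rw [tendsto_iff_enorm_sub_tendsto_zero]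
    refine tendsto_of_tendsto_of_tendsto_of_le_of_le tendsto_const_nhds h1 (fun _ => zero_le)
      fun k => ?_
    dsimp only
    rw [sub_zero, ← lintegral_const_mul' _ _ ENNReal.ofReal_ne_top]
    refine (enorm_integral_le_lintegral_enorm _).trans (lintegral_mono fun p => ?_)
    rw [hg, enorm_mul]
    refine mul_le_mul' ?_ (ContinuousLinearMap.le_opENorm _ _)
    rw [← ofReal_norm]
    exact ENNReal.ofReal_le_ofReal (hC p)
  have hl := hl1.add hl2
  rw [add_zero] at hl
  exact tendsto_nhds_unique hl (hl3.congr fun k => (hgreen k).symm)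

end IPG

namespace IPG

/-! ### Weak gradients -/

section WeakGrad

variable {d : ℕ} {U V : Set (E d)}

/-- The measure is arbitrary because the fundamental lemma is used with volume, for weak gradients,
and with the surface measure of a disc, for boundary fluxes. -/
theorem ae_eq_zero_of_forall_isTest {U : Set (E d)} (hU : IsOpen U) {μ : Measure (E d)}
    {f : E d → ℝ} (hf : IntegrableOn f U μ) (h : ∀ φ, IsTest U φ → ∫ x in U, f x * φ x ∂μ = 0) :
    ∀ᵐ x ∂(μ.restrict U), f x = 0 := by
  have h1 := hU.ae_eq_zero_of_integral_contDiff_smul_eq_zero (μ := μ) hf.locallyIntegrableOn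
    fun φ h1 h2 h3 => ?_
  · exact (ae_restrict_iff' hU.measurableSet).2 h1
  · rw [← h φ ⟨h1, h2, h3⟩, setIntegral_eq_integral_of_forall_compl_eq_zero]
    · exact integral_congr_ae (Eventually.of_forall fun x => by simp [mul_comm])
    · intro x hx
      rw [image_eq_zero_of_notMem_tsupport fun h => hx (h3 h), mul_zero]

theorem HasWeakGrad.ae_eq (hU : IsOpen U) (hUb : Bornology.IsBounded U) {w : E d → ℝ}
    {G G' : E d → E d} (h : HasWeakGrad U w G) (h' : HasWeakGrad U w G') :
    ∀ᵐ x ∂(volume.restrict U), G x = G' x := by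
  have hfin : IsFiniteMeasure (volume.restrict U) :=
    ⟨by rw [Measure.restrict_apply_univ]; exact hUb.measure_lt_top⟩
  have hi : ∀ {G : E d → E d}, MemLp G 2 (volume.restrict U) → ∀ i, IntegrableOn (fun x => G x i) U :=
    fun hG i => (EuclideanSpace.proj (𝕜 := ℝ) i).integrable_comp (hG.integrable one_le_two)
  have key : ∀ i : Fin d, ∀ᵐ x ∂(volume.restrict U), G x i - G' x i = 0 := by
    intro i
    refine ae_eq_zero_of_forall_isTest hU ((hi h.1 i).sub (hi h'.1 i)) fun φ hφ => ?_
    have h1 := h.2 (EuclideanSpace.single i 1) φ hφ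
    have h2 := h'.2 (EuclideanSpace.single i 1) φ hφ
    simp only [EuclideanSpace.inner_single_right, one_mul, conj_trivial] at h1 h2
    simp_rw [sub_mul]
    rw [integral_sub (integrableOn_mul_test hφ (hi h.1 i)) (integrableOn_mul_test hφ (hi h'.1 i))]
    linarith
  filter_upwards [ae_all_iff.2 key] with x hx
  ext i
  exact sub_eq_zero.1 (hx i)

theorem HasWeakGrad.weakGrad_ae_eq (hU : IsOpen U) (hUb : Bornology.IsBounded U) {w : E d → ℝ}
    {G : E d → E d} (h : HasWeakGrad U w G) :
    ∀ᵐ x ∂(volume.restrict U), weakGrad U w x = G x := by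
  have hex : ∃ G, HasWeakGrad U w G := ⟨G, h⟩
  rw [weakGrad, dif_pos hex]
  exact hex.choose_spec.ae_eq hU hUb h

theorem hasWeakGrad_weakGrad {w : E d → ℝ} (h : MemH1 U w) : HasWeakGrad U w (weakGrad U w) := by
  rw [weakGrad, dif_pos h.2]; exact h.2.choose_spec

theorem HasWeakGrad.mono {w : E d → ℝ} {G : E d → E d} (h : HasWeakGrad U w G) (hVU : V ⊆ U) :
    HasWeakGrad V w G :=
  ⟨h.1.mono_measure (Measure.restrict_mono_set _ hVU), fun e => (h.2 e).mono hVU⟩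

theorem HasWeakGrad.congr {w w' : E d → ℝ} {G : E d → E d} (h : HasWeakGrad U w G)
    (hw : ∀ᵐ x ∂(volume.restrict U), w x = w' x) : HasWeakGrad U w' G := by
  refine ⟨h.1, fun e φ hφ => ?_⟩
  rw [← h.2 e φ hφ]
  refine integral_congr_ae ?_
  filter_upwards [hw] with x hx
  rw [hx]

theorem memLp_of_continuous {G : Type*} [NormedAddCommGroup G] (hU : IsOpen U)
    (hUb : Bornology.IsBounded U) {φ : E d → G}
    (hφ : Continuous φ) (p : ℝ≥0∞) : MemLp φ p (volume.restrict U) := by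
  have hfin : IsFiniteMeasure (volume.restrict U) :=
    ⟨by rw [Measure.restrict_apply_univ]; exact hUb.measure_lt_top⟩
  obtain ⟨C, hC⟩ := hUb.isCompact_closure.exists_bound_of_continuousOn hφ.continuousOn
  have hm : AEStronglyMeasurable φ (volume.restrict U) :=
    AEStronglyMeasurable.mono_set subset_closure
      (hφ.continuousOn.aestronglyMeasurable_of_isCompact hUb.isCompact_closure
        isClosed_closure.measurableSet)
  refine MemLp.of_bound hm C ?_
  filter_upwards [ae_restrict_mem hU.measurableSet] with x hx
  exact hC x (subset_closure hx)

/-- Since the test function has compact support in U, the integration by parts takes place on the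
whole space. -/
theorem hasWeakGrad_of_contDiff (hU : IsOpen U) (hUb : Bornology.IsBounded U) {φ : E d → ℝ}
    (hφ : ContDiff ℝ ∞ φ) : HasWeakGrad U φ (gradient φ) := by
  have hc : Continuous (fderiv ℝ φ) := hφ.continuous_fderiv (by simp)
  have hg : Continuous (gradient φ) := (InnerProductSpace.toDual ℝ (E d)).symm.continuous.comp hc
  refine ⟨memLp_of_continuous hU hUb hg 2, fun e ψ hψ => ?_⟩
  have hcψ : Continuous (fderiv ℝ ψ) := hψ.1.continuous_fderiv (by simp)
  simp_rw [inner_gradient_left]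
  rw [setIntegral_eq_integral_of_forall_compl_eq_zero
      (fun x hx => by rw [hψ.fderiv_eq_zero hx]; simp),
    setIntegral_eq_integral_of_forall_compl_eq_zero
      (fun x hx => by rw [hψ.eq_zero hx, mul_zero])]
  have hψe : HasCompactSupport fun x => fderiv ℝ ψ x e := (hψ.2.1.fderiv (𝕜 := ℝ)).comp_left
    (g := fun L : E d →L[ℝ] ℝ => L e) rfl
  refine integral_mul_fderiv_eq_neg_fderiv_mul_of_integrable ?_ ?_ ?_
    (fun x _ => hφ.differentiable (by simp) x) (fun x _ => hψ.1.differentiable (by simp) x)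
  · exact ((hc.clm_apply continuous_const).mul hψ.1.continuous).integrable_of_hasCompactSupport
      hψ.2.1.mul_left
  · exact (hφ.continuous.mul (hcψ.clm_apply continuous_const)).integrable_of_hasCompactSupport
      hψe.mul_left
  · exact (hφ.continuous.mul hψ.1.continuous).integrable_of_hasCompactSupport hψ.2.1.mul_left

theorem memH1_of_contDiff (hU : IsOpen U) (hUb : Bornology.IsBounded U) {φ : E d → ℝ}
    (hφ : ContDiff ℝ ∞ φ) : MemH1 U φ :=
  ⟨memLp_of_continuous hU hUb hφ.continuous 2, _, hasWeakGrad_of_contDiff hU hUb hφ⟩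

theorem contDiff_mvPolynomial_eval (p : MvPolynomial (Fin d) ℝ) :
    ContDiff ℝ ∞ fun x : E d => MvPolynomial.eval (fun i => x i) p := by
  induction p using MvPolynomial.induction_on with
  | C a => simpa using contDiff_const
  | add p q hp hq => simpa using hp.add hq
  | mul_X p i hp =>
    simp only [map_mul, MvPolynomial.eval_X]
    exact hp.mul (EuclideanSpace.proj (𝕜 := ℝ) i).contDiff

end WeakGrad

end IPG

namespace IPG

/-! ### Geometry of a mesh -/

/-- If ν' were not −ν, the direction −(ν + ν') would enter both interiors. -/
theorem IsFlatPoint.eq_neg_of_disjoint {d : ℕ} {A B : Set (E d)} {x ν ν' : E d}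
    (h : IsFlatPoint A x ν) (h' : IsFlatPoint B x ν') (hAB : Disjoint (interior A) (interior B)) :
    ν' = -ν := by
  obtain ⟨hν, ρ, hρ, hi⟩ := h
  obtain ⟨hν', ρ', hρ', hi'⟩ := h'
  by_contra hne
  have hlt : -1 < ⟪ν, ν'⟫ := by
    have h1 : ⟪-ν, ν'⟫ < 1 := by
      refine lt_of_le_of_ne ?_ fun h1 => hne
        ((inner_eq_one_iff_of_norm_eq_one (by rwa [norm_neg]) hν').1 h1).symm
      simpa [hν, hν'] using real_inner_le_norm (-ν) ν'
    rw [inner_neg_left] at h1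
    linarith
  have hcont : Tendsto (fun s : ℝ => x + s • (-(ν + ν'))) (𝓝[>] 0) (𝓝 x) := by
    have : Continuous fun s : ℝ => x + s • (-(ν + ν')) := by fun_prop
    simpa using (this.tendsto 0).mono_left (nhdsWithin_le_nhds (s := Ioi 0))
  obtain ⟨s, ⟨h1, h2⟩, hs⟩ := (((hcont.eventually (Metric.ball_mem_nhds x hρ)).and
    (hcont.eventually (Metric.ball_mem_nhds x hρ'))).and self_mem_nhdsWithin).exists
  have hs : (0 : ℝ) < s := hs
  have e1 : ⟪ν, -(ν + ν')⟫ < 0 := by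
    rw [inner_neg_right, inner_add_right, real_inner_self_eq_norm_sq, hν]; linarith
  have e2 : ⟪ν', -(ν + ν')⟫ < 0 := by
    rw [inner_neg_right, inner_add_right, real_inner_self_eq_norm_sq, hν', real_inner_comm]
    linarith
  refine Set.disjoint_left.1 hAB ((hi _ h1).2 ?_) ((hi' _ h2).2 ?_)
  · rw [add_sub_cancel_left, inner_smul_right]; exact mul_neg_of_pos_of_neg hs e1
  · rw [add_sub_cancel_left, inner_smul_right]; exact mul_neg_of_pos_of_neg hs e2

/-- If the normals differed, the direction ν' − ν would enter the interior of A and leave that of B.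
-/
theorem IsFlatPoint.eq_of_subset {d : ℕ} {A B : Set (E d)} {x ν ν' : E d}
    (h : IsFlatPoint A x ν) (h' : IsFlatPoint B x ν') (hAB : interior A ⊆ interior B) : ν = ν' := by
  obtain ⟨hν, ρ, hρ, hi⟩ := h
  obtain ⟨hν', ρ', hρ', hi'⟩ := h'
  by_contra hne
  have hlt : ⟪ν, ν'⟫ < 1 := by
    refine lt_of_le_of_ne ?_ fun h1 => hne ((inner_eq_one_iff_of_norm_eq_one hν hν').1 h1)
    simpa [hν, hν'] using real_inner_le_norm ν ν'
  have hcont : Tendsto (fun s : ℝ => x + s • (ν' - ν)) (𝓝[>] 0) (𝓝 x) := by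
    have : Continuous fun s : ℝ => x + s • (ν' - ν) := by fun_prop
    simpa using (this.tendsto 0).mono_left (nhdsWithin_le_nhds (s := Ioi 0))
  obtain ⟨s, ⟨h1, h2⟩, hs⟩ := (((hcont.eventually (Metric.ball_mem_nhds x hρ)).and
    (hcont.eventually (Metric.ball_mem_nhds x hρ'))).and self_mem_nhdsWithin).exists
  have hs : (0 : ℝ) < s := hs
  have e1 : ⟪ν, ν' - ν⟫ < 0 := by
    rw [inner_sub_right, real_inner_self_eq_norm_sq, hν]; linarith
  have e2 : 0 < ⟪ν', ν' - ν⟫ := by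
    rw [inner_sub_right, real_inner_self_eq_norm_sq, hν', real_inner_comm]; linarith
  have h3 := hAB ((hi _ h1).2 (by
    rw [add_sub_cancel_left, inner_smul_right]; exact mul_neg_of_pos_of_neg hs e1))
  have h4 := (hi' _ h2).1 h3
  rw [add_sub_cancel_left, inner_smul_right] at h4
  have := mul_pos hs e2
  linarith

/-- The two half balls and, by closedness, the disc between them fill a ball inside C. -/
theorem IsFlatPoint.mem_interior_union {d : ℕ} {A B C : Set (E d)} {x ν : E d}
    (h : IsFlatPoint A x ν) (h' : IsFlatPoint B x (-ν)) (hA : A ⊆ closure (interior A))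
    (hB : B ⊆ closure (interior B)) (hC : IsClosed C) (hAC : A ⊆ C) (hBC : B ⊆ C) :
    x ∈ interior C := by
  obtain ⟨ρ, hρ, h1⟩ := h.exists_radius hA
  obtain ⟨ρ', hρ', h2⟩ := h'.exists_radius hB
  have h1 := (h1 (min ρ ρ') (min_le_left _ _)).1
  have h2 := (h2 (min ρ ρ') (min_le_right _ _)).1
  have hsub : halfBall x ν (min ρ ρ') ⊆ C := by
    rw [← h1]; exact inter_subset_left.trans (interior_subset.trans hAC)
  have hsub' : halfBall x (-ν) (min ρ ρ') ⊆ C := by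
    rw [← h2]; exact inter_subset_left.trans (interior_subset.trans hBC)
  refine mem_interior.2 ⟨_, fun y hy => ?_, Metric.isOpen_ball,
    Metric.mem_ball_self (lt_min hρ hρ')⟩
  rcases ball_subset_union x ν _ hy with (hy | hy) | hy
  · exact hsub hy
  · exact closure_minimal hsub hC (disc_subset_closure_halfBall h.1 hy)
  · exact hsub' hy

theorem IsPolyhedron.isCompact {d n : ℕ} {A : Set (E d)} (h : IsPolyhedron n A) : IsCompact A := by
  obtain ⟨_, -, 𝒬, hfin, -, hQ, rfl⟩ := h
  refine hfin.isCompact_sUnion fun Q hQ' => ?_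
  obtain ⟨⟨s, rfl⟩, -⟩ := hQ Q hQ'
  exact Set.Finite.isCompact_convexHull ℝ s.finite_toSet

/-- All elements of the mesh and the domain are bounded by hyperplanes of the arrangement `𝒜`. -/
structure Mesh.IsArranged {d : ℕ} (T : Mesh d) (Ω : Set (E d)) (𝒜 : Finset (E d × ℝ)) : Prop where
  arr : IsArrangement 𝒜
  isOpen : IsOpen Ω
  interior_closure : interior (closure Ω) = Ω
  cell : ∀ κ ∈ T.cells, ∃ 𝒬, IsBody 𝒜 𝒬 κ
  domain : ∃ 𝒬, IsBody 𝒜 𝒬 (closure Ω)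

/-- The arrangements of all elements and of the domain are merged. A single skeleton then contains
every exceptional boundary point at once. -/
theorem Mesh.IsConsistent.exists_isArranged {n : ℕ} {T : Mesh (n + 1)} {P : Problem (n + 1)}
    (hT : T.IsConsistent P) (hP : P.Admissible) : ∃ 𝒜, T.IsArranged P.Ω 𝒜 := by
  classical
  have h1 : ∀ κ ∈ T.cells, ∃ 𝒜 : Finset (E (n + 1) × ℝ), IsArrangement 𝒜 ∧ ∃ 𝒬, IsBody 𝒜 𝒬 κ :=
    fun κ hκ => (hT.cell_polyhedron κ hκ).exists_isBody
  choose! f hf hf' using h1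
  obtain ⟨𝒜₀, h𝒜₀, 𝒬₀, h𝒬₀⟩ := hP.polyhedral.exists_isBody
  refine ⟨𝒜₀ ∪ T.cells.biUnion f, fun p hp => ?_, hP.isOpen,
    hP.lipschitz.interior_closure hP.isOpen, fun κ hκ => ?_,
    𝒬₀, h𝒬₀.mono Finset.subset_union_left⟩
  · rcases Finset.mem_union.1 hp with hp | hp
    · exact h𝒜₀ p hp
    · obtain ⟨κ, hκ, hp⟩ := Finset.mem_biUnion.1 hp
      exact hf κ hκ p hp
  · obtain ⟨𝒬, h𝒬⟩ := hf' κ hκ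
    exact ⟨𝒬, h𝒬.mono ((Finset.subset_biUnion_of_mem f hκ).trans Finset.subset_union_right)⟩

namespace Mesh

theorem mem_allFaces {d : ℕ} {T : Mesh d} {F : Set (E d)} :
    F ∈ T.allFaces ↔ ∃ κ ∈ T.cells, F ∈ T.faces κ := by
  simp [allFaces]

theorem mem_boundaryFaces {d : ℕ} {T : Mesh d} {Ω F : Set (E d)} :
    F ∈ T.boundaryFaces Ω ↔ F ∈ T.allFaces ∧ F ⊆ frontier Ω := by
  simp [boundaryFaces]

theorem mem_interiorFaces {d : ℕ} {T : Mesh d} {Ω F : Set (E d)} :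
    F ∈ T.interiorFaces Ω ↔ F ∈ T.allFaces ∧ ¬ F ⊆ frontier Ω := by
  simp [interiorFaces]

theorem mem_facesOn {d : ℕ} {T : Mesh d} {Ω Γ F : Set (E d)} :
    F ∈ T.facesOn Ω Γ ↔ F ∈ T.boundaryFaces Ω ∧ F ⊆ closure Γ := by
  simp [facesOn]

theorem mem_cellsAt {d : ℕ} {T : Mesh d} {F κ : Set (E d)} :
    κ ∈ T.cellsAt F ↔ κ ∈ T.cells ∧ F ∈ T.faces κ := by
  simp [cellsAt]

namespace IsArranged

variable {n : ℕ} {T : Mesh (n + 1)} {P : Problem (n + 1)} {𝒜 : Finset (E (n + 1) × ℝ)}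
  {κ κ' F F' : Set (E (n + 1))} {x : E (n + 1)}

theorem isFlatBody (hM : T.IsArranged P.Ω 𝒜) (hκ : κ ∈ T.cells) : IsFlatBody κ := by
  obtain ⟨𝒬, h⟩ := hM.cell κ hκ
  exact h.isFlatBody hM.arr

theorem isFlatBody_closure (hM : T.IsArranged P.Ω 𝒜) : IsFlatBody (closure P.Ω) := by
  obtain ⟨𝒬, h⟩ := hM.domain
  exact h.isFlatBody hM.arr

theorem frontier_closure (hM : T.IsArranged P.Ω 𝒜) : frontier (closure P.Ω) = frontier P.Ω := by
  rw [frontier, frontier, hM.interior_closure, closure_closure, hM.isOpen.interior_eq]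

theorem interior_eq (hM : T.IsArranged P.Ω 𝒜) : interior P.Ω = interior (closure P.Ω) := by
  rw [hM.interior_closure, hM.isOpen.interior_eq]

theorem isFlatPoint (hM : T.IsArranged P.Ω 𝒜) (hκ : κ ∈ T.cells) (hx : x ∈ frontier κ)
    (hxS : x ∉ skeleton 𝒜) : IsFlatPoint κ x (outerNormal κ x) := by
  obtain ⟨𝒬, h⟩ := hM.cell κ hκ
  obtain ⟨ν, hν, -⟩ := h.exists_isFlatPoint hM.arr hx hxS
  rwa [hν.outerNormal_eq]

theorem isFlatPoint_closure (hM : T.IsArranged P.Ω 𝒜) (hx : x ∈ frontier P.Ω)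
    (hxS : x ∉ skeleton 𝒜) : IsFlatPoint (closure P.Ω) x (outerNormal P.Ω x) := by
  obtain ⟨𝒬, h⟩ := hM.domain
  rw [← hM.frontier_closure] at hx
  obtain ⟨ν, hν, -⟩ := h.exists_isFlatPoint hM.arr hx hxS
  rwa [outerNormal_congr hM.interior_eq, hν.outerNormal_eq]

end IsArranged

variable {n : ℕ} {T : Mesh (n + 1)} {P : Problem (n + 1)} {𝒜 : Finset (E (n + 1) × ℝ)}
  {κ κ' F F' : Set (E (n + 1))} {x : E (n + 1)}

theorem IsConsistent.face_subset (hT : T.IsConsistent P) (hκ : κ ∈ T.cells) (hF : F ∈ T.faces κ) :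
    F ⊆ frontier κ := by
  rw [hT.cell_boundary κ hκ]
  exact subset_biUnion_of_mem (u := fun F => F) (s := {F | F ∈ T.faces κ}) hF

theorem IsConsistent.cell_subset (hT : T.IsConsistent P) (hκ : κ ∈ T.cells) : κ ⊆ closure P.Ω := by
  rw [hT.cover]
  exact subset_biUnion_of_mem (u := fun κ => κ) (s := {κ | κ ∈ T.cells}) hκ

theorem IsConsistent.interior_subset (hT : T.IsConsistent P) (hM : T.IsArranged P.Ω 𝒜)
    (hκ : κ ∈ T.cells) : interior κ ⊆ P.Ω := by
  rw [← hM.interior_closure]; exact interior_mono (hT.cell_subset hκ)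

theorem IsConsistent.isClosed_face (hT : T.IsConsistent P) (hF : F ∈ T.allFaces) : IsClosed F := by
  obtain ⟨κ, hκ, hF⟩ := mem_allFaces.1 hF
  exact (hT.face_polyhedron κ hκ F hF).isCompact.isClosed

/-- Two elements which share a boundary point outside the skeleton have opposite normals there, and
the point is an inner point of the domain. -/
theorem IsConsistent.two_cells (hT : T.IsConsistent P) (hM : T.IsArranged P.Ω 𝒜) (hκ : κ ∈ T.cells)
    (hκ' : κ' ∈ T.cells) (hne : κ ≠ κ') (hx : x ∈ frontier κ) (hx' : x ∈ frontier κ')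
    (hxS : x ∉ skeleton 𝒜) : outerNormal κ' x = -outerNormal κ x ∧ x ∈ P.Ω := by
  have h1 := hM.isFlatPoint hκ hx hxS
  have h2 := hM.isFlatPoint hκ' hx' hxS
  have h3 := h1.eq_neg_of_disjoint h2 (hT.disjoint κ hκ κ' hκ' hne)
  refine ⟨h3, ?_⟩
  rw [h3] at h2
  rw [← hM.interior_closure]
  exact h1.mem_interior_union h2 (hM.isFlatBody hκ).subset (hM.isFlatBody hκ').subset isClosed_closure
    (hT.cell_subset hκ) (hT.cell_subset hκ')

/-- Two elements with a common boundary point off the skeleton would surround it and make it an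
inner point of the open set Ω. -/
theorem IsConsistent.cells_eq_of_mem_frontier (hT : T.IsConsistent P) (hM : T.IsArranged P.Ω 𝒜)
    (hκ : κ ∈ T.cells) (hκ' : κ' ∈ T.cells) (hx : x ∈ frontier κ) (hx' : x ∈ frontier κ')
    (hxS : x ∉ skeleton 𝒜) (hxΩ : x ∈ frontier P.Ω) : κ = κ' := by
  by_contra hne
  have := (hT.two_cells hM hκ hκ' hne hx hx' hxS).2
  rw [hM.isOpen.frontier_eq] at hxΩ
  exact hxΩ.2 this

/-- A third element would have a normal opposite to each of the other two, which are opposite to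
each other; the normal would equal its own negative and vanish. -/
theorem IsConsistent.cellsAt_interior (hT : T.IsConsistent P) (hM : T.IsArranged P.Ω 𝒜)
    (hF : F ∈ T.interiorFaces P.Ω) (hx : x ∈ F) (hxS : x ∉ skeleton 𝒜) :
    ∃ κ κ', κ ≠ κ' ∧ (κ ∈ T.cells ∧ F ∈ T.faces κ) ∧ (κ' ∈ T.cells ∧ F ∈ T.faces κ') ∧
      ∀ κ'', κ'' ∈ T.cellsAt F ↔ κ'' = κ ∨ κ'' = κ' := by
  obtain ⟨hF, hFΩ⟩ := mem_interiorFaces.1 hF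
  obtain ⟨κ, hκ, hFκ⟩ := mem_allFaces.1 hF
  rcases hT.matching κ hκ F hFκ with h | ⟨κ', hκ', hne, hFκ'⟩
  · exact absurd h hFΩ
  refine ⟨κ, κ', hne.symm, ⟨hκ, hFκ⟩, ⟨hκ', hFκ'⟩, fun κ'' => ⟨fun h => ?_, ?_⟩⟩
  · obtain ⟨hκ'', hFκ''⟩ := mem_cellsAt.1 h
    by_contra hcon
    rw [not_or] at hcon
    have hm := hT.face_subset hκ hFκ hx
    have hm' := hT.face_subset hκ' hFκ' hx
    have hm'' := hT.face_subset hκ'' hFκ'' hx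
    have h1 := (hT.two_cells hM hκ'' hκ hcon.1 hm'' hm hxS).1
    have h2 := (hT.two_cells hM hκ'' hκ' hcon.2 hm'' hm' hxS).1
    have h3 := (hT.two_cells hM hκ hκ' hne.symm hm hm' hxS).1
    rw [h1, h2, neg_neg] at h3
    have h4 := (hM.isFlatPoint hκ'' hm'' hxS).1
    have h5 : (2 : ℝ) • outerNormal κ'' x = 0 := by
      rw [two_smul]; nth_rewrite 1 [← h3]; exact neg_add_cancel _
    rw [(smul_eq_zero.1 h5).resolve_left two_ne_zero, norm_zero] at h4
    exact zero_ne_one h4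
  · rintro (rfl | rfl)
    · exact mem_cellsAt.2 ⟨hκ, hFκ⟩
    · exact mem_cellsAt.2 ⟨hκ', hFκ'⟩

theorem IsConsistent.cellsAt_boundary (hT : T.IsConsistent P) (hM : T.IsArranged P.Ω 𝒜)
    (hF : F ∈ T.boundaryFaces P.Ω) (hx : x ∈ F) (hxS : x ∉ skeleton 𝒜) :
    ∃ κ, κ ∈ T.cells ∧ F ∈ T.faces κ ∧ T.cellsAt F = {κ} := by
  obtain ⟨hF, hFΩ⟩ := mem_boundaryFaces.1 hF
  obtain ⟨κ, hκ, hFκ⟩ := mem_allFaces.1 hF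
  refine ⟨κ, hκ, hFκ, Finset.ext fun κ' => ?_⟩
  rw [Finset.mem_singleton]
  constructor
  · intro h
    obtain ⟨hκ', hFκ'⟩ := mem_cellsAt.1 h
    exact hT.cells_eq_of_mem_frontier hM hκ' hκ (hT.face_subset hκ' hFκ' hx)
      (hT.face_subset hκ hFκ hx) hxS (hFΩ hx)
  · rintro rfl
    exact mem_cellsAt.2 ⟨hκ, hFκ⟩

theorem IsConsistent.outerNormal_eq (hT : T.IsConsistent P) (hM : T.IsArranged P.Ω 𝒜)
    (hκ : κ ∈ T.cells) (hx : x ∈ frontier κ) (hxΩ : x ∈ frontier P.Ω) (hxS : x ∉ skeleton 𝒜) :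
    outerNormal κ x = outerNormal P.Ω x :=
  (hM.isFlatPoint hκ hx hxS).eq_of_subset (hM.isFlatPoint_closure hxΩ hxS)
    (interior_mono (hT.cell_subset hκ))

/-- For faces of one element this is part of the partition; faces of different elements can meet on
the boundary of Ω only inside the skeleton. -/
theorem IsConsistent.surf_inter_eq_zero (hT : T.IsConsistent P) (hM : T.IsArranged P.Ω 𝒜)
    (hF : F ∈ T.boundaryFaces P.Ω) (hF' : F' ∈ T.boundaryFaces P.Ω) (hne : F ≠ F') :
    surf (n + 1) (F ∩ F') = 0 := by
  obtain ⟨hF, hFΩ⟩ := mem_boundaryFaces.1 hF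
  obtain ⟨κ, hκ, hFκ⟩ := mem_allFaces.1 hF
  obtain ⟨κ', hκ', hFκ'⟩ := mem_allFaces.1 (mem_boundaryFaces.1 hF').1
  by_cases h : κ = κ'
  · subst h
    exact hT.face_overlap κ hκ F hFκ F' hFκ' hne
  · refine measure_mono_null (fun x hx => ?_) (surf_skeleton hM.arr)
    by_contra hxS
    exact h (hT.cells_eq_of_mem_frontier hM hκ hκ' (hT.face_subset hκ hFκ hx.1)
      (hT.face_subset hκ' hFκ' hx.2) hxS (hFΩ hx.1))

theorem IsConsistent.surf_closure_inter (hT : T.IsConsistent P) (hM : T.IsArranged P.Ω 𝒜)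
    {Γ Γ' : Set (E (n + 1))} (hΓ : closure Γ = ⋃ F ∈ T.facesOn P.Ω Γ, F)
    (hΓ' : closure Γ' = ⋃ F ∈ T.facesOn P.Ω Γ', F)
    (hd : Disjoint (T.facesOn P.Ω Γ) (T.facesOn P.Ω Γ')) :
    surf (n + 1) (closure Γ ∩ closure Γ') = 0 := by
  have hsub : closure Γ ∩ closure Γ' ⊆
      ⋃ F ∈ T.facesOn P.Ω Γ, ⋃ F' ∈ T.facesOn P.Ω Γ', F ∩ F' := by
    rintro x ⟨hx, hx'⟩
    rw [hΓ] at hx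
    rw [hΓ'] at hx'
    obtain ⟨F, hF, hxF⟩ := mem_iUnion₂.1 hx
    obtain ⟨F', hF', hxF'⟩ := mem_iUnion₂.1 hx'
    exact mem_iUnion₂.2 ⟨F, hF, mem_iUnion₂.2 ⟨F', hF', hxF, hxF'⟩⟩
  refine measure_mono_null hsub (measure_biUnion_finset_null fun F hF =>
    measure_biUnion_finset_null fun F' hF' => ?_)
  refine hT.surf_inter_eq_zero hM (mem_facesOn.1 hF).1 (mem_facesOn.1 hF').1 ?_
  rintro rfl
  exact Finset.disjoint_left.1 hd hF hF'

/-- A part of the boundary agrees with its closure up to null sets. -/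
theorem closure_ae_eq_of_cover {d : ℕ} {X Γ Γ' Γ'' : Set (E d)} (hX : IsClosed X)
    (hcov : X = Γ ∪ Γ' ∪ Γ'') (h' : surf d (closure Γ ∩ closure Γ') = 0)
    (h'' : surf d (closure Γ ∩ closure Γ'') = 0) : (Γ : Set (E d)) =ᵐ[surf d] closure Γ := by
  refine subset_closure.eventuallyLE.antisymm (ae_le_set.2 ?_)
  refine measure_mono_null (fun x hx => ?_) (measure_union_null h' h'')
  have hxX : x ∈ X := by
    refine closure_minimal ?_ hX hx.1
    rw [hcov]
    exact subset_union_left.trans subset_union_left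
  rw [hcov] at hxX
  rcases hxX with (h | h) | h
  · exact absurd h hx.2
  · exact Or.inl ⟨hx.1, subset_closure h⟩
  · exact Or.inr ⟨hx.1, subset_closure h⟩

/-- The boundary conditions see the parts of the boundary only up to null sets. -/
structure BoundaryParts (T : Mesh (n + 1)) (P : Problem (n + 1)) : Prop where
  null₁₂ : surf (n + 1) (closure P.Γ₁ ∩ closure P.Γ₂) = 0
  null₁₃ : surf (n + 1) (closure P.Γ₁ ∩ closure P.Γ₃) = 0
  null₂₃ : surf (n + 1) (closure P.Γ₂ ∩ closure P.Γ₃) = 0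
  ae_eq₁ : (P.Γ₁ : Set (E (n + 1))) =ᵐ[surf (n + 1)] closure P.Γ₁
  ae_eq₂ : (P.Γ₂ : Set (E (n + 1))) =ᵐ[surf (n + 1)] closure P.Γ₂
  null_face : ∀ F ∈ T.boundaryFaces P.Ω, F ∉ T.facesOn P.Ω P.Γ₁ → F ∉ T.facesOn P.Ω P.Γ₂ →
    F ∉ T.facesOn P.Ω P.Γ₃ → surf (n + 1) F = 0

/-- A part Γ_j differs from its closure only where that closure meets another one, that is, on
overlaps of distinct boundary faces. A boundary face in none of the three families is covered by its
overlaps with faces that belong to them. -/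
theorem IsConsistent.boundaryParts (hT : T.IsConsistent P) (hM : T.IsArranged P.Ω 𝒜)
    (hP : P.Admissible) : BoundaryParts T P := by
  have h12 := hT.surf_closure_inter hM hT.closure₁ hT.closure₂ hT.faces_disjoint₁₂
  have h13 := hT.surf_closure_inter hM hT.closure₁ hT.closure₃ hT.faces_disjoint₁₃
  have h23 := hT.surf_closure_inter hM hT.closure₂ hT.closure₃ hT.faces_disjoint₂₃
  have hcov := hP.boundary_eq
  refine ⟨h12, h13, h23, closure_ae_eq_of_cover isClosed_frontier hcov h12 h13,
    closure_ae_eq_of_cover (Γ' := P.Γ₁) isClosed_frontier (by rw [hcov, union_comm P.Γ₁ P.Γ₂])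
      (by rwa [inter_comm]) h23, fun F hF h1 h2 h3 => ?_⟩
  have hΓ : ∀ Γ, F ∉ T.facesOn P.Ω Γ → closure Γ = ⋃ F ∈ T.facesOn P.Ω Γ, F →
      surf (n + 1) (F ∩ closure Γ) = 0 := by
    intro Γ hFΓ hc
    have hsub : F ∩ closure Γ ⊆ ⋃ F' ∈ T.facesOn P.Ω Γ, F ∩ F' := by
      rintro x ⟨hx, hx'⟩
      rw [hc] at hx'
      obtain ⟨F', hF', hxF'⟩ := mem_iUnion₂.1 hx'
      exact mem_iUnion₂.2 ⟨F', hF', hx, hxF'⟩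
    refine measure_mono_null hsub (measure_biUnion_finset_null fun F' hF' => ?_)
    refine hT.surf_inter_eq_zero hM hF (mem_facesOn.1 hF').1 ?_
    rintro rfl
    exact hFΓ hF'
  refine measure_mono_null (fun x hx => ?_) (measure_union_null (measure_union_null
    (hΓ _ h1 hT.closure₁) (hΓ _ h2 hT.closure₂)) (hΓ _ h3 hT.closure₃))
  have hx' := (mem_boundaryFaces.1 hF).2 hx
  rw [hcov] at hx'
  rcases hx' with (h | h) | h
  · exact Or.inl (Or.inl ⟨hx, subset_closure h⟩)
  · exact Or.inl (Or.inr ⟨hx, subset_closure h⟩)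
  · exact Or.inr ⟨hx, subset_closure h⟩

end Mesh

end IPG

namespace IPG

/-! ### The flux of the solution -/

/-- The flux `K∇u - c u`. -/
noncomputable def Problem.flux {d : ℕ} (P : Problem d) (u : E d → ℝ) (x : E d) : E d :=
  P.K x (weakGrad P.Ω u x) - u x • P.c x

/-- The boundary value of the normal component of the flux on an element. -/
noncomputable def bdryFlux {d : ℕ} (P : Problem d) (u : E d → ℝ) (κ : Set (E d)) (y : E d) : ℝ :=
  ⟪trace κ (cellFlux P κ u) y, outerNormal κ y⟫ - normalTrace κ P.c y * trace κ u y

theorem ae_enorm_le_eLpNorm_top {α G : Type*} [MeasurableSpace α] {μ : Measure α}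
    [NormedAddCommGroup G] {f : α → G} : ∀ᵐ x ∂μ, ‖f x‖ₑ ≤ eLpNorm f ⊤ μ := by
  rw [eLpNorm_exponent_top]
  exact enorm_ae_le_eLpNormEssSup f μ

theorem memLp_top_of_enorm_le {α G : Type*} [MeasurableSpace α] {μ : Measure α}
    [NormedAddCommGroup G] {f : α → G} (hf : AEStronglyMeasurable f μ) {M : ℝ≥0∞} (hM : M ≠ ⊤)
    (h : ∀ᵐ x ∂μ, ‖f x‖ₑ ≤ M) : MemLp f ⊤ μ := by
  refine memLp_top_of_bound hf M.toReal ?_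
  filter_upwards [h] with x hx
  rw [← ofReal_norm] at hx
  exact (ENNReal.ofReal_le_iff_le_toReal hM).1 hx

theorem memLp_clm_apply {α : Type*} [MeasurableSpace α] {μ : Measure α} {d : ℕ}
    {K : α → E d →L[ℝ] E d} {G : α → E d} (hK : MemLp K ⊤ μ) (hG : MemLp G 2 μ) :
    MemLp (fun x => K x (G x)) 2 μ :=
  (ContinuousLinearMap.id ℝ (E d →L[ℝ] E d)).memLp_of_bilin (p := ⊤) (q := 2) 2 hK hG

section Cell

variable {n : ℕ} {T : Mesh (n + 1)} {P : Problem (n + 1)} {𝒜 : Finset (E (n + 1) × ℝ)}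
  {κ κ' F : Set (E (n + 1))} {u : E (n + 1) → ℝ}

theorem Problem.isFiniteMeasure (hP : P.Admissible) : IsFiniteMeasure (volume.restrict P.Ω) :=
  ⟨by rw [Measure.restrict_apply_univ]; exact hP.isBounded.measure_lt_top⟩

theorem Problem.memLp_flux (hP : P.Admissible) (hu : MemH1 P.Ω u) :
    MemLp (P.flux u) 2 (volume.restrict P.Ω) := by
  have h1 := memLp_clm_apply hP.K_bounded (hasWeakGrad_weakGrad hu).1
  have h2 : MemLp (fun x => u x • P.c x) 2 (volume.restrict P.Ω) :=
    (ContinuousLinearMap.lsmul ℝ ℝ).memLp_of_bilin (p := 2) (q := ⊤) 2 hu.1 hP.c_bounded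
  exact h1.sub h2

theorem Mesh.IsConsistent.restrict_le (hT : T.IsConsistent P) (hM : T.IsArranged P.Ω 𝒜)
    (hκ : κ ∈ T.cells) : volume.restrict (interior κ) ≤ volume.restrict P.Ω :=
  Measure.restrict_mono_set _ (hT.interior_subset hM hκ)

theorem Mesh.IsConsistent.weakGrad_ae_eq (hT : T.IsConsistent P) (hM : T.IsArranged P.Ω 𝒜)
    (hP : P.Admissible) (hu : MemH1 P.Ω u) (hκ : κ ∈ T.cells) :
    ∀ᵐ x ∂(volume.restrict (interior κ)), weakGrad (interior κ) u x = weakGrad P.Ω u x :=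
  ((hasWeakGrad_weakGrad hu).mono (hT.interior_subset hM hκ)).weakGrad_ae_eq isOpen_interior
    (hP.isBounded.subset (hT.interior_subset hM hκ))

/-- On an element K is bounded with a trace and the components of ∇u are in H¹; the trace of the
product is the product of the traces. -/
theorem Mesh.IsConsistent.exists_hasTrace_flux (hT : T.IsConsistent P) (hM : T.IsArranged P.Ω 𝒜)
    (hP : P.Admissible) (hκ : κ ∈ T.cells)
    (hK : ∃ Kκ : E (n + 1) → E (n + 1) →L[ℝ] E (n + 1), HasTrace κ P.K Kκ)
    (hu : MemH2 (interior κ) u) : ∃ g, HasTrace κ (cellFlux P κ u) g := by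
  obtain ⟨𝒬, hB⟩ := hM.cell κ hκ
  have hA := hM.isFlatBody hκ
  have hfin := hA.isFiniteMeasure
  obtain ⟨Kκ, hKκ⟩ := hK
  obtain ⟨g, hg⟩ := hB.exists_hasTrace_of_components hM.arr hu.2
  have hKM : ∀ᵐ p ∂(volume.restrict (interior κ)), ‖P.K p‖ₑ ≤ eLpNorm P.K ⊤ (volume.restrict P.Ω) :=
    ae_restrict_of_ae_restrict_of_subset (hT.interior_subset hM hκ) ae_enorm_le_eLpNorm_top
  have hKb := HasLimit.enorm_le (W := fun _ => P.K) hKκ.2 hA hKκ.1.1 fun _ _ => hKM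
  refine ⟨fun y => Kκ y (g y),
    memLp_clm_apply (memLp_top_of_enorm_le hKκ.1.1 hP.K_bounded.2.ne hKb) hg.1, ?_⟩
  exact HasLimit.bilin (W₁ := fun _ => P.K) (W₂ := fun _ => weakGrad (interior κ) u)
    (fun K v => K v) (fun K K' v v' => by
      have : K v - K' v' = K (v - v') + (K - K') v' := by
        rw [map_sub, sub_apply]; abel
      rw [this]
      exact (enorm_add_le _ _).trans (add_le_add (K.le_opENorm _) ((K - K').le_opENorm _)))
    hKκ.2 hg.2 hA (fun _ => (hasWeakGrad_weakGrad hu.1).1.1) hKκ.1.1 (hg.1.integrable one_le_two)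
    hP.K_bounded.2.ne fun _ _ => hKM

/-- The data of the solution on a single element: traces and the boundary values of the flux. -/
structure CellTraces (P : Problem (n + 1)) (u : E (n + 1) → ℝ) (κ : Set (E (n + 1))) : Prop where
  hasTrace : HasTrace κ u (trace κ u)
  hasNormalTrace : HasNormalTrace κ P.c (normalTrace κ P.c)
  bounded : MemLp (normalTrace κ P.c) ⊤ ((surf (n + 1)).restrict (frontier κ))
  flux_mem : MemLp (bdryFlux P u κ) 2 ((surf (n + 1)).restrict (frontier κ))
  flux_limit : HasLimit κ (fun ν p => ⟪P.flux u p, ν⟫) (bdryFlux P u κ)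

theorem Problem.exists_hasNormalTrace (hP : P.Admissible) {A : Set (E (n + 1))} (hA : IsFlatBody A)
    (hAΩ : interior A ⊆ P.Ω) : HasNormalTrace A P.c (normalTrace A P.c) ∧
      MemLp (normalTrace A P.c) ⊤ ((surf (n + 1)).restrict (frontier A)) := by
  have hle := Measure.restrict_mono_set (volume : Measure (E (n + 1))) hAΩ
  have hfin := Problem.isFiniteMeasure hP
  have h1 := hasNormalTrace_normalTrace (hA.exists_hasNormalTrace (hP.c_bounded.mono_measure hle)
    fun j => by
      obtain ⟨D, hD, hw⟩ := hP.c_deriv j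
      refine ⟨D, IntegrableOn.mono_set (hD.integrable ?_) hAΩ, hw.mono hAΩ⟩
      rw [ENNReal.le_div_iff_mul_le (by simp) (by simp)]
      norm_num)
  refine ⟨h1, memLp_top_of_enorm_le h1.1.1 hP.c_bounded.2.ne ?_⟩
  refine HasLimit.enorm_le (hasNormalTrace_iff.1 h1).2 hA h1.1.1 fun ν hν => ?_
  filter_upwards [ae_restrict_of_ae_restrict_of_subset hAΩ
    (ae_enorm_le_eLpNorm_top (f := P.c) (μ := volume.restrict P.Ω))] with p hp
  refine le_trans ?_ hp
  have := norm_inner_le_norm (𝕜 := ℝ) (P.c p) ν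
  rw [hν, mul_one] at this
  exact enorm_le_iff_norm_le.2 this

/-- The elementwise gradient agrees almost everywhere in the element with the global one. Hence the
elementwise boundary value `bdryFlux` is the normal limit of the global flux, the field whose
divergence is known. -/
theorem Mesh.IsConsistent.cellTraces (hT : T.IsConsistent P) (hM : T.IsArranged P.Ω 𝒜)
    (hP : P.Admissible) (hκ : κ ∈ T.cells)
    (hK : ∃ Kκ : E (n + 1) → E (n + 1) →L[ℝ] E (n + 1), HasTrace κ P.K Kκ)
    (hu : MemH1 P.Ω u) (hu₂ : MemH2 (interior κ) u) : CellTraces P u κ := by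
  obtain ⟨𝒬, hB⟩ := hM.cell κ hκ
  have hA := hM.isFlatBody hκ
  have hfin := hA.isFiniteMeasure
  have hsub := hT.interior_subset hM hκ
  have hle := hT.restrict_le hM hκ
  have ht := hasTrace_trace (hB.exists_hasTrace hM.arr hu₂.1)
  obtain ⟨hn, hnb⟩ := Problem.exists_hasNormalTrace hP hA hsub
  have hf := hasTrace_trace (hT.exists_hasTrace_flux hM hP hκ hK hu₂)
  have hcM : ∀ ν : E (n + 1), ‖ν‖ = 1 → ∀ᵐ p ∂(volume.restrict (interior κ)),
      ‖⟪P.c p, ν⟫‖ₑ ≤ eLpNorm P.c ⊤ (volume.restrict P.Ω) := by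
    intro ν hν
    filter_upwards [ae_restrict_of_ae_restrict_of_subset hsub
      (ae_enorm_le_eLpNorm_top (f := P.c) (μ := volume.restrict P.Ω))] with p hp
    refine le_trans ?_ hp
    have := norm_inner_le_norm (𝕜 := ℝ) (P.c p) ν
    rw [hν, mul_one] at this
    exact enorm_le_iff_norm_le.2 this
  have hcu : HasLimit κ (fun ν p => ⟪P.c p, ν⟫ * u p)
      (fun y => normalTrace κ P.c y * trace κ u y) :=
    HasLimit.bilin (W₁ := fun ν p => ⟪P.c p, ν⟫) (W₂ := fun _ => u) (fun a b : ℝ => a * b)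
      (fun a a' b b' => by
        rw [← enorm_mul, ← enorm_mul]
        have : a * b - a' * b' = a * (b - b') + (a - a') * b' := by ring
        rw [this]
        exact enorm_add_le _ _)
      (hasNormalTrace_iff.1 hn).2 ht.2 hA (fun _ => hu₂.1.1.1) hn.1.1 (ht.1.integrable one_le_two)
      hP.c_bounded.2.ne hcM
  have hcum : MemLp (fun y => normalTrace κ P.c y * trace κ u y) 2
      ((surf (n + 1)).restrict (frontier κ)) :=
    (ContinuousLinearMap.mul ℝ ℝ).memLp_of_bilin (p := ⊤) (q := 2) 2 hnb ht.1
  have hgm : AEStronglyMeasurable (cellFlux P κ u) (volume.restrict (interior κ)) :=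
    (memLp_clm_apply (hP.K_bounded.mono_measure hle) (hasWeakGrad_weakGrad hu₂.1).1).1
  have hfm : MemLp (fun y => ⟪trace κ (cellFlux P κ u) y, outerNormal κ y⟫) 2
      ((surf (n + 1)).restrict (frontier κ)) := by
    refine hf.1.of_le_mul (c := 1) (hf.1.1.inner hA.aestronglyMeasurable_outerNormal)
      (Eventually.of_forall fun y => ?_)
    rw [one_mul]
    exact (norm_inner_le_norm _ _).trans
      (mul_le_of_le_one_right (norm_nonneg _) (norm_outerNormal_le κ y))
  have hfl := HasLimit.inner_outerNormal hf.2 hA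
  refine ⟨ht, hn, hnb, hfm.sub hcum, ?_⟩
  have hsum := hfl.add (hcu.clm (-(1 : ℝ →L[ℝ] ℝ))) hA (fun ν => hgm.inner aestronglyMeasurable_const)
    hfm.1
  refine (hsum.congr_left hA fun ν => ?_).congr_right (Eventually.of_forall fun y => ?_)
  · filter_upwards [hT.weakGrad_ae_eq hM hP hu hκ] with p hp
    simp only [neg_apply, one_apply_eq_self, cellFlux, Problem.flux, hp, inner_sub_left,
      real_inner_smul_left]
    ring
  · simp only [neg_apply, one_apply_eq_self, bdryFlux]
    ring

/-! ### Matching of traces -/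

/-- The normal components from the two sides of an interface cancel. -/
theorem Mesh.IsConsistent.ae_add_eq_zero (hT : T.IsConsistent P) (hM : T.IsArranged P.Ω 𝒜)
    (hκ : κ ∈ T.cells) (hκ' : κ' ∈ T.cells) (hne : κ ≠ κ') {q : E (n + 1) → E (n + 1)}
    {D b b' : E (n + 1) → ℝ} (hq : IntegrableOn q P.Ω) (hD : IntegrableOn D P.Ω)
    (hdiv : HasWeakDiv P.Ω q D)
    (hb : IntegrableOn b (frontier κ) (surf (n + 1)))
    (hb' : IntegrableOn b' (frontier κ') (surf (n + 1)))
    (hl : HasLimit κ (fun ν p => ⟪q p, ν⟫) b) (hl' : HasLimit κ' (fun ν p => ⟪q p, ν⟫) b') :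
    ∀ᵐ y ∂((surf (n + 1)).restrict (frontier κ ∩ frontier κ')), b y + b' y = 0 := by
  have hcover : frontier κ ∩ frontier κ' ⊆ ((frontier κ ∩ frontier κ') \ skeleton 𝒜) ∪ skeleton 𝒜 :=
    fun x hx => (em (x ∈ skeleton 𝒜)).elim Or.inr fun h => Or.inl ⟨hx, h⟩
  refine ae_restrict_of_ae_restrict_of_subset hcover ((ae_restrict_union_iff _ _ _).2 ⟨?_, ?_⟩)
  swap
  · rw [Measure.restrict_eq_zero.2 (surf_skeleton hM.arr)]; simp
  refine ae_restrict_of_local fun x hx => ?_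
  obtain ⟨⟨hxκ, hxκ'⟩, hxS⟩ := hx
  obtain ⟨hνν', hxΩ⟩ := hT.two_cells hM hκ hκ' hne hxκ hxκ' hxS
  have hfl := hM.isFlatPoint hκ hxκ hxS
  have hfl' := hM.isFlatPoint hκ' hxκ' hxS
  rw [hνν'] at hfl'
  set ν := outerNormal κ x
  have hA := hM.isFlatBody hκ
  have hA' := hM.isFlatBody hκ'
  obtain ⟨ρ, hρ, hd, hlim⟩ := hl.exists_disc hA hfl
  obtain ⟨ρ', hρ', hd', hlim'⟩ := hl'.exists_disc hA' hfl'
  obtain ⟨R, hR, hR1⟩ := hfl.exists_radius hA.subset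
  obtain ⟨R', hR', hR2⟩ := hfl'.exists_radius hA'.subset
  obtain ⟨R'', hR'', hball⟩ := Metric.isOpen_iff.1 hM.isOpen x hxΩ
  obtain ⟨r, hr, h1, h2, h3, h4, h5⟩ : ∃ r > 0, r ≤ ρ ∧ r ≤ ρ' ∧ r ≤ R ∧ r ≤ R' ∧ r ≤ R'' :=
    ⟨min ρ (min ρ' (min R (min R' R''))), by positivity, by simp, by simp, by simp, by simp, by simp⟩
  obtain ⟨e1, e2, -⟩ := hR1 r h3
  obtain ⟨e3, e4, -⟩ := hR2 r h4
  have hsub := (Metric.ball_subset_ball h5).trans hball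
  have hs1 : halfBall x ν r ⊆ interior κ := by rw [← e1]; exact inter_subset_left
  have hs2 : halfBall x (-ν) r ⊆ interior κ' := by rw [← e3]; exact inter_subset_left
  have hd1 : disc x ν r ⊆ frontier κ := by rw [← e2]; exact inter_subset_left
  have hd2 : disc x ν r ⊆ frontier κ' := by rw [← disc_neg, ← e4]; exact inter_subset_left
  have hlim := hlim.mono (disc_mono h1)
  have hlim' := hlim'.mono (disc_mono h2)
  -- The field is extended by zero from each element separately, which gives two globally measurable
  -- fields that agree with `q` on their own side of the hyperplane.
  rw [indicator_inner] at hlim hlim'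
  rw [disc_neg] at hlim'
  refine ⟨disc x ν r, ?_, ?_⟩
  · refine mem_nhdsWithin.2 ⟨_, Metric.isOpen_ball, Metric.mem_ball_self hr, fun y hy => ?_⟩
    rw [← e2]
    exact ⟨hy.2.1.1, hy.1⟩
  · refine normalLimit_add_eq_zero hfl.1
      (aestronglyMeasurable_indicator_interior
        (hq.1.mono_measure (hT.restrict_le hM hκ)))
      (aestronglyMeasurable_indicator_interior
        (hq.1.mono_measure (hT.restrict_le hM hκ'))) ?_ ?_ (hq.mono_set hsub) (hD.mono_set hsub)
      (hdiv.mono hsub) (hb.mono_set hd1) (hb'.mono_set hd2) hlim hlim'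
    · filter_upwards [ae_restrict_mem (isOpen_halfBall x ν r).measurableSet] with p hp
      exact (indicator_of_mem (hs1 hp) q).symm
    · filter_upwards [ae_restrict_mem (isOpen_halfBall x (-ν) r).measurableSet] with p hp
      exact (indicator_of_mem (hs2 hp) q).symm

/-- Boundary limits from an element and from the domain agree. -/
theorem Mesh.IsConsistent.ae_eq_of_hasLimit (hT : T.IsConsistent P) (hM : T.IsArranged P.Ω 𝒜)
    (hκ : κ ∈ T.cells) {W : E (n + 1) → E (n + 1) → ℝ} {g g' : E (n + 1) → ℝ}
    (hW : ∀ ν, AEStronglyMeasurable (W ν) (volume.restrict P.Ω))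
    (hg : AEStronglyMeasurable g ((surf (n + 1)).restrict (frontier κ)))
    (hg' : AEStronglyMeasurable g' ((surf (n + 1)).restrict (frontier (closure P.Ω))))
    (hl : HasLimit κ W g) (hl' : HasLimit (closure P.Ω) W g') :
    ∀ᵐ y ∂((surf (n + 1)).restrict (frontier κ ∩ frontier P.Ω)), g y = g' y := by
  have hcover : frontier κ ∩ frontier P.Ω ⊆
      ((frontier κ ∩ frontier P.Ω) \ skeleton 𝒜) ∪ skeleton 𝒜 :=
    fun x hx => (em (x ∈ skeleton 𝒜)).elim Or.inr fun h => Or.inl ⟨hx, h⟩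
  refine ae_restrict_of_ae_restrict_of_subset hcover ((ae_restrict_union_iff _ _ _).2 ⟨?_, ?_⟩)
  swap
  · rw [Measure.restrict_eq_zero.2 (surf_skeleton hM.arr)]; simp
  refine ae_restrict_of_local fun x hx => ?_
  obtain ⟨⟨hxκ, hxΩ⟩, hxS⟩ := hx
  have hfl := hM.isFlatPoint hκ hxκ hxS
  have hfl' := hM.isFlatPoint_closure hxΩ hxS
  rw [← hT.outerNormal_eq hM hκ hxκ hxΩ hxS] at hfl'
  set ν := outerNormal κ x
  have hA := hM.isFlatBody hκ
  obtain ⟨ρ, hρ, hd, hlim⟩ := hl.exists_disc hA hfl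
  obtain ⟨ρ', hρ', hlim'⟩ := hl' x ν hfl'
  obtain ⟨R', hR', hR2⟩ := hfl'.exists_radius hM.isFlatBody_closure.subset
  have hlim' := hlim'.mono (inter_subset_inter_right _ (Metric.ball_subset_ball (min_le_left ρ' R')))
  have hd' := (hR2 _ (min_le_right ρ' R')).2.1
  rw [hd'] at hlim'
  obtain ⟨s, hs, hsR, hlim'⟩ := hlim'.exists_indicator hA hfl (lt_min hρ' hR')
  have hd1 : disc x ν (min ρ s) ⊆ frontier κ := by
    refine (disc_mono (min_le_left ρ s)).trans ?_
    rw [← hd]; exact inter_subset_left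
  have hd2 : disc x ν (min ρ s) ⊆ frontier (closure P.Ω) := by
    refine (disc_mono ((min_le_right ρ s).trans hsR)).trans ?_
    rw [← hd']; exact inter_subset_left
  refine ⟨disc x ν (min ρ s), ?_, ?_⟩
  · refine mem_nhdsWithin.2 ⟨_, Metric.isOpen_ball, Metric.mem_ball_self (lt_min hρ hs),
      fun y hy => ?_⟩
    have : y ∈ disc x ν ρ := by
      rw [← hd]; exact ⟨hy.2.1.1, Metric.ball_subset_ball (min_le_left _ _) hy.1⟩
    exact ⟨this.1, hy.1⟩
  · exact (hlim.mono (disc_mono (min_le_left _ _))).unique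
      (hlim'.mono (disc_mono (min_le_right _ _))) hfl.1 (disc_subset_plane x ν _)
      (aestronglyMeasurable_indicator_interior ((hW ν).mono_measure (hT.restrict_le hM hκ)))
      (hg.mono_set hd1) (hg'.mono_set hd2)

end Cell

end IPG

namespace IPG

section Weak

variable {n : ℕ} {T : Mesh (n + 1)} {P : Problem (n + 1)} {𝒜 : Finset (E (n + 1) × ℝ)}
  {κ κ' F : Set (E (n + 1))} {u : E (n + 1) → ℝ}

/-! ### The weak formulation with smooth test functions -/

theorem Mesh.IsArranged.trace_eq (hM : T.IsArranged P.Ω 𝒜) {G : Type*} [NormedAddCommGroup G] :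
    trace (closure P.Ω) = (trace P.Ω : (E (n + 1) → G) → E (n + 1) → G) :=
  (trace_congr hM.interior_eq hM.frontier_closure.symm).symm

theorem Mesh.IsArranged.ae_trace_eq (hM : T.IsArranged P.Ω 𝒜) {φ : E (n + 1) → ℝ}
    (hφ : Continuous φ) :
    ∀ᵐ y ∂((surf (n + 1)).restrict (frontier P.Ω)), trace P.Ω φ y = φ y := by
  have h := (HasTrace.of_continuous hφ hM.isFlatBody_closure).ae_eq hM.isFlatBody_closure
    hφ.aestronglyMeasurable
  rwa [hM.trace_eq, hM.frontier_closure] at h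

theorem Mesh.IsArranged.isFiniteMeasure_surf (hM : T.IsArranged P.Ω 𝒜) :
    IsFiniteMeasure ((surf (n + 1)).restrict (frontier P.Ω)) := by
  rw [← hM.frontier_closure]
  exact hM.isFlatBody_closure.isFiniteMeasure

/-- The zeroth order part of the divergence of the flux. -/
def Problem.source (P : Problem (n + 1)) (u : E (n + 1) → ℝ) (x : E (n + 1)) : ℝ :=
  P.r x * u x - P.f x

/-- The value of the flux on `Γ₂`. -/
noncomputable def Problem.robin (P : Problem (n + 1)) (u : E (n + 1) → ℝ) (x : E (n + 1)) : ℝ :=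
  P.g₂ x - P.α x * trace P.Ω u x

theorem Problem.memLp_source (hP : P.Admissible) (hu : MemH1 P.Ω u) :
    MemLp (P.source u) 2 (volume.restrict P.Ω) :=
  MemLp.sub ((ContinuousLinearMap.mul ℝ ℝ).memLp_of_bilin (p := ⊤) (q := 2) 2 hP.r_bounded hu.1)
    hP.f_mem

theorem Problem.integrableOn_flux (hP : P.Admissible) (hu : MemH1 P.Ω u) :
    IntegrableOn (P.flux u) P.Ω := by
  have := Problem.isFiniteMeasure hP
  exact (Problem.memLp_flux hP hu).integrable one_le_two

theorem Problem.integrableOn_source (hP : P.Admissible) (hu : MemH1 P.Ω u) :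
    IntegrableOn (P.source u) P.Ω := by
  have := Problem.isFiniteMeasure hP
  exact (Problem.memLp_source hP hu).integrable one_le_two

theorem Mesh.IsArranged.restrict_le (hM : T.IsArranged P.Ω 𝒜) {Γ : Set (E (n + 1))}
    (hΓ : Γ ⊆ frontier P.Ω) : IsFiniteMeasure ((surf (n + 1)).restrict Γ) ∧
      (surf (n + 1)).restrict Γ ≤ (surf (n + 1)).restrict (frontier P.Ω) := by
  have h1 := Measure.restrict_mono_set (surf (n + 1)) hΓ
  have := hM.isFiniteMeasure_surf
  exact ⟨isFiniteMeasure_of_le _ h1, h1⟩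

theorem Problem.Admissible.subset₁ (hP : P.Admissible) : P.Γ₁ ⊆ frontier P.Ω := by
  rw [hP.boundary_eq]; exact fun x hx => Or.inl (Or.inl hx)

theorem Problem.Admissible.subset₂ (hP : P.Admissible) : P.Γ₂ ⊆ frontier P.Ω := by
  rw [hP.boundary_eq]; exact fun x hx => Or.inl (Or.inr hx)

theorem Problem.Admissible.subset₃ (hP : P.Admissible) : P.Γ₃ ⊆ frontier P.Ω := by
  rw [hP.boundary_eq]; exact fun x hx => Or.inr hx

theorem Mesh.IsArranged.integrableOn_g₁ (hM : T.IsArranged P.Ω 𝒜) (hP : P.Admissible) :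
    IntegrableOn P.g₁ P.Γ₁ (surf (n + 1)) := by
  have := (hM.restrict_le hP.subset₁).1
  exact hP.g₁_mem.integrable one_le_two

theorem Mesh.IsArranged.integrableOn_α_mul (hM : T.IsArranged P.Ω 𝒜) (hP : P.Admissible) :
    IntegrableOn (fun x => P.α x * trace P.Ω u x) P.Γ₂ (surf (n + 1)) := by
  obtain ⟨h1, h2⟩ := hM.restrict_le hP.subset₂
  have h3 : MemLp (fun x => P.α x * trace P.Ω u x) 2 ((surf (n + 1)).restrict P.Γ₂) :=
    (ContinuousLinearMap.mul ℝ ℝ).memLp_of_bilin (p := ⊤) (q := 2) 2 hP.α_bounded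
      ((memLp_trace P.Ω u).mono_measure h2)
  exact h3.integrable one_le_two

theorem Mesh.IsArranged.integrableOn_g₂ (hM : T.IsArranged P.Ω 𝒜) (hP : P.Admissible) :
    IntegrableOn P.g₂ P.Γ₂ (surf (n + 1)) := by
  have := (hM.restrict_le hP.subset₂).1
  exact hP.g₂_mem.integrable one_le_two

/-- A smooth function vanishing on Γ₃ is admissible in the weak formulation; its chosen weak
gradient and trace are the classical ones. The boundary parts may be replaced by their closures
since they differ by null sets. -/
theorem Mesh.IsConsistent.weak_identity (hT : T.IsConsistent P) (hM : T.IsArranged P.Ω 𝒜)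
    (hP : P.Admissible) (hu : P.IsWeakSolution u) {φ : E (n + 1) → ℝ} (hφ : IsTest univ φ)
    (h0 : ∀ x ∈ P.Γ₃, φ x = 0) :
    ∫ x in P.Ω, (fderiv ℝ φ x (P.flux u x) + P.source u x * φ x) =
      (∫ x in closure P.Γ₁, P.g₁ x * φ x ∂(surf (n + 1)))
        + ∫ x in closure P.Γ₂, P.robin u x * φ x ∂(surf (n + 1)) := by
  have hB := hT.boundaryParts hM hP
  have hV : P.MemV φ := by
    refine ⟨memH1_of_contDiff hP.isOpen hP.isBounded hφ.1, ?_⟩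
    have := ae_restrict_of_ae_restrict_of_subset hP.subset₃ (hM.ae_trace_eq hφ.1.continuous)
    filter_upwards [this, ae_restrict_mem hP.isClosed₃.measurableSet] with x h1 h2
    rw [h1, h0 x h2]
  have hmain := hu.2.2 φ hV
  have hfin := Problem.isFiniteMeasure hP
  have hru : IntegrableOn (fun x => P.r x * u x) P.Ω :=
    ((ContinuousLinearMap.mul ℝ ℝ).memLp_of_bilin (p := ⊤) (q := 2) 2 hP.r_bounded
      hu.1.1).integrable one_le_two
  have hf : IntegrableOn P.f P.Ω := hP.f_mem.integrable one_le_two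
  have hi1 := integrableOn_fderiv_apply hφ (Problem.integrableOn_flux hP hu.1)
  have hi2 := integrableOn_mul_test hφ hru
  have hi3 := integrableOn_mul_test hφ hf
  have e1 : ∫ x in P.Ω, (⟪P.K x (weakGrad P.Ω u x) - u x • P.c x, weakGrad P.Ω φ x⟫
      + P.r x * u x * φ x) =
      ∫ x in P.Ω, (fderiv ℝ φ x (P.flux u x) + P.r x * u x * φ x) := by
    refine integral_congr_ae ?_
    filter_upwards [(hasWeakGrad_of_contDiff hP.isOpen hP.isBounded hφ.1).weakGrad_ae_eq
      hP.isOpen hP.isBounded] with x hx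
    rw [hx, real_inner_comm, inner_gradient_left]
    rfl
  have e2 : ∫ x in P.Γ₂, P.α x * trace P.Ω u x * trace P.Ω φ x ∂(surf (n + 1)) =
      ∫ x in P.Γ₂, P.α x * trace P.Ω u x * φ x ∂(surf (n + 1)) := by
    refine integral_congr_ae ?_
    filter_upwards [ae_restrict_of_ae_restrict_of_subset hP.subset₂
      (hM.ae_trace_eq hφ.1.continuous)] with x hx
    rw [hx]
  have e3 : ∫ x in P.Γ₁, P.g₁ x * trace P.Ω φ x ∂(surf (n + 1)) =
      ∫ x in P.Γ₁, P.g₁ x * φ x ∂(surf (n + 1)) := by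
    refine integral_congr_ae ?_
    filter_upwards [ae_restrict_of_ae_restrict_of_subset hP.subset₁
      (hM.ae_trace_eq hφ.1.continuous)] with x hx
    rw [hx]
  have e4 : ∫ x in P.Γ₂, P.g₂ x * trace P.Ω φ x ∂(surf (n + 1)) =
      ∫ x in P.Γ₂, P.g₂ x * φ x ∂(surf (n + 1)) := by
    refine integral_congr_ae ?_
    filter_upwards [ae_restrict_of_ae_restrict_of_subset hP.subset₂
      (hM.ae_trace_eq hφ.1.continuous)] with x hx
    rw [hx]
  rw [Problem.form, Problem.functional, e1, e2, e3, e4] at hmain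
  have e5 : ∫ x in P.Ω, (fderiv ℝ φ x (P.flux u x) + P.source u x * φ x) =
      (∫ x in P.Ω, (fderiv ℝ φ x (P.flux u x) + P.r x * u x * φ x))
        - ∫ x in P.Ω, P.f x * φ x := by
    have hi12 : IntegrableOn (fun x => fderiv ℝ φ x (P.flux u x) + P.r x * u x * φ x) P.Ω :=
      hi1.add hi2
    rw [← integral_sub hi12 hi3]
    refine integral_congr_ae (Eventually.of_forall fun x => ?_)
    simp only [Problem.source]; ring
  have e6 : ∫ x in P.Γ₂, P.robin u x * φ x ∂(surf (n + 1)) =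
      (∫ x in P.Γ₂, P.g₂ x * φ x ∂(surf (n + 1)))
        - ∫ x in P.Γ₂, P.α x * trace P.Ω u x * φ x ∂(surf (n + 1)) := by
    rw [← integral_sub (integrableOn_mul_test hφ (hM.integrableOn_g₂ hP))
      (integrableOn_mul_test hφ (hM.integrableOn_α_mul hP))]
    refine integral_congr_ae (Eventually.of_forall fun x => ?_)
    simp only [Problem.robin]; ring
  rw [← setIntegral_congr_set hB.ae_eq₁, ← setIntegral_congr_set hB.ae_eq₂, e5, e6]
  linarith

/-- Test functions supported in the open set Ω vanish on its boundary, so only the volume terms of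
the weak formulation remain. -/
theorem Mesh.IsConsistent.hasWeakDiv_flux (hT : T.IsConsistent P) (hM : T.IsArranged P.Ω 𝒜)
    (hP : P.Admissible) (hu : P.IsWeakSolution u) : HasWeakDiv P.Ω (P.flux u) (P.source u) := by
  intro φ hφ
  have hz : ∀ x ∈ frontier P.Ω, φ x = 0 := fun x hx => hφ.eq_zero fun hx' => by
    rw [hP.isOpen.frontier_eq] at hx
    exact hx.2 hx'
  have hcl : ∀ Γ ⊆ frontier P.Ω, ∀ β : E (n + 1) → ℝ,
      ∫ x in closure Γ, β x * φ x ∂(surf (n + 1)) = 0 := fun Γ hΓ β => by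
    refine setIntegral_eq_zero_of_forall_eq_zero fun x hx => ?_
    rw [hz x (closure_minimal hΓ isClosed_frontier hx), mul_zero]
  have h := hT.weak_identity hM hP hu (hφ.mono (subset_univ _)) fun x hx => hz x (hP.subset₃ hx)
  rw [hcl _ hP.subset₁, hcl _ hP.subset₂,
    integral_add (integrableOn_fderiv_apply hφ (Problem.integrableOn_flux hP hu.1))
      (integrableOn_mul_test hφ (Problem.integrableOn_source hP hu.1))] at h
  linarith

theorem Problem.exists_hasWeakDiv_c (hP : P.Admissible) :
    ∃ D, IntegrableOn D P.Ω ∧ HasWeakDiv P.Ω P.c D := by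
  have hfin := Problem.isFiniteMeasure hP
  choose D hD hw using hP.c_deriv
  have hDi : ∀ j, IntegrableOn (D j) P.Ω := fun j => (hD j).integrable (by
    rw [ENNReal.le_div_iff_mul_le (by simp) (by simp)]
    norm_num)
  refine ⟨fun x => ∑ j, D j x, integrable_finsetSum _ fun j _ => hDi j, fun φ hφ => ?_⟩
  have hci : IntegrableOn P.c P.Ω := hP.c_bounded.integrable le_top
  have e1 : ∀ x, fderiv ℝ φ x (P.c x) =
      ∑ j, P.c x j * fderiv ℝ φ x (EuclideanSpace.single j 1) := fun x => by
    conv_lhs => rw [← (EuclideanSpace.basisFun (Fin (n + 1)) ℝ).sum_repr (P.c x)]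
    simp [map_sum]
  have hcj : ∀ j, IntegrableOn (fun x => P.c x j) P.Ω := fun j =>
    (EuclideanSpace.proj (𝕜 := ℝ) j).integrable_comp hci
  simp only [e1, Finset.sum_mul]
  rw [integral_finsetSum, integral_finsetSum, ← Finset.sum_neg_distrib]
  · exact Finset.sum_congr rfl fun j _ => hw j φ hφ
  · exact fun j _ => integrableOn_mul_test hφ (hDi j)
  · intro j _
    have := integrableOn_fderiv_apply hφ (q := fun x => P.c x j • EuclideanSpace.single j (1 : ℝ))
      ((hcj j).smul_const _)
    simpa [IntegrableOn] using this

/-- This turns the continuity of a scalar trace across an interface into the cancellation of normal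
traces of the fields w e. -/
theorem HasWeakGrad.hasWeakDiv_smul {d : ℕ} {U : Set (E d)} {w : E d → ℝ} {G : E d → E d}
    (h : HasWeakGrad U w G) (e : E d) : HasWeakDiv U (fun x => w x • e) (fun x => ⟪G x, e⟫) := by
  intro φ hφ
  simpa using h.2 e φ hφ

/-! ### Jumps -/

theorem ae_notMem_skeleton (h𝒜 : IsArrangement 𝒜) (s : Set (E (n + 1))) :
    ∀ᵐ y ∂((surf (n + 1)).restrict s), y ∉ skeleton 𝒜 :=
  ae_restrict_of_ae (measure_eq_zero_iff_ae_notMem.1 (surf_skeleton h𝒜))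

theorem ae_restrict_mem_of_isClosed {s : Set (E (n + 1))} (hs : IsClosed s) :
    ∀ᵐ y ∂((surf (n + 1)).restrict s), y ∈ s := ae_restrict_mem hs.measurableSet

/-- All matching conditions come from one cancellation principle, `ae_add_eq_zero`, applied to c, to
the flux and to the fields u e_j. -/
theorem Mesh.IsConsistent.ae_interface (hT : T.IsConsistent P) (hM : T.IsArranged P.Ω 𝒜)
    (hP : P.Admissible) (hu : P.IsWeakSolution u) (hκ : κ ∈ T.cells) (hκ' : κ' ∈ T.cells)
    (hne : κ ≠ κ') (hc : CellTraces P u κ) (hc' : CellTraces P u κ') :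
    ∀ᵐ y ∂((surf (n + 1)).restrict (frontier κ ∩ frontier κ')),
      outerNormal κ' y = -outerNormal κ y ∧ trace κ u y = trace κ' u y ∧
        normalTrace κ P.c y + normalTrace κ' P.c y = 0 ∧
        bdryFlux P u κ y + bdryFlux P u κ' y = 0 := by
  have hA := hM.isFlatBody hκ
  have hA' := hM.isFlatBody hκ'
  have hf := hA.isFiniteMeasure
  have hf' := hA'.isFiniteMeasure
  have hfin := Problem.isFiniteMeasure hP
  obtain ⟨D, hD, hdiv⟩ := Problem.exists_hasWeakDiv_c hP
  have hG := hasWeakGrad_weakGrad hu.1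
  have hui : IntegrableOn u P.Ω := hu.1.1.integrable one_le_two
  have hGi : IntegrableOn (weakGrad P.Ω u) P.Ω := hG.1.integrable one_le_two
  have h1 := hT.ae_add_eq_zero hM hκ hκ' hne (hP.c_bounded.integrable le_top) hD hdiv
    (hc.hasNormalTrace.1.integrable one_le_two) (hc'.hasNormalTrace.1.integrable one_le_two)
    (hasNormalTrace_iff.1 hc.hasNormalTrace).2 (hasNormalTrace_iff.1 hc'.hasNormalTrace).2
  have h2 := hT.ae_add_eq_zero hM hκ hκ' hne (Problem.integrableOn_flux hP hu.1)
    (Problem.integrableOn_source hP hu.1) (hT.hasWeakDiv_flux hM hP hu)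
    (hc.flux_mem.integrable one_le_two) (hc'.flux_mem.integrable one_le_two)
    hc.flux_limit hc'.flux_limit
  have hlim : ∀ {A : Set (E (n + 1))}, IsFlatBody A → CellTraces P u A → ∀ e : E (n + 1),
      HasLimit A (fun ν p => ⟪u p • e, ν⟫) (fun y => ⟪trace A u y • e, outerNormal A y⟫) ∧
      IntegrableOn (fun y => ⟪trace A u y • e, outerNormal A y⟫) (frontier A) (surf (n + 1)) := by
    intro A hA hc e
    have hf := hA.isFiniteMeasure
    refine ⟨HasLimit.inner_outerNormal
      (HasLimit.clm (ContinuousLinearMap.toSpanSingleton ℝ e) hc.hasTrace.2) hA, ?_⟩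
    have hi : IntegrableOn (fun y => trace A u y • e) (frontier A) (surf (n + 1)) :=
      Integrable.smul_const (hc.hasTrace.1.integrable one_le_two) e
    refine Integrable.mono hi (hi.1.inner hA.aestronglyMeasurable_outerNormal)
      (Eventually.of_forall fun y => ?_)
    exact (norm_inner_le_norm _ _).trans
      (mul_le_of_le_one_right (norm_nonneg _) (norm_outerNormal_le A y))
  have h3 : ∀ j : Fin (n + 1), ∀ᵐ y ∂((surf (n + 1)).restrict (frontier κ ∩ frontier κ')),
      ⟪trace κ u y • EuclideanSpace.single j (1 : ℝ), outerNormal κ y⟫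
        + ⟪trace κ' u y • EuclideanSpace.single j (1 : ℝ), outerNormal κ' y⟫ = 0 := fun j =>
    hT.ae_add_eq_zero hM hκ hκ' hne (hui.smul_const _) (hGi.inner_const _)
      (hG.hasWeakDiv_smul _) (hlim hA hc _).2 (hlim hA' hc' _).2 (hlim hA hc _).1 (hlim hA' hc' _).1
  filter_upwards [h1, h2, ae_all_iff.2 h3, ae_notMem_skeleton hM.arr _,
    ae_restrict_mem_of_isClosed (isClosed_frontier.inter isClosed_frontier)] with y h1 h2 h3 hS hy
  obtain ⟨hν, -⟩ := hT.two_cells hM hκ hκ' hne hy.1 hy.2 hS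
  refine ⟨hν, ?_, h1, h2⟩
  have hfl := hM.isFlatPoint hκ hy.1 hS
  -- The scalar relations for the basis vectors assemble to (u_κ − u_κ') ν = 0, and ν is a unit
  -- vector.
  have hz : (trace κ u y - trace κ' u y) • outerNormal κ y = 0 := by
    ext j
    have := h3 j
    rw [hν, real_inner_smul_left, real_inner_smul_left, inner_neg_right,
      EuclideanSpace.inner_single_left] at this
    simp only [map_one, one_mul] at this
    simp only [PiLp.smul_apply, smul_eq_mul, PiLp.zero_apply]
    linarith
  rcases smul_eq_zero.1 hz with h | h
  · linarith
  · have := hfl.1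
    rw [h, norm_zero] at this
    exact absurd this zero_ne_one

theorem Mesh.IsConsistent.ae_boundary (hT : T.IsConsistent P) (hM : T.IsArranged P.Ω 𝒜)
    (hP : P.Admissible) (hu : MemH1 P.Ω u) (hκ : κ ∈ T.cells) (hc : CellTraces P u κ) :
    ∀ᵐ y ∂((surf (n + 1)).restrict (frontier κ ∩ frontier P.Ω)),
      outerNormal κ y = outerNormal P.Ω y ∧ trace κ u y = trace P.Ω u y ∧
        normalTrace κ P.c y = normalTrace P.Ω P.c y := by
  obtain ⟨𝒬, hB⟩ := hM.domain
  have ht := hasTrace_trace (hB.exists_hasTrace hM.arr (w := u) (by rwa [hM.interior_closure]))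
  obtain ⟨hn, -⟩ := Problem.exists_hasNormalTrace hP hM.isFlatBody_closure hM.interior_closure.subset
  have h1 := hT.ae_eq_of_hasLimit hM hκ (W := fun _ => u) (fun _ => hu.1.1) hc.hasTrace.1.1 ht.1.1
    hc.hasTrace.2 ht.2
  have h2 := hT.ae_eq_of_hasLimit hM hκ (W := fun ν p => ⟪P.c p, ν⟫)
    (fun _ => hP.c_bounded.1.inner aestronglyMeasurable_const) hc.hasNormalTrace.1.1 hn.1.1
    (hasNormalTrace_iff.1 hc.hasNormalTrace).2 (hasNormalTrace_iff.1 hn).2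
  rw [hM.trace_eq] at h1
  rw [← normalTrace_congr hM.interior_eq hM.frontier_closure.symm] at h2
  filter_upwards [h1, h2, ae_notMem_skeleton hM.arr _,
    ae_restrict_mem_of_isClosed (isClosed_frontier.inter isClosed_frontier)] with y h1 h2 hS hy
  exact ⟨hT.outerNormal_eq hM hκ hy.1 hy.2 hS, h1, h2⟩

end Weak

end IPG

namespace IPG

section Natural

variable {n : ℕ} {T : Mesh (n + 1)} {P : Problem (n + 1)} {𝒜 : Finset (E (n + 1) × ℝ)}
  {κ κ' F : Set (E (n + 1))} {u : E (n + 1) → ℝ}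

/-! ### Natural boundary conditions -/

/-- If the weak formulation, tested with functions that vanish near the closed set `Z`, has only
the boundary term `∫_Γ β φ`, then `β` is the boundary value of the flux off `Z`. -/
theorem Mesh.IsConsistent.bdryFlux_ae_eq (hT : T.IsConsistent P) (hM : T.IsArranged P.Ω 𝒜)
    (hP : P.Admissible) (hu : P.IsWeakSolution u) (hκ : κ ∈ T.cells) (hc : CellTraces P u κ)
    {Γ Z : Set (E (n + 1))} {β : E (n + 1) → ℝ} (hΓ : Γ ⊆ frontier P.Ω) (hZ : IsClosed Z)
    (hΓZ : frontier P.Ω ⊆ Γ ∪ Z) (hΓm : MeasurableSet Γ) (hβ : IntegrableOn β Γ (surf (n + 1)))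
    (hweak : ∀ φ : E (n + 1) → ℝ, IsTest Zᶜ φ →
      ∫ x in P.Ω, (fderiv ℝ φ x (P.flux u x) + P.source u x * φ x) =
        ∫ x in Γ, β x * φ x ∂(surf (n + 1))) :
    ∀ᵐ y ∂((surf (n + 1)).restrict ((frontier κ ∩ frontier P.Ω) \ Z)), bdryFlux P u κ y = β y := by
  have hcover : (frontier κ ∩ frontier P.Ω) \ Z ⊆
      (((frontier κ ∩ frontier P.Ω) \ Z) \ skeleton 𝒜) ∪ skeleton 𝒜 :=
    fun x hx => (em (x ∈ skeleton 𝒜)).elim Or.inr fun h => Or.inl ⟨hx, h⟩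
  refine ae_restrict_of_ae_restrict_of_subset hcover ((ae_restrict_union_iff _ _ _).2 ⟨?_, ?_⟩)
  swap
  · rw [Measure.restrict_eq_zero.2 (surf_skeleton hM.arr)]; simp
  refine ae_restrict_of_local fun x hx => ?_
  obtain ⟨⟨⟨hxκ, hxΩ⟩, hxZ⟩, hxS⟩ := hx
  have hfl := hM.isFlatPoint hκ hxκ hxS
  have hfl' := hM.isFlatPoint_closure hxΩ hxS
  rw [← hT.outerNormal_eq hM hκ hxκ hxΩ hxS] at hfl'
  set ν := outerNormal κ x
  have hA := hM.isFlatBody hκ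
  have hfin := hA.isFiniteMeasure
  have hsub := hT.interior_subset hM hκ
  have hb : IntegrableOn (bdryFlux P u κ) (frontier κ) (surf (n + 1)) :=
    hc.flux_mem.integrable one_le_two
  have hσ := Problem.integrableOn_flux hP hu.1
  have hD := Problem.integrableOn_source hP hu.1
  obtain ⟨R₀, hR₀, hG⟩ := hA.integral_eq_of_isTest_ball (hσ.mono_set hsub) (hD.mono_set hsub)
    ((hT.hasWeakDiv_flux hM hP hu).mono hsub) hb hc.flux_limit hfl
  obtain ⟨R₁, hR₁, hR1⟩ := hfl.exists_radius hA.subset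
  obtain ⟨R₂, hR₂, hR2⟩ := hfl'.exists_radius hM.isFlatBody_closure.subset
  obtain ⟨R₃, hR₃, hball⟩ := Metric.isOpen_iff.1 hZ.isOpen_compl x hxZ
  obtain ⟨r, hr, h0, h1, h2, h3⟩ : ∃ r > 0, r ≤ R₀ ∧ r ≤ R₁ ∧ r ≤ R₂ ∧ r ≤ R₃ :=
    ⟨min R₀ (min R₁ (min R₂ R₃)), by positivity, by simp, by simp, by simp, by simp⟩
  obtain ⟨e1, e2, -⟩ := hR1 r h1
  obtain ⟨e3, e4, -⟩ := hR2 r h2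
  rw [hM.interior_closure] at e3
  rw [hM.frontier_closure] at e4
  have hbZ := (Metric.ball_subset_ball h3).trans hball
  -- The ball avoids Z, so there the boundary of Ω consists of Γ alone and is the same disc as the
  -- boundary of the element.
  have e5 : Γ ∩ Metric.ball x r = disc x ν r := by
    rw [← e4]
    refine Subset.antisymm (inter_subset_inter_left _ hΓ) fun y hy => ⟨?_, hy.2⟩
    exact (hΓZ hy.1).resolve_right (hbZ hy.2)
  have hloc : ∀ {s : Set (E (n + 1))} {μ : Measure (E (n + 1))} {f : E (n + 1) → ℝ},
      MeasurableSet s → (∀ y ∉ Metric.ball x r, f y = 0) →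
      ∫ y in s, f y ∂μ = ∫ y in s ∩ Metric.ball x r, f y ∂μ := fun hs hf =>
    setIntegral_eq_of_subset_of_forall_sdiff_eq_zero hs inter_subset_left
      fun y hy => hf y fun h => hy.2 ⟨hy.1, h⟩
  refine ⟨disc x ν r, ?_, ?_⟩
  · refine mem_nhdsWithin.2 ⟨_, Metric.isOpen_ball, Metric.mem_ball_self hr, fun y hy => ?_⟩
    rw [← e2]
    exact ⟨hy.2.1.1.1, hy.1⟩
  have hbd : IntegrableOn (bdryFlux P u κ) (disc x ν r) (surf (n + 1)) :=
    hb.mono_set (by rw [← e2]; exact inter_subset_left)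
  have hβd : IntegrableOn β (disc x ν r) (surf (n + 1)) :=
    hβ.mono_set (by rw [← e5]; exact inter_subset_left)
  have hμ : ((surf (n + 1)).restrict (disc x ν r)).restrict (Metric.ball x r) =
      (surf (n + 1)).restrict (disc x ν r) := by
    rw [Measure.restrict_restrict Metric.isOpen_ball.measurableSet,
      inter_eq_right.2 (show disc x ν r ⊆ Metric.ball x r from inter_subset_right)]
  have key := ae_eq_zero_of_forall_isTest (U := Metric.ball x r) Metric.isOpen_ball
    (μ := (surf (n + 1)).restrict (disc x ν r)) (f := fun y => bdryFlux P u κ y - β y)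
    (by rw [IntegrableOn, hμ]; exact hbd.sub hβd) fun φ hφ => ?_
  · rw [hμ] at key
    filter_upwards [key] with y hy
    linarith
  rw [hμ]
  have hφ0 : ∀ y ∉ Metric.ball x r, φ y = 0 := fun y hy => hφ.eq_zero hy
  have hF0 : ∀ y ∉ Metric.ball x r, fderiv ℝ φ y (P.flux u y) + P.source u y * φ y = 0 :=
    fun y hy => by rw [hφ0 y hy, hφ.fderiv_eq_zero hy]; simp
  -- Green's formula on the element and the weak formulation on Ω have the same volume term, because
  -- inside the ball both sets are the same half ball; their boundary terms must therefore agree.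
  have i1 := hG φ (hφ.mono (Metric.ball_subset_ball h0))
  have i2 := hweak φ (hφ.mono hbZ)
  rw [hloc isOpen_interior.measurableSet hF0, e1,
    hloc isClosed_frontier.measurableSet (fun y hy => by rw [hφ0 y hy, mul_zero]), e2] at i1
  rw [hloc hM.isOpen.measurableSet hF0, e3,
    hloc hΓm (fun y hy => by rw [hφ0 y hy, mul_zero]), e5, i1] at i2
  simp only [sub_mul]
  rw [integral_sub (integrableOn_mul_test hφ hbd) (integrableOn_mul_test hφ hβd), i2, sub_self]

theorem ae_restrict_of_sdiff_null {α : Type*} [MeasurableSpace α] {μ : Measure α} {s t Z : Set α}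
    {p : α → Prop} (h : ∀ᵐ y ∂μ.restrict (t \ Z), p y) (hst : s ⊆ t) (hZ : μ (s ∩ Z) = 0) :
    ∀ᵐ y ∂μ.restrict s, p y := by
  have hcover : s ⊆ (t \ Z) ∪ (s ∩ Z) :=
    fun x hx => (em (x ∈ Z)).elim (fun h => Or.inr ⟨hx, h⟩) fun h => Or.inl ⟨hst hx, h⟩
  refine ae_restrict_of_ae_restrict_of_subset hcover ((ae_restrict_union_iff _ _ _).2 ⟨h, ?_⟩)
  rw [Measure.restrict_eq_zero.2 hZ]; simp

theorem Mesh.IsConsistent.subset_inter_frontier (hT : T.IsConsistent P) (hκ : κ ∈ T.cells)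
    (hF : F ∈ T.boundaryFaces P.Ω) (hFκ : F ∈ T.faces κ) : F ⊆ frontier κ ∩ frontier P.Ω :=
  subset_inter (hT.face_subset hκ hFκ) (Mesh.mem_boundaryFaces.1 hF).2

theorem Problem.Admissible.closure_cover (hP : P.Admissible) :
    frontier P.Ω = closure P.Γ₁ ∪ closure P.Γ₂ ∪ closure P.Γ₃ := by
  rw [← closure_union, ← closure_union, ← hP.boundary_eq, isClosed_frontier.closure_eq]

/-- With Z the union of the closures of the other two parts, only the term with g₁ is left, and the
face meets Z in a null set. -/
theorem Mesh.IsConsistent.bdryFlux_ae_eq₁ (hT : T.IsConsistent P) (hM : T.IsArranged P.Ω 𝒜)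
    (hP : P.Admissible) (hu : P.IsWeakSolution u) (hκ : κ ∈ T.cells) (hc : CellTraces P u κ)
    (hF : F ∈ T.facesOn P.Ω P.Γ₁) (hFκ : F ∈ T.faces κ) :
    ∀ᵐ y ∂((surf (n + 1)).restrict F), bdryFlux P u κ y = P.g₁ y := by
  have hB := hT.boundaryParts hM hP
  obtain ⟨hF1, hF2⟩ := Mesh.mem_facesOn.1 hF
  have hcov := hP.closure_cover
  have hi : IntegrableOn P.g₁ (closure P.Γ₁) (surf (n + 1)) :=
    (hM.integrableOn_g₁ hP).congr_set_ae hB.ae_eq₁.symm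
  refine ae_restrict_of_sdiff_null (hT.bdryFlux_ae_eq hM hP hu hκ hc
    (Z := closure P.Γ₂ ∪ closure P.Γ₃) (closure_minimal hP.subset₁ isClosed_frontier)
    (isClosed_closure.union isClosed_closure) (by rw [hcov, union_assoc])
    isClosed_closure.measurableSet hi fun φ hφ => ?_) (hT.subset_inter_frontier hκ hF1 hFκ) ?_
  · rw [hT.weak_identity hM hP hu (hφ.mono (subset_univ _))
      fun x hx => hφ.eq_zero fun h => h (Or.inr (subset_closure hx)),
      setIntegral_eq_zero_of_forall_eq_zero (t := closure P.Γ₂) fun x hx => by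
        rw [hφ.eq_zero fun h => h (Or.inl hx), mul_zero], add_zero]
  · rw [inter_union_distrib_left]
    exact measure_union_null (measure_mono_null (inter_subset_inter_left _ hF2) hB.null₁₂)
      (measure_mono_null (inter_subset_inter_left _ hF2) hB.null₁₃)

theorem Mesh.IsConsistent.bdryFlux_ae_eq₂ (hT : T.IsConsistent P) (hM : T.IsArranged P.Ω 𝒜)
    (hP : P.Admissible) (hu : P.IsWeakSolution u) (hκ : κ ∈ T.cells) (hc : CellTraces P u κ)
    (hF : F ∈ T.facesOn P.Ω P.Γ₂) (hFκ : F ∈ T.faces κ) :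
    ∀ᵐ y ∂((surf (n + 1)).restrict F), bdryFlux P u κ y = P.robin u y := by
  have hB := hT.boundaryParts hM hP
  obtain ⟨hF1, hF2⟩ := Mesh.mem_facesOn.1 hF
  have hcov := hP.closure_cover
  have hi : IntegrableOn (P.robin u) (closure P.Γ₂) (surf (n + 1)) :=
    IntegrableOn.congr_set_ae ((hM.integrableOn_g₂ hP).sub (hM.integrableOn_α_mul hP))
      hB.ae_eq₂.symm
  refine ae_restrict_of_sdiff_null (hT.bdryFlux_ae_eq hM hP hu hκ hc
    (Z := closure P.Γ₁ ∪ closure P.Γ₃) (closure_minimal hP.subset₂ isClosed_frontier)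
    (isClosed_closure.union isClosed_closure)
    (by rw [hcov, union_comm (closure P.Γ₁), union_assoc])
    isClosed_closure.measurableSet hi fun φ hφ => ?_) (hT.subset_inter_frontier hκ hF1 hFκ) ?_
  · rw [hT.weak_identity hM hP hu (hφ.mono (subset_univ _))
      fun x hx => hφ.eq_zero fun h => h (Or.inr (subset_closure hx)),
      setIntegral_eq_zero_of_forall_eq_zero (t := closure P.Γ₁) fun x hx => by
        rw [hφ.eq_zero fun h => h (Or.inl hx), mul_zero], zero_add]
  · rw [inter_union_distrib_left]
    refine measure_union_null (measure_mono_null (inter_subset_inter_left _ hF2) ?_)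
      (measure_mono_null (inter_subset_inter_left _ hF2) hB.null₂₃)
    rw [inter_comm]
    exact hB.null₁₂

end Natural

end IPG

namespace IPG

theorem setIntegral_biUnion_finset_ae {X : Type*} [MeasurableSpace X] {μ : Measure X}
    {I : Finset (Set X)} {f : X → ℝ} (hm : ∀ s ∈ I, MeasurableSet s)
    (hd : ∀ s ∈ I, ∀ t ∈ I, s ≠ t → μ (s ∩ t) = 0) (hf : IntegrableOn f (⋃ s ∈ I, s) μ) :
    ∫ x in ⋃ s ∈ I, s, f x ∂μ = ∑ s ∈ I, ∫ x in s, f x ∂μ := by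
  have hU : (⋃ s ∈ I, s) = ⋃ s : (I : Set (Set X)), (s : Set X) := by ext; simp
  rw [hU] at hf ⊢
  have h := integral_iUnion_ae (μ := μ) (s := fun s : (I : Set (Set X)) => (s : Set X))
    (fun s => (hm s s.2).nullMeasurableSet)
    (fun s t hst => hd s s.2 t t.2 fun h => hst (Subtype.ext h)) hf
  refine h.trans ?_
  rw [tsum_fintype]
  exact Finset.sum_coe_sort I fun s => ∫ x in s, f x ∂μ

theorem integrable_fun_mul {X : Type*} [MeasurableSpace X] {μ : Measure X} {f g : X → ℝ}
    (hf : MemLp f 2 μ) (hg : MemLp g 2 μ) : Integrable (fun x => f x * g x) μ :=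
  hf.integrable_mul hg

section Sum

variable {n : ℕ} {T : Mesh (n + 1)} {P : Problem (n + 1)} {𝒜 : Finset (E (n + 1) × ℝ)}
  {κ κ' F : Set (E (n + 1))} {u v : E (n + 1) → ℝ}

/-! ### Discrete functions on an element -/

/-- On the element `κ` the function `v` is given by a test function. -/
def IsSmoothOn (κ : Set (E (n + 1))) (v : E (n + 1) → ℝ) : Prop :=
  ∃ φ, IsTest univ φ ∧ ∀ᵐ x ∂(volume.restrict (interior κ)), v x = φ x

/-- Multiplying the polynomial by a cutoff that is one near the compact element produces a test
function without changing it there. -/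
theorem Mesh.MemBrokenPoly.isSmoothOn {kind : Set (E (n + 1)) → PolyKind} {k : ℕ}
    (hv : T.MemBrokenPoly P.Ω kind k v) (hκ : κ ∈ T.cells) (hA : IsFlatBody κ) :
    IsSmoothOn κ v := by
  obtain ⟨p, -, hp⟩ := hv.2 κ hκ
  obtain ⟨χ, hχ, hχ1⟩ := exists_isTest_one hA.isCompact isOpen_univ (subset_univ κ)
  refine ⟨_, hχ.mul_left (contDiff_mvPolynomial_eval p), ?_⟩
  filter_upwards [ae_restrict_of_ae_restrict_of_subset _root_.interior_subset hp,
    ae_restrict_mem isOpen_interior.measurableSet] with x hx hx'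
  have : χ x = 1 := subset_of_mem_nhdsSet hχ1 (_root_.interior_subset hx')
  rw [hx, this, mul_one]

theorem IsSmoothOn.ae_eq (hA : IsFlatBody κ) {φ : E (n + 1) → ℝ} (hφ : IsTest univ φ)
    (hv : ∀ᵐ x ∂(volume.restrict (interior κ)), v x = φ x) :
    (∀ᵐ x ∂(volume.restrict (interior κ)), weakGrad (interior κ) v x = gradient φ x) ∧
      ∀ᵐ y ∂((surf (n + 1)).restrict (frontier κ)), trace κ v y = φ y := by
  have hb := hA.isCompact.isBounded.subset (_root_.interior_subset (s := κ))
  have hv' : ∀ᵐ x ∂(volume.restrict (interior κ)), φ x = v x := by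
    filter_upwards [hv] with x hx using hx.symm
  refine ⟨((hasWeakGrad_of_contDiff isOpen_interior hb hφ.1).congr hv').weakGrad_ae_eq
    isOpen_interior hb, ?_⟩
  exact ((HasTrace.of_continuous hφ.1.continuous hA).congr_left hA hv').ae_eq hA
    (hφ.1.continuous.aestronglyMeasurable.congr hv')

/-! ### Faces -/

theorem memLp_inner_outerNormal (hA : IsFlatBody κ) {g : E (n + 1) → E (n + 1)}
    (hg : MemLp g 2 ((surf (n + 1)).restrict (frontier κ))) :
    MemLp (fun y => ⟪g y, outerNormal κ y⟫) 2 ((surf (n + 1)).restrict (frontier κ)) := by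
  refine hg.of_le_mul (c := 1) (hg.1.inner hA.aestronglyMeasurable_outerNormal)
    (Eventually.of_forall fun y => ?_)
  rw [one_mul]
  exact (norm_inner_le_norm _ _).trans
    (mul_le_of_le_one_right (norm_nonneg _) (norm_outerNormal_le κ y))

/-- The contribution of a face to the sum of the boundary terms of all elements. -/
noncomputable def Mesh.faceTerm (T : Mesh (n + 1)) (P : Problem (n + 1)) (u v : E (n + 1) → ℝ)
    (F : Set (E (n + 1))) : ℝ :=
  ∑ κ ∈ T.cellsAt F, ∫ y in F, bdryFlux P u κ y * trace κ v y ∂(surf (n + 1))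

theorem CellTraces.memLp_mul (hc : CellTraces P u κ) :
    MemLp (fun y => normalTrace κ P.c y * trace κ u y) 2
      ((surf (n + 1)).restrict (frontier κ)) :=
  (ContinuousLinearMap.mul ℝ ℝ).memLp_of_bilin (p := ⊤) (q := 2) 2 hc.bounded hc.hasTrace.1

/-- A face inside the skeleton is surface null and contributes nothing; any other face has a point
off the skeleton, at which its elements can be counted. -/
theorem Mesh.IsConsistent.eq_pair_or_null (hT : T.IsConsistent P) (hM : T.IsArranged P.Ω 𝒜)
    (hF : F ∈ T.interiorFaces P.Ω) : surf (n + 1) F = 0 ∨ ∃ κ κ', κ ≠ κ' ∧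
      (κ ∈ T.cells ∧ F ∈ T.faces κ) ∧ (κ' ∈ T.cells ∧ F ∈ T.faces κ') ∧
        ∀ κ'', κ'' ∈ T.cellsAt F ↔ κ'' = κ ∨ κ'' = κ' := by
  by_cases h : F ⊆ skeleton 𝒜
  · exact Or.inl (measure_mono_null h (surf_skeleton hM.arr))
  · obtain ⟨x, hx, hxS⟩ := not_subset.1 h
    exact Or.inr (hT.cellsAt_interior hM hF hx hxS)

theorem Mesh.IsConsistent.eq_singleton_or_null (hT : T.IsConsistent P)
    (hM : T.IsArranged P.Ω 𝒜) (hF : F ∈ T.boundaryFaces P.Ω) :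
    surf (n + 1) F = 0 ∨ ∃ κ ∈ T.cells, F ∈ T.faces κ ∧ T.cellsAt F = {κ} := by
  by_cases h : F ⊆ skeleton 𝒜
  · exact Or.inl (measure_mono_null h (surf_skeleton hM.arr))
  · obtain ⟨x, hx, hxS⟩ := not_subset.1 h
    exact Or.inr (hT.cellsAt_boundary hM hF hx hxS)

theorem Mesh.faceTerm_of_null (h : surf (n + 1) F = 0) : T.faceTerm P u v F = 0 := by
  rw [Mesh.faceTerm, Measure.restrict_eq_zero.2 h]
  simp

/-- With u continuous across the face, both the symmetrisation and the penalty term vanish. The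
element terms give σ·ν_κ times the jump of v, and the average of K∇u together with the upwind term
gives minus the same. -/
theorem Mesh.IsConsistent.interior_face (hT : T.IsConsistent P) (hM : T.IsArranged P.Ω 𝒜)
    (hP : P.Admissible) (hu : P.IsWeakSolution u) (hc : ∀ κ ∈ T.cells, CellTraces P u κ)
    (θ η : ℝ) (hF : F ∈ T.interiorFaces P.Ω) :
    T.faceTerm P u v F
      + (∫ x in F, (θ * ⟪T.avgFlux P F v x, T.jump F u x⟫
          - ⟪T.avgFlux P F u x - (η / Metric.diam F) • T.jump F u x, T.jump F v x⟫)
            ∂(surf (n + 1)))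
      + ∫ x in F, T.upwindJump P F u v x ∂(surf (n + 1)) = 0 := by
  rcases hT.eq_pair_or_null hM hF with h | ⟨κ, κ', hne, ⟨hκ, hFκ⟩, ⟨hκ', hFκ'⟩, hat⟩
  · rw [Mesh.faceTerm_of_null h, Measure.restrict_eq_zero.2 h]
    simp
  have hat : T.cellsAt F = {κ, κ'} := by
    ext κ''
    rw [hat, Finset.mem_insert, Finset.mem_singleton]
  have hs := hT.face_subset hκ hFκ
  have hs' := hT.face_subset hκ' hFκ'
  have hle := Measure.restrict_mono_set (surf (n + 1)) hs
  have hle' := Measure.restrict_mono_set (surf (n + 1)) hs'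
  have hb : MemLp (bdryFlux P u κ) 2 ((surf (n + 1)).restrict F) :=
    (hc κ hκ).flux_mem.mono_measure hle
  have hnu : MemLp (fun y => normalTrace κ P.c y * trace κ u y) 2 ((surf (n + 1)).restrict F) :=
    (hc κ hκ).memLp_mul.mono_measure hle
  have hv : MemLp (trace κ v) 2 ((surf (n + 1)).restrict F) :=
    (memLp_trace κ v).mono_measure hle
  have hv' : MemLp (trace κ' v) 2 ((surf (n + 1)).restrict F) :=
    (memLp_trace κ' v).mono_measure hle'
  have hae := ae_restrict_of_ae_restrict_of_subset (subset_inter hs hs')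
    (hT.ae_interface hM hP hu hκ hκ' hne (hc κ hκ) (hc κ' hκ'))
  have hnorm : ∀ᵐ y ∂((surf (n + 1)).restrict F), ⟪outerNormal κ y, outerNormal κ y⟫ = 1 := by
    have hFc := hT.isClosed_face (Mesh.mem_interiorFaces.1 hF).1
    filter_upwards [ae_notMem_skeleton hM.arr _, ae_restrict_mem_of_isClosed hFc] with y hS hy
    rw [real_inner_self_eq_norm_sq, (hM.isFlatPoint hκ (hs hy) hS).1, one_pow]
  have e1 : T.faceTerm P u v F = (∫ y in F, bdryFlux P u κ y * trace κ v y ∂(surf (n + 1)))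
      - ∫ y in F, bdryFlux P u κ y * trace κ' v y ∂(surf (n + 1)) := by
    rw [Mesh.faceTerm, hat, Finset.sum_pair hne, sub_eq_add_neg, ← integral_neg]
    congr 1
    refine integral_congr_ae ?_
    filter_upwards [hae] with y hy
    rw [eq_neg_of_add_eq_zero_right hy.2.2.2, neg_mul]
  have e2 : ∫ x in F, (θ * ⟪T.avgFlux P F v x, T.jump F u x⟫
      - ⟪T.avgFlux P F u x - (η / Metric.diam F) • T.jump F u x, T.jump F v x⟫) ∂(surf (n + 1)) =
      ∫ y in F, -((bdryFlux P u κ y + normalTrace κ P.c y * trace κ u y)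
        * (trace κ v y - trace κ' v y)) ∂(surf (n + 1)) := by
    refine integral_congr_ae ?_
    filter_upwards [hae, hnorm] with y hy hn
    obtain ⟨h1, h2, h3, h4⟩ := hy
    have hj : ∀ w, T.jump F w y = (trace κ w y - trace κ' w y) • outerNormal κ y := fun w => by
      rw [Mesh.jump, hat, Finset.sum_pair hne, h1, sub_smul, smul_neg, sub_eq_add_neg]
    have hju : T.jump F u y = 0 := by rw [hj, h2, sub_self, zero_smul]
    have ha : T.avgFlux P F u y = (2 : ℝ)⁻¹ •
        (trace κ (cellFlux P κ u) y + trace κ' (cellFlux P κ' u) y) := by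
      rw [Mesh.avgFlux, hat, Finset.sum_pair hne, Finset.card_pair hne]
      norm_num
    have hn' : normalTrace κ' P.c y = -normalTrace κ P.c y := eq_neg_of_add_eq_zero_right h3
    -- The convective parts drop out, and what remains says that the two traces of K∇u have the same
    -- normal component. Their mean therefore equals `bdryFlux` plus (c·ν)u.
    rw [bdryFlux, bdryFlux, h1, hn', ← h2, inner_neg_right] at h4
    rw [hju, hj v, ha, bdryFlux, inner_zero_right, smul_zero, sub_zero, real_inner_smul_left,
      real_inner_smul_right, inner_add_left]
    linear_combination (1 / 2 * (trace κ v y - trace κ' v y)) * h4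
  have e3 : ∫ x in F, T.upwindJump P F u v x ∂(surf (n + 1)) =
      ∫ y in F, (normalTrace κ P.c y * trace κ u y) * (trace κ v y - trace κ' v y)
        ∂(surf (n + 1)) := by
    refine integral_congr_ae ?_
    filter_upwards [hae] with y hy
    obtain ⟨h1, h2, h3, h4⟩ := hy
    have hn' : normalTrace κ' P.c y = -normalTrace κ P.c y := eq_neg_of_add_eq_zero_right h3
    rw [Mesh.upwindJump, Mesh.upwind, hat, Finset.sum_pair hne, Finset.sum_pair hne, hn', ← h2]
    -- The upwind side is one of the two elements according to the sign; as u has equal traces the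
    -- result is the same, and where c·ν = 0 the default upwind value 0 is multiplied by zero.
    rcases lt_trichotomy (normalTrace κ P.c y) 0 with h | h | h
    · rw [if_neg h.not_gt, if_pos (neg_pos.2 h)]; ring
    · rw [h]; simp
    · rw [if_pos h, if_neg (by linarith)]; ring
  have i1 := integrable_fun_mul hb hv
  have i2 := integrable_fun_mul hb hv'
  have i3 : Integrable (fun y => bdryFlux P u κ y * trace κ v y - bdryFlux P u κ y * trace κ' v y)
    ((surf (n + 1)).restrict F) := i1.sub i2
  have i4 : Integrable (fun y => -((bdryFlux P u κ y + normalTrace κ P.c y * trace κ u y)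
    * (trace κ v y - trace κ' v y))) ((surf (n + 1)).restrict F) :=
    (integrable_fun_mul (hb.add hnu) (hv.sub hv')).neg
  have i5 : Integrable (fun y => normalTrace κ P.c y * trace κ u y
    * (trace κ v y - trace κ' v y)) ((surf (n + 1)).restrict F) :=
    integrable_fun_mul hnu (hv.sub hv')
  have i6 : Integrable (fun y => bdryFlux P u κ y * trace κ v y - bdryFlux P u κ y * trace κ' v y
    + -((bdryFlux P u κ y + normalTrace κ P.c y * trace κ u y)
    * (trace κ v y - trace κ' v y))) ((surf (n + 1)).restrict F) := i3.add i4
  rw [e1, e2, e3, ← integral_sub i1 i2, ← integral_add i3 i4, ← integral_add i6 i5]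
  refine integral_eq_zero_of_ae (Eventually.of_forall fun y => ?_)
  simp only [Pi.zero_apply]
  ring

theorem Mesh.IsConsistent.face₁ (hT : T.IsConsistent P) (hM : T.IsArranged P.Ω 𝒜)
    (hP : P.Admissible) (hu : P.IsWeakSolution u) (hc : ∀ κ ∈ T.cells, CellTraces P u κ)
    (hF : F ∈ T.facesOn P.Ω P.Γ₁) :
    T.faceTerm P u v F = ∫ x in F, P.g₁ x * T.bdryTrace F v x ∂(surf (n + 1)) := by
  rcases hT.eq_singleton_or_null hM (Mesh.mem_facesOn.1 hF).1 with h | ⟨κ, hκ, hFκ, hat⟩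
  · rw [Mesh.faceTerm_of_null h, Measure.restrict_eq_zero.2 h]
    simp
  rw [Mesh.faceTerm, hat, Finset.sum_singleton]
  refine integral_congr_ae ?_
  filter_upwards [hT.bdryFlux_ae_eq₁ hM hP hu hκ (hc κ hκ) hF hFκ] with y hy
  rw [hy, Mesh.bdryTrace, hat, Finset.sum_singleton]

theorem Mesh.IsConsistent.restrict_face_le₂ (hT : T.IsConsistent P) (hM : T.IsArranged P.Ω 𝒜)
    (hP : P.Admissible) (hF : F ∈ T.facesOn P.Ω P.Γ₂) :
    (surf (n + 1)).restrict F ≤ (surf (n + 1)).restrict P.Γ₂ := by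
  rw [Measure.restrict_congr_set (hT.boundaryParts hM hP).ae_eq₂]
  exact Measure.restrict_mono_set _ (Mesh.mem_facesOn.1 hF).2

/-- The natural condition σ·ν = g₂ − αu holds on every face of Γ₂, so this balance is not restricted
to `faces₂₂`; the outflow faces are reduced to it. -/
theorem Mesh.IsConsistent.face₂₂ (hT : T.IsConsistent P) (hM : T.IsArranged P.Ω 𝒜)
    (hP : P.Admissible) (hu : P.IsWeakSolution u) (hc : ∀ κ ∈ T.cells, CellTraces P u κ)
    (hF : F ∈ T.facesOn P.Ω P.Γ₂) :
    T.faceTerm P u v F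
      + ∫ x in F, P.α x * T.bdryTrace F u x * T.bdryTrace F v x ∂(surf (n + 1)) =
    ∫ x in F, P.g₂ x * T.bdryTrace F v x ∂(surf (n + 1)) := by
  have hFb := (Mesh.mem_facesOn.1 hF).1
  rcases hT.eq_singleton_or_null hM hFb with h | ⟨κ, hκ, hFκ, hat⟩
  · rw [Mesh.faceTerm_of_null h, Measure.restrict_eq_zero.2 h]
    simp
  have hle := Measure.restrict_mono_set (surf (n + 1)) (hT.face_subset hκ hFκ)
  have hb : MemLp (bdryFlux P u κ) 2 ((surf (n + 1)).restrict F) :=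
    (hc κ hκ).flux_mem.mono_measure hle
  have hv : MemLp (trace κ v) 2 ((surf (n + 1)).restrict F) :=
    (memLp_trace κ v).mono_measure hle
  have hg := hP.g₂_mem.mono_measure (hT.restrict_face_le₂ hM hP hF)
  have e1 : ∫ x in F, P.α x * T.bdryTrace F u x * T.bdryTrace F v x ∂(surf (n + 1)) =
      ∫ x in F, (P.g₂ x * trace κ v x - bdryFlux P u κ x * trace κ v x) ∂(surf (n + 1)) := by
    refine integral_congr_ae ?_
    filter_upwards [hT.bdryFlux_ae_eq₂ hM hP hu hκ (hc κ hκ) hF hFκ,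
      ae_restrict_of_ae_restrict_of_subset (hT.subset_inter_frontier hκ hFb hFκ)
        (hT.ae_boundary hM hP hu.1 hκ (hc κ hκ))] with y h1 h2
    rw [h1, Mesh.bdryTrace, Mesh.bdryTrace, hat, Finset.sum_singleton, Finset.sum_singleton, h2.2.1,
      Problem.robin]
    ring
  rw [e1, integral_sub (integrable_fun_mul hg hv) (integrable_fun_mul hb hv), Mesh.faceTerm, hat,
    Finset.sum_singleton]
  simp only [Mesh.bdryTrace, hat, Finset.sum_singleton]
  ring

/-- Where α = ν·c > 0, the upwind value is the trace of u and the upwind flux is αu; where α = ν·c =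
0, both terms vanish. -/
theorem Mesh.IsConsistent.face₂₁ (hT : T.IsConsistent P) (hM : T.IsArranged P.Ω 𝒜)
    (hP : P.Admissible) (hu : P.IsWeakSolution u) (hc : ∀ κ ∈ T.cells, CellTraces P u κ)
    (hout : P.OutflowSign) (hF : F ∈ T.faces₂₁ P) :
    T.faceTerm P u v F + ∫ x in F, T.upwindJump P F u v x ∂(surf (n + 1)) =
    ∫ x in F, P.g₂ x * T.bdryTrace F v x ∂(surf (n + 1)) := by
  classical
  obtain ⟨hF, hα⟩ := Finset.mem_filter.1 hF
  rw [← hT.face₂₂ hM hP hu hc hF]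
  congr 1
  have hFb := (Mesh.mem_facesOn.1 hF).1
  rcases hT.eq_singleton_or_null hM hFb with h | ⟨κ, hκ, hFκ, hat⟩
  · rw [Measure.restrict_eq_zero.2 h]
    simp
  refine integral_congr_ae ?_
  filter_upwards [hα, ae_mono (hT.restrict_face_le₂ hM hP hF) hout,
    ae_restrict_of_ae_restrict_of_subset (hT.subset_inter_frontier hκ hFb hFκ)
      (hT.ae_boundary hM hP hu.1 hκ (hc κ hκ))] with y h1 h2 h3
  have hn := h2 h1
  rw [← h3.2.2] at h1 hn
  rw [Mesh.upwindJump, Mesh.upwind, Mesh.bdryTrace, Mesh.bdryTrace, hat]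
  simp only [Finset.sum_singleton]
  rw [h1]
  rcases hn.eq_or_lt with h | h
  · rw [← h]; simp
  · rw [if_pos h]; ring

/-- No flux is prescribed here. The diffusive part of the element term cancels against the average
of K∇u, its convective part remains, and replacing u by g₃ in what is left yields the data terms. -/
theorem Mesh.IsConsistent.face₃ (hT : T.IsConsistent P) (hM : T.IsArranged P.Ω 𝒜)
    (hP : P.Admissible) (hu : P.IsWeakSolution u) (hc : ∀ κ ∈ T.cells, CellTraces P u κ)
    (θ η : ℝ) (hF : F ∈ T.facesOn P.Ω P.Γ₃) :
    T.faceTerm P u v F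
      + (∫ x in F, (θ * ⟪T.avgFlux P F v x, T.jump F u x⟫
          - ⟪T.avgFlux P F u x - (η / Metric.diam F) • T.jump F u x, T.jump F v x⟫)
            ∂(surf (n + 1))) =
    ∫ x in F, ((η / Metric.diam F) * (P.g₃ x * T.bdryTrace F v x)
          + (θ * ⟪T.avgFlux P F v x, outerNormal P.Ω x⟫
              - normalTrace P.Ω P.c x * T.bdryTrace F v x) * P.g₃ x) ∂(surf (n + 1)) := by
  obtain ⟨hFb, hFΓ⟩ := Mesh.mem_facesOn.1 hF
  rw [hP.isClosed₃.closure_eq] at hFΓ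
  rcases hT.eq_singleton_or_null hM hFb with h | ⟨κ, hκ, hFκ, hat⟩
  · rw [Mesh.faceTerm_of_null h, Measure.restrict_eq_zero.2 h]
    simp
  have hs := hT.face_subset hκ hFκ
  have hle := Measure.restrict_mono_set (surf (n + 1)) hs
  have hb : MemLp (bdryFlux P u κ) 2 ((surf (n + 1)).restrict F) :=
    (hc κ hκ).flux_mem.mono_measure hle
  have hnu : MemLp (fun y => normalTrace κ P.c y * trace κ u y) 2 ((surf (n + 1)).restrict F) :=
    (hc κ hκ).memLp_mul.mono_measure hle
  have hu' : MemLp (trace κ u) 2 ((surf (n + 1)).restrict F) :=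
    (memLp_trace κ u).mono_measure hle
  have hv : MemLp (trace κ v) 2 ((surf (n + 1)).restrict F) :=
    (memLp_trace κ v).mono_measure hle
  have ht : MemLp (fun y => ⟪trace κ (cellFlux P κ v) y, outerNormal κ y⟫) 2
      ((surf (n + 1)).restrict F) :=
    (memLp_inner_outerNormal (hM.isFlatBody hκ) (memLp_trace κ _)).mono_measure hle
  have hja : ∀ w y, T.jump F w y = trace κ w y • outerNormal κ y ∧
      T.avgFlux P F w y = trace κ (cellFlux P κ w) y ∧ T.bdryTrace F w y = trace κ w y := by
    intro w y
    simp [Mesh.jump, Mesh.avgFlux, Mesh.bdryTrace, hat]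
  have hnorm : ∀ᵐ y ∂((surf (n + 1)).restrict F), ⟪outerNormal κ y, outerNormal κ y⟫ = 1 := by
    have hFc := hT.isClosed_face (Mesh.mem_boundaryFaces.1 hFb).1
    filter_upwards [ae_notMem_skeleton hM.arr _, ae_restrict_mem_of_isClosed hFc] with y hS hy
    rw [real_inner_self_eq_norm_sq, (hM.isFlatPoint hκ (hs hy) hS).1, one_pow]
  set h := η / Metric.diam F
  have e1 : ∫ x in F, (θ * ⟪T.avgFlux P F v x, T.jump F u x⟫
      - ⟪T.avgFlux P F u x - h • T.jump F u x, T.jump F v x⟫) ∂(surf (n + 1)) =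
      ∫ y in F, (θ * (⟪trace κ (cellFlux P κ v) y, outerNormal κ y⟫ * trace κ u y)
        + h * (trace κ u y * trace κ v y)
        - (bdryFlux P u κ y + normalTrace κ P.c y * trace κ u y) * trace κ v y)
        ∂(surf (n + 1)) := by
    refine integral_congr_ae ?_
    filter_upwards [hnorm] with y hn
    rw [(hja v y).2.1, (hja u y).1, (hja v y).1, (hja u y).2.1, inner_sub_left,
      real_inner_smul_left, real_inner_smul_left, real_inner_smul_right, real_inner_smul_right,
      real_inner_smul_right, hn, bdryFlux]
    ring
  have i1 : Integrable (fun y => θ * (⟪trace κ (cellFlux P κ v) y, outerNormal κ y⟫ * trace κ u y)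
      + h * (trace κ u y * trace κ v y)
      - (bdryFlux P u κ y + normalTrace κ P.c y * trace κ u y) * trace κ v y)
      ((surf (n + 1)).restrict F) :=
    (((integrable_fun_mul ht hu').const_mul θ).add ((integrable_fun_mul hu' hv).const_mul h)).sub
      (integrable_fun_mul (hb.add hnu) hv)
  rw [e1, Mesh.faceTerm, hat, Finset.sum_singleton, ← integral_add (integrable_fun_mul hb hv) i1]
  refine integral_congr_ae ?_
  filter_upwards [ae_restrict_of_ae_restrict_of_subset (hT.subset_inter_frontier hκ hFb hFκ)
    (hT.ae_boundary hM hP hu.1 hκ (hc κ hκ)),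
    ae_restrict_of_ae_restrict_of_subset hFΓ hu.2.1] with y h1 h2
  rw [(hja v y).2.1, (hja v y).2.2, ← h2, ← h1.1, ← h1.2.1, ← h1.2.2]
  ring

end Sum

end IPG

namespace IPG

/-! ### Summation over elements and faces -/

section Elements

variable {m : ℕ} {T : Mesh (m + 2)} {P : Problem (m + 2)} {𝒜 : Finset (E (m + 2) × ℝ)}
  {κ : Set (E (m + 2))} {u v : E (m + 2) → ℝ}

/-- Green's formula on an element. -/
theorem Mesh.IsConsistent.green (hT : T.IsConsistent P) (hM : T.IsArranged P.Ω 𝒜)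
    (hP : P.Admissible) (hu : P.IsWeakSolution u) (hκ : κ ∈ T.cells) (hc : CellTraces P u κ)
    (hv : IsSmoothOn κ v) :
    ∫ x in κ, (⟪cellFlux P κ u x - u x • P.c x, weakGrad (interior κ) v x⟫ + P.r x * u x * v x) =
      (∫ x in interior κ, P.f x * v x)
        + ∫ y in frontier κ, bdryFlux P u κ y * trace κ v y ∂(surf (m + 2)) := by
  obtain ⟨φ, hφ, hvφ⟩ := hv
  obtain ⟨𝒬, hB⟩ := hM.cell κ hκ
  have hA := hM.isFlatBody hκ
  have hfin := hA.isFiniteMeasure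
  have hsub := hT.interior_subset hM hκ
  obtain ⟨hg, ht⟩ := IsSmoothOn.ae_eq hA hφ hvφ
  have hσ := (Problem.integrableOn_flux hP hu.1).mono_set hsub
  have hD := (Problem.integrableOn_source hP hu.1).mono_set hsub
  have hPfin := Problem.isFiniteMeasure hP
  have hf : IntegrableOn P.f (interior κ) :=
    IntegrableOn.mono_set (hP.f_mem.integrable one_le_two) hsub
  have key := hB.integral_eq hM.arr
    ((Problem.memLp_flux hP hu.1).mono_measure (hT.restrict_le hM hκ)) hD
    ((hT.hasWeakDiv_flux hM hP hu).mono hsub) (hc.flux_mem.integrable one_le_two) hc.flux_limit hφ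
  have e1 : ∫ y in frontier κ, bdryFlux P u κ y * trace κ v y ∂(surf (m + 2)) =
      ∫ y in frontier κ, bdryFlux P u κ y * φ y ∂(surf (m + 2)) := by
    refine integral_congr_ae ?_
    filter_upwards [ht] with y hy
    rw [hy]
  have e2 : ∫ x in interior κ, P.f x * v x = ∫ x in interior κ, P.f x * φ x := by
    refine integral_congr_ae ?_
    filter_upwards [hvφ] with y hy
    rw [hy]
  have i1 : IntegrableOn (fun x => fderiv ℝ φ x (P.flux u x) + P.source u x * φ x) (interior κ) :=
    (integrableOn_fderiv_apply hφ hσ).add (integrableOn_mul_test hφ hD)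
  rw [e1, e2, ← key, ← integral_add (integrableOn_mul_test hφ hf) i1,
    ← setIntegral_congr_set (interior_ae_eq_of_null_frontier hA.volume_frontier)]
  refine integral_congr_ae ?_
  filter_upwards [hvφ, hg, hT.weakGrad_ae_eq hM hP hu.1 hκ] with x h1 h2 h3
  rw [h1, h2, real_inner_comm, inner_gradient_left, cellFlux, h3, Problem.source, ← Problem.flux]
  ring

/-- The open elements are disjoint and fill Ω up to their boundaries, which have zero volume. -/
theorem Mesh.IsConsistent.sum_integral_cells (hT : T.IsConsistent P) (hM : T.IsArranged P.Ω 𝒜)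
    {f : E (m + 2) → ℝ} (hf : IntegrableOn f P.Ω) :
    ∑ κ ∈ T.cells, ∫ x in interior κ, f x = ∫ x in P.Ω, f x := by
  rw [← integral_biUnion_finset T.cells (fun κ _ => isOpen_interior.measurableSet)
    (fun κ hκ κ' hκ' hne => hT.disjoint κ hκ κ' hκ' hne)
    fun κ hκ => hf.mono_set (hT.interior_subset hM hκ)]
  refine setIntegral_congr_set ?_
  have hsub : (⋃ κ ∈ T.cells, interior κ) ⊆ P.Ω :=
    iUnion₂_subset fun κ hκ => hT.interior_subset hM hκ
  refine Filter.EventuallyLE.antisymm (Eventually.of_forall fun x hx => hsub hx) (ae_le_set.2 ?_)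
  refine measure_mono_null (t := ⋃ κ ∈ T.cells, frontier κ) (fun x hx => ?_)
    (measure_biUnion_finset_null fun κ hκ => (hM.isFlatBody hκ).volume_frontier)
  have h := subset_closure hx.1
  rw [hT.cover] at h
  obtain ⟨κ, hκ, hxκ⟩ := mem_iUnion₂.1 h
  exact mem_iUnion₂.2 ⟨κ, hκ, subset_closure hxκ,
    fun hx' => hx.2 (mem_iUnion₂.2 ⟨κ, hκ, hx'⟩)⟩

theorem Mesh.IsConsistent.sum_integral_frontier (hT : T.IsConsistent P)
    (hc : ∀ κ ∈ T.cells, CellTraces P u κ) :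
    ∑ κ ∈ T.cells, ∫ y in frontier κ, bdryFlux P u κ y * trace κ v y ∂(surf (m + 2)) =
      ∑ F ∈ T.allFaces, T.faceTerm P u v F := by
  classical
  have h1 : ∀ κ ∈ T.cells,
      ∫ y in frontier κ, bdryFlux P u κ y * trace κ v y ∂(surf (m + 2)) =
        ∑ F ∈ T.faces κ, ∫ y in F, bdryFlux P u κ y * trace κ v y ∂(surf (m + 2)) := by
    intro κ hκ
    have hi := integrable_fun_mul (hc κ hκ).flux_mem (memLp_trace κ v)
    rw [hT.cell_boundary κ hκ] at hi ⊢
    exact setIntegral_biUnion_finset_ae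
      (fun F hF => (hT.isClosed_face (Finset.mem_biUnion.2 ⟨κ, hκ, hF⟩)).measurableSet)
      (hT.face_overlap κ hκ) hi
  rw [Finset.sum_congr rfl h1]
  simp only [Mesh.faceTerm]
  refine Finset.sum_comm' fun κ F => ?_
  rw [Mesh.mem_cellsAt]
  exact ⟨fun h => ⟨h, Finset.mem_biUnion.2 ⟨κ, h.1, h.2⟩⟩, fun h => h.1⟩

/-- Boundary faces outside the three families are null, so it is enough that X ignores null faces.
-/
theorem Mesh.IsConsistent.sum_boundaryFaces (hT : T.IsConsistent P) (hM : T.IsArranged P.Ω 𝒜)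
    (hP : P.Admissible) {X : Set (E (m + 2)) → ℝ} (hX : ∀ F, surf (m + 2) F = 0 → X F = 0) :
    ∑ F ∈ T.boundaryFaces P.Ω, X F = (∑ F ∈ T.facesOn P.Ω P.Γ₁, X F)
      + (∑ F ∈ T.facesOn P.Ω P.Γ₂, X F) + ∑ F ∈ T.facesOn P.Ω P.Γ₃, X F := by
  classical
  have hB := hT.boundaryParts hM hP
  rw [← Finset.sum_union hT.faces_disjoint₁₂, ← Finset.sum_union
    (Finset.disjoint_union_left.2 ⟨hT.faces_disjoint₁₃, hT.faces_disjoint₂₃⟩)]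
  refine (Finset.sum_subset (fun F hF => ?_) fun F hF hF' => ?_).symm
  · rcases Finset.mem_union.1 hF with h | h
    · rcases Finset.mem_union.1 h with h | h
      · exact (Mesh.mem_facesOn.1 h).1
      · exact (Mesh.mem_facesOn.1 h).1
    · exact (Mesh.mem_facesOn.1 h).1
  · simp only [Finset.mem_union, not_or] at hF'
    exact hX F (hB.null_face F hF hF'.1.1 hF'.1.2 hF'.2)

theorem Mesh.sum_allFaces (X : Set (E (m + 2)) → ℝ) (Ω : Set (E (m + 2))) :
    ∑ F ∈ T.allFaces, X F = (∑ F ∈ T.boundaryFaces Ω, X F) + ∑ F ∈ T.interiorFaces Ω, X F := by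
  classical
  rw [← Finset.sum_filter_add_sum_filter_not T.allFaces (fun F => F ⊆ frontier Ω) X]
  congr!

theorem Mesh.disjoint_interiorFaces {S : Finset (Set (E (m + 2)))} {Ω : Set (E (m + 2))}
    (hS : S ⊆ T.boundaryFaces Ω) : Disjoint (T.interiorFaces Ω) S :=
  Finset.disjoint_left.2 fun _ h h' =>
    (Mesh.mem_interiorFaces.1 h).2 (Mesh.mem_boundaryFaces.1 (hS h')).2

/-- The interior penalty method is consistent. -/
theorem Mesh.IsConsistent.ipForm_eq (hT : T.IsConsistent P) (hP : P.Admissible)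
    (hout : P.OutflowSign)
    (hK : ∀ κ ∈ T.cells, ∃ Kκ : E (m + 2) → E (m + 2) →L[ℝ] E (m + 2), HasTrace κ P.K Kκ)
    (θ η : ℝ) {kind : Set (E (m + 2)) → PolyKind} {k : ℕ} (hu : P.IsWeakSolution u)
    (hu₂ : T.MemBrokenH2 P.Ω u) (hv : T.MemBrokenPoly P.Ω kind k v) :
    T.ipForm P θ η u v = T.ipFunctional P θ η v := by
  classical
  obtain ⟨𝒜, hM⟩ := hT.exists_isArranged hP
  have hc : ∀ κ ∈ T.cells, CellTraces P u κ := fun κ hκ =>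
    hT.cellTraces hM hP hκ (hK κ hκ) hu.1 (hu₂.2 κ hκ)
  have hfv := integrable_fun_mul hP.f_mem hv.1
  have hvol : ∑ κ ∈ T.cells, ∫ x in κ, (⟪cellFlux P κ u x - u x • P.c x,
      weakGrad (interior κ) v x⟫ + P.r x * u x * v x) =
      (∫ x in P.Ω, P.f x * v x) + ∑ F ∈ T.allFaces, T.faceTerm P u v F := by
    rw [Finset.sum_congr rfl fun κ hκ => hT.green hM hP hu hκ (hc κ hκ)
      (hv.isSmoothOn hκ (hM.isFlatBody hκ)), Finset.sum_add_distrib,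
      hT.sum_integral_cells hM hfv, hT.sum_integral_frontier hc]
  have hsub : ∀ Γ, T.facesOn P.Ω Γ ⊆ T.boundaryFaces P.Ω := fun Γ F hF =>
    (Mesh.mem_facesOn.1 hF).1
  have hsub₂₁ : T.faces₂₁ P ⊆ T.facesOn P.Ω P.Γ₂ := Finset.filter_subset _ _
  have hsum₂ : ∀ X : Set (E (m + 2)) → ℝ, ∑ F ∈ T.facesOn P.Ω P.Γ₂, X F =
      (∑ F ∈ T.faces₂₂ P, X F) + ∑ F ∈ T.faces₂₁ P, X F := fun X => by
    rw [← Finset.sum_sdiff hsub₂₁, Mesh.faces₂₂]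
  have hi := Finset.sum_eq_zero fun F hF => hT.interior_face (v := v) hM hP hu hc θ η hF
  have h1 := Finset.sum_congr rfl fun F hF => hT.face₁ (v := v) hM hP hu hc hF
  have h21 := Finset.sum_congr rfl fun F hF => hT.face₂₁ (v := v) hM hP hu hc hout hF
  have h22 := Finset.sum_congr rfl fun F (hF : F ∈ T.faces₂₂ P) =>
    hT.face₂₂ (v := v) hM hP hu hc (Finset.mem_sdiff.1 hF).1
  have h3 := Finset.sum_congr rfl fun F hF => hT.face₃ (v := v) hM hP hu hc θ η hF
  simp only [Finset.sum_add_distrib] at hi h21 h22 h3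
  rw [Mesh.ipForm, Mesh.ipFunctional, hvol, Mesh.sum_allFaces (Ω := P.Ω),
    hT.sum_boundaryFaces hM hP fun F hF => Mesh.faceTerm_of_null hF,
    Finset.sum_union (Mesh.disjoint_interiorFaces (hsub P.Γ₃)),
    Finset.sum_union (Mesh.disjoint_interiorFaces (hsub₂₁.trans (hsub P.Γ₂))), hsum₂, hsum₂]
  linarith

end Elements

end IPG

theorem mainTheorem10 (d : ℕ) (hd : d = 2 ∨ d = 3)
    (P : IPG.Problem d) (hP : P.Admissible)
    (T : IPG.Mesh d) (hT : T.IsConsistent P) (hT₂ : T.IsCompatible P)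
    (hout : P.OutflowSign)
    (hK : ∀ κ ∈ T.cells, ∃ Kκ : IPG.E d → IPG.E d →L[ℝ] IPG.E d, IPG.HasTrace κ P.K Kκ)
    (θ : ℝ) (hθ : θ = 0 ∨ θ = 1 ∨ θ = -1) (η : ℝ) (hη : 0 < η)
    (kind : Set (IPG.E d) → IPG.PolyKind) (k : ℕ)
    (u : IPG.E d → ℝ) (hu : P.IsWeakSolution u) (hu₂ : T.MemBrokenH2 P.Ω u)
    (hflux : P.FluxRegular u)
    (v : IPG.E d → ℝ) (hv : T.MemBrokenPoly P.Ω kind k v) :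
    T.ipForm P θ η u v = T.ipFunctional P θ η v := by
  -- Two spare dimensions are needed for the skeleton: the volume of its tubes is computed by
  -- splitting off two directions.
  obtain ⟨m, rfl⟩ : ∃ m, d = m + 2 := ⟨d - 2, by omega⟩
  exact hT.ipForm_eq hP hout hK θ η hu hu₂ hv
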